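/- **Spaces.** Fix the list of the 124 reflexive polytopes $\Delta^\circ\subset\mathbb R^4$ whose face fan defines a smooth (projective) toric fourfold $A$ (one explicit representative for each isomorphism class in the Kreuzer–Skarke list), with vertices $v_1,\dots,v_k\in\mathbb Z^4$ and toric divisors $D_1,\dots,D_k$. Let $X\subset A$ be a smooth anticanonical hypersurface, $\mathcal N=\mathcal O(\sum_\rho D_\rho)$ its normal bundle, and identify $\mathrm{Pic}\,X=\mathrm{Pic}\,A=\mathbb Z^k/\mathbb Z^4$ (of rank $k-4=h^{1,1}(X)$), and the Kähler and Mori cones of $X$ with those of $A$. The quadruple intersection numbers of $A$ are given by the unique 4-linear form on $\mathrm{Pic}\,A$ with $D_{\rho_1}D_{\rho_2}D_{\rho_3}D_{\rho_4}=1$ if the $\rho_i$ are distinct and span a cone of the fan and $=0$ if $\{\rho_i\}$ does not span a cone; $\int_X\alpha=\int_A\alpha\, c_1(\mathcal N)$; $c_2(X)=\sum_{\rho<\sigma}D_\rho D_\sigma$ and $\chi(X)=\int_X\big(\sum_{\rho<\sigma<\tau}D_\rho D_\sigma D_\tau-c_2(X)\,c_1(\mathcal N)\big)$. Call $X$ simple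 if its Kähler cone has exactly $h^{1,1}(X)$ facets. Exactly 101 of the 124 spaces are simple. **Monads.** A positive monad on a simple $X$ is a pair of finite multisets $\{b_i\}_{i=1}^{r_B}$, $\{c_j\}_{j=1}^{r_C}$ in $\mathrm{Pic}\,X$ (defining $0\to V\to\bigoplus_i\mathcal O_X(b_i)\to\bigoplus_j\mathcal O_X(c_j)\to0$) such that: $r_B-r_C\in\{3,4,5\}$; $c_1(V)=\sum_i b_i-\sum_j c_j=0$; all $b_i$ and $c_j$ are ample; all $c_j-b_i$ are nef and nonzero; and $c_2(X)-c_2(V)$ lies in the Mori cone (the dual of the Kähler cone), where $\int_X c_2(V)J=\tfrac12\big(\sum_j\int_X c_j^2J-\sum_i\int_X b_i^2J\big)$. Put $\mathrm{ind}(V)=\tfrac12\int_Xc_3(V)=\tfrac16\big(\sum_i\int_X b_i^3-\sum_j\int_X c_j^3\big)$. Monads are counted per space of the list. If $A$ is a product of projective spaces, then monads that differ by a permutation of equal factors of $A$ are counted once; on the other spaces no further identification is made. **Group orders.** Let $S(X)$ be the set of integers $n>1$ that divide all of the Euler characteristics $\chi(TX)$, $\chi(\mathcal N)$, $\chi(\mathcal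 N^2)$, $\chi(\mathcal N^3)$ and the Hirzebruch signature $\sigma(\mathcal N\otimes TX)$, where $\chi(E)=\int_X\mathrm{ch}(E)\,\mathrm{td}(X)$ and $\sigma(E)=\int_X\mathrm{ch}(E)\prod_i x_i\coth(x_i/2)$ with $x_i$ the Chern roots of $TX$. **Theorem.** There are 2190 positive monads on the 101 simple spaces. Exactly 265 of them satisfy $\mathrm{ind}(V)=3k$ for a nonzero integer $k$ that divides $\chi(X)$. Exactly 21 of them satisfy in addition $|k|\in S(X)$. These 21 monads live on exactly three of the spaces, each of which is a hypersurface in a product of projective spaces; so there is no such monad on any other of the simple spaces. -/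

import Mathlib

/-! ## Lattice polytopes, face fans and Picard groups

`N = ℤ⁴` is the lattice of the fan and `M = Hom(N, ℤ)` the dual lattice. -/

/-- The list `v_1, …, v_k` of vertices of a reflexive polytope `Δ° ⊂ N_ℝ` with simplicial facets.
It stands for the toric fourfold `A` whose fan consists of the cones over the proper faces of `Δ°`,
and for a smooth anticanonical (Calabi-Yau) hypersurface `X ⊂ A`. -/
structure ToricSpace where
  k : ℕ
  v : Fin k → Fin 4 → ℤ

namespace ToricSpace

variable (X : ToricSpace)

/-- The map `α : M → ⊕ ℤ D_ρ`, `m ↦ ∑ ⟨m, v_ρ⟩ D_ρ`. -/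
def alpha : Module.Dual ℤ (Fin 4 → ℤ) →ₗ[ℤ] (Fin X.k → ℤ) where
  toFun m := fun ρ => m (X.v ρ)
  map_add' _ _ := rfl
  map_smul' _ _ := rfl

/-- `Pic A = ⊕ ℤ D_ρ / M`, which is also the group of line bundles on the hypersurface `X`.
It is free of rank `k - 4 = h^{1,1}(X)`. -/
abbrev Pic : Type := (Fin X.k → ℤ) ⧸ LinearMap.range X.alpha

/-- The class of the divisor `∑ a_ρ D_ρ`. -/
def cls (a : Fin X.k → ℤ) : X.Pic := Submodule.Quotient.mk a

/-- The class of the toric divisor `D_ρ`. -/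
def toricDivisor (ρ : Fin X.k) : X.Pic := X.cls (Pi.single ρ 1)

/-- The normal bundle `O(∑ D_ρ)` of the hypersurface. -/
def normalBundle : X.Pic := ∑ ρ, X.toricDivisor ρ

/-- The rays through the vertices in `σ` span a cone of the fan: these vertices lie on a common
proper face of `Δ°`. Since `Δ°` is reflexive, its facets are cut out by lattice points `m` of the
dual polytope `Δ = {m | ⟨m, v_ρ⟩ ≥ -1 for all ρ}`. -/
def SpansCone (σ : Finset (Fin X.k)) : Prop :=
  ∃ m : Module.Dual ℤ (Fin 4 → ℤ), (∀ ρ, -1 ≤ m (X.v ρ)) ∧ ∀ ρ ∈ σ, m (X.v ρ) = -1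

/-- Four-dimensional cones of the fan. -/
def IsMaximalCone (σ : Finset (Fin X.k)) : Prop := X.SpansCone σ ∧ σ.card = 4

/-! ## Nef and ample classes -/

/-- `∑ a_ρ D_ρ` is nef: its support function, which on a maximal cone `σ` is the linear function
`m_σ` with `⟨m_σ, v_ρ⟩ = -a_ρ` for `ρ ∈ σ`, is convex (`ψ(v + w) ≥ ψ(v) + ψ(w)`), that is,
`ψ(v_ρ) ≤ ⟨m_σ, v_ρ⟩` for all `σ` and `ρ`. -/
def IsNef (D : X.Pic) : Prop :=
  ∃ a, X.cls a = D ∧ ∀ σ, X.IsMaximalCone σ →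
    ∃ m : Module.Dual ℤ (Fin 4 → ℤ), (∀ ρ ∈ σ, m (X.v ρ) = -a ρ) ∧ ∀ ρ, -a ρ ≤ m (X.v ρ)

/-- Positive (ample) classes: the support function is strictly convex, that is, `D` lies in the
interior of the nef cone (the Kähler cone). -/
def IsAmple (D : X.Pic) : Prop :=
  ∃ a, X.cls a = D ∧ ∀ σ, X.IsMaximalCone σ →
    ∃ m : Module.Dual ℤ (Fin 4 → ℤ),
      (∀ ρ ∈ σ, m (X.v ρ) = -a ρ) ∧ ∀ ρ, ρ ∉ σ → -a ρ < m (X.v ρ)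

/-- The space is simple: its Kähler cone is cut out by `h^{1,1} = k - 4` linear inequalities. -/
def IsSimple : Prop :=
  ∃ K : Fin (X.k - 4) → (X.Pic →ₗ[ℤ] ℤ), ∀ D, X.IsNef D ↔ ∀ r, 0 ≤ K r D

/-! ## Intersection numbers and characteristic classes -/

/-- The linear equations for the quadruple intersection numbers of `A`. -/
def IsIntersectionForm (d : MultilinearMap ℤ (fun _ : Fin 4 => X.Pic) ℤ) : Prop :=
  ∀ ρ : Fin 4 → Fin X.k,
    (Function.Injective ρ → X.SpansCone (Finset.univ.image ρ) →
      d (fun i => X.toricDivisor (ρ i)) = 1) ∧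
    (¬ X.SpansCone (Finset.univ.image ρ) → d (fun i => X.toricDivisor (ρ i)) = 0)

/-- The intersection form `(J_1, …, J_4) ↦ ∫_A J_1 J_2 J_3 J_4`; it is the only solution of the
linear equations `IsIntersectionForm`. -/
noncomputable def intersectionForm : MultilinearMap ℤ (fun _ : Fin 4 => X.Pic) ℤ :=
  Classical.epsilon X.IsIntersectionForm

/-- The triple intersection numbers `∫_X J_1 J_2 J_3 = ∫_A J_1 J_2 J_3 c_1(𝒩)`. -/
noncomputable def triple (D E F : X.Pic) : ℤ := X.intersectionForm ![D, E, F, X.normalBundle]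

/-- `∫_X c_2(X) J`, where `c_2(X) = ∑_{ρ<σ} D_ρ D_σ`. -/
noncomputable def c₂ (J : X.Pic) : ℤ :=
  ∑ ρ, ∑ σ ∈ Finset.Ioi ρ, X.triple (X.toricDivisor ρ) (X.toricDivisor σ) J

/-- The Euler number `χ(X) = ∫_X c_3(X)`, where
`c_3(X) = ∑_{ρ<σ<τ} D_ρ D_σ D_τ - c_2(X) ∑_τ D_τ`. -/
noncomputable def eulerNumber : ℤ :=
  (∑ ρ, ∑ σ ∈ Finset.Ioi ρ, ∑ τ ∈ Finset.Ioi σ,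
    X.triple (X.toricDivisor ρ) (X.toricDivisor σ) (X.toricDivisor τ)) - X.c₂ X.normalBundle

/-- `∫_X c_1(𝒩)³`. -/
noncomputable def normalCubed : ℤ := X.triple X.normalBundle X.normalBundle X.normalBundle

/-- The Euler characteristic `χ(X, 𝒩^p ⊗ TX^q) = ∫_X ch(𝒩)^p ch(TX)^q td(X)`, with
`ch(TX) = 3 - c_2 + c_3 / 2` and `td(X) = 1 + c_2 / 12`. -/
noncomputable def twistedEuler (p q : ℕ) : ℚ :=
  3 ^ q * (p ^ 3 * X.normalCubed / 6 + p * X.c₂ X.normalBundle / 12)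
    + q * 3 ^ (q - 1) * (X.eulerNumber / 2 - p * X.c₂ X.normalBundle)

/-- The Hirzebruch signature `σ(X, 𝒩^p ⊗ TX^q) = ∫_X ch(𝒩)^p ch(TX)^q ∏ x_i coth(x_i / 2)`,
where the `x_i` are the Chern roots of `TX`, so that the product is `8 - 4 c_2 / 3`. -/
noncomputable def twistedSignature (p q : ℕ) : ℚ :=
  8 * (3 ^ q * (p ^ 3 * X.normalCubed / 6)
    + q * 3 ^ (q - 1) * (X.eulerNumber / 2 - p * X.c₂ X.normalBundle))
    - 4 / 3 * (3 ^ q * (p * X.c₂ X.normalBundle))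

/-- The set `S(X)` of orders of nontrivial groups that are allowed by the divisibility
invariants. -/
def groupOrders : Set ℕ :=
  {n | 1 < n ∧
    (∀ pq ∈ [(0, 1), (1, 0), (2, 0), (3, 0)], ∃ z : ℤ, X.twistedEuler pq.1 pq.2 = n * z) ∧
    ∃ z : ℤ, X.twistedSignature 1 1 = n * z}

/-! ## Monads -/

/-- The data `B = ⊕ O_X(b_i)`, `C = ⊕ O_X(c_j)` of a monad `0 → V → B → C → 0`, the summands
being unordered. -/
@[ext] structure MonadData where
  B : Multiset X.Pic
  C : Multiset X.Pic

namespace MonadData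

variable {X} (V : X.MonadData)

/-- `∫_X c_2(V) J`, for `c_1(V) = 0`. -/
noncomputable def c₂ (J : X.Pic) : ℚ :=
  (((V.C.map fun c => X.triple J c c).sum - (V.B.map fun b => X.triple J b b).sum : ℤ) : ℚ) / 2

/-- `∫_X c_3(V)`, for `c_1(V) = 0`. -/
noncomputable def c₃ : ℚ :=
  (((V.B.map fun b => X.triple b b b).sum - (V.C.map fun c => X.triple c c c).sum : ℤ) : ℚ) / 3

/-- The index `ind(V) = ½ ∫_X c_3(V)`. -/
noncomputable def ind : ℚ := V.c₃ / 2

/-- Anomaly-free positive monads with structure group `SU(3)`, `SU(4)` or `SU(5)`. -/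
structure IsPositiveMonad : Prop where
  /-- `rk V = N` with `N = 3, 4, 5` -/
  rank : ∃ N ∈ ({3, 4, 5} : Set ℕ), V.B.card = V.C.card + N
  /-- `c_1(V) = 0` -/
  c₁_eq_zero : V.B.sum = V.C.sum
  /-- `B` and `C` are sums of positive line bundles -/
  ample_B : ∀ b ∈ V.B, X.IsAmple b
  ample_C : ∀ c ∈ V.C, X.IsAmple c
  /-- bundleness -/
  nef_sub : ∀ b ∈ V.B, ∀ c ∈ V.C, X.IsNef (c - b)
  /-- non-triviality -/
  ne : ∀ b ∈ V.B, ∀ c ∈ V.C, b ≠ c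
  /-- anomaly cancellation: the five-brane class `c_2(X) - c_2(V)` is effective, that is, it lies
  in the Mori cone, the dual of the Kähler cone -/
  effective : ∀ J, X.IsNef J → 0 ≤ X.c₂ J - V.c₂ J

/-- `ind(V) = 3k` for a nonzero integer `k` that divides `χ(X)`. -/
def IsThreeFamily : Prop :=
  ∃ k : ℤ, k ≠ 0 ∧ V.ind = 3 * k ∧ k ∣ X.eulerNumber

/-- `ind(V) = 3k` for a nonzero integer `k` that divides `χ(X)` and whose absolute value belongs to
the set `S(X)`. -/
def IsStrongThreeFamily : Prop :=
  ∃ k : ℤ, k ≠ 0 ∧ V.ind = 3 * k ∧ k ∣ X.eulerNumber ∧ k.natAbs ∈ X.groupOrders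

end MonadData

/-! ## Products of projective spaces and permutations of their factors -/

/-- The primitive ray generators of the fan of `ℙⁿ`: the unit vectors and `(-1, …, -1)`. -/
def projectiveRay (n : ℕ) : Fin (n + 1) → Fin n → ℤ :=
  Fin.lastCases (fun _ => -1) (fun j => Pi.single j 1)

/-- The ambient space is isomorphic, as a toric variety, to `ℙ^{n_1} × ⋯ × ℙ^{n_s}`. -/
def IsProductOfProjectiveSpaces : Prop :=
  ∃ (s : ℕ) (n : Fin s → ℕ) (e : Fin X.k ≃ Σ i, Fin (n i + 1))
    (g : (Fin 4 → ℤ) ≃ₗ[ℤ] ((i : Fin s) → Fin (n i) → ℤ)),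
    (∀ i, 1 ≤ n i) ∧ ∀ ρ, g (X.v ρ) = Pi.single (e ρ).1 (projectiveRay _ (e ρ).2)

/-- The permutations of the rays that are induced by automorphisms of the fan. -/
def fanSymmetries : Subgroup (Equiv.Perm (Fin X.k)) where
  carrier := {π | ∃ g : (Fin 4 → ℤ) ≃ₗ[ℤ] (Fin 4 → ℤ), ∀ ρ, g (X.v ρ) = X.v (π ρ)}
  one_mem' := ⟨LinearEquiv.refl ℤ _, fun _ => rfl⟩
  mul_mem' := by
    rintro π π' ⟨g, hg⟩ ⟨g', hg'⟩
    exact ⟨g'.trans g, fun ρ => by simp [hg, hg']⟩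
  inv_mem' := by
    rintro π ⟨g, hg⟩
    refine ⟨g.symm, fun ρ => ?_⟩
    rw [LinearEquiv.symm_apply_eq, hg]
    simp

/-- The action `D_ρ ↦ D_{π ρ}` of a symmetry of the fan on line bundles. -/
def symmetryOnPic (π : X.fanSymmetries) : X.Pic →ₗ[ℤ] X.Pic :=
  Submodule.mapQ _ _ (LinearMap.funLeft ℤ ℤ (π : Equiv.Perm (Fin X.k)).symm) (by
    rintro _ ⟨m, rfl⟩
    obtain ⟨π, g, hg⟩ := π
    refine ⟨m ∘ₗ (g.symm : (Fin 4 → ℤ) →ₗ[ℤ] (Fin 4 → ℤ)), ?_⟩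
    funext ρ
    have h : g.symm (X.v ρ) = X.v (π.symm ρ) := by
      rw [LinearEquiv.symm_apply_eq, hg]; simp
    simp [alpha, LinearMap.funLeft_apply, h])

theorem symmetryOnPic_one (D : X.Pic) : X.symmetryOnPic 1 D = D := by
  obtain ⟨a, rfl⟩ := Submodule.Quotient.mk_surjective _ D
  rfl

theorem symmetryOnPic_mul (π π' : X.fanSymmetries) (D : X.Pic) :
    X.symmetryOnPic (π * π') D = X.symmetryOnPic π (X.symmetryOnPic π' D) := by
  obtain ⟨a, rfl⟩ := Submodule.Quotient.mk_surjective _ D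
  rfl

/-- The action of a symmetry of the fan on monads. -/
def MonadData.map {X : ToricSpace} (π : X.fanSymmetries) (V : X.MonadData) : X.MonadData where
  B := V.B.map (X.symmetryOnPic π)
  C := V.C.map (X.symmetryOnPic π)

theorem MonadData.map_one {X : ToricSpace} (V : X.MonadData) : V.map 1 = V := by
  ext1 <;> simp [MonadData.map, symmetryOnPic_one]

theorem MonadData.map_mul {X : ToricSpace} (π π' : X.fanSymmetries) (V : X.MonadData) :
    V.map (π * π') = (V.map π').map π := by
  ext1 <;> simp [MonadData.map, symmetryOnPic_mul]

/-- On a product of projective spaces, monads that differ by a symmetry of the fan are identified.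
The symmetries of the fan act on `Pic = ℤ^s` by the permutations of equal factors `ℙⁿ`. On all
other spaces only equal monads are identified. -/
def monadSetoid : Setoid X.MonadData where
  r V V' := V = V' ∨ X.IsProductOfProjectiveSpaces ∧ ∃ π : X.fanSymmetries, V.map π = V'
  iseqv := by
    refine ⟨fun _ => Or.inl rfl, ?_, ?_⟩
    · rintro V V' (rfl | ⟨h, π, rfl⟩)
      · exact Or.inl rfl
      · refine Or.inr ⟨h, π⁻¹, ?_⟩
        rw [← MonadData.map_mul, inv_mul_cancel, MonadData.map_one]
    · rintro V V' V'' (rfl | ⟨h, π, rfl⟩) (rfl | ⟨h', π', rfl⟩)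
      · exact Or.inl rfl
      · exact Or.inr ⟨h', π', rfl⟩
      · exact Or.inr ⟨h, π, rfl⟩
      · exact Or.inr ⟨h, π' * π, MonadData.map_mul _ _ _⟩

end ToricSpace

/-! ## The database -/

def spaces1to10 : List (List (ℤ × ℤ × ℤ × ℤ)) :=
  [[(-1, -1, -1, -1)],
   [(-1, 0, 0, 0), (0, -1, -1, -1)],
   [(-1, 0, 0, 0), (1, -1, -1, -1)],
   [(-1, -1, 0, 0), (1, 0, -1, -1)],
   [(-1, -1, 0, 0), (1, 1, -1, -1)],
   [(-1, -1, -1, 0), (1, 0, 0, -1)],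
   [(0, -1, -1, 0), (-1, 0, 0, -1)],
   [(-1, 0, 0, 0), (2, -1, -1, -1)],
   [(-1, -1, 0, 0), (2, 0, -1, -1)],
   [(-1, 0, 0, 0), (3, -1, -1, -1)]]

def spaces11to20 : List (List (ℤ × ℤ × ℤ × ℤ)) :=
  [[(-1, 0, 0, 0), (-1, -1, 0, 0), (1, 0, -1, -1)],
   [(-1, 0, 0, 0), (0, -1, -1, 0), (0, 1, 0, -1)],
   [(-1, 0, 0, 0), (0, -1, -1, 0), (1, 1, 1, -1)],
   [(-1, 0, 0, 0), (0, -1, -1, -1), (1, 1, 0, 0)],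
   [(-1, 0, 0, 0), (1, -1, -1, -1), (1, 1, 0, 0)],
   [(-1, 0, 0, 0), (1, -1, -1, 0), (0, 1, 0, -1)],
   [(-1, 0, 0, 0), (1, 0, -1, 0), (0, -1, 0, -1)],
   [(-1, 0, 0, 0), (1, -1, -1, 0), (1, 1, 1, -1)],
   [(-1, 0, 0, 0), (1, -1, 0, 0), (-1, 1, -1, -1)],
   [(-1, 0, 0, 0), (1, -1, 0, 0), (0, 1, -1, -1)]]

def spaces21to30 : List (List (ℤ × ℤ × ℤ × ℤ)) :=
  [[(-1, 0, 0, 0), (1, -1, 0, 0), (1, 0, -1, -1)],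
   [(-1, -1, 0, 0), (0, 1, -1, 0), (1, 0, 0, -1)],
   [(-1, -1, 0, 0), (1, 1, -1, -1), (0, -1, 1, 0)],
   [(-1, -1, 0, 0), (1, 0, -1, 0), (0, 0, 1, -1)],
   [(-1, -1, 0, 0), (1, 0, -1, 0), (1, 0, 0, -1)],
   [(0, -1, 0, 0), (-1, 0, 0, 0), (0, 0, -1, -1)],
   [(0, -1, 0, 0), (-1, 0, 0, 0), (1, 0, -1, -1)],
   [(0, -1, 0, 0), (-1, 0, 0, 0), (1, 1, -1, -1)],
   [(0, -1, -1, 0), (-1, 0, 0, -1), (1, 1, 0, 0)],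
   [(0, -1, -1, 0), (-1, 0, 0, -1), (1, 1, 1, 0)]]

def spaces31to40 : List (List (ℤ × ℤ × ℤ × ℤ)) :=
  [[(-1, 0, 0, 0), (-1, -1, 0, 0), (2, 0, -1, -1)],
   [(-1, 0, 0, 0), (2, -1, -1, -1), (1, 1, 0, 0)],
   [(-1, 0, 0, 0), (2, -1, -1, 0), (0, 1, 0, -1)],
   [(-1, 0, 0, 0), (1, -1, 0, 0), (0, 2, -1, -1)],
   [(-1, 0, 0, 0), (1, -1, 0, 0), (2, -1, -1, -1)],
   [(-1, 0, 0, 0), (1, -1, 0, 0), (2, 0, -1, -1)],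
   [(-1, -1, 0, 0), (1, 0, -1, -1), (2, 0, -1, -1)],
   [(0, -1, 0, 0), (-1, 0, 0, 0), (2, 0, -1, -1)],
   [(0, -1, -1, 0), (-1, 0, 0, -1), (1, 1, 0, 0), (0, 0, 1, 1)],
   [(0, 0, 0, -1), (0, 0, -1, 0), (0, -1, 0, 0), (-1, 0, 0, 0)]]

def spaces41to50 : List (List (ℤ × ℤ × ℤ × ℤ)) :=
  [[(-1, 0, 0, 0), (-1, -1, 0, 0), (0, 0, -1, -1), (1, 0, 1, 0)],
   [(-1, 0, 0, 0), (-1, -1, 0, 0), (1, 0, -1, -1), (1, 0, 1, 0)],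
   [(-1, 0, 0, 0), (-1, -1, 0, 0), (1, 0, -1, 0), (0, 0, 1, -1)],
   [(-1, 0, 0, 0), (-1, 1, 0, 0), (1, -1, -1, 0), (0, -1, 0, -1)],
   [(-1, 0, 0, 0), (-1, 0, -1, 0), (1, 0, 0, -1), (1, -1, 0, 0)],
   [(-1, 0, 0, 0), (0, -1, -1, 0), (1, 1, 0, 0), (0, 1, 0, -1)],
   [(-1, 0, 0, 0), (0, -1, -1, 0), (1, 0, 0, -1), (0, 1, 1, 1)],
   [(-1, 0, 0, 0), (0, -1, -1, 0), (1, 1, 0, 0), (0, 0, 1, -1)],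
   [(-1, 0, 0, 0), (0, -1, -1, 0), (1, 1, 0, 0), (1, -1, 0, -1)],
   [(-1, 0, 0, 0), (0, -1, -1, 0), (1, 1, 0, 0), (1, 1, 0, -1)]]

def spaces51to60 : List (List (ℤ × ℤ × ℤ × ℤ)) :=
  [[(-1, 0, 0, 0), (1, -1, -1, 0), (1, 1, 0, 0), (0, 1, 0, -1)],
   [(-1, 0, 0, 0), (1, -1, 0, 0), (1, 0, 0, -1), (1, 0, -1, 0)],
   [(-1, 0, 0, 0), (1, -1, 0, 0), (1, 0, -1, 0), (-1, 1, 1, -1)],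
   [(-1, 0, 0, 0), (1, -1, -1, 0), (1, 1, 0, 0), (0, 0, 1, -1)],
   [(-1, 0, 0, 0), (1, -1, -1, 0), (1, 1, 0, 0), (1, 1, 0, -1)],
   [(-1, 0, 0, 0), (1, -1, 0, 0), (-1, 1, -1, -1), (1, 0, 1, 0)],
   [(-1, 0, 0, 0), (1, -1, 0, 0), (0, 1, -1, 0), (0, 0, 1, -1)],
   [(-1, 0, 0, 0), (1, -1, 0, 0), (0, 1, -1, 0), (0, 1, 0, -1)],
   [(-1, 0, 0, 0), (1, -1, 0, 0), (0, 0, -1, -1), (1, 0, 1, 0)],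
   [(-1, 0, 0, 0), (1, -1, 0, 0), (0, 1, -1, -1), (1, 0, 1, 0)]]

def spaces61to70 : List (List (ℤ × ℤ × ℤ × ℤ)) :=
  [[(-1, 0, 0, 0), (1, -1, 0, 0), (1, -1, -1, 0), (0, 1, 0, -1)],
   [(-1, 0, 0, 0), (1, -1, 0, 0), (1, 0, -1, -1), (1, 0, 1, 0)],
   [(-1, 0, 0, 0), (1, -1, 0, 0), (1, 0, -1, 0), (0, 0, 1, -1)],
   [(0, -1, 0, 0), (-1, 0, 0, 0), (-1, -1, 0, 0), (1, 1, -1, -1)],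
   [(0, -1, 0, 0), (-1, 0, 0, 0), (-1, 1, 0, 0), (1, 0, -1, -1)],
   [(0, -1, 0, 0), (-1, 0, 0, 0), (-1, 1, 0, 0), (1, 1, -1, -1)],
   [(0, -1, 0, 0), (-1, 0, 0, 0), (-1, 0, -1, 0), (1, 0, 0, -1)],
   [(0, -1, 0, 0), (-1, 0, 0, 0), (0, 0, -1, -1), (1, 0, 1, 0)],
   [(0, -1, 0, 0), (-1, 0, 0, 0), (0, 1, 0, -1), (1, 0, -1, 0)],
   [(0, -1, 0, 0), (-1, 0, 0, 0), (0, 1, -1, 0), (1, 0, -1, -1)]]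

def spaces71to80 : List (List (ℤ × ℤ × ℤ × ℤ)) :=
  [[(0, -1, 0, 0), (-1, 0, 0, 0), (1, 0, -1, -1), (0, 1, 1, 0)],
   [(0, -1, 0, 0), (-1, 0, 0, 0), (1, 0, -1, -1), (1, 0, 1, 0)],
   [(0, -1, 0, 0), (-1, 0, 0, 0), (1, 0, 0, -1), (1, 0, -1, 0)],
   [(0, -1, 0, 0), (-1, 0, 0, 0), (1, 0, -1, 0), (0, 0, 1, -1)],
   [(0, -1, 0, 0), (-1, 0, 0, 0), (1, 1, 0, 0), (0, 0, -1, -1)],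
   [(0, -1, 0, 0), (-1, 0, 0, 0), (1, 1, 0, 0), (1, 0, -1, -1)],
   [(0, -1, 0, 0), (-1, 0, 0, 0), (1, 1, 0, 0), (1, 1, -1, -1)],
   [(0, 0, -1, 0), (0, -1, 0, 0), (-1, 0, 0, 0), (1, 0, 0, -1)],
   [(0, 0, -1, 0), (0, -1, 0, 0), (-1, 0, 0, 0), (1, 1, 1, -1)],
   [(0, -1, -1, 0), (-1, 0, 0, -1), (1, 1, 1, 0), (0, 0, -1, 1)]]

def spaces81to90 : List (List (ℤ × ℤ × ℤ × ℤ)) :=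
  [[(0, -1, -1, 0), (-1, 0, 0, -1), (1, 1, 1, 0), (1, 1, 0, 0)],
   [(0, -1, 0, 0), (-1, 0, 0, 0), (-1, 1, 0, 0), (2, 0, -1, -1)],
   [(0, -1, 0, 0), (-1, 0, 0, 0), (1, 1, 0, 0), (2, 0, -1, -1)],
   [(0, -1, 0, 0), (-1, 0, 0, 0), (1, 1, 0, 0), (2, 1, -1, -1)],
   [(0, -1, 0, 0), (-1, 0, 0, 0), (1, 1, 0, 0), (2, 2, -1, -1)],
   [(0, 0, 0, -1), (0, 0, -1, 0), (0, -1, 0, 0), (-1, 0, 0, 0), (1, 1, 0, 0)],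
   [(0, 0, 0, -1), (0, 0, -1, 0), (0, -1, 0, 0), (-1, 0, 0, 0), (1, 1, 1, 1)],
   [(0, -1, 0, 0), (-1, 0, 0, 0), (-1, 1, 0, 0), (0, 1, -1, 0), (1, -1, 1, -1)],
   [(0, -1, 0, 0), (-1, 0, 0, 0), (-1, 1, 0, 0), (1, 0, 0, -1), (1, 0, -1, 0)],
   [(0, -1, 0, 0), (-1, 0, 0, 0), (-1, 1, 0, 0), (1, 0, -1, 0), (0, 0, 1, -1)]]

def spaces91to100 : List (List (ℤ × ℤ × ℤ × ℤ)) :=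
  [[(0, -1, 0, 0), (-1, 0, 0, 0), (-1, 0, -1, 0), (1, 1, 0, 0), (0, -1, 0, -1)],
   [(0, -1, 0, 0), (-1, 0, 0, 0), (-1, 0, -1, 0), (1, 1, 0, 0), (1, 0, 0, -1)],
   [(0, -1, 0, 0), (-1, 0, 0, 0), (0, 0, -1, -1), (1, 0, 0, 1), (0, 1, 1, 0)],
   [(0, -1, 0, 0), (-1, 0, 0, 0), (0, -1, -1, 0), (1, 1, 0, 0), (1, 0, 0, -1)],
   [(0, -1, 0, 0), (-1, 0, 0, 0), (0, -1, -1, 0), (1, 1, 0, 0), (1, 1, 0, -1)],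
   [(0, -1, 0, 0), (-1, 0, 0, 0), (1, 1, 0, 0), (1, 0, -1, 0), (0, 0, 1, -1)],
   [(0, -1, 0, 0), (-1, 0, 0, 0), (1, 1, 0, 0), (1, 0, -1, 0), (1, 0, 0, -1)],
   [(0, -1, 0, 0), (-1, 0, 0, 0), (1, 1, 0, 0), (0, 0, -1, -1), (1, 1, 1, 1)],
   [(0, -1, 0, 0), (-1, 0, 0, 0), (1, 1, 0, 0), (0, 1, -1, 0), (1, 0, 0, -1)],
   [(0, -1, 0, 0), (-1, 0, 0, 0), (1, 1, 0, 0), (1, 1, -1, 0), (0, 0, 1, -1)]]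

def spaces101to110 : List (List (ℤ × ℤ × ℤ × ℤ)) :=
  [[(0, -1, 0, 0), (-1, 0, 0, 0), (1, 1, 0, 0), (1, 0, -1, 0), (1, 1, 0, -1)],
   [(0, -1, 0, 0), (-1, 0, 0, 0), (1, 1, 0, 0), (1, 1, -1, 0), (1, 1, 0, -1)],
   [(0, 0, -1, 0), (0, -1, 0, 0), (-1, 0, 0, 0), (0, -1, -1, 0), (1, 1, 1, -1)],
   [(0, 0, -1, 0), (0, -1, 0, 0), (-1, 0, 0, 0), (0, 1, 1, 0), (1, 0, 0, -1)],
   [(0, 0, -1, 0), (0, -1, 0, 0), (-1, 0, 0, 0), (1, 1, 0, 0), (1, 0, 0, -1)],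
   [(0, 0, -1, 0), (0, -1, 0, 0), (-1, 0, 0, 0), (1, 1, 0, 0), (0, -1, 0, -1)],
   [(0, 0, -1, 0), (0, -1, 0, 0), (-1, 0, 0, 0), (1, 1, 0, 0), (1, 1, 0, -1)],
   [(1, -1, 0, 0), (-1, 1, 0, 0), (0, -1, 0, 0), (-1, 0, 0, 0), (0, 0, -1, -1)],
   [(1, -1, 0, 0), (-1, 1, 0, 0), (0, -1, 0, 0), (-1, 0, 0, 0), (1, 0, -1, -1)],
   [(1, -1, 0, 0), (-1, 1, 0, 0), (0, -1, 0, 0), (-1, 0, 0, 0), (1, 1, -1, -1)]]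

def spaces111to120 : List (List (ℤ × ℤ × ℤ × ℤ)) :=
  [[(1, -1, 0, 0), (-1, 1, -1, 0), (0, -1, 0, -1), (0, -1, 1, -1), (-1, 1, -1, 1)],
   [(1, -1, 0, 0), (-1, 1, 0, 0), (0, -1, 0, 0), (-1, 0, 0, 0), (2, 0, -1, -1)],
   [(0, 0, 0, -1), (0, 0, -1, 0), (0, -1, 0, 0), (-1, 0, 0, 0), (1, 1, 0, 0), (0, 0, 1, 1)],
   [(0, 0, 1, -1), (0, 0, -1, 1), (0, 0, 0, -1), (0, 0, -1, 0), (0, -1, 0, 0), (-1, 0, 0, 0)],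
   [(1, 1, -1, -1), (-1, -1, 1, 1), (0, 0, 0, -1), (0, 0, -1, 0), (0, -1, 0, 0), (-1, 0, 0, 0)],
   [(0, 1, -1, 0), (0, -1, 1, 0), (0, 0, -1, 0), (0, -1, 0, 0), (-1, 0, 0, 0), (1, 0, 0, -1)],
   [(1, 0, -1, 0), (-1, 0, 1, 0), (0, 0, -1, 0), (0, -1, 0, 0), (-1, 0, 0, 0), (1, 0, 0, -1)],
   [(1, -1, 0, 0), (-1, 1, 0, 0), (0, -1, 0, 0), (-1, 0, 0, 0), (-1, 0, -1, 0), (1, 0, 0, -1)],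
   [(1, -1, 0, 0), (-1, 1, 0, 0), (0, -1, 0, 0), (-1, 0, 0, 0), (-1, 1, -1, 0), (1, 0, 0, -1)],
   [(1, -1, 0, 0), (-1, 1, 0, 0), (0, -1, 0, 0), (-1, 0, 0, 0), (0, 1, 0, -1), (1, 0, -1, 0)]]

def spaces121to124 : List (List (ℤ × ℤ × ℤ × ℤ)) :=
  [[(1, -1, 0, 0), (-1, 1, 0, 0), (0, -1, 0, 0), (-1, 0, 0, 0), (1, 0, 0, -1), (1, 0, -1, 0)],
   [(1, -1, 0, 0), (-1, 1, 0, 0), (0, -1, 0, 0), (-1, 0, 0, 0), (1, 0, -1, 0), (0, 0, 1, -1)],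
   [(0, 0, 1, -1), (0, 0, -1, 1), (0, 0, 0, -1), (0, 0, -1, 0), (0, -1, 0, 0), (-1, 0, 0, 0), (1, 1, 0, 0)],
   [(1, 0, 0, -1), (0, 1, -1, 0), (0, -1, 1, 0), (-1, 0, 0, 1), (0, 0, 0, -1), (0, 0, -1, 0), (0, -1, 0, 0), (-1, 0, 0, 0)]]

/-- One polytope `Δ°` for each of the 124 smooth projective toric fourfolds given by the face fan
of a reflexive polytope. The first four vertices of each polytope are the unit vectors; the list
gives the other ones. -/
def database : List (List (ℤ × ℤ × ℤ × ℤ)) :=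
  spaces1to10 ++ spaces11to20 ++ spaces21to30 ++ spaces31to40 ++
    spaces41to50 ++ spaces51to60 ++ spaces61to70 ++ spaces71to80 ++
    spaces81to90 ++ spaces91to100 ++ spaces101to110 ++ spaces111to120 ++
    spaces121to124

/-- The polytope with the unit vectors and the vectors in `L` as its vertices. -/
def ToricSpace.ofList (L : List (ℤ × ℤ × ℤ × ℤ)) : ToricSpace where
  k := 4 + L.length
  v := Fin.append (fun i => Pi.single i 1)
    (fun j => ![(L.get j).1, (L.get j).2.1, (L.get j).2.2.1, (L.get j).2.2.2])

/-- The spaces in the database, counted from 0. -/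
def space (i : Fin database.length) : ToricSpace := ToricSpace.ofList (database.get i)

/-- The number of monads with the property `P` on the simple spaces of the database, counted up to
permutations of equal factors if the ambient space is a product of projective spaces. -/
noncomputable def numberOfMonads (P : (i : Fin database.length) → (space i).MonadData → Prop) : ℕ :=
  Set.ncard {x : Σ i, Quotient (space i).monadSetoid |
    (space x.1).IsSimple ∧ ∃ V, Quotient.mk _ V = x.2 ∧ P x.1 V}

/-! Everything is reduced, space by space, to a finite combinatorial check on a certificate, and the
counts are then added up. Four arguments make the reduction possible.

Fan and nef cone. The fan is described by relations `∑_P v = ∑_R v` with fewer terms on the right. A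
set containing some `P` cannot lie on a facet (`Relation.not_spansCone`), and the certificate shows
that every other set lies in a listed four-element cone. Each relation is a curve class, hence a
functional on the Picard group, and a class is nef (ample) exactly when all these functionals are
nonnegative (positive) on it: `IsFan.isNef_iff`, `IsFan.isAmple_iff`. The nontrivial direction
rewrites a sum of rays by means of the relations until it lies in one cone (`IsFan.exists_support`).
If the functionals of some relations form a basis dual to nef classes with ample sum, the nef cone
is an orthant and the space is simple (`Checked.exists_frame`). Otherwise more than `k - 4` nef
classes, lying on distinct facets and with pairwise ample sums, show that it is not
(`IsSmoothFan.not_isSimple`).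

Intersection numbers. Uniqueness is the moving argument of `IsSmoothFan.form_eq_zero`: a linear
equivalence replaces a repeated divisor by divisors that do not yet occur. Existence and numerical
values come from the fixed point formula for a one-parameter group (`IsLocalization.exists_form`).
Its integrality follows from the same moving argument modulo `L`. Newton's identities turn `c₂` and
the Euler number into sums of power sums over the fixed points.

Monads. On a simple space a positive monad is a pair of multisets of vectors in `ℕ^h` with positive
entries. Let `m` be the join of the `b_i`. Since `b_i ≤ c_j`, also `m ≤ c_j`, and `c₁ = 0` reads `∑
(m - b_i) + ∑ (c_j - m) = N m`. Therefore the multiplicities of unit vectors among the `c_j - m` are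
determined by the other data. The numbers of `b_i` and of `c_j` equal to `m` are determined as well,
because nontriviality forbids that both are nonzero while their difference is known. So monads
correspond to valid codes (`IsMonad.encode_spec`, `Code.IsValid.encode_eq`). The anomaly condition,
rewritten relative to `m`, has nonnegative terms and gives a linear lower bound for the cost
(`Code.IsValid.bound`). This bounds `m`, and for fixed `m` it turns the choice of the two multisets
into two successive knapsack problems. The resulting list contains each valid code exactly once
(`entries_sound`, `entries_complete`, `entries_nodup`).

Identifications. A symmetry of the fan preserves the nef orthant and the normal bundle, so it
permutes coordinates and fixes the coordinate vector of the normal bundle (`NefFrame.exists_perm`).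
For products of projective spaces all such permutations occur. For the other spaces, and for
products whose normal bundle has distinct coordinates, nothing is identified. Orbits are counted by
the codes that minimize a numerical key (`IsSymmetry.ncard_eq`).

The certificates show that monads with a group order in `S(X)` occur on hypersurfaces in `ℙ⁴`, `ℙ² ×
ℙ²` and `(ℙ¹)⁴` only, where there are 5, 1 and 15 of them. -/

namespace ToricSpace

/-! ### Smooth fans: uniqueness of the intersection form, positivity, non-simplicial nef cones -/

section Basic

variable {X : ToricSpace}

theorem cls_alpha (m : Module.Dual ℤ (Fin 4 → ℤ)) : X.cls (X.alpha m) = 0 :=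
  (Submodule.Quotient.mk_eq_zero _).2 ⟨m, rfl⟩

theorem exists_cls (D : X.Pic) : ∃ a, X.cls a = D := Submodule.Quotient.mk_surjective _ D

theorem cls_eq_cls_iff {a b : Fin X.k → ℤ} :
    X.cls a = X.cls b ↔ ∃ m : Module.Dual ℤ (Fin 4 → ℤ), ∀ ρ, a ρ = b ρ + m (X.v ρ) := by
  refine (Submodule.Quotient.eq _).trans ⟨?_, ?_⟩
  · rintro ⟨m, hm⟩
    refine ⟨m, fun ρ => ?_⟩
    have := congrFun hm ρ
    simp only [alpha, LinearMap.coe_mk, AddHom.coe_mk, Pi.sub_apply] at this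
    linarith
  · rintro ⟨m, hm⟩
    exact ⟨m, funext fun ρ => by simp [alpha, hm ρ]⟩

theorem cls_eq_sum (a : Fin X.k → ℤ) : X.cls a = ∑ ρ, a ρ • X.toricDivisor ρ := by
  have h : a = ∑ ρ, a ρ • (Pi.single ρ 1 : Fin X.k → ℤ) := by
    ext σ
    simp [Finset.sum_apply, Pi.single_apply]
  calc X.cls a = (Submodule.mkQ (LinearMap.range X.alpha)) (∑ ρ, a ρ • Pi.single ρ 1) := by
        rw [← h]; rfl
    _ = _ := by rw [map_sum]; simp only [map_smul]; rfl

theorem sum_smul_toricDivisor_eq_zero (m : Module.Dual ℤ (Fin 4 → ℤ)) :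
    ∑ ρ, m (X.v ρ) • X.toricDivisor ρ = 0 := by
  rw [← cls_alpha m, cls_eq_sum]; rfl

theorem SpansCone.mono {σ τ : Finset (Fin X.k)} (h : X.SpansCone τ) (hs : σ ⊆ τ) :
    X.SpansCone σ := by
  obtain ⟨m, h1, h2⟩ := h
  exact ⟨m, h1, fun ρ hρ => h2 ρ (hs hρ)⟩

/-- Every cone of the fan is a face of a four-dimensional cone generated by a basis of the
lattice. -/
structure IsSmoothFan (X : ToricSpace) : Prop where
  solve : ∀ σ, X.IsMaximalCone σ → ∀ a : Fin X.k → ℤ,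
    ∃ m : Module.Dual ℤ (Fin 4 → ℤ), ∀ ρ ∈ σ, m (X.v ρ) = a ρ
  extend : ∀ σ, X.SpansCone σ → σ.card ≤ 4 → ∃ τ, X.IsMaximalCone τ ∧ σ ⊆ τ

/-- The toric divisors generate the Picard group, so multilinear maps are tested on them. The target
is an arbitrary abelian group because `ℤ/L` is needed later. -/
theorem multilinear_ext {G : Type*} [AddCommGroup G]
    {d d' : MultilinearMap ℤ (fun _ : Fin 4 => X.Pic) G}
    (h : ∀ ρ : Fin 4 → Fin X.k,
      d (fun i => X.toricDivisor (ρ i)) = d' (fun i => X.toricDivisor (ρ i))) : d = d' := by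
  ext D
  choose a ha using fun i => exists_cls (D i)
  have hD : D = fun i => ∑ ρ, a i ρ • X.toricDivisor ρ := by
    ext i; rw [← ha i, cls_eq_sum]
  rw [hD, MultilinearMap.map_sum, MultilinearMap.map_sum]
  refine Finset.sum_congr rfl fun ρ _ => ?_
  rw [MultilinearMap.map_smul_univ, MultilinearMap.map_smul_univ, h]

/-- Moving argument, by induction on the number of missing distinct divisors. In a product with a
repeated divisor whose rays span a cone, one copy is replaced, by linear equivalence, with a
combination of divisors that do not occur in the product. This strictly increases the number of
distinct factors, so only products of distinct divisors and products off the fan remain. Besides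
uniqueness over `ℤ`, the lemma gives divisibility when applied over `ZMod L`. -/
theorem IsSmoothFan.form_eq_zero {G : Type*} [AddCommGroup G] (hX : X.IsSmoothFan)
    {e : MultilinearMap ℤ (fun _ : Fin 4 => X.Pic) G}
    (h : ∀ ρ : Fin 4 → Fin X.k, (Function.Injective ρ ∨ ¬ X.SpansCone (Finset.univ.image ρ)) →
      e (fun i => X.toricDivisor (ρ i)) = 0) : e = 0 := by
  have key : ∀ n : ℕ, ∀ ρ : Fin 4 → Fin X.k, 4 - (Finset.univ.image ρ).card = n →
      e (fun i => X.toricDivisor (ρ i)) = 0 := by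
    intro n
    induction n using Nat.strong_induction_on with
    | _ n ih =>
    intro ρ hn
    by_cases hsp : X.SpansCone (Finset.univ.image ρ)
    swap
    · exact h ρ (Or.inr hsp)
    by_cases hinj : Function.Injective ρ
    · exact h ρ (Or.inl hinj)
    obtain ⟨i, j, hij, hne⟩ : ∃ i j, ρ i = ρ j ∧ i ≠ j := by
      simpa [Function.Injective] using hinj
    have hcard : (Finset.univ.image ρ).card ≤ 4 := by
      simpa using Finset.card_image_le (s := Finset.univ) (f := ρ)
    have hlt : (Finset.univ.image ρ).card < 4 := by
      refine lt_of_le_of_ne hcard fun h4 => hinj ?_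
      have := (Finset.card_image_iff (s := Finset.univ) (f := ρ)).1 (by simpa using h4)
      simpa using this
    obtain ⟨τ, hτ, hsub⟩ := hX.extend _ hsp hcard
    -- The rays of the maximal cone `τ` form a basis, so `m` can be chosen to be 1 at the repeated
    -- ray and 0 at the other rays of the product. Its linear relation then involves, besides the
    -- repeated divisor, new divisors only.
    obtain ⟨m, hm⟩ := hX.solve τ hτ (Pi.single (ρ i) 1)
    have hm1 : m (X.v (ρ i)) = 1 := by
      rw [hm _ (hsub (Finset.mem_image_of_mem _ (Finset.mem_univ _)))]; simp
    have hm0 : ∀ σ ∈ Finset.univ.image ρ, σ ≠ ρ i → m (X.v σ) = 0 := by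
      intro σ hσ hne
      rw [hm _ (hsub hσ)]; simp [hne]
    have hrel : ∑ σ, m (X.v σ) • X.toricDivisor σ = 0 := sum_smul_toricDivisor_eq_zero m
    have hupd : ∀ D, e (Function.update (fun i => X.toricDivisor (ρ i)) i D)
        = e.toLinearMap (fun i => X.toricDivisor (ρ i)) i D := fun D => rfl
    have hz := congrArg (e.toLinearMap (fun i => X.toricDivisor (ρ i)) i) hrel
    rw [map_sum, map_zero, Finset.sum_eq_single (ρ i)] at hz
    · rw [map_smul, hm1, one_smul, ← hupd] at hz
      rw [← hz]; congr 1; ext t; by_cases ht : t = i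
      · subst ht; simp
      · simp [ht]
    · intro σ _ hσ
      rw [map_smul, ← hupd]
      by_cases hmem : σ ∈ Finset.univ.image ρ
      · rw [hm0 σ hmem hσ, zero_smul]
      · have himg : insert σ (Finset.univ.image ρ)
            ⊆ Finset.univ.image (Function.update ρ i σ) := by
          intro t ht
          rcases Finset.mem_insert.1 ht with rfl | ht
          · exact Finset.mem_image.2 ⟨i, Finset.mem_univ _, by simp⟩
          · obtain ⟨l, _, rfl⟩ := Finset.mem_image.1 ht
            -- Overwriting position `i` does not remove the ray `ρ i` from the image: its other copy
            -- sits at position `j`.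
            by_cases hl : l = i
            · exact Finset.mem_image.2 ⟨j, Finset.mem_univ _, by
                rw [Function.update_of_ne hne.symm, hl, hij]⟩
            · exact Finset.mem_image.2 ⟨l, Finset.mem_univ _, by rw [Function.update_of_ne hl]⟩
        have hc := Finset.card_le_card himg
        rw [Finset.card_insert_of_notMem hmem] at hc
        have := ih (4 - (Finset.univ.image (Function.update ρ i σ)).card) (by omega)
          (Function.update ρ i σ) rfl
        have heq : Function.update (fun i => X.toricDivisor (ρ i)) i (X.toricDivisor σ)
            = fun l => X.toricDivisor (Function.update ρ i σ l) := by
          ext l; by_cases hl : l = i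
          · subst hl; simp
          · simp [hl]
        rw [heq, this, smul_zero]
    · simp
  exact multilinear_ext fun ρ => by simpa using key _ ρ rfl

theorem IsSmoothFan.form_unique (hX : X.IsSmoothFan)
    {d d' : MultilinearMap ℤ (fun _ : Fin 4 => X.Pic) ℤ}
    (hd : X.IsIntersectionForm d) (hd' : X.IsIntersectionForm d') : d = d' := by
  refine sub_eq_zero.1 (hX.form_eq_zero fun ρ hρ => ?_)
  rw [sub_apply]
  by_cases hsp : X.SpansCone (Finset.univ.image ρ)
  · have hinj := hρ.resolve_right (not_not.2 hsp)
    rw [(hd ρ).1 hinj hsp, (hd' ρ).1 hinj hsp, sub_self]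
  · rw [(hd ρ).2 hsp, (hd' ρ).2 hsp, sub_self]

/-- The form is defined by choice. Once one solution is exhibited the choice is a solution too, and
uniqueness identifies the two. -/
theorem IsSmoothFan.intersectionForm_eq (hX : X.IsSmoothFan)
    {d : MultilinearMap ℤ (fun _ : Fin 4 => X.Pic) ℤ} (hd : X.IsIntersectionForm d) :
    X.intersectionForm = d :=
  hX.form_unique (Classical.epsilon_spec (p := X.IsIntersectionForm) ⟨d, hd⟩) hd

/-! ### Nef and ample classes -/

/-- Linear equivalence lets the representative be adapted to a chosen cone before the functional is
evaluated. -/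
theorem functional_eq {a : Fin X.k → ℤ} (K : X.Pic →ₗ[ℤ] ℤ) (m : Module.Dual ℤ (Fin 4 → ℤ)) :
    K (X.cls a) = ∑ ρ, (a ρ + m (X.v ρ)) * K (X.toricDivisor ρ) := by
  have h : X.cls a = X.cls fun ρ => a ρ + m (X.v ρ) :=
    cls_eq_cls_iff.2 ⟨-m, fun ρ => by simp⟩
  rw [h, cls_eq_sum, map_sum]
  simp

/-- A functional whose negative values on toric divisors occur on a cone only is nonnegative on
nef classes. -/
theorem IsNef.functional_nonneg {D : X.Pic} (hD : X.IsNef D) {K : X.Pic →ₗ[ℤ] ℤ}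
    {σ : Finset (Fin X.k)} (hσ : X.IsMaximalCone σ)
    (hK : ∀ ρ, ρ ∉ σ → 0 ≤ K (X.toricDivisor ρ)) : 0 ≤ K D := by
  obtain ⟨a, rfl, ha⟩ := hD
  obtain ⟨m, h1, h2⟩ := ha σ hσ
  rw [functional_eq K m]
  -- With the support function `m` of the cone `σ` added, the representative is effective and
  -- vanishes on `σ`, so only rays off `σ` contribute.
  refine Finset.sum_nonneg fun ρ _ => ?_
  by_cases hρ : ρ ∈ σ
  · rw [h1 ρ hρ]; simp
  · exact mul_nonneg (by linarith [h2 ρ]) (hK ρ hρ)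

theorem IsAmple.functional_pos {D : X.Pic} (hD : X.IsAmple D) {K : X.Pic →ₗ[ℤ] ℤ}
    {σ : Finset (Fin X.k)} (hσ : X.IsMaximalCone σ)
    (hK : ∀ ρ, ρ ∉ σ → 0 ≤ K (X.toricDivisor ρ))
    (hK' : ∃ ρ, ρ ∉ σ ∧ 0 < K (X.toricDivisor ρ)) : 0 < K D := by
  obtain ⟨a, rfl, ha⟩ := hD
  obtain ⟨m, h1, h2⟩ := ha σ hσ
  obtain ⟨τ, hτ, hpos⟩ := hK'
  rw [functional_eq K m]
  refine Finset.sum_pos' (fun ρ _ => ?_) ⟨τ, Finset.mem_univ _, ?_⟩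
  · by_cases hρ : ρ ∈ σ
    · rw [h1 ρ hρ]; simp
    · exact mul_nonneg (by linarith [h2 ρ hρ]) (hK ρ hρ)
  · exact mul_pos (by linarith [h2 τ hτ]) hpos

/-- Ample classes are interior points of the nef cone: the finitely many strict inequalities between
integers hold with slack at least 1, and a large multiple absorbs any perturbation. -/
theorem IsSmoothFan.exists_isNef_sub (hX : X.IsSmoothFan) {D : X.Pic} (hD : X.IsAmple D)
    (E : X.Pic) : ∃ N : ℤ, X.IsNef (N • D - E) := by
  classical
  obtain ⟨a, rfl, ha⟩ := hD
  obtain ⟨b, rfl⟩ := exists_cls E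
  have hb : ∀ σ, X.IsMaximalCone σ → ∃ m : Module.Dual ℤ (Fin 4 → ℤ),
      ∀ ρ ∈ σ, m (X.v ρ) = -b ρ := fun σ hσ => hX.solve σ hσ (fun ρ => -b ρ)
  choose! m h1 h2 using ha
  choose! m' h' using hb
  -- A crude bound that dominates every correction term. The sum runs over all sets `σ`; for
  -- non-maximal ones `m'` has an arbitrary value, which only enlarges `N`.
  set N : ℤ := ∑ σ : Finset (Fin X.k), ∑ ρ, |b ρ + m' σ (X.v ρ)| with hN
  refine ⟨N, fun ρ => N * a ρ - b ρ, rfl, fun σ hσ => ⟨N • m σ - m' σ, fun ρ hρ => ?_, fun ρ => ?_⟩⟩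
  · simp only [LinearMap.sub_apply, LinearMap.smul_apply, h1 σ hσ ρ hρ, h' σ hσ ρ hρ, smul_eq_mul]
    ring
  · simp only [LinearMap.sub_apply, LinearMap.smul_apply, smul_eq_mul]
    by_cases hρ : ρ ∈ σ
    · rw [h1 σ hσ ρ hρ, h' σ hσ ρ hρ]; linarith
    · have hpos : 1 ≤ a ρ + m σ (X.v ρ) := by linarith [h2 σ hσ ρ hρ]
      have hle : |b ρ + m' σ (X.v ρ)| ≤ N :=
        (Finset.single_le_sum (f := fun ρ => |b ρ + m' σ (X.v ρ)|)
          (fun _ _ => abs_nonneg _) (Finset.mem_univ ρ)).trans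
        (Finset.single_le_sum (f := fun σ : Finset (Fin X.k) => ∑ ρ, |b ρ + m' σ (X.v ρ)|)
          (fun _ _ => Finset.sum_nonneg fun _ _ => abs_nonneg _) (Finset.mem_univ σ))
      have hN0 : 0 ≤ N := (abs_nonneg _).trans hle
      nlinarith [le_abs_self (b ρ + m' σ (X.v ρ)), mul_nonneg hN0 (sub_nonneg.2 hpos)]

/-- A nef cone with more than `k - 4` facets: `p f` is a point in the relative interior of the
facet cut out by `κ f`. -/
theorem IsSmoothFan.not_isSimple (hX : X.IsSmoothFan) {n : ℕ} (hn : X.k - 4 < n)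
    (p : Fin n → X.Pic) (κ : Fin n → X.Pic →ₗ[ℤ] ℤ) (hp : ∀ f, X.IsNef (p f))
    (hκ : ∀ f D, X.IsNef D → 0 ≤ κ f D) (h0 : ∀ f, κ f (p f) = 0) (h1 : ∀ f, ∃ q, 0 < κ f q)
    (hamp : ∀ f g, f ≠ g → X.IsAmple (p f + p g)) : ¬ X.IsSimple := by
  rintro ⟨K, hK⟩
  -- If every nonzero `K r` were positive at `p f`, then `N • p f - q` would be nef for large `N`
  -- and every `q`. But `κ f` vanishes at `p f`, so it is negative on this class when `κ f q > 0`.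
  have step : ∀ f, ∃ r, K r ≠ 0 ∧ K r (p f) = 0 := by
    intro f
    by_contra! hcon
    obtain ⟨q, hq⟩ := h1 f
    set N : ℤ := ∑ r, |K r q| with hN
    have hnef : X.IsNef (N • p f - q) := by
      rw [hK]
      intro r
      rw [map_sub, map_smul, smul_eq_mul]
      by_cases hr : K r = 0
      · simp [hr]
      · have hge := (hK (p f)).1 (hp f) r
        have hpos : 1 ≤ K r (p f) := by
          have := hcon r hr; omega
        have hle : |K r q| ≤ N := Finset.single_le_sum (f := fun r => |K r q|)
          (fun _ _ => abs_nonneg _) (Finset.mem_univ r)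
        have hN0 : 0 ≤ N := (abs_nonneg _).trans hle
        nlinarith [le_abs_self (K r q), mul_nonneg hN0 (sub_nonneg.2 hpos)]
    have := hκ f _ hnef
    rw [map_sub, map_smul, h0] at this
    simp at this
    omega
  choose r hr hr0 using step
  -- There are fewer inequalities than facets, so two of the points lie on the same hyperplane `K r
  -- = 0`.
  obtain ⟨f, g, hfg, heq⟩ := Fintype.exists_ne_map_eq_of_card_lt r (by simpa using hn)
  refine hr f (LinearMap.ext fun q => ?_)
  have hz : K (r f) (p f + p g) = 0 := by
    rw [map_add, hr0 f, heq, hr0 g, add_zero]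
  -- The ample class `p f + p g` is interior and is killed by `K (r f)`, so this functional is
  -- nonpositive in every direction, hence zero.
  have hle : ∀ q, K (r f) q ≤ 0 := by
    intro q
    obtain ⟨N, hN⟩ := hX.exists_isNef_sub (hamp f g hfg) q
    have := (hK _).1 hN (r f)
    rw [map_sub, map_smul, hz] at this
    simpa using this
  have h2 := hle (-q)
  rw [map_neg] at h2
  simpa using le_antisymm (hle q) (by linarith)

end Basic

end ToricSpace


/-! ## Monads on a lattice with a simplicial nef cone -/

namespace LatticeMonad

variable {h : ℕ}

section Form

variable (d : Fin h → Fin h → Fin h → ℕ)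

/-- The quadratic forms `(x, y) ↦ ∑ d_{abr} x_a y_b`. -/
def quad (r : Fin h) (x y : Fin h → ℕ) : ℕ := ∑ a, ∑ b, d a b r * x a * y b

variable {d} (r : Fin h)

theorem quad_add_right (x y z : Fin h → ℕ) :
    quad d r x (y + z) = quad d r x y + quad d r x z := by
  simp only [quad, Pi.add_apply, mul_add, Finset.sum_add_distrib]

theorem quad_add_left (x y z : Fin h → ℕ) :
    quad d r (x + y) z = quad d r x z + quad d r y z := by
  simp only [quad, Pi.add_apply, mul_add, add_mul, Finset.sum_add_distrib]

@[simp] theorem quad_zero_right (x : Fin h → ℕ) : quad d r x 0 = 0 := by simp [quad]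

@[simp] theorem quad_zero_left (x : Fin h → ℕ) : quad d r 0 x = 0 := by simp [quad]

theorem quad_mono {x x' y y' : Fin h → ℕ} (hx : x ≤ x') (hy : y ≤ y') :
    quad d r x y ≤ quad d r x' y' :=
  Finset.sum_le_sum fun a _ => Finset.sum_le_sum fun b _ =>
    Nat.mul_le_mul (Nat.mul_le_mul_left _ (hx a)) (hy b)

theorem quad_sum_right (x : Fin h → ℕ) (M : Multiset (Fin h → ℕ)) :
    quad d r x M.sum = (M.map (quad d r x)).sum := by
  induction M using Multiset.induction_on with
  | empty => simp
  | cons a M ih => simp [quad_add_right, ih]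

theorem quad_sum_left (x : Fin h → ℕ) (M : Multiset (Fin h → ℕ)) :
    quad d r M.sum x = (M.map fun y => quad d r y x).sum := by
  induction M using Multiset.induction_on with
  | empty => simp
  | cons a M ih => simp [quad_add_left, ih]

theorem quad_smul_right (n : ℕ) (x y : Fin h → ℕ) : quad d r x (n • y) = n * quad d r x y := by
  simp only [quad, Pi.smul_apply, smul_eq_mul, Finset.mul_sum]
  exact Finset.sum_congr rfl fun _ _ => Finset.sum_congr rfl fun _ _ => by ring

/-- The unit vectors. -/
abbrev unit (a : Fin h) : Fin h → ℕ := Pi.single a 1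

theorem quad_unit_right (x : Fin h → ℕ) (b : Fin h) : quad d r x (unit b) = ∑ a, d a b r * x a := by
  simp [quad, Pi.single_apply]

theorem quad_eq_sum_unit (x y : Fin h → ℕ) :
    quad d r x y = ∑ b, y b * quad d r x (unit b) := by
  rw [quad, Finset.sum_comm]
  refine Finset.sum_congr rfl fun b _ => ?_
  rw [quad_unit_right, Finset.mul_sum]
  exact Finset.sum_congr rfl fun _ _ => by ring

theorem quad_unit_unit (a : Fin h) : quad d r (unit a) (unit a) = d a a r := by
  simp [quad_unit_right, Pi.single_apply]

/-- For natural numbers `g_a ≤ g_a²`, and the off-diagonal terms are nonnegative. This makes the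
truncated subtraction in `excess` exact. -/
theorem sum_diag_le_quad (g : Fin h → ℕ) : ∑ a, g a * d a a r ≤ quad d r g g := by
  refine Finset.sum_le_sum fun a _ => ?_
  refine le_trans ?_ (Finset.single_le_sum (f := fun b => d a b r * g a * g b)
    (fun _ _ => Nat.zero_le _) (Finset.mem_univ a))
  rcases Nat.eq_zero_or_pos (g a) with h0 | h0
  · simp [h0]
  · calc g a * d a a r = d a a r * g a * 1 := by ring
      _ ≤ _ := Nat.mul_le_mul_left _ h0

end Form

/-- The conditions on the charges of a positive monad, in coordinates for which the nef cone is the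
positive orthant. -/
structure IsMonad (d : Fin h → Fin h → Fin h → ℕ) (S : Fin h → ℕ)
    (B C : Multiset (Fin h → ℕ)) : Prop where
  rank : ∃ N ∈ ({3, 4, 5} : Set ℕ), B.card = C.card + N
  sum_eq : B.sum = C.sum
  one_le_B : ∀ b ∈ B, 1 ≤ b
  one_le_C : ∀ c ∈ C, 1 ≤ c
  le : ∀ b ∈ B, ∀ c ∈ C, b ≤ c
  ne : ∀ b ∈ B, ∀ c ∈ C, b ≠ c
  cost : ∀ r, (C.map fun c => quad d r c c).sum ≤ (B.map fun b => quad d r b b).sum + S r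

/-- Monads are encoded by `N = r_B - r_C`, the join `m` of the `b_i`, the nonzero `m - b_i`, and
those `c_j - m` that are neither zero nor unit vectors. -/
@[ext] structure Code (h : ℕ) where
  N : ℕ
  m : Fin h → ℕ
  β : Multiset (Fin h → ℕ)
  γ : Multiset (Fin h → ℕ)

/-- The sum of the coordinates. -/
def size (x : Fin h → ℕ) : ℕ := ∑ a, x a

theorem size_eq_zero {x : Fin h → ℕ} : size x = 0 ↔ x = 0 := by
  simp [size, Finset.sum_eq_zero_iff, funext_iff]

theorem size_add (x y : Fin h → ℕ) : size (x + y) = size x + size y := by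
  simp [size, Finset.sum_add_distrib]

theorem exists_eq_unit {x : Fin h → ℕ} (hx : size x = 1) : ∃ a, x = unit a := by
  obtain ⟨a, ha⟩ : ∃ a, x a ≠ 0 := by
    by_contra! hcon
    simp [size, hcon] at hx
  have h1 := Finset.add_sum_erase Finset.univ x (Finset.mem_univ a)
  rw [show ∑ b, x b = 1 from hx] at h1
  have h2 : ∑ b ∈ Finset.univ.erase a, x b = 0 := by omega
  refine ⟨a, funext fun b => ?_⟩
  by_cases hb : b = a
  · subst hb; simp; omega
  · simp only [unit, Pi.single_apply, hb, if_false]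
    exact (Finset.sum_eq_zero_iff.1 h2) b (Finset.mem_erase.2 ⟨hb, Finset.mem_univ _⟩)

@[simp] theorem size_unit (a : Fin h) : size (unit a) = 1 := by
  simp [size, Pi.single_apply]

/-- The multiset that contains the unit vector `e_a` with multiplicity `n_a`. -/
def units (n : Fin h → ℕ) : Multiset (Fin h → ℕ) := ∑ a, Multiset.replicate (n a) (unit a)

theorem units_add (n n' : Fin h → ℕ) : units (n + n') = units n + units n' := by
  simp [units, Multiset.replicate_add, Finset.sum_add_distrib]

theorem units_unit (a : Fin h) : units (unit a) = {unit a} := by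
  rw [units, Finset.sum_eq_single a]
  · simp
  · intro b _ hb; simp [hb]
  · simp

theorem units_zero : units (0 : Fin h → ℕ) = 0 := by simp [units]

/-- A multiset of unit vectors is determined by its sum. This is why codes do not store the unit
vectors among the `c_j - m`. -/
theorem eq_units {M : Multiset (Fin h → ℕ)} (hM : ∀ x ∈ M, size x = 1) : M = units M.sum := by
  induction M using Multiset.induction_on with
  | empty => simp [units_zero]
  | cons x M ih =>
    obtain ⟨a, rfl⟩ := exists_eq_unit (hM x (Multiset.mem_cons_self _ _))
    rw [Multiset.sum_cons, units_add, units_unit,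
      ← ih fun y hy => hM y (Multiset.mem_cons_of_mem hy), Multiset.singleton_add]

theorem sum_map_units {f : (Fin h → ℕ) → ℕ} (n : Fin h → ℕ) :
    ((units n).map f).sum = ∑ a, n a * f (unit a) := by
  rw [units, ← Multiset.coe_mapAddMonoidHom, map_sum, ← Multiset.coe_sumAddMonoidHom, map_sum]
  simp

theorem sum_units (n : Fin h → ℕ) : (units n).sum = n := by
  rw [units, ← Multiset.coe_sumAddMonoidHom, map_sum]
  ext b
  simp [Finset.sum_apply, Pi.single_apply]

theorem card_units (n : Fin h → ℕ) : (units n).card = size n := by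
  simp [units, size]

theorem size_of_mem_units {n x : Fin h → ℕ} (hx : x ∈ units n) : size x = 1 := by
  rw [units, Multiset.mem_sum] at hx
  obtain ⟨a, _, ha⟩ := hx
  rw [Multiset.eq_of_mem_replicate ha, size_unit]

namespace Code

variable (c : Code h)

/-- The multiplicities of the unit vectors among the `c_j - m`. -/
def mult : Fin h → ℕ := c.N • c.m - c.β.sum - c.γ.sum

/-- The number of nonzero `c_j - m`. -/
def p : ℕ := c.γ.card + size c.mult

/-- The `b_i` of the monad. -/
def B : Multiset (Fin h → ℕ) :=
  c.β.map (fun b => c.m - b) + Multiset.replicate (c.N + c.p - c.β.card) c.m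

/-- The `c_j` of the monad. -/
def C : Multiset (Fin h → ℕ) :=
  (c.γ + units c.mult).map (fun g => c.m + g) + Multiset.replicate (c.β.card - (c.N + c.p)) c.m

/-- The contribution of the code to the anomaly condition. -/
def cost (d : Fin h → Fin h → Fin h → ℕ) (r : Fin h) : ℕ :=
  (c.β.map fun b => quad d r (c.m - b) b).sum + (c.γ.map fun g => quad d r (c.m + g) g).sum
    + ∑ a, c.mult a * quad d r (c.m + unit a) (unit a)

/-- The codes of monads. -/
structure IsValid (d : Fin h → Fin h → Fin h → ℕ) (S : Fin h → ℕ) : Prop where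
  N_mem : c.N ∈ ({3, 4, 5} : Set ℕ)
  one_le : 1 ≤ c.m
  β_ne : ∀ b ∈ c.β, b ≠ 0
  β_le : ∀ b ∈ c.β, b + 1 ≤ c.m
  γ_size : ∀ g ∈ c.γ, 2 ≤ size g
  sum_le : c.β.sum + c.γ.sum ≤ c.N • c.m
  cost_le : ∀ r, c.cost d r ≤ S r
  join : c.N + c.p ≤ c.β.card → ∀ a, ∃ b ∈ c.β, b a = 0

end Code

/-- The code of a monad. -/
def encode (B C : Multiset (Fin h → ℕ)) : Code h where
  N := B.card - C.card
  m := B.sup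
  β := (B.map fun b => B.sup - b).filter (· ≠ 0)
  γ := (C.map fun c => c - B.sup).filter (2 ≤ size ·)

theorem le_sup {B : Multiset (Fin h → ℕ)} {b : Fin h → ℕ} (hb : b ∈ B) : b ≤ B.sup :=
  Multiset.le_sup hb

theorem filter_add_replicate_zero (M : Multiset (Fin h → ℕ)) :
    M = M.filter (· ≠ 0) + Multiset.replicate (M.card - (M.filter (· ≠ 0)).card) 0 := by
  have h1 := Multiset.filter_add_not (p := fun x : Fin h → ℕ => x ≠ 0) M
  have h2 : M.filter (fun x => ¬ x ≠ 0) = Multiset.replicate (M.card - (M.filter (· ≠ 0)).card) 0 := by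
    rw [Multiset.eq_replicate]
    refine ⟨?_, fun b hb => by simpa using (Multiset.mem_filter.1 hb).2⟩
    have := congrArg Multiset.card h1
    rw [Multiset.card_add] at this
    omega
  rw [← h2, h1]

variable {d : Fin h → Fin h → Fin h → ℕ} {S : Fin h → ℕ}

/-- The anomaly condition in terms of the join `m`. -/
theorem cost_eq {B C : Multiset (Fin h → ℕ)} {m : Fin h → ℕ}
    (hs : B.sum = C.sum) (hB : ∀ b ∈ B, b ≤ m) (hC : ∀ c ∈ C, m ≤ c) (r : Fin h) :
    (C.map fun c => quad d r c c).sum = (B.map fun b => quad d r b b).sum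
      + ((B.map fun b => quad d r b (m - b)).sum + (C.map fun c => quad d r c (c - m)).sum) := by
  have h1 : (C.map fun c => quad d r c c).sum
      = (C.map fun c => quad d r c m).sum + (C.map fun c => quad d r c (c - m)).sum := by
    rw [← Multiset.sum_map_add]
    congr 1
    refine Multiset.map_congr rfl fun c hc => ?_
    rw [← quad_add_right, add_tsub_cancel_of_le (hC c hc)]
  have h2 : (B.map fun b => quad d r b m).sum
      = (B.map fun b => quad d r b b).sum + (B.map fun b => quad d r b (m - b)).sum := by
    rw [← Multiset.sum_map_add]
    congr 1
    refine Multiset.map_congr rfl fun b hb => ?_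
    rw [← quad_add_right, add_tsub_cancel_of_le (hB b hb)]
  -- Here `c₁ = 0` enters: pairing with the fixed vector `m` gives the same total for the `b_i` and
  -- for the `c_j`.
  rw [h1, ← quad_sum_left, ← hs, quad_sum_left, h2]
  ring

/-- The condition `c₁ = 0`, written relative to a vector `m` between the `b_i` and the `c_j`. The
copies of `m` cancel up to `N = r_B - r_C` of them. -/
theorem sum_sub_add_sum {B C : Multiset (Fin h → ℕ)} {m : Fin h → ℕ} {N : ℕ}
    (hN : B.card = C.card + N) (hs : B.sum = C.sum) (hB : ∀ b ∈ B, b ≤ m) (hC : ∀ c ∈ C, m ≤ c) :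
    (B.map fun b => m - b).sum + (C.map fun c => c - m).sum = N • m := by
  have h1 : (B.map fun b => m - b).sum + B.sum = B.card • m := by
    nth_rewrite 2 [← Multiset.map_id B]
    rw [← Multiset.sum_map_add, ← Multiset.sum_replicate, ← Multiset.map_const']
    congr 1
    exact Multiset.map_congr rfl fun b hb => tsub_add_cancel_of_le (hB b hb)
  have h2 : (C.map fun c => c - m).sum + C.card • m = C.sum := by
    rw [← Multiset.sum_replicate, ← Multiset.map_const', ← Multiset.sum_map_add]
    nth_rewrite 2 [← Multiset.map_id C]
    congr 1
    exact Multiset.map_congr rfl fun c hc => tsub_add_cancel_of_le (hC c hc)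
  have h3 : (B.map fun b => m - b).sum + (C.map fun c => c - m).sum + C.card • m
      = N • m + C.card • m := by
    rw [add_assoc, h2, ← hs, h1, hN, add_smul, add_comm]
  exact add_right_cancel h3

namespace IsMonad

variable {B C : Multiset (Fin h → ℕ)}

/-- Nothing is lost in the code. The differences from `m` that are stored are the nonzero `m - b_i`
and the `c_j - m` of size at least 2. The unit vectors are recovered from `c₁ = 0`, and the zero
differences from the rank together with the fact that they occur on one side only. -/
theorem encode_spec (hm : IsMonad d S B C) :
    (encode B C).IsValid d S ∧ (encode B C).B = B ∧ (encode B C).C = C := by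
  obtain ⟨N, hN, hcard⟩ := hm.rank
  set m := B.sup with hmdef
  have hN' : B.card - C.card = N := by omega
  have hN3 : 3 ≤ N := by
    simp only [Set.mem_insert_iff, Set.mem_singleton_iff] at hN; omega
  have hB : ∀ b ∈ B, b ≤ m := fun b hb => le_sup hb
  have hC : ∀ c ∈ C, m ≤ c := fun c hc => Multiset.sup_le.2 fun b hb => hm.le b hb c hc
  have hBne : ∃ b, b ∈ B := Multiset.card_pos_iff_exists_mem.1 (by omega)
  set B' := B.map fun b => m - b with hB'
  set C' := C.map fun c => c - m with hC'
  set β := B'.filter (· ≠ 0) with hβ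
  set γ := C'.filter (2 ≤ size ·) with hγ
  set C₁ := C'.filter (· ≠ 0) with hC₁
  have hsum : B'.sum + C'.sum = N • m := sum_sub_add_sum hcard hm.sum_eq hB hC
  have eB' : B' = β + Multiset.replicate (B'.card - β.card) 0 := filter_add_replicate_zero B'
  have eC' : C' = C₁ + Multiset.replicate (C'.card - C₁.card) 0 := filter_add_replicate_zero C'
  have sβ : β.sum = B'.sum := by
    conv_rhs => rw [eB']
    simp
  -- A nonzero vector has size at least 2 or is a unit vector, and the unit vectors are known from
  -- their sum.
  have eC₁ : C₁ = γ + units (C₁.sum - γ.sum) := by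
    have h1 := Multiset.filter_add_not (p := fun x : Fin h → ℕ => 2 ≤ size x) C₁
    have h2 : C₁.filter (2 ≤ size ·) = γ := by
      rw [hC₁, Multiset.filter_filter, hγ]
      refine Multiset.filter_congr fun x _ => ⟨fun hx => hx.1, fun hx => ⟨hx, fun h0 => ?_⟩⟩
      rw [h0] at hx
      have : size (0 : Fin h → ℕ) = 0 := size_eq_zero.2 rfl
      omega
    have h3 : ∀ x ∈ C₁.filter (fun x => ¬ 2 ≤ size x), size x = 1 := by
      intro x hx
      obtain ⟨hx1, hx2⟩ := Multiset.mem_filter.1 hx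
      have h4 : size x ≠ 0 := fun h0 => (Multiset.mem_filter.1 hx1).2 (size_eq_zero.1 h0)
      omega
    have h5 := eq_units h3
    rw [h2] at h1
    have h6 : C₁.sum - γ.sum = (C₁.filter (fun x => ¬ 2 ≤ size x)).sum := by
      rw [← h1, Multiset.sum_add, add_tsub_cancel_left]
      rw [h1]
    rw [h6, ← h5, h1]
  have sC₁ : C₁.sum = C'.sum := by
    conv_rhs => rw [eC']
    simp
  have emult : (encode B C).mult = C₁.sum - γ.sum := by
    simp only [Code.mult, encode, ← hmdef, ← hB', ← hC', ← hβ, ← hγ, hN', sβ, sC₁, ← hsum,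
      add_tsub_cancel_left]
  have ep : (encode B C).p = C₁.card := by
    conv_rhs => rw [eC₁]
    rw [Multiset.card_add, card_units, ← emult]
    rfl
  have cβ : β.card ≤ B'.card := Multiset.card_le_card (Multiset.filter_le _ _)
  have cC₁ : C₁.card ≤ C'.card := Multiset.card_le_card (Multiset.filter_le _ _)
  have cB' : B'.card = B.card := Multiset.card_map _ _
  have cC' : C'.card = C.card := Multiset.card_map _ _
  -- A zero difference on both sides would give some `b_i = m = c_j`, which nontriviality excludes.
  have hzero : B'.card - β.card = 0 ∨ C'.card - C₁.card = 0 := by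
    by_contra! hcon
    have h1 : (0 : Fin h → ℕ) ∈ B' := by
      rw [eB']
      exact Multiset.mem_add.2 (Or.inr (Multiset.mem_replicate.2 ⟨hcon.1, rfl⟩))
    have h2 : (0 : Fin h → ℕ) ∈ C' := by
      rw [eC']
      exact Multiset.mem_add.2 (Or.inr (Multiset.mem_replicate.2 ⟨hcon.2, rfl⟩))
    obtain ⟨b, hb, hb0⟩ := Multiset.mem_map.1 h1
    obtain ⟨c, hc, hc0⟩ := Multiset.mem_map.1 h2
    refine hm.ne b hb c hc ?_
    rw [le_antisymm (hB b hb) (tsub_eq_zero_iff_le.1 hb0),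
      le_antisymm (tsub_eq_zero_iff_le.1 hc0) (hC c hc)]
  have hBB : (encode B C).B = B := by
    have h1 : B = B'.map fun x => m - x := by
      rw [hB', Multiset.map_map]
      nth_rewrite 1 [← Multiset.map_id B]
      exact Multiset.map_congr rfl fun b hb => (tsub_tsub_cancel_of_le (hB b hb)).symm
    -- The numbers of zero differences in `B'` and `C'` differ by `N + p - |β|`, and one of them is
    -- zero. So each of them is a truncated difference.
    have h2 : N + C₁.card - β.card = B'.card - β.card := by omega
    conv_rhs => rw [h1, eB', Multiset.map_add, Multiset.map_replicate, tsub_zero, ← h2, ← ep, ← hN']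
    rfl
  have hCC : (encode B C).C = C := by
    have h1 : C = C'.map fun x => m + x := by
      rw [hC', Multiset.map_map]
      nth_rewrite 1 [← Multiset.map_id C]
      exact Multiset.map_congr rfl fun b hb => (add_tsub_cancel_of_le (hC b hb)).symm
    have h2 : β.card - (N + C₁.card) = C'.card - C₁.card := by omega
    conv_rhs =>
      rw [h1, eC', Multiset.map_add, Multiset.map_replicate, add_zero, ← h2, ← ep, ← hN', eC₁,
        ← emult]
    rfl
  refine ⟨⟨?_, ?_, ?_, ?_, ?_, ?_, ?_, ?_⟩, hBB, hCC⟩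
  · simpa [encode, hN'] using hN
  · obtain ⟨b, hb⟩ := hBne
    exact (hm.one_le_B b hb).trans (hB b hb)
  · intro b hb
    exact (Multiset.mem_filter.1 hb).2
  · intro x hx
    obtain ⟨b, hb, rfl⟩ := Multiset.mem_map.1 (Multiset.mem_filter.1 hx).1
    calc m - b + 1 ≤ m - b + b := by gcongr; exact hm.one_le_B b hb
      _ = m := tsub_add_cancel_of_le (hB b hb)
  · intro g hg
    exact (Multiset.mem_filter.1 hg).2
  · change β.sum + γ.sum ≤ (B.card - C.card) • m
    rw [hN', ← hsum, sβ, ← sC₁]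
    gcongr
    conv_rhs => rw [eC₁]
    rw [Multiset.sum_add]
    exact le_self_add
  · intro r
    have h1 := hm.cost r
    rw [cost_eq hm.sum_eq hB hC r] at h1
    have h2 : (B.map fun b => quad d r b (m - b)).sum
        = (β.map fun b => quad d r (m - b) b).sum := by
      have : (B.map fun b => quad d r b (m - b)) = B'.map fun x => quad d r (m - x) x := by
        rw [hB', Multiset.map_map]
        refine Multiset.map_congr rfl fun b hb => ?_
        simp only [Function.comp, tsub_tsub_cancel_of_le (hB b hb)]
      rw [this, eB', Multiset.map_add, Multiset.sum_add, Multiset.map_replicate,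
        Multiset.sum_replicate, quad_zero_right, smul_zero, add_zero]
    have h3 : (C.map fun c => quad d r c (c - m)).sum
        = (γ.map fun g => quad d r (m + g) g).sum
          + ∑ a, (C₁.sum - γ.sum) a * quad d r (m + unit a) (unit a) := by
      have : (C.map fun c => quad d r c (c - m)) = C'.map fun x => quad d r (m + x) x := by
        rw [hC', Multiset.map_map]
        refine Multiset.map_congr rfl fun b hb => ?_
        simp only [Function.comp, add_tsub_cancel_of_le (hC b hb)]
      rw [this, eC', Multiset.map_add, Multiset.sum_add, Multiset.map_replicate,
        Multiset.sum_replicate, quad_zero_right, smul_zero, add_zero]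
      conv_lhs => rw [eC₁, Multiset.map_add, Multiset.sum_add]
      rw [sum_map_units]
    rw [h2, h3] at h1
    have h4 : (encode B C).cost d r = (β.map fun b => quad d r (m - b) b).sum
        + (γ.map fun g => quad d r (m + g) g).sum
        + ∑ a, (C₁.sum - γ.sum) a * quad d r (m + unit a) (unit a) := by
      rw [Code.cost, emult]
      rfl
    omega
  -- In this case no `b_i` equals `m`. If no `b_i` attained the coordinate `m a`, then `m` could be
  -- lowered by one there and would not be the join.
  · intro hle a
    change (B.card - C.card) + (encode B C).p ≤ β.card at hle
    rw [ep, hN'] at hle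
    by_contra! hcon
    have hall : ∀ b ∈ B, b a + 1 ≤ m a := by
      intro b hb
      have h0 : m - b ∈ β := by
        have h1 : β.card = B'.card := by omega
        have h5 : β = B' := Multiset.eq_of_le_of_card_le (Multiset.filter_le _ _) h1.ge
        exact (congrArg (m - b ∈ ·) h5).mpr (Multiset.mem_map_of_mem _ hb)
      have h2 := hcon _ h0
      simp only [Pi.sub_apply] at h2
      omega
    have h3 : m ≤ Function.update m a (m a - 1) := by
      refine Multiset.sup_le.2 fun b hb t => ?_
      by_cases ht : t = a
      · subst ht; simp; have := hall b hb; omega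
      · simp [ht]; exact hB b hb t
    have h4 := h3 a
    simp only [Function.update_self] at h4
    obtain ⟨b, hb⟩ := hBne
    have := hall b hb
    omega

end IsMonad

namespace Code.IsValid

variable {c : Code h}

theorem size_mult_add (hc : c.IsValid d S) : c.β.sum + (c.γ.sum + c.mult) = c.N • c.m := by
  rw [Code.mult, tsub_tsub, ← add_assoc, add_tsub_cancel_of_le hc.sum_le]

theorem card_B (_ : c.IsValid d S) : c.B.card = c.C.card + c.N := by
  simp only [Code.B, Code.C, Multiset.card_add, Multiset.card_map, Multiset.card_replicate,
    card_units]
  have : c.p = c.γ.card + size c.mult := rfl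
  omega

theorem mem_B (hc : c.IsValid d S) {b : Fin h → ℕ} (hb : b ∈ c.B) : 1 ≤ b ∧ b ≤ c.m := by
  rcases Multiset.mem_add.1 hb with hb | hb
  · obtain ⟨x, hx, rfl⟩ := Multiset.mem_map.1 hb
    exact ⟨le_tsub_of_add_le_left (hc.β_le x hx), tsub_le_self⟩
  · rw [Multiset.eq_of_mem_replicate hb]
    exact ⟨hc.one_le, le_rfl⟩

theorem mem_C (_ : c.IsValid d S) {x : Fin h → ℕ} (hx : x ∈ c.C) : c.m ≤ x := by
  rcases Multiset.mem_add.1 hx with hb | hb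
  · obtain ⟨x, hx, rfl⟩ := Multiset.mem_map.1 hb
    exact le_self_add
  · rw [Multiset.eq_of_mem_replicate hb]

theorem map_sub_B (hc : c.IsValid d S) : c.B.map (fun b => c.m - b)
    = c.β + Multiset.replicate (c.N + c.p - c.β.card) 0 := by
  rw [Code.B, Multiset.map_add, Multiset.map_map, Multiset.map_replicate, tsub_self]
  congr 1
  nth_rewrite 2 [← Multiset.map_id c.β]
  refine Multiset.map_congr rfl fun b hb => ?_
  exact tsub_tsub_cancel_of_le (le_self_add.trans (hc.β_le b hb))

theorem map_sub_C (c : Code h) : c.C.map (fun x => x - c.m)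
    = c.γ + units c.mult + Multiset.replicate (c.β.card - (c.N + c.p)) 0 := by
  rw [Code.C, Multiset.map_add, Multiset.map_map, Multiset.map_replicate, tsub_self]
  congr 1
  nth_rewrite 2 [← Multiset.map_id (c.γ + units c.mult)]
  exact Multiset.map_congr rfl fun b _ => add_tsub_cancel_left _ _

/-- Either a copy of `m` is among the `b_i`, or the join condition provides for each coordinate some
`b_i` that agrees with `m` there. -/
theorem sup_B (hc : c.IsValid d S) : c.B.sup = c.m := by
  refine le_antisymm (Multiset.sup_le.2 fun b hb => (hc.mem_B hb).2) fun a => ?_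
  by_cases hle : c.N + c.p ≤ c.β.card
  · obtain ⟨b, hb, h0⟩ := hc.join hle a
    have : c.m - b ∈ c.B := Multiset.mem_add.2 (Or.inl (Multiset.mem_map_of_mem _ hb))
    have := le_sup this a
    simpa [h0] using this
  · exact le_sup (B := c.B) (b := c.m) (Multiset.mem_add.2 (Or.inr (Multiset.mem_replicate.2
      ⟨by omega, rfl⟩))) a

/-- Decoding is injective on valid codes; hence counting monads is counting codes. -/
theorem encode_eq (hc : c.IsValid d S) : encode c.B c.C = c := by
  have hz : size (0 : Fin h → ℕ) = 0 := size_eq_zero.2 rfl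
  ext1
  · have := hc.card_B
    simp only [encode]; omega
  · exact hc.sup_B
  · simp only [encode, hc.sup_B]
    rw [hc.map_sub_B, Multiset.filter_add, Multiset.filter_eq_self.2 hc.β_ne,
      Multiset.filter_eq_nil.2, add_zero]
    intro x hx
    simpa using Multiset.eq_of_mem_replicate hx
  · simp only [encode, hc.sup_B]
    rw [map_sub_C, Multiset.filter_add, Multiset.filter_add,
      Multiset.filter_eq_self.2 hc.γ_size, Multiset.filter_eq_nil.2, Multiset.filter_eq_nil.2,
      add_zero, add_zero]
    · intro x hx
      rw [Multiset.eq_of_mem_replicate hx, hz]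
      omega
    · intro x hx
      rw [size_of_mem_units hx]
      omega

/-- Each condition on a monad was translated reversibly: the differences from `m` of the decoded
multisets are those of the code, padded by zeros on one side. -/
theorem isMonad (hc : c.IsValid d S) : IsMonad d S c.B c.C := by
  have hsum : c.B.sum = c.C.sum := by
    have h1 : (c.B.map fun b => c.m - b).sum + c.B.sum = c.B.card • c.m := by
      nth_rewrite 2 [← Multiset.map_id c.B]
      rw [← Multiset.sum_map_add, ← Multiset.sum_replicate, ← Multiset.map_const']
      congr 1
      exact Multiset.map_congr rfl fun b hb => tsub_add_cancel_of_le (hc.mem_B hb).2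
    have h2 : (c.C.map fun x => x - c.m).sum + c.C.card • c.m = c.C.sum := by
      rw [← Multiset.sum_replicate, ← Multiset.map_const', ← Multiset.sum_map_add]
      nth_rewrite 2 [← Multiset.map_id c.C]
      congr 1
      exact Multiset.map_congr rfl fun b hb => tsub_add_cancel_of_le (hc.mem_C hb)
    rw [hc.map_sub_B] at h1
    rw [map_sub_C] at h2
    simp only [Multiset.sum_add, Multiset.sum_replicate, smul_zero, add_zero, sum_units] at h1 h2
    have h3 := hc.size_mult_add
    rw [hc.card_B, add_smul, ← h3] at h1
    rw [← h2]
    refine add_left_cancel (a := c.β.sum) ?_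
    rw [h1]
    abel
  refine ⟨⟨c.N, hc.N_mem, hc.card_B⟩, hsum, fun b hb => (hc.mem_B hb).1,
    fun x hx => hc.one_le.trans (hc.mem_C hx), fun b hb x hx => (hc.mem_B hb).2.trans (hc.mem_C hx),
    ?_, fun r => ?_⟩
  · rintro b hb x hx rfl
    have hbm : b = c.m := le_antisymm (hc.mem_B hb).2 (hc.mem_C hx)
    subst hbm
    -- A common element must be `m`. Copies of `m` among the `b_i` need `|β| < N + p`, copies among
    -- the `c_j` need the opposite strict inequality.
    have h1 : c.β.card < c.N + c.p := by
      rcases Multiset.mem_add.1 hb with hb | hb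
      · obtain ⟨y, hy, hy'⟩ := Multiset.mem_map.1 hb
        refine absurd ?_ (hc.β_ne y hy)
        have hle : y ≤ c.m := le_self_add.trans (hc.β_le y hy)
        rw [← tsub_tsub_cancel_of_le hle, hy', tsub_self]
      · have := (Multiset.mem_replicate.1 hb).1
        omega
    rcases Multiset.mem_add.1 hx with hx | hx
    · obtain ⟨y, hy, hy'⟩ := Multiset.mem_map.1 hx
      have hy0 : y = 0 := by simpa using hy'
      have hz : size y = 0 := size_eq_zero.2 hy0
      rcases Multiset.mem_add.1 hy with hy | hy
      · have := hc.γ_size y hy; omega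
      · have := size_of_mem_units hy; omega
    · have := (Multiset.mem_replicate.1 hx).1
      omega
  · rw [cost_eq hsum (fun b hb => (hc.mem_B hb).2) (fun x hx => hc.mem_C hx) r]
    have h2 : (c.B.map fun b => quad d r b (c.m - b)).sum
        = (c.β.map fun b => quad d r (c.m - b) b).sum := by
      have : (c.B.map fun b => quad d r b (c.m - b))
          = (c.B.map fun b => c.m - b).map fun x => quad d r (c.m - x) x := by
        rw [Multiset.map_map]
        refine Multiset.map_congr rfl fun b hb => ?_
        simp only [Function.comp, tsub_tsub_cancel_of_le (hc.mem_B hb).2]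
      rw [this, hc.map_sub_B, Multiset.map_add, Multiset.sum_add, Multiset.map_replicate,
        Multiset.sum_replicate, quad_zero_right, smul_zero, add_zero]
    have h3 : (c.C.map fun x => quad d r x (x - c.m)).sum
        = (c.γ.map fun g => quad d r (c.m + g) g).sum
          + ∑ a, c.mult a * quad d r (c.m + unit a) (unit a) := by
      have : (c.C.map fun x => quad d r x (x - c.m))
          = (c.C.map fun x => x - c.m).map fun x => quad d r (c.m + x) x := by
        rw [Multiset.map_map]
        refine Multiset.map_congr rfl fun b hb => ?_
        simp only [Function.comp, add_tsub_cancel_of_le (hc.mem_C hb)]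
      rw [this, map_sub_C, Multiset.map_add, Multiset.sum_add, Multiset.map_replicate,
        Multiset.sum_replicate, quad_zero_right, smul_zero, add_zero, Multiset.map_add,
        Multiset.sum_add, sum_map_units]
    have h4 := hc.cost_le r
    rw [Code.cost] at h4
    rw [h2, h3]
    omega

end Code.IsValid

end LatticeMonad


/-! ## Enumeration of monads by lists of natural numbers -/

namespace MonadSearch

/-- Componentwise `≤` for lists of the same length. -/
def leL : List ℕ → List ℕ → Bool
  | a :: l, b :: s => Nat.ble a b && leL l s
  | _, _ => true

/-- Componentwise difference. -/
def subL (l s : List ℕ) : List ℕ := List.zipWith Nat.sub l s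

/-- Componentwise sum. -/
def addL (l s : List ℕ) : List ℕ := List.zipWith Nat.add l s

/-- The sum of the entries. -/
def sumL : List ℕ → ℕ
  | [] => 0
  | a :: l => Nat.add a (sumL l)

/-- The standard scalar product. -/
def dotL : List ℕ → List ℕ → ℕ
  | a :: l, b :: s => Nat.add (Nat.mul a b) (dotL l s)
  | _, _ => 0

theorem leL_iff {l s : List ℕ} (hl : l.length = s.length) :
    leL l s = true ↔ ∀ i, l.getD i 0 ≤ s.getD i 0 := by
  induction l generalizing s with
  | nil => simp [leL]
  | cons a l ih =>
    cases s with
    | nil => simp at hl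
    | cons b s =>
      rw [leL, Bool.and_eq_true, ih (by simpa using hl), Nat.ble_eq]
      refine ⟨?_, fun h => ⟨by simpa using h 0, fun i => by simpa using h (i + 1)⟩⟩
      rintro ⟨h1, h2⟩ (_ | i)
      · simpa using h1
      · simpa using h2 i

theorem length_subL {l s : List ℕ} (hl : l.length = s.length) : (subL l s).length = l.length := by
  simp [subL, hl]

theorem length_addL {l s : List ℕ} (hl : l.length = s.length) : (addL l s).length = l.length := by
  simp [addL, hl]

theorem getD_subL {l s : List ℕ} (hl : l.length = s.length) (i : ℕ) :
    (subL l s).getD i 0 = l.getD i 0 - s.getD i 0 := by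
  induction l generalizing s i with
  | nil => simp [subL]
  | cons a l ih =>
    cases s with
    | nil => simp at hl
    | cons b s =>
      cases i with
      | zero => rfl
      | succ i => exact ih (by simpa using hl) i

theorem getD_addL {l s : List ℕ} (hl : l.length = s.length) (i : ℕ) :
    (addL l s).getD i 0 = l.getD i 0 + s.getD i 0 := by
  induction l generalizing s i with
  | nil =>
    cases s with
    | nil => rfl
    | cons b s => simp at hl
  | cons a l ih =>
    cases s with
    | nil => simp at hl
    | cons b s =>
      cases i with
      | zero => rfl
      | succ i => exact ih (by simpa using hl) i

/-- A list as a vector. -/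
def vec (h : ℕ) (l : List ℕ) : Fin h → ℕ := fun i => l.getD i 0

theorem vec_injOn {h : ℕ} {l s : List ℕ} (hl : l.length = h) (hs : s.length = h)
    (heq : vec h l = vec h s) : l = s := by
  refine List.ext_getElem (hl.trans hs.symm) fun i h1 h2 => ?_
  have := congrFun heq ⟨i, hl ▸ h1⟩
  simpa [vec, List.getD_eq_getElem, h1, h2] using this

theorem vec_ofFn {h : ℕ} (x : Fin h → ℕ) : vec h (List.ofFn x) = x := by
  ext i; simp [vec]

theorem sumL_eq {h : ℕ} {l : List ℕ} (hl : l.length = h) :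
    sumL l = LatticeMonad.size (vec h l) := by
  induction l generalizing h with
  | nil => subst hl; simp [sumL, LatticeMonad.size]
  | cons a l ih =>
    cases h with
    | zero => simp at hl
    | succ h =>
      rw [sumL, ih (by simpa using hl), LatticeMonad.size, LatticeMonad.size, Fin.sum_univ_succ]
      rfl

theorem dotL_eq {h : ℕ} {l : List ℕ} (s : List ℕ) (hl : l.length = h) :
    dotL l s = ∑ i : Fin h, l.getD i 0 * s.getD i 0 := by
  induction l generalizing h s with
  | nil => subst hl; simp [dotL]
  | cons a l ih =>
    cases h with
    | zero => simp at hl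
    | succ h =>
      cases s with
      | nil => simp [dotL]
      | cons b s =>
        rw [dotL, ih s (by simpa using hl), Fin.sum_univ_succ]
        rfl

/-- All lists with entries bounded by those of the given list. -/
def box : List ℕ → List (List ℕ)
  | [] => [[]]
  | b :: bs => (List.range (Nat.succ b)).flatMap fun x => (box bs).map (List.cons x)

theorem mem_box {l bs : List ℕ} :
    l ∈ box bs ↔ l.length = bs.length ∧ ∀ i, l.getD i 0 ≤ bs.getD i 0 := by
  induction bs generalizing l with
  | nil => 
    simp only [box, List.mem_singleton, List.length_nil, List.length_eq_zero_iff]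
    constructor
    · rintro rfl; simp
    · exact fun h => h.1
  | cons b bs ih =>
    simp only [box, List.mem_flatMap, List.mem_range, List.mem_map, ih]
    constructor
    · rintro ⟨x, hx, l, ⟨h1, h2⟩, rfl⟩
      refine ⟨by simp [h1], ?_⟩
      rintro (_ | i)
      · simp; omega
      · simpa using h2 i
    · rintro ⟨h1, h2⟩
      cases l with
      | nil => simp at h1
      | cons a l =>
        refine ⟨a, by have := h2 0; simp at this; omega, l, ⟨by simpa using h1, fun i => ?_⟩, rfl⟩
        simpa using h2 (i + 1)

theorem nodup_box (bs : List ℕ) : (box bs).Nodup := by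
  induction bs with
  | nil => simp [box]
  | cons b bs ih =>
    rw [box, List.nodup_flatMap]
    refine ⟨fun x _ => ih.map (List.cons_injective), ?_⟩
    refine List.nodup_range.imp ?_
    intro x y hxy l hx hy
    obtain ⟨_, _, rfl⟩ := List.mem_map.1 hx
    obtain ⟨_, _, h⟩ := List.mem_map.1 hy
    exact hxy (List.cons_eq_cons.1 h).1.symm

section Knapsack

variable {I : Type} (w : I → List ℕ)

/-- The multisets in `knap` that contain an item of the given list. -/
def knapAux (rec : List I → List ℕ → List (List I)) (s : List ℕ) : List I → List (List I)
  | [] => []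
  | it :: rest => ((rec ((it :: rest).filter fun j => leL (w j) (subL s (w it))) (subL s (w it))).map
      (List.cons it)) ++ knapAux rec s rest

/-- All multisets of items (each of which fits) whose total weight is at most `s`. -/
def knap : ℕ → List I → List ℕ → List (List I)
  | 0, _, _ => [[]]
  | n + 1, items, s => [] :: knapAux w (knap n) s items

variable {w} {k : ℕ}

/-- The total weight of a multiset of items. -/
def weight (w : I → List ℕ) (M : Multiset I) (i : ℕ) : ℕ := (M.map fun x => (w x).getD i 0).sum

theorem weight_cons (x : I) (M : Multiset I) (i : ℕ) :
    weight w (x ::ₘ M) i = (w x).getD i 0 + weight w M i := by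
  simp [weight]

theorem le_weight {x : I} {M : Multiset I} (hx : x ∈ M) (i : ℕ) :
    (w x).getD i 0 ≤ weight w M i := by
  obtain ⟨M, rfl⟩ := Multiset.exists_cons_of_mem hx
  rw [weight_cons]
  exact Nat.le_add_right _ _

theorem knapAux_sound {rec : List I → List ℕ → List (List I)} {s : List ℕ} {items : List I}
    {l : List I} (hl : l ∈ knapAux w rec s items) : ∃ it rest, (it :: rest) <:+ items ∧
      ∃ l' ∈ rec ((it :: rest).filter fun j => leL (w j) (subL s (w it))) (subL s (w it)),
        l = it :: l' := by
  induction items with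
  | nil => simp [knapAux] at hl
  | cons it rest ih =>
    rcases List.mem_append.1 hl with hl | hl
    · obtain ⟨l', h1, rfl⟩ := List.mem_map.1 hl
      exact ⟨it, rest, List.suffix_refl _, l', h1, rfl⟩
    · obtain ⟨it', rest', h1, h2⟩ := ih hl
      exact ⟨it', rest', h1.trans (List.suffix_cons _ _), h2⟩

/-- Each item is known to fit before it is taken, so the truncated subtraction of its weight from
the remaining capacity is exact. -/
theorem knap_sound {n : ℕ} {items : List I} {s : List ℕ} (hs : s.length = k)
    (hit : ∀ x ∈ items, (w x).length = k ∧ leL (w x) s = true) {l : List I}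
    (hl : l ∈ knap w n items s) :
    (∀ x ∈ l, x ∈ items) ∧ ∀ i, weight w l i ≤ s.getD i 0 := by
  induction n generalizing items s l with
  | zero =>
    rw [knap, List.mem_singleton] at hl
    subst hl
    simp [weight]
  | succ n ih =>
    rcases List.mem_cons.1 hl with rfl | hl
    · simp [weight]
    obtain ⟨it, rest, hsuf, l', hl', rfl⟩ := knapAux_sound hl
    have hmem : it ∈ items := hsuf.subset List.mem_cons_self
    have hlen : s.length = (w it).length := hs.trans (hit it hmem).1.symm
    have hlen' : (subL s (w it)).length = k := (length_subL hlen).trans hs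
    obtain ⟨h1, h2⟩ := ih hlen' (fun x hx => by
      obtain ⟨hx1, hx2⟩ := List.mem_filter.1 hx
      exact ⟨(hit x (hsuf.subset hx1)).1, hx2⟩) hl'
    refine ⟨?_, fun i => ?_⟩
    · intro x hx
      rcases List.mem_cons.1 hx with rfl | hx
      · exact hmem
      · exact hsuf.subset (List.mem_filter.1 (h1 x hx)).1
    · have h3 := h2 i
      rw [getD_subL hlen] at h3
      have h4 := (leL_iff ((hit it hmem).1.trans hs.symm)).1 (hit it hmem).2 i
      rw [← Multiset.cons_coe, weight_cons]
      omega

/-- Order the multiset by the position of its items in the list. Its first item is the head of some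
branch of `knapAux`, and the rest is found recursively with the reduced capacity. The fuel `n` only
has to bound the number of items. -/
theorem knap_complete {n : ℕ} {items : List I} {s : List ℕ} (hs : s.length = k)
    (hit : ∀ x ∈ items, (w x).length = k) {M : Multiset I} (hM : ∀ x ∈ M, x ∈ items)
    (hw : ∀ i, weight w M i ≤ s.getD i 0) (hcard : M.card ≤ n) :
    ∃ l ∈ knap w n items s, (l : Multiset I) = M := by
  classical
  induction n generalizing items s M with
  | zero =>
    have : M = 0 := Multiset.card_eq_zero.1 (by omega)
    exact ⟨[], by simp [knap], by simp [this]⟩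
  | succ n ih =>
    rcases eq_or_ne M 0 with rfl | hne
    · exact ⟨[], by simp [knap], rfl⟩
    suffices h : ∃ l ∈ knapAux w (knap w n) s items, (l : Multiset I) = M by
      obtain ⟨l, h1, h2⟩ := h
      exact ⟨l, List.mem_cons_of_mem _ h1, h2⟩
    induction items with
    | nil =>
      obtain ⟨x, hx⟩ := Multiset.exists_mem_of_ne_zero hne
      simpa using hM x hx
    | cons it rest ih' =>
      -- If the item occurs, one copy is removed and the item stays available, so that repetitions
      -- are found. If it does not occur, it is dropped for good.
      by_cases hmem : it ∈ M
      · obtain ⟨M', rfl⟩ := Multiset.exists_cons_of_mem hmem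
        have hlen : s.length = (w it).length := hs.trans (hit it List.mem_cons_self).symm
        have hlen' : (subL s (w it)).length = k := (length_subL hlen).trans hs
        have hw' : ∀ i, weight w M' i ≤ (subL s (w it)).getD i 0 := by
          intro i
          have := hw i
          rw [weight_cons] at this
          rw [getD_subL hlen]
          omega
        obtain ⟨l, h1, h2⟩ := ih (items := (it :: rest).filter
            fun j => leL (w j) (subL s (w it))) (M := M') hlen'
          (fun x hx => hit x (List.mem_filter.1 hx).1)
          (fun x hx => by
            have hx' := hM x (Multiset.mem_cons_of_mem hx)
            refine List.mem_filter.2 ⟨hx', ?_⟩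
            rw [leL_iff ((hit x hx').trans hlen'.symm)]
            exact fun i => (le_weight hx i).trans (hw' i))
          hw' (by simpa using hcard)
        exact ⟨it :: l, List.mem_append.2 (Or.inl (List.mem_map_of_mem h1)), by
          rw [← Multiset.cons_coe, h2]⟩
      · obtain ⟨l, h1, h2⟩ := ih' (fun x hx => hit x (List.mem_cons_of_mem _ hx))
          (fun x hx => (List.mem_cons.1 (hM x hx)).resolve_left fun h => hmem (h ▸ hx))
        exact ⟨l, List.mem_append.2 (Or.inr h1), h2⟩

/-- Distinctness is needed for multisets, not only for lists. All results of the branch of `it`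
contain `it`, and those of the later branches do not, because the items are distinct. -/
theorem knap_nodup {n : ℕ} {items : List I} {s : List ℕ} (hnd : items.Nodup) :
    (((knap w n items s).map fun l : List I => (l : Multiset I)).Nodup) ∧
      ∀ l ∈ knap w n items s, ∀ x ∈ l, x ∈ items := by
  induction n generalizing items s with
  | zero => simp [knap]
  | succ n ih =>
    have key : (((knapAux w (knap w n) s items).map fun l : List I => (l : Multiset I)).Nodup) ∧
        ∀ l ∈ knapAux w (knap w n) s items, l ≠ [] ∧ ∀ x ∈ l, x ∈ items := by
      induction items with
      | nil => simp [knapAux]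
      | cons it rest ih' =>
        obtain ⟨h1, h2⟩ := ih' (List.nodup_cons.1 hnd).2
        obtain ⟨h3, h4⟩ := ih (items := (it :: rest).filter
          fun j => leL (w j) (subL s (w it))) (s := subL s (w it)) (hnd.filter _)
        refine ⟨?_, ?_⟩
        · rw [knapAux, List.map_append, List.nodup_append]
          refine ⟨?_, h1, ?_⟩
          · rw [List.map_map]
            have := h3.map (f := fun M : Multiset I => it ::ₘ M) fun _ _ hh => (Multiset.cons_inj_right it).1 hh
            rw [List.map_map] at this
            exact this
          · rintro M hM M' hM' rfl
            obtain ⟨l, hl, rfl⟩ := List.mem_map.1 hM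
            obtain ⟨l', -, rfl⟩ := List.mem_map.1 hl
            obtain ⟨l₂, hl₂, heq⟩ := List.mem_map.1 hM'
            have hmem : it ∈ (l₂ : Multiset I) := by rw [heq]; simp
            exact (List.nodup_cons.1 hnd).1 ((h2 l₂ hl₂).2 it (by simpa using hmem))
        · intro l hl
          rcases List.mem_append.1 hl with hl | hl
          · obtain ⟨l', hl', rfl⟩ := List.mem_map.1 hl
            refine ⟨by simp, fun x hx => ?_⟩
            rcases List.mem_cons.1 hx with rfl | hx
            · exact List.mem_cons_self
            · exact (List.mem_filter.1 (h4 l' hl' x hx)).1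
          · exact ⟨(h2 l hl).1, fun x hx => List.mem_cons_of_mem _ ((h2 l hl).2 x hx)⟩
    refine ⟨?_, ?_⟩
    · rw [knap, List.map_cons, List.nodup_cons]
      refine ⟨fun hmem => ?_, key.1⟩
      obtain ⟨l, hl, heq⟩ := List.mem_map.1 hmem
      exact (key.2 l hl).1 (by simpa using heq)
    · intro l hl
      rcases List.mem_cons.1 hl with rfl | hl
      · simp
      · exact (key.2 l hl).2

end Knapsack

end MonadSearch


/-! ### Enumeration of codes by two successive knapsack searches -/

namespace MonadSearch

open LatticeMonad

/-- The value of a bilinear form given by its matrix. -/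
def quadL (M : List (List ℕ)) (x y : List ℕ) : ℕ := dotL y (M.map (dotL x))

/-- The tensor with the given table. -/
def form (h : ℕ) (D : List (List (List ℕ))) (a b r : Fin h) : ℕ :=
  ((D.getD r []).getD b []).getD a 0

/-- The value of the cubic form. -/
def cubeL (D : List (List (List ℕ))) (x : List ℕ) : ℕ := dotL x (D.map fun M => quadL M x x)

/-- The cubic form `∑ d_{abr} x_a x_b x_r`. -/
def cube {h : ℕ} (d : Fin h → Fin h → Fin h → ℕ) (x : Fin h → ℕ) : ℕ :=
  ∑ r, x r * quad d r x x

/-- The unit vectors. -/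
def unitsL (h : ℕ) : List (List ℕ) :=
  (List.range h).map fun a => (List.range h).map fun b => bif Nat.beq a b then 1 else 0

/-- An item of the search: a vector, its weight, and the cube of the corresponding charge. -/
abbrev Item : Type := List ℕ × List ℕ × ℕ

/-- The items `m - b_i`. -/
def itemβ (h : ℕ) (D : List (List (List ℕ))) (m b : List ℕ) : Item :=
  (b, b ++ D.map fun M => Nat.sub (quadL M (subL m b) b) (quadL M (List.replicate h 1) b),
    cubeL D (subL m b))

/-- The items `c_j - m`. -/
def itemγ (h : ℕ) (D : List (List (List ℕ))) (m g : List ℕ) : Item :=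
  (g, g ++ D.map fun M => Nat.sub (quadL M g g) (dotL g ((unitsL h).map fun e => quadL M e e)),
    cubeL D (addL m g))

/-- The items of the first search. -/
def itemsβ (h : ℕ) (D : List (List (List ℕ))) (m : List ℕ) : List Item :=
  ((box (m.map Nat.pred)).filter fun b => Nat.ble 1 (sumL b)).map (itemβ h D m)

/-- The items of the second search. -/
def itemsγ (h : ℕ) (D : List (List (List ℕ))) (m bound : List ℕ) : List Item :=
  ((box bound).filter fun b => Nat.ble 2 (sumL b)).map (itemγ h D m)

/-- All multisets of items with total weight at most `s`. -/
def search (n : ℕ) (items : List Item) (s : List ℕ) : List (List Item) :=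
  knap (fun it => it.2.1) n (items.filter fun it => leL it.2.1 s) s

/-- An encoded monad, together with `∑ b_i³` and `∑ c_j³`. -/
structure Entry where
  N : ℕ
  m : List ℕ
  β : List (List ℕ)
  γ : List (List ℕ)
  x : ℕ
  y : ℕ

/-- The code of an entry. -/
def Entry.toCode (h : ℕ) (e : Entry) : Code h where
  N := e.N
  m := vec h e.m
  β := e.β.map (vec h)
  γ := e.γ.map (vec h)

/-- Subtract the vectors of some items. -/
def subAll (s : List ℕ) : List Item → List ℕ
  | [] => s
  | it :: l => subAll (subL s it.1) l

/-- The monad with the given items, provided that `m` is the join of the `b_i`. -/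
def leaf (h : ℕ) (D : List (List (List ℕ))) (N : ℕ) (m mult : List ℕ) (βs γs : List Item) :
    List Entry :=
  bif Nat.ble (N + (γs.length + sumL mult)) βs.length &&
      !((List.range h).all fun a => βs.any fun b => Nat.beq (b.1.getD a 0) 0) then []
  else [⟨N, m, βs.map Prod.fst, γs.map Prod.fst,
    sumL (βs.map fun it => it.2.2) + (N + (γs.length + sumL mult) - βs.length) * cubeL D m,
    sumL (γs.map fun it => it.2.2) + dotL mult ((unitsL h).map fun e => cubeL D (addL m e))
      + (βs.length - (N + (γs.length + sumL mult))) * cubeL D m⟩]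

/-- The contribution of the `b_i` and of unit vectors to the anomaly condition. -/
def baseCost (h : ℕ) (D : List (List (List ℕ))) (m rem : List ℕ) (βs : List Item) : List ℕ :=
  D.map fun M => sumL (βs.map fun it => quadL M (subL m it.1) it.1)
    + dotL rem ((unitsL h).map fun e => quadL M (addL m e) e)

/-- All monads with given `N`, `m` and `b_i`. -/
def entriesβ (h : ℕ) (D : List (List (List ℕ))) (S : List ℕ) (N : ℕ) (m rem : List ℕ)
    (βs : List Item) : List Entry :=
  bif leL (baseCost h D m rem βs) S then
    (search (sumL rem) (itemsγ h D m (m.map (N * ·))) (rem ++ subL S (baseCost h D m rem βs))).flatMap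
      fun γs => leaf h D N m (subAll rem γs) βs γs
  else []

/-- The least possible costs. -/
def minCost (h : ℕ) (D : List (List (List ℕ))) (N : ℕ) (m : List ℕ) : List ℕ :=
  D.map fun M => N * quadL M (List.replicate h 1) m

/-- All monads with given `N` and `m`. -/
def entriesm (h : ℕ) (D : List (List (List ℕ))) (S : List ℕ) (N : ℕ) (m : List ℕ) : List Entry :=
  bif leL (minCost h D N m) S && m.all (Nat.ble 1) then
    (search (sumL (m.map (N * ·))) (itemsβ h D m) (m.map (N * ·) ++ subL S (minCost h D N m))).flatMap
      fun βs => entriesβ h D S N m (subAll (m.map (N * ·)) βs) βs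
  else []

/-- All monads, provided that `b` bounds the entries of `m`. -/
def entries (h : ℕ) (D : List (List (List ℕ))) (S : List ℕ) (b : ℕ) : List Entry :=
  [3, 4, 5].flatMap fun N => (box (List.replicate h b)).flatMap (entriesm h D S N)

/-- If an entry of `m` exceeds `b` then the anomaly condition fails. -/
def boundOK (h : ℕ) (D : List (List (List ℕ))) (S : List ℕ) (b : ℕ) : Bool :=
  (unitsL h).all fun e => !(leL (D.map fun M => 3 * (quadL M (List.replicate h 1) (List.replicate h 1)
    + b * quadL M (List.replicate h 1) e)) S)

/-! ### Correctness -/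

theorem dotL_nil (x : List ℕ) : dotL x [] = 0 := by cases x <;> rfl

theorem getD_map {α β : Type*} (f : α → β) (l : List α) (i : ℕ) (a : α) :
    (l.map f).getD i (f a) = f (l.getD i a) := by
  simp [List.getD, List.getElem?_map]

variable {h : ℕ} {D : List (List (List ℕ))} {S : List ℕ}

theorem quadL_eq {x y : List ℕ} (hx : x.length = h) (hy : y.length = h) (r : Fin h) :
    quadL (D.getD r []) x y = quad (form h D) r (vec h x) (vec h y) := by
  rw [quadL, dotL_eq _ hy, quad_eq_sum_unit]
  refine Finset.sum_congr rfl fun b _ => ?_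
  have h1 := getD_map (dotL x) (D.getD r []) b []
  rw [dotL_nil] at h1
  rw [quad_unit_right, h1, dotL_eq _ hx]
  congr 1
  exact Finset.sum_congr rfl fun a _ => mul_comm _ _

theorem quadL_nil (x y : List ℕ) : quadL [] x y = 0 := by simp [quadL, dotL_nil]

/-- A missing matrix is read as `[]`; the condition `f [] = 0` makes the two default values agree.
-/
theorem getD_map_form {f : List (List ℕ) → ℕ} (h0 : f [] = 0) (r : Fin h) :
    (D.map f).getD r 0 = f (D.getD r []) := by
  have h1 := getD_map f D r []
  rwa [h0] at h1

theorem cubeL_eq {x : List ℕ} (hx : x.length = h) : cubeL D x = cube (form h D) (vec h x) := by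
  rw [cubeL, dotL_eq _ hx, cube]
  refine Finset.sum_congr rfl fun r _ => ?_
  rw [getD_map_form (quadL_nil _ _), quadL_eq hx hx]
  rfl

theorem vec_subL {l s : List ℕ} (hl : l.length = s.length) : vec h (subL l s) = vec h l - vec h s :=
  funext fun i => getD_subL hl i

theorem vec_addL {l s : List ℕ} (hl : l.length = s.length) : vec h (addL l s) = vec h l + vec h s :=
  funext fun i => getD_addL hl i

theorem vec_replicate_one : vec h (List.replicate h 1) = 1 := by
  ext i; simp [vec]

theorem length_unitsL : (unitsL h).length = h := by simp [unitsL]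

theorem length_of_mem_unitsL {e : List ℕ} (he : e ∈ unitsL h) : e.length = h := by
  obtain ⟨a, _, rfl⟩ := List.mem_map.1 he
  simp

theorem getD_unitsL (a : Fin h) : (unitsL h).getD a [] ∈ unitsL h ∧
    vec h ((unitsL h).getD a []) = unit a := by
  have hlt : (a : ℕ) < (unitsL h).length := by rw [length_unitsL]; exact a.2
  rw [List.getD_eq_getElem _ _ hlt]
  refine ⟨List.getElem_mem hlt, ?_⟩
  ext b
  simp only [unitsL, vec, List.getElem_map, List.getElem_range, unit, Pi.single_apply]
  rw [List.getD_eq_getElem _ _ (by simp)]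
  simp only [List.getElem_map, List.getElem_range]
  by_cases hab : b = a
  · subst hab; simp
  · have : Nat.beq a b = false := by
      rw [← Bool.not_eq_true, Nat.beq_eq]
      exact fun hh => hab (Fin.ext hh.symm)
    simp [hab, this]

theorem dotL_unitsL {f : List ℕ → ℕ} {g : (Fin h → ℕ) → ℕ} {x : List ℕ} (hx : x.length = h)
    (hfg : ∀ e : List ℕ, e.length = h → f e = g (vec h e)) :
    dotL x ((unitsL h).map f) = ∑ a, vec h x a * g (unit a) := by
  rw [dotL_eq _ hx]
  refine Finset.sum_congr rfl fun a _ => ?_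
  have hlt : (a : ℕ) < (unitsL h).length := by rw [length_unitsL]; exact a.2
  obtain ⟨h1, h2⟩ := getD_unitsL a
  rw [List.getD_eq_getElem ((unitsL h).map f) _ (by simpa using hlt), List.getElem_map,
    ← List.getD_eq_getElem _ [] hlt, hfg _ (length_of_mem_unitsL h1), h2]
  rfl

theorem sumL_map {α : Type*} (l : List α) (f : α → ℕ) : sumL (l.map f) = (l.map f).sum := by
  induction l with
  | nil => rfl
  | cons a l ih => rw [List.map_cons, sumL, ih, List.sum_cons]; rfl

theorem vec_map_mul {m : List ℕ} (N : ℕ) : vec h (m.map (N * ·)) = N • vec h m := by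
  ext i
  simp only [vec, Pi.smul_apply, smul_eq_mul]
  have := getD_map (N * ·) m i 0
  simpa using this

/-- The vectors of some items. -/
def vecs (h : ℕ) (l : List Item) : Multiset (Fin h → ℕ) := (l.map fun it => vec h it.1 : List _)

@[simp] theorem vecs_nil : vecs h [] = 0 := rfl

@[simp] theorem vecs_cons (it : Item) (l : List Item) :
    vecs h (it :: l) = vec h it.1 ::ₘ vecs h l := rfl

theorem vecs_eq_map (l : List Item) :
    vecs h l = (l : Multiset Item).map fun it => vec h it.1 := rfl

theorem sum_map_vecs (f : (Fin h → ℕ) → ℕ) (l : List Item) :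
    ((vecs h l).map f).sum = (l.map fun it => f (vec h it.1)).sum := by
  simp [vecs, List.map_map, Function.comp_def]

theorem subAll_spec {s : List ℕ} {l : List Item} (hs : s.length = h)
    (hl : ∀ it ∈ l, it.1.length = h) :
    (subAll s l).length = h ∧ vec h (subAll s l) = vec h s - (vecs h l).sum := by
  induction l generalizing s with
  | nil => simp [subAll, hs]
  | cons it l ih =>
    have hlen : s.length = it.1.length := by rw [hs, hl it List.mem_cons_self]
    obtain ⟨h1, h2⟩ := ih (s := subL s it.1) ((length_subL hlen).trans hs)
      fun x hx => hl x (List.mem_cons_of_mem _ hx)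
    refine ⟨h1, ?_⟩
    rw [subAll, h2, vec_subL hlen, vecs_cons, Multiset.sum_cons, tsub_tsub]

/-- Sound and complete description of `search`, for items with vector part of length `h` and
weight the vector followed by `h` costs. -/
structure GoodItems (h : ℕ) (items : List Item) (mk : List ℕ → Item)
    (cost : Fin h → (Fin h → ℕ) → ℕ) : Prop where
  length_vec : ∀ it ∈ items, it.1.length = h
  eq_mk : ∀ it ∈ items, it = mk it.1
  length_weight : ∀ it ∈ items, it.2.1.length = h + h
  weight_vec : ∀ it ∈ items, ∀ i : Fin h, it.2.1.getD i 0 = vec h it.1 i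
  weight_cost : ∀ it ∈ items, ∀ r : Fin h, it.2.1.getD (h + r) 0 = cost r (vec h it.1)
  nodup : items.Nodup

namespace GoodItems

variable {items : List Item} {mk : List ℕ → Item} {cost : Fin h → (Fin h → ℕ) → ℕ}

theorem weight_eq (hg : GoodItems h items mk cost) {l : List Item} (hl : ∀ x ∈ l, x ∈ items) :
    (∀ i : Fin h, weight (fun it : Item => it.2.1) l i = (vecs h l).sum i) ∧
    (∀ r : Fin h, weight (fun it : Item => it.2.1) l (h + r) = ((vecs h l).map (cost r)).sum) := by
  induction l with
  | nil => simp [weight]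
  | cons it l ih =>
    obtain ⟨h1, h2⟩ := ih fun x hx => hl x (List.mem_cons_of_mem _ hx)
    have hit := hl it List.mem_cons_self
    refine ⟨fun i => ?_, fun r => ?_⟩
    · rw [← Multiset.cons_coe, weight_cons, h1 i, hg.weight_vec it hit i]
      simp
    · rw [← Multiset.cons_coe, weight_cons, h2 r, hg.weight_cost it hit r]
      simp

theorem search_sound (hg : GoodItems h items mk cost) {n : ℕ} {s t : List ℕ} (hs : s.length = h)
    (ht : t.length = h) {l : List Item} (hl : l ∈ search n items (s ++ t)) :
    (∀ x ∈ l, x ∈ items) ∧ (vecs h l).sum ≤ vec h s ∧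
      ∀ r : Fin h, ((vecs h l).map (cost r)).sum ≤ vec h t r := by
  obtain ⟨h1, h2⟩ := knap_sound (k := h + h) (by simp [hs, ht])
    (fun x hx => ⟨hg.length_weight x (List.mem_filter.1 hx).1, (List.mem_filter.1 hx).2⟩) hl
  have h3 : ∀ x ∈ l, x ∈ items := fun x hx => (List.mem_filter.1 (h1 x hx)).1
  obtain ⟨h4, h5⟩ := hg.weight_eq h3
  refine ⟨h3, fun i => ?_, fun r => ?_⟩
  · rw [← h4 i]
    refine (h2 i).trans ?_
    rw [List.getD_append _ _ _ _ (by rw [hs]; exact i.2)]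
    rfl
  · rw [← h5 r]
    refine (h2 (h + r)).trans ?_
    rw [List.getD_append_right _ _ _ _ (by omega), hs]
    simp [vec]

theorem search_complete (hg : GoodItems h items mk cost) {n : ℕ} {s t : List ℕ} (hs : s.length = h)
    (ht : t.length = h) {M : Multiset (Fin h → ℕ)} (hM : ∀ x ∈ M, mk (List.ofFn x) ∈ items)
    (hfst : ∀ x, (mk x).1 = x) (hsum : M.sum ≤ vec h s)
    (hcost : ∀ r : Fin h, (M.map (cost r)).sum ≤ vec h t r) (hcard : M.card ≤ n) :
    ∃ l ∈ search n items (s ++ t), vecs h l = M := by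
  -- Vectors are lifted to items through `mk`; the search then returns a list with the same
  -- underlying multiset.
  obtain ⟨l₀, hl₀⟩ : ∃ l₀ : List Item, (l₀ : Multiset Item) = M.map fun x => mk (List.ofFn x) :=
    Quot.exists_rep _
  have hvec : vecs h l₀ = M := by
    rw [vecs_eq_map, hl₀, Multiset.map_map]
    nth_rewrite 2 [← Multiset.map_id M]
    refine Multiset.map_congr rfl fun x _ => ?_
    simp only [Function.comp, hfst, vec_ofFn, id]
  have hmem : ∀ x ∈ l₀, x ∈ items := by
    intro x hx
    have hx' : x ∈ (l₀ : Multiset Item) := hx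
    rw [hl₀] at hx'
    obtain ⟨y, hy, rfl⟩ := Multiset.mem_map.1 hx'
    exact hM y hy
  obtain ⟨h4, h5⟩ := hg.weight_eq hmem
  have hw : ∀ i, weight (fun it : Item => it.2.1) l₀ i ≤ (s ++ t).getD i 0 := by
    intro i
    by_cases hi : i < h
    · rw [List.getD_append _ _ _ _ (by rw [hs]; exact hi), h4 ⟨i, hi⟩, hvec]
      exact hsum ⟨i, hi⟩
    · by_cases hi' : i < h + h
      · have hr : i = h + (⟨i - h, by omega⟩ : Fin h) := by simp; omega
        rw [List.getD_append_right _ _ _ _ (by omega), hs]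
        rw [hr, h5, hvec]
        simpa [vec] using hcost ⟨i - h, by omega⟩
      -- Weights have length `h + h`, and beyond this range both sides are the default value 0.
      · have : weight (fun it : Item => it.2.1) l₀ i = 0 := by
          rw [weight, Multiset.sum_eq_zero_iff]
          intro y hy
          obtain ⟨x, hx, rfl⟩ := Multiset.mem_map.1 hy
          rw [List.getD_eq_default]
          rw [hg.length_weight x (hmem x hx)]
          omega
        omega
  obtain ⟨l, h6, h7⟩ := knap_complete (k := h + h) (w := fun it : Item => it.2.1) (n := n)
    (items := items.filter fun it => leL it.2.1 (s ++ t)) (s := s ++ t) (M := l₀)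
    (by simp [hs, ht]) (fun x hx => hg.length_weight x (List.mem_filter.1 hx).1)
    (fun x hx => List.mem_filter.2 ⟨hmem x hx, by
      rw [leL_iff (by rw [hg.length_weight x (hmem x hx)]; simp [hs, ht])]
      exact fun i => (le_weight (w := fun it : Item => it.2.1) hx i).trans (hw i)⟩) hw
    (by rw [hl₀, Multiset.card_map]; exact hcard)
  exact ⟨l, h6, by rw [vecs_eq_map, h7, ← vecs_eq_map, hvec]⟩

/-- The knapsack separates multisets of items. An item is determined by its vector through `mk`, so
the multisets of vectors are distinct as well. -/
theorem search_nodup (hg : GoodItems h items mk cost) (n : ℕ) (s : List ℕ) :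
    ((search n items s).map (vecs h)).Nodup := by
  obtain ⟨h1, h2⟩ := knap_nodup (w := fun it : Item => it.2.1) (n := n) (s := s)
    (hg.nodup.filter fun it => leL it.2.1 s)
  refine List.Nodup.of_map (fun M : Multiset (Fin h → ℕ) => M.map fun x => mk (List.ofFn x)) ?_
  rw [List.map_map]
  have : (search n items s).map ((fun M : Multiset (Fin h → ℕ) => M.map fun x => mk (List.ofFn x))
      ∘ vecs h) = (search n items s).map fun l : List Item => (l : Multiset Item) := by
    refine List.map_congr_left fun l hl => ?_
    simp only [Function.comp, vecs_eq_map, Multiset.map_map]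
    nth_rewrite 2 [← Multiset.map_id (l : Multiset Item)]
    refine Multiset.map_congr rfl fun x hx => ?_
    have hx' : x ∈ items := (List.mem_filter.1 (h2 l hl x hx)).1
    have h3 : List.ofFn (vec h x.1) = x.1 := by
      refine vec_injOn (by simp) (hg.length_vec x hx') (vec_ofFn _)
    simp only [h3, id]
    exact (hg.eq_mk x hx').symm
  rw [this]
  exact h1

end GoodItems

end MonadSearch


/-! ### Lower bounds for the anomaly cost -/

namespace LatticeMonad

variable {h : ℕ} {d : Fin h → Fin h → Fin h → ℕ} {S : Fin h → ℕ}

/-- The excess cost of a vector over that of unit vectors with the same sum. -/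
def excess (d : Fin h → Fin h → Fin h → ℕ) (r : Fin h) (g : Fin h → ℕ) : ℕ :=
  quad d r g g - ∑ a, g a * quad d r (unit a) (unit a)

/-- The cost of `c_j = m + g` splits into a part linear in `g`, namely the cost of unit vectors with
the same sum, and an excess that does not depend on `m`. Only the excess varies in the second
search. -/
theorem quad_add_self_eq (r : Fin h) (m g : Fin h → ℕ) :
    quad d r (m + g) g = excess d r g + ∑ a, g a * quad d r (m + unit a) (unit a) := by
  have h1 : ∑ a, g a * quad d r (unit a) (unit a) ≤ quad d r g g := by
    simpa only [quad_unit_unit] using sum_diag_le_quad r g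
  have h2 : ∑ a, g a * quad d r (m + unit a) (unit a)
      = quad d r m g + ∑ a, g a * quad d r (unit a) (unit a) := by
    rw [quad_eq_sum_unit r m g, ← Finset.sum_add_distrib]
    exact Finset.sum_congr rfl fun a _ => by rw [quad_add_left, mul_add]
  rw [h2, quad_add_left, excess]
  omega

theorem sum_sum_mul (M : Multiset (Fin h → ℕ)) (u : Fin h → ℕ) :
    (M.map fun g => ∑ a, g a * u a).sum = ∑ a, M.sum a * u a := by
  induction M using Multiset.induction_on with
  | empty => simp
  | cons g M ih => simp [ih, add_mul, Finset.sum_add_distrib]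

namespace Code

/-- The linear parts of all `c_j - m`, stored or not, combine into one term for their total `N m - ∑
(m - b_i)`. Once `m` and the `b_i` are fixed, the remaining budget therefore bounds the sum of the
excesses alone. -/
theorem cost_eq (c : Code h) (hs : c.β.sum + c.γ.sum ≤ c.N • c.m) (r : Fin h) :
    c.cost d r = (c.β.map fun b => quad d r (c.m - b) b).sum
      + ∑ a, (c.N • c.m - c.β.sum) a * quad d r (c.m + unit a) (unit a)
      + (c.γ.map (excess d r)).sum := by
  have h1 : c.N • c.m - c.β.sum = c.γ.sum + c.mult := by
    rw [mult, add_tsub_cancel_of_le (le_tsub_of_add_le_left hs)]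
  have h2 : (c.γ.map fun g => quad d r (c.m + g) g).sum = (c.γ.map (excess d r)).sum
      + ∑ a, c.γ.sum a * quad d r (c.m + unit a) (unit a) := by
    rw [← sum_sum_mul, ← Multiset.sum_map_add]
    exact congrArg _ (Multiset.map_congr rfl fun g _ => quad_add_self_eq r _ g)
  rw [cost, h1, h2]
  simp only [Pi.add_apply, add_mul, Finset.sum_add_distrib]
  ring

/-- The excess cost of `m - b`, compared with the least possible cost. -/
def excessβ (d : Fin h → Fin h → Fin h → ℕ) (m : Fin h → ℕ) (r : Fin h) (b : Fin h → ℕ) : ℕ :=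
  quad d r (m - b) b - quad d r 1 b

/-- All entries of `b_i` and `c_j` are at least 1, so a difference `x` costs at least `quad 1 x`,
and these differences add up to `N m`. The minimum `N quad 1 m` is thus unavoidable. What remains of
the budget limits the excesses of the `m - b_i`: this is the first knapsack, and the source of the
bound on `m`. -/
theorem IsValid.bound {c : Code h} (hc : c.IsValid d S) (r : Fin h) :
    c.N * quad d r 1 c.m + (c.β.map (excessβ d c.m r)).sum ≤ S r := by
  refine le_trans ?_ (hc.cost_le r)
  have h1 : (c.β.map fun b => quad d r (c.m - b) b).sum
      = (c.β.map (excessβ d c.m r)).sum + quad d r 1 c.β.sum := by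
    rw [quad_sum_right, ← Multiset.sum_map_add]
    refine congrArg _ (Multiset.map_congr rfl fun b hb => ?_)
    have : quad d r 1 b ≤ quad d r (c.m - b) b :=
      quad_mono r (le_tsub_of_add_le_left (hc.β_le b hb)) le_rfl
    rw [excessβ]
    omega
  have h2 : quad d r 1 c.γ.sum ≤ (c.γ.map fun g => quad d r (c.m + g) g).sum := by
    rw [quad_sum_right]
    exact Multiset.sum_map_le_sum_map _ _ fun g _ =>
      quad_mono r (hc.one_le.trans le_self_add) le_rfl
  have h3 : quad d r 1 c.mult ≤ ∑ a, c.mult a * quad d r (c.m + unit a) (unit a) := by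
    rw [quad_eq_sum_unit]
    exact Finset.sum_le_sum fun a _ => Nat.mul_le_mul_left _
      (quad_mono r (hc.one_le.trans le_self_add) le_rfl)
  have h4 : c.N * quad d r 1 c.m
      = quad d r 1 c.β.sum + (quad d r 1 c.γ.sum + quad d r 1 c.mult) := by
    rw [← quad_smul_right, ← hc.size_mult_add, quad_add_right, quad_add_right]
  rw [cost, h1, h4]
  omega

end Code

/-- It provides the fuel for the searches: nonzero vectors with a bounded sum are bounded in number.
-/
theorem card_le_size_sum {M : Multiset (Fin h → ℕ)} (hM : ∀ x ∈ M, 1 ≤ size x) :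
    M.card ≤ size M.sum := by
  induction M using Multiset.induction_on with
  | empty => simp
  | cons x M ih =>
    have h1 := hM x (Multiset.mem_cons_self _ _)
    have h2 := ih fun y hy => hM y (Multiset.mem_cons_of_mem hy)
    rw [Multiset.card_cons, Multiset.sum_cons, size_add]
    omega

theorem size_mono {x y : Fin h → ℕ} (hxy : x ≤ y) : size x ≤ size y :=
  Finset.sum_le_sum fun a _ => hxy a

end LatticeMonad

/-! ### The enumeration finds every valid code exactly once -/

namespace MonadSearch

open LatticeMonad

variable {h : ℕ} {D : List (List (List ℕ))} {S : List ℕ}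

/-- The common pattern of both searches: the weight of a vector is the vector followed by its costs,
so one comparison of lists tests the sum and the anomaly condition together. -/
theorem goodItems_map {vs : List (List ℕ)} {f : List ℕ → List (List ℕ) → ℕ} {c : List ℕ → ℕ}
    {cost : Fin h → (Fin h → ℕ) → ℕ} (hD : D.length = h) (hvs : ∀ v ∈ vs, v.length = h)
    (hnd : vs.Nodup) (h0 : ∀ v, f v [] = 0)
    (hf : ∀ v ∈ vs, ∀ r : Fin h, f v (D.getD r []) = cost r (vec h v)) :
    GoodItems h (vs.map fun v => (v, v ++ D.map (f v), c v)) (fun v => (v, v ++ D.map (f v), c v))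
      cost where
  length_vec := by
    intro it hit
    obtain ⟨v, hv, rfl⟩ := List.mem_map.1 hit
    exact hvs v hv
  eq_mk := by
    intro it hit
    obtain ⟨v, hv, rfl⟩ := List.mem_map.1 hit
    rfl
  length_weight := by
    intro it hit
    obtain ⟨v, hv, rfl⟩ := List.mem_map.1 hit
    simp [hD, hvs v hv]
  weight_vec := by
    intro it hit i
    obtain ⟨v, hv, rfl⟩ := List.mem_map.1 hit
    exact List.getD_append _ _ _ _ (by rw [hvs v hv]; exact i.2)
  weight_cost := by
    intro it hit r
    obtain ⟨v, hv, rfl⟩ := List.mem_map.1 hit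
    refine (List.getD_append_right _ _ _ _ (by rw [hvs v hv]; omega)).trans ?_
    rw [hvs v hv, Nat.add_sub_cancel_left, getD_map_form (h0 v), hf v hv]
  nodup := hnd.map fun v w hvw => congrArg Prod.fst hvw

theorem length_of_mem_box {m : List ℕ} (hm : m.length = h) {p : List ℕ → Bool} {v : List ℕ}
    (hv : v ∈ (box m).filter p) : v.length = h :=
  ((mem_box.1 (List.mem_filter.1 hv).1).1).trans hm

theorem goodItems_β (hD : D.length = h) {m : List ℕ} (hm : m.length = h) :
    GoodItems h (itemsβ h D m) (itemβ h D m) (Code.excessβ (form h D) (vec h m)) := by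
  refine goodItems_map (f := fun b M => Nat.sub (quadL M (subL m b) b)
    (quadL M (List.replicate h 1) b)) (c := fun b => cubeL D (subL m b)) hD
    (fun v hv => length_of_mem_box (by simpa using hm) hv) ((nodup_box _).filter _)
    (fun v => by simp [quadL_nil]) fun v hv r => ?_
  have hv' : v.length = h := length_of_mem_box (by simpa using hm) hv
  have hl : m.length = v.length := hm.trans hv'.symm
  rw [quadL_eq ((length_subL hl).trans hm) hv', quadL_eq (by simp) hv', vec_subL hl,
    vec_replicate_one]
  rfl

theorem goodItems_γ (hD : D.length = h) {m bound : List ℕ} (hb : bound.length = h) :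
    GoodItems h (itemsγ h D m bound) (itemγ h D m) (excess (form h D)) := by
  refine goodItems_map (f := fun g M => Nat.sub (quadL M g g)
    (dotL g ((unitsL h).map fun e => quadL M e e))) (c := fun b => cubeL D (addL m b)) hD
    (fun v hv => length_of_mem_box hb hv) ((nodup_box _).filter _)
    (fun v => by simp [quadL_nil]) fun v hv r => ?_
  have hv' : v.length = h := length_of_mem_box hb hv
  rw [quadL_eq hv' hv', dotL_unitsL (g := fun e => quad (form h D) r e e) hv'
    fun e he => quadL_eq he he r]
  rfl

theorem mem_itemsβ {m b : List ℕ} (hm : m.length = h) : itemβ h D m b ∈ itemsβ h D m ↔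
    b.length = h ∧ vec h b ≠ 0 ∧ ∀ i, vec h b i ≤ vec h m i - 1 := by
  have hinj : Function.Injective (itemβ h D m) := fun v w hvw => congrArg Prod.fst hvw
  rw [itemsβ, List.mem_map_of_injective hinj, List.mem_filter, mem_box, Nat.ble_eq,
    List.length_map, hm]
  have hp : ∀ i, (m.map Nat.pred).getD i 0 = m.getD i 0 - 1 := fun i => getD_map Nat.pred m i 0
  constructor
  · rintro ⟨⟨h1, h2⟩, h3⟩
    refine ⟨h1, fun h0 => ?_, fun i => (h2 i).trans_eq (hp i)⟩
    rw [sumL_eq h1, h0, size_eq_zero.2 rfl] at h3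
    omega
  · rintro ⟨h1, h2, h3⟩
    refine ⟨⟨h1, fun i => ?_⟩, ?_⟩
    · by_cases hi : i < h
      · exact (h3 ⟨i, hi⟩).trans_eq (hp i).symm
      · rw [List.getD_eq_default _ _ (by omega)]; exact Nat.zero_le _
    · rw [sumL_eq h1]
      exact Nat.one_le_iff_ne_zero.2 fun h0 => h2 (size_eq_zero.1 h0)

theorem mem_itemsγ {m bound g : List ℕ} (hb : bound.length = h) :
    itemγ h D m g ∈ itemsγ h D m bound ↔
      g.length = h ∧ 2 ≤ size (vec h g) ∧ vec h g ≤ vec h bound := by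
  have hinj : Function.Injective (itemγ h D m) := fun v w hvw => congrArg Prod.fst hvw
  rw [itemsγ, List.mem_map_of_injective hinj, List.mem_filter, mem_box, Nat.ble_eq, hb]
  constructor
  · rintro ⟨⟨h1, h2⟩, h3⟩
    exact ⟨h1, by rwa [← sumL_eq h1], fun i => h2 i⟩
  · rintro ⟨h1, h2, h3⟩
    refine ⟨⟨h1, fun i => ?_⟩, by rwa [sumL_eq h1]⟩
    by_cases hi : i < h
    · exact h3 ⟨i, hi⟩
    · rw [List.getD_eq_default _ _ (by omega)]; exact Nat.zero_le _

theorem length_baseCost (hD : D.length = h) (m rem : List ℕ) (βs : List Item) :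
    (baseCost h D m rem βs).length = h := by simp [baseCost, hD]

theorem vec_baseCost {m rem : List ℕ} {βs : List Item} (hm : m.length = h) (hr : rem.length = h)
    (hβ : ∀ x ∈ βs, x.1.length = h) (r : Fin h) :
    vec h (baseCost h D m rem βs) r
      = ((vecs h βs).map fun b => quad (form h D) r (vec h m - b) b).sum
        + ∑ a, vec h rem a * quad (form h D) r (vec h m + unit a) (unit a) := by
  rw [vec, baseCost, getD_map_form]
  · rw [dotL_unitsL (g := fun e => quad (form h D) r (vec h m + e) e) hr]
    · rw [sumL_map, sum_map_vecs]
      congr 2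
      refine List.map_congr_left fun x hx => ?_
      have hl : m.length = x.1.length := hm.trans (hβ x hx).symm
      rw [quadL_eq ((length_subL hl).trans hm) (hβ x hx), vec_subL hl]
    · intro e he
      have hl : m.length = e.length := hm.trans he.symm
      rw [quadL_eq ((length_addL hl).trans hm) he, vec_addL hl]
  · have h1 : ∀ l : List ℕ, dotL rem (l.map fun _ => 0) = 0 := by
      intro l
      rw [dotL_eq _ hr]
      refine Finset.sum_eq_zero fun i _ => ?_
      have := getD_map (fun _ : ℕ => 0) l i 0
      rw [this, mul_zero]
    have h2 : (unitsL h).map (fun e => quadL [] (addL m e) e)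
        = ((unitsL h).map sumL).map fun _ => 0 := by
      rw [List.map_map]
      exact List.map_congr_left fun e _ => quadL_nil _ _
    rw [h2, h1, sumL_map]
    simp [quadL_nil]

theorem length_minCost (hD : D.length = h) (N : ℕ) (m : List ℕ) :
    (minCost h D N m).length = h := by simp [minCost, hD]

theorem vec_minCost {m : List ℕ} (hm : m.length = h) (N : ℕ) (r : Fin h) :
    vec h (minCost h D N m) r = N * quad (form h D) r 1 (vec h m) := by
  rw [vec, minCost, getD_map_form, quadL_eq (by simp) hm, vec_replicate_one]
  simp [quadL_nil]

theorem leL_iff_vec {l s : List ℕ} (hl : l.length = h) (hs : s.length = h) :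
    leL l s = true ↔ vec h l ≤ vec h s := by
  rw [leL_iff (hl.trans hs.symm)]
  refine ⟨fun H i => H i, fun H i => ?_⟩
  by_cases hi : i < h
  · exact H ⟨i, hi⟩
  · rw [List.getD_eq_default _ _ (by omega), List.getD_eq_default _ _ (by omega)]

/-- The data of an entry in terms of items. -/
theorem mem_leaf {N : ℕ} {m mult : List ℕ} {βs γs : List Item} {e : Entry} :
    e ∈ leaf h D N m mult βs γs ↔
      (N + (γs.length + sumL mult) ≤ βs.length → ∀ a < h, ∃ b ∈ βs, b.1.getD a 0 = 0) ∧
      e = ⟨N, m, βs.map Prod.fst, γs.map Prod.fst,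
        sumL (βs.map fun it => it.2.2) + (N + (γs.length + sumL mult) - βs.length) * cubeL D m,
        sumL (γs.map fun it => it.2.2) + dotL mult ((unitsL h).map fun e => cubeL D (addL m e))
          + (βs.length - (N + (γs.length + sumL mult))) * cubeL D m⟩ := by
  rw [leaf]
  have hc : (Nat.ble (N + (γs.length + sumL mult)) βs.length &&
      !((List.range h).all fun a => βs.any fun b => Nat.beq (b.1.getD a 0) 0)) = true ↔
      ¬ (N + (γs.length + sumL mult) ≤ βs.length → ∀ a < h, ∃ b ∈ βs, b.1.getD a 0 = 0) := by
    simp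
  cases hb : (Nat.ble (N + (γs.length + sumL mult)) βs.length &&
      !((List.range h).all fun a => βs.any fun b => Nat.beq (b.1.getD a 0) 0)) with
  | true =>
    have := hc.1 hb
    simp only [cond_true, List.not_mem_nil, false_iff]
    exact fun H => this H.1
  | false =>
    have : ¬ _ := fun H => Bool.false_ne_true (hb.symm.trans (hc.2 H))
    rw [not_not] at this
    simp only [cond_false, List.mem_singleton]
    exact ⟨fun H => ⟨this, H⟩, fun H => H.2⟩

theorem toCode_mk {N : ℕ} {m : List ℕ} {βs γs : List Item} {x y : ℕ} :
    Entry.toCode h ⟨N, m, βs.map Prod.fst, γs.map Prod.fst, x, y⟩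
      = ⟨N, vec h m, vecs h βs, vecs h γs⟩ := by
  simp [Entry.toCode, vecs, List.map_map, Function.comp_def]

/-- The sums of cubes of an entry are correct. -/
def Entry.Correct (h : ℕ) (D : List (List (List ℕ))) (e : Entry) : Prop :=
  e.x = ((e.toCode h).B.map (cube (form h D))).sum ∧
    e.y = ((e.toCode h).C.map (cube (form h D))).sum

theorem card_vecs (l : List Item) : (vecs h l).card = l.length := by simp [vecs]

/-- The items carry the cubes of the charges, hence the two sums needed for the index are
accumulated along with the code. The charges equal to `m` and those differing from `m` by a unit
vector, which are not items, are added here. -/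
theorem leaf_sound {N : ℕ} {m rem : List ℕ} {βs γs : List Item} {e : Entry}
    (hD : D.length = h) (hm : m.length = h) (hN : N ∈ ({3, 4, 5} : Set ℕ)) (h1 : 1 ≤ vec h m)
    (hβ : ∀ x ∈ βs, x ∈ itemsβ h D m) (hγ : ∀ x ∈ γs, x ∈ itemsγ h D m (m.map (N * ·)))
    (hr : rem.length = h) (hrem : vec h rem = N • vec h m - (vecs h βs).sum)
    (hβs : (vecs h βs).sum ≤ N • vec h m) (hγs : (vecs h γs).sum ≤ vec h rem)
    (hcost : ∀ r, vec h (baseCost h D m rem βs) r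
      + ((vecs h γs).map (excess (form h D) r)).sum ≤ vec h S r)
    (he : e ∈ leaf h D N m (subAll rem γs) βs γs) :
    (e.toCode h).IsValid (form h D) (vec h S) ∧ e.Correct h D := by
  obtain ⟨hjoin, rfl⟩ := mem_leaf.1 he
  have gβ := goodItems_β hD hm
  have gγ := goodItems_γ (m := m) hD (bound := m.map (N * ·)) (by simpa using hm)
  have lβ : ∀ x ∈ βs, x.1.length = h := fun x hx => gβ.length_vec x (hβ x hx)
  have lγ : ∀ x ∈ γs, x.1.length = h := fun x hx => gγ.length_vec x (hγ x hx)
  obtain ⟨hlen, hmult⟩ := subAll_spec (h := h) hr lγ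
  set mult := subAll rem γs
  rw [Entry.Correct, toCode_mk]
  set c : Code h := ⟨N, vec h m, vecs h βs, vecs h γs⟩ with hc
  have hcm : c.mult = vec h mult := by rw [hmult, hrem]; rfl
  have hcp : c.p = γs.length + sumL mult := by
    rw [Code.p, hcm, sumL_eq hlen]
    congr 1
    exact card_vecs γs
  have hsum : c.β.sum + c.γ.sum ≤ c.N • c.m := by
    rw [hrem] at hγs
    calc c.β.sum + c.γ.sum ≤ c.β.sum + (c.N • c.m - c.β.sum) := by gcongr
      _ = c.N • c.m := add_tsub_cancel_of_le hβs
  have mβ : ∀ x ∈ βs, vec h x.1 ≠ 0 ∧ vec h x.1 + 1 ≤ vec h m := by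
    intro x hx
    have h2 := hβ x hx
    rw [gβ.eq_mk x h2, mem_itemsβ hm] at h2
    refine ⟨h2.2.1, fun i => ?_⟩
    have h3 := h2.2.2 i
    have h4 := h1 i
    simp only [Pi.add_apply, Pi.one_apply] at h4 ⊢
    omega
  have mγ : ∀ x ∈ γs, 2 ≤ size (vec h x.1) := by
    intro x hx
    have h2 := hγ x hx
    rw [gγ.eq_mk x h2, mem_itemsγ (by simpa using hm)] at h2
    exact h2.2.1
  refine ⟨⟨hN, h1, ?_, ?_, ?_, hsum, ?_, ?_⟩, ?_, ?_⟩
  · intro b hb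
    obtain ⟨x, hx, rfl⟩ := List.mem_map.1 (Multiset.mem_coe.1 hb)
    exact (mβ x hx).1
  · intro b hb
    obtain ⟨x, hx, rfl⟩ := List.mem_map.1 (Multiset.mem_coe.1 hb)
    exact (mβ x hx).2
  · intro b hb
    obtain ⟨x, hx, rfl⟩ := List.mem_map.1 (Multiset.mem_coe.1 hb)
    exact mγ x hx
  · intro r
    rw [Code.cost_eq c hsum]
    have h2 := hcost r
    rw [vec_baseCost hm hr lβ, hrem] at h2
    exact h2
  · intro hle a
    rw [hcp] at hle
    change N + _ ≤ (vecs h βs).card at hle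
    rw [card_vecs] at hle
    obtain ⟨x, hx, h0⟩ := hjoin hle a a.2
    exact ⟨vec h x.1, Multiset.mem_coe.2 (List.mem_map_of_mem hx), h0⟩
  · rw [Code.B, Multiset.map_add, Multiset.sum_add, Multiset.map_replicate, Multiset.sum_replicate,
      hcp, smul_eq_mul, Multiset.map_map]
    change _ = ((vecs h βs).map _).sum + (N + _ - (vecs h βs).card) * _
    rw [card_vecs, sum_map_vecs, sumL_map, cubeL_eq hm]
    dsimp only
    congr 2
    refine List.map_congr_left fun x hx => ?_
    rw [gβ.eq_mk x (hβ x hx)]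
    have hl : m.length = x.1.length := hm.trans (lβ x hx).symm
    change cubeL D (subL m x.1) = _
    rw [cubeL_eq ((length_subL hl).trans hm), vec_subL hl]
    rfl
  · rw [Code.C, Multiset.map_add, Multiset.sum_add, Multiset.map_replicate, Multiset.sum_replicate,
      hcp, smul_eq_mul, Multiset.map_map, Multiset.map_add, Multiset.sum_add, sum_map_units, hcm]
    change _ = ((vecs h γs).map _).sum + _ + ((vecs h βs).card - (N + _)) * _
    rw [card_vecs, sum_map_vecs, cubeL_eq hm,
      dotL_unitsL (g := fun e => cube (form h D) (vec h m + e)) hlen]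
    · dsimp only
      rw [sumL_map]
      congr 3
      refine List.map_congr_left fun x hx => ?_
      rw [gγ.eq_mk x (hγ x hx)]
      have hl : m.length = x.1.length := hm.trans (lγ x hx).symm
      change cubeL D (addL m x.1) = _
      rw [cubeL_eq ((length_addL hl).trans hm), vec_addL hl]
      rfl
    · intro e he
      have hl : m.length = e.length := hm.trans he.symm
      rw [cubeL_eq ((length_addL hl).trans hm), vec_addL hl]

theorem entries_sound {b : ℕ} (hD : D.length = h) (hS : S.length = h) {e : Entry}
    (he : e ∈ entries h D S b) :
    (e.toCode h).IsValid (form h D) (vec h S) ∧ e.Correct h D := by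
  obtain ⟨N, hN, he⟩ := List.mem_flatMap.1 he
  obtain ⟨m, hm, he⟩ := List.mem_flatMap.1 he
  have hm' : m.length = h := by simpa using (mem_box.1 hm).1
  have hmN : (m.map (N * ·)).length = h := by simpa using hm'
  rw [entriesm] at he
  cases hb : (leL (minCost h D N m) S && m.all (Nat.ble 1)) with
  | false => simp [hb] at he
  | true =>
  rw [hb, cond_true] at he
  obtain ⟨βs, hβs, he⟩ := List.mem_flatMap.1 he
  obtain ⟨hb1, hb2⟩ := Bool.and_eq_true_iff.1 hb
  have hlenS : S.length = (minCost h D N m).length := hS.trans (length_minCost hD N m).symm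
  have h1 : 1 ≤ vec h m := by
    intro i
    have hi : (i : ℕ) < m.length := by rw [hm']; exact i.2
    have := List.all_eq_true.1 hb2 _ (List.getElem_mem hi)
    rw [Nat.ble_eq] at this
    simpa [vec, hi] using this
  obtain ⟨s1, s2, s3⟩ := (goodItems_β hD hm').search_sound hmN ((length_subL hlenS).trans hS) hβs
  rw [vec_map_mul] at s2
  have lβ : ∀ x ∈ βs, x.1.length = h := fun x hx => (goodItems_β hD hm').length_vec x (s1 x hx)
  obtain ⟨hr, hrem⟩ := subAll_spec (h := h) hmN lβ
  rw [vec_map_mul] at hrem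
  rw [entriesβ] at he
  cases hb' : leL (baseCost h D m (subAll (m.map (N * ·)) βs) βs) S with
  | false => simp [hb'] at he
  | true =>
  rw [hb', cond_true] at he
  obtain ⟨γs, hγs, he⟩ := List.mem_flatMap.1 he
  have hlen : S.length = (baseCost h D m (subAll (m.map (N * ·)) βs) βs).length :=
    hS.trans (length_baseCost hD _ _ _).symm
  obtain ⟨t1, t2, t3⟩ := (goodItems_γ (m := m) hD hmN).search_sound hr
    ((length_subL hlen).trans hS) hγs
  refine leaf_sound hD hm' ?_ h1 s1 t1 hr hrem s2 t2 (fun r => ?_) he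
  · simpa using hN
  · have h2 := t3 r
    have h3 : vec h (baseCost h D m (subAll (m.map (N * ·)) βs) βs) r ≤ vec h S r :=
      (leL_iff_vec (length_baseCost hD _ _ _) hS).1 hb' r
    rw [vec_subL hlen, Pi.sub_apply] at h2
    omega

/-- A vector `m` with an entry above `b` dominates `1 + b • unit a`. Already its minimal cost, with
`N ≥ 3`, exceeds the budget in some component, which is what `boundOK` verifies. -/
theorem le_bound {b : ℕ} (hD : D.length = h) (hS : S.length = h) (hb : boundOK h D S b = true)
    {c : Code h} (hc : c.IsValid (form h D) (vec h S)) (a : Fin h) : c.m a ≤ b := by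
  by_contra! hlt
  obtain ⟨h1, h2⟩ := getD_unitsL a
  set e := (unitsL h).getD a []
  have h3 := List.all_eq_true.1 hb e h1
  have hle := length_of_mem_unitsL h1
  rw [Bool.not_eq_true', ← Bool.not_eq_true, leL_iff_vec (by simp [hD]) hS] at h3
  refine h3 fun r => ?_
  rw [vec, getD_map_form (by simp [quadL_nil]), quadL_eq (by simp) (by simp),
    quadL_eq (by simp) hle, vec_replicate_one, h2]
  refine le_trans ?_ ((Nat.le_add_right _ _).trans (hc.bound r))
  -- Coordinate `a` has the value `1 + b` on the left, the least entry that violates the bound.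
  have hm : 1 + b • unit a ≤ c.m := by
    intro i
    have h4 : 1 ≤ c.m i := hc.one_le i
    by_cases hi : i = a
    · subst hi; simp; omega
    · simpa [hi] using h4
  have hN : 3 ≤ c.N := by
    have := hc.N_mem
    simp only [Set.mem_insert_iff, Set.mem_singleton_iff] at this; omega
  rw [← quad_smul_right, ← quad_add_right]
  exact Nat.mul_le_mul hN (quad_mono r le_rfl hm)

/-- A valid code survives every pruning test: the bound on `m`, the minimal cost, the first search
with the excesses of `m - b_i`, the base cost, and the second search with the excesses of `c_j - m`.
Each test is a consequence of the anomaly condition with nonnegative terms omitted. -/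
theorem entries_complete {b : ℕ} (hD : D.length = h) (hS : S.length = h)
    (hb : boundOK h D S b = true) {c : Code h} (hc : c.IsValid (form h D) (vec h S)) :
    ∃ e ∈ entries h D S b, e.toCode h = c := by
  set m := List.ofFn c.m with hmdef
  have hm : m.length = h := by simp [m]
  have hvm : vec h m = c.m := vec_ofFn _
  have hmN : (m.map (c.N * ·)).length = h := by simpa using hm
  have hlenS : S.length = (minCost h D c.N m).length := hS.trans (length_minCost hD c.N m).symm
  have hmin : leL (minCost h D c.N m) S = true := by
    rw [leL_iff_vec (length_minCost hD _ _) hS]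
    intro r
    rw [vec_minCost hm, hvm]
    exact (Nat.le_add_right _ _).trans (hc.bound r)
  have hone : m.all (Nat.ble 1) = true := by
    rw [List.all_eq_true]
    intro x hx
    obtain ⟨i, rfl⟩ := (List.mem_ofFn' _ _).1 hx
    rw [Nat.ble_eq]
    exact hc.one_le i
  have hβN : c.β.sum ≤ c.N • c.m := le_self_add.trans hc.sum_le
  -- The fuel is the size of `N m`, which bounds the number of nonzero vectors with sum at most `N
  -- m`.
  obtain ⟨βs, hβs, eβ⟩ := (goodItems_β hD hm).search_complete
    (n := sumL (m.map (c.N * ·))) hmN ((length_subL hlenS).trans hS) (M := c.β)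
    (fun x hx => (mem_itemsβ hm).2 ⟨by simp, by rw [vec_ofFn]; exact hc.β_ne x hx, fun i => by
      have h2 : x i + 1 ≤ c.m i := hc.β_le x hx i
      rw [vec_ofFn, hvm]
      omega⟩)
    (fun _ => rfl) (by rw [vec_map_mul, hvm]; exact hβN)
    (fun r => by
      have h2 := hc.bound r
      rw [vec_subL hlenS, Pi.sub_apply, vec_minCost hm, hvm]
      omega)
    (by
      rw [sumL_eq hmN, vec_map_mul, hvm]
      exact (card_le_size_sum fun x hx => Nat.one_le_iff_ne_zero.2 fun h0 =>
        hc.β_ne x hx (size_eq_zero.1 h0)).trans (size_mono hβN))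
  obtain ⟨s1, -, -⟩ := (goodItems_β hD hm).search_sound hmN ((length_subL hlenS).trans hS) hβs
  have lβ : ∀ x ∈ βs, x.1.length = h := fun x hx => (goodItems_β hD hm).length_vec x (s1 x hx)
  obtain ⟨hr, hrem⟩ := subAll_spec (h := h) hmN lβ
  rw [vec_map_mul, eβ, hvm] at hrem
  set rem := subAll (m.map (c.N * ·)) βs with hremdef
  have hlen : S.length = (baseCost h D m rem βs).length := hS.trans (length_baseCost hD _ _ _).symm
  have hcost : ∀ r, vec h (baseCost h D m rem βs) r + (c.γ.map (excess (form h D) r)).sum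
      ≤ vec h S r := by
    intro r
    rw [vec_baseCost hm hr lβ, hrem, eβ, hvm, ← Code.cost_eq c hc.sum_le]
    exact hc.cost_le r
  have hγ : c.γ.sum ≤ vec h rem := by rw [hrem]; exact le_tsub_of_add_le_left hc.sum_le
  have gγ := goodItems_γ (m := m) (D := D) hD hmN
  obtain ⟨γs, hγs, eγ⟩ := gγ.search_complete
    (n := sumL rem) hr ((length_subL hlen).trans hS) (M := c.γ)
    (fun x hx => (mem_itemsγ hmN).2 ⟨by simp, by rw [vec_ofFn]; exact hc.γ_size x hx, by
      rw [vec_ofFn, vec_map_mul, hvm]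
      exact (Multiset.single_le_sum (fun _ _ => zero_le) x hx).trans
        (le_add_self.trans hc.sum_le)⟩)
    (fun _ => rfl) hγ
    (fun r => by
      have h2 := hcost r
      rw [vec_subL hlen, Pi.sub_apply]
      omega)
    (by
      rw [sumL_eq hr]
      exact (card_le_size_sum fun x hx => (hc.γ_size x hx).trans' (by norm_num)).trans
        (size_mono hγ))
  obtain ⟨t1, -, -⟩ := gγ.search_sound hr ((length_subL hlen).trans hS) hγs
  obtain ⟨hlen', hmult⟩ := subAll_spec (h := h) hr fun x hx => gγ.length_vec x (t1 x hx)
  rw [hrem, eγ] at hmult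
  have hp : γs.length + sumL (subAll rem γs) = c.p := by
    rw [sumL_eq hlen', hmult, ← card_vecs (h := h), eγ]
    rfl
  suffices H : ∃ e ∈ entriesm h D S c.N m, e.toCode h = c by
    obtain ⟨e, he, hce⟩ := H
    refine ⟨e, List.mem_flatMap.2 ⟨c.N, ?_, List.mem_flatMap.2 ⟨m, ?_, he⟩⟩, hce⟩
    · simpa using hc.N_mem
    · refine mem_box.2 ⟨by simp [m], fun i => ?_⟩
      by_cases hi : i < h
      · have := le_bound hD hS hb hc ⟨i, hi⟩
        simpa [m, hi, List.getD_eq_getElem] using this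
      · rw [List.getD_eq_default _ _ (by omega)]; exact Nat.zero_le _
  have hb' : leL (baseCost h D m rem βs) S = true := by
    rw [leL_iff_vec (length_baseCost hD _ _ _) hS]
    exact fun r => (Nat.le_add_right _ _).trans (hcost r)
  rw [entriesm, hmin, hone, Bool.and_self, cond_true]
  have H : ∃ e ∈ entriesβ h D S c.N m rem βs, e.toCode h = c := by
    rw [entriesβ, hb', cond_true]
    have H' : ∃ e ∈ leaf h D c.N m (subAll rem γs) βs γs, e.toCode h = c := by
      refine ⟨_, mem_leaf.2 ⟨fun hle a ha => ?_, rfl⟩, by rw [toCode_mk, hvm, eβ, eγ]⟩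
      rw [hp, ← card_vecs (h := h), eβ] at hle
      obtain ⟨x, hx, h0⟩ := hc.join hle ⟨a, ha⟩
      rw [← eβ] at hx
      obtain ⟨y, hy, rfl⟩ := List.mem_map.1 (Multiset.mem_coe.1 hx)
      exact ⟨y, hy, h0⟩
    obtain ⟨e, he, hce⟩ := H'
    exact ⟨e, List.mem_flatMap.2 ⟨γs, hγs, he⟩, hce⟩
  obtain ⟨e, he, hce⟩ := H
  exact ⟨e, List.mem_flatMap.2 ⟨βs, hβs, he⟩, hce⟩

/-- Results of different branches stay distinct when the branch can be read off from the result by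
`key`. It is applied once for each component of a code. -/
theorem nodup_map_flatMap {α β γ δ : Type*} {l : List α} {f : α → List β} {g : β → γ}
    {key : γ → δ} {κ : α → δ} (hl : (l.map κ).Nodup) (h1 : ∀ a ∈ l, ((f a).map g).Nodup)
    (h2 : ∀ a ∈ l, ∀ b ∈ f a, key (g b) = κ a) : ((l.flatMap f).map g).Nodup := by
  rw [List.map_flatMap, List.nodup_flatMap]
  refine ⟨h1, ?_⟩
  rw [List.Nodup, List.pairwise_map] at hl
  refine hl.imp_of_mem fun {a b} ha hb hab => ?_
  intro x hx hy
  obtain ⟨y, hy1, rfl⟩ := List.mem_map.1 hx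
  obtain ⟨z, hz1, hz2⟩ := List.mem_map.1 hy
  exact hab (by rw [← h2 a ha y hy1, ← h2 b hb z hz1, hz2])

theorem mem_entriesβ {N : ℕ} {m rem : List ℕ} {βs : List Item} {e : Entry}
    (he : e ∈ entriesβ h D S N m rem βs) :
    ∃ γs, e ∈ leaf h D N m (subAll rem γs) βs γs := by
  rw [entriesβ] at he
  cases hb : leL (baseCost h D m rem βs) S with
  | false => simp [hb] at he
  | true =>
    rw [hb, cond_true] at he
    obtain ⟨γs, -, he⟩ := List.mem_flatMap.1 he
    exact ⟨γs, he⟩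

theorem mem_entriesm {N : ℕ} {m : List ℕ} {e : Entry} (he : e ∈ entriesm h D S N m) :
    ∃ mult βs γs, e ∈ leaf h D N m mult βs γs := by
  rw [entriesm] at he
  cases hb : (leL (minCost h D N m) S && m.all (Nat.ble 1)) with
  | false => simp [hb] at he
  | true =>
    rw [hb, cond_true] at he
    obtain ⟨βs, -, he⟩ := List.mem_flatMap.1 he
    obtain ⟨γs, he⟩ := mem_entriesβ he
    exact ⟨_, βs, γs, he⟩

/-- The four nested choices `N`, `m`, `β`, `γ` are the four components of the code, so no code
arises from two branches. -/
theorem entries_nodup (hD : D.length = h) (b : ℕ) :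
    ((entries h D S b).map (Entry.toCode h)).Nodup := by
  refine nodup_map_flatMap (key := Code.N) (κ := id) (by simp) (fun N _ => ?_) ?_
  · refine nodup_map_flatMap (key := Code.m) (κ := vec h) ?_ (fun m hm => ?_) ?_
    · refine (nodup_box _).map_on fun x hx y hy hxy => ?_
      exact vec_injOn (by simpa using (mem_box.1 hx).1) (by simpa using (mem_box.1 hy).1) hxy
    · have hm' : m.length = h := by simpa using (mem_box.1 hm).1
      have hmN : (m.map (N * ·)).length = h := by simpa using hm'
      rw [entriesm]
      cases (leL (minCost h D N m) S && m.all (Nat.ble 1)) with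
      | false => simp
      | true =>
      rw [cond_true]
      refine nodup_map_flatMap (key := Code.β) (κ := vecs h)
        ((goodItems_β hD hm').search_nodup _ _) (fun βs _ => ?_) ?_
      · rw [entriesβ]
        cases leL (baseCost h D m (subAll (m.map (N * ·)) βs) βs) S with
        | false => simp
        | true =>
        rw [cond_true]
        refine nodup_map_flatMap (key := Code.γ) (κ := vecs h)
          ((goodItems_γ (m := m) hD hmN).search_nodup _ _) (fun γs _ => ?_) ?_
        · rw [leaf]
          cases (Nat.ble _ _ && _) <;> simp
        · intro γs _ e he
          obtain ⟨-, rfl⟩ := mem_leaf.1 he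
          rw [toCode_mk]
      · intro βs _ e he
        obtain ⟨γs, he⟩ := mem_entriesβ he
        obtain ⟨-, rfl⟩ := mem_leaf.1 he
        rw [toCode_mk]
    · intro m _ e he
      obtain ⟨_, _, _, he⟩ := mem_entriesm he
      obtain ⟨-, rfl⟩ := mem_leaf.1 he
      rfl
  · intro N _ e he
    obtain ⟨m, _, he⟩ := List.mem_flatMap.1 he
    obtain ⟨_, _, _, he⟩ := mem_entriesm he
    obtain ⟨-, rfl⟩ := mem_leaf.1 he
    rfl

end MonadSearch


/-! ## Fans given by primitive relations -/

namespace ToricSpace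

/-- A relation `∑_P v_ρ = ∑_R v_ρ` between the rays, with fewer terms on the right hand side. -/
structure Relation (X : ToricSpace) where
  P : Multiset (Fin X.k)
  R : Multiset (Fin X.k)
  nodup : P.Nodup
  card_lt : R.card < P.card
  sum_eq : (P.map X.v).sum = (R.map X.v).sum

variable {X : ToricSpace}

theorem dual_multiset_sum (m : Module.Dual ℤ (Fin 4 → ℤ)) (M : Multiset (Fin X.k)) :
    m ((M.map X.v).sum) = (M.map fun ρ => m (X.v ρ)).sum := by
  rw [map_multiset_sum, Multiset.map_map]; rfl

/-- The intersection number with the curve class of a relation. -/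
def Relation.functional (r : X.Relation) : X.Pic →ₗ[ℤ] ℤ :=
  Submodule.liftQ _
    { toFun := fun a => (r.P.map a).sum - (r.R.map a).sum
      map_add' := fun a b => by simp only [Pi.add_apply, Multiset.sum_map_add]; ring
      map_smul' := fun c a => by
        simp only [Pi.smul_apply, smul_eq_mul, Multiset.sum_map_mul_left, RingHom.id_apply]; ring }
    (by
      rintro _ ⟨m, rfl⟩
      have h := congrArg m r.sum_eq
      rw [dual_multiset_sum, dual_multiset_sum] at h
      exact sub_eq_zero.2 h)

theorem Relation.functional_cls (r : X.Relation) (a : Fin X.k → ℤ) :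
    r.functional (X.cls a) = (r.P.map a).sum - (r.R.map a).sum := rfl

theorem Relation.functional_toricDivisor (r : X.Relation) (ρ : Fin X.k) :
    r.functional (X.toricDivisor ρ) = r.P.count ρ - r.R.count ρ := by
  have h : ∀ M : Multiset (Fin X.k), (M.map (Pi.single ρ (1 : ℤ) : Fin X.k → ℤ)).sum = M.count ρ := by
    intro M
    induction M using Multiset.induction_on with
    | empty => simp
    | cons a M ih =>
      rw [Multiset.map_cons, Multiset.sum_cons, ih, Multiset.count_cons, Pi.single_apply]
      simp only [eq_comm (a := ρ)]
      split_ifs <;> push_cast <;> ring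
  rw [toricDivisor, functional_cls, h, h]

/-- The sets in `cones` are the maximal cones of a smooth fan, and every set of rays that does not
span a cone contains the left hand side of a relation in `rels`. -/
structure IsFan (X : ToricSpace) (cones : Set (Finset (Fin X.k))) (rels : Set X.Relation) :
    Prop where
  cover : ∀ s : Finset (Fin X.k), (∃ r ∈ rels, ∀ ρ ∈ r.P, ρ ∈ s) ∨ ∃ t ∈ cones, s ⊆ t
  card_eq : ∀ t ∈ cones, t.card = 4
  spans : ∀ t ∈ cones, X.SpansCone t
  dual : ∀ t ∈ cones, ∃ u : Fin X.k → Module.Dual ℤ (Fin 4 → ℤ),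
    (∀ ρ ∈ t, ∀ σ ∈ t, u ρ (X.v σ) = if ρ = σ then 1 else 0)
  right : ∀ r ∈ rels, ∃ t ∈ cones, ∀ ρ ∈ r.R, ρ ∈ t

/-- A linear form that is at least -1 on all rays and equal to -1 on `P` would give `-|P|` on the
left of the relation and at least `-|R|` on the right, contrary to `|R| < |P|`. -/
theorem Relation.not_spansCone (r : X.Relation) {s : Finset (Fin X.k)} (h : ∀ ρ ∈ r.P, ρ ∈ s) :
    ¬ X.SpansCone s := by
  rintro ⟨m, h1, h2⟩
  have e1 : (r.P.map fun ρ => m (X.v ρ)).sum = -(r.P.card : ℤ) := by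
    rw [Multiset.map_congr rfl fun ρ hρ => h2 ρ (h ρ hρ)]
    simp
  have e2 : -(r.R.card : ℤ) ≤ (r.R.map fun ρ => m (X.v ρ)).sum := by
    have := Multiset.card_nsmul_le_sum (s := r.R.map fun ρ => m (X.v ρ)) (a := -1)
      (by simpa using fun ρ _ => h1 ρ)
    simpa using this
  have e3 := congrArg m r.sum_eq
  rw [dual_multiset_sum, dual_multiset_sum] at e3
  have := r.card_lt
  omega

namespace IsFan

variable {cones : Set (Finset (Fin X.k))} {rels : Set X.Relation} (hX : X.IsFan cones rels)
include hX

/-- The relations exclude sets from the fan, the listed cones include them, and `cover` says that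
every set falls under one of the two. -/
theorem spansCone_iff {s : Finset (Fin X.k)} : X.SpansCone s ↔ ∃ t ∈ cones, s ⊆ t := by
  refine ⟨fun h => (hX.cover s).resolve_left ?_, ?_⟩
  · rintro ⟨r, _, hr⟩
    exact r.not_spansCone hr h
  · rintro ⟨t, ht, hs⟩
    exact (hX.spans t ht).mono hs

theorem isMaximalCone_iff {s : Finset (Fin X.k)} : X.IsMaximalCone s ↔ s ∈ cones := by
  refine ⟨?_, fun h => ⟨hX.spans s h, hX.card_eq s h⟩⟩
  rintro ⟨h1, h2⟩
  obtain ⟨t, ht, hs⟩ := hX.spansCone_iff.1 h1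
  rwa [Finset.eq_of_subset_of_card_le hs (by rw [hX.card_eq t ht, h2])]

theorem exists_dual {t : Finset (Fin X.k)} (ht : t ∈ cones) (a : Fin X.k → ℤ) :
    ∃ m : Module.Dual ℤ (Fin 4 → ℤ), ∀ ρ ∈ t, m (X.v ρ) = a ρ := by
  obtain ⟨u, hu⟩ := hX.dual t ht
  refine ⟨∑ ρ ∈ t, a ρ • u ρ, fun σ hσ => ?_⟩
  rw [LinearMap.sum_apply, Finset.sum_eq_single σ]
  · simp [hu σ hσ σ hσ]
  · intro ρ hρ hne
    simp [hu ρ hρ σ hσ, hne]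
  · exact fun h => (h hσ).elim

theorem isSmoothFan : X.IsSmoothFan where
  solve σ hσ a := hX.exists_dual (hX.isMaximalCone_iff.1 hσ) a
  extend σ hσ _ := by
    obtain ⟨t, ht, hs⟩ := hX.spansCone_iff.1 hσ
    exact ⟨t, hX.isMaximalCone_iff.2 ht, hs⟩

/-- The functional is negative at most on divisors in `R`, and `R` lies in a maximal cone. -/
theorem functional_nonneg {r : X.Relation} (hr : r ∈ rels) {D : X.Pic} (hD : X.IsNef D) :
    0 ≤ r.functional D := by
  obtain ⟨t, ht, hs⟩ := hX.right r hr
  refine hD.functional_nonneg (hX.isMaximalCone_iff.2 ht) fun ρ hρ => ?_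
  rw [r.functional_toricDivisor, Multiset.count_eq_zero.2 fun h => hρ (hs ρ h)]
  simp

theorem functional_pos {r : X.Relation} (hr : r ∈ rels) {D : X.Pic} (hD : X.IsAmple D) :
    0 < r.functional D := by
  obtain ⟨t, ht, hs⟩ := hX.right r hr
  have h0 : ∀ ρ, ρ ∉ t → r.functional (X.toricDivisor ρ) = r.P.count ρ := by
    intro ρ hρ
    rw [r.functional_toricDivisor, Multiset.count_eq_zero.2 fun h => hρ (hs ρ h)]
    simp
  refine hD.functional_pos (hX.isMaximalCone_iff.2 ht) (fun ρ hρ => by simp [h0 ρ hρ]) ?_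
  by_contra! hcon
  -- If no divisor off `t` had a positive value, then `P` would be contained in the cone `t`.
  refine r.not_spansCone (s := t) (fun ρ hρ => ?_) (hX.spans t ht)
  by_contra hρt
  have h1 := hcon ρ hρt
  have h2 := Multiset.count_pos.2 hρ
  rw [h0 ρ hρt] at h1
  omega

/-- Every sum of rays can be moved into a cone by means of the relations. -/
theorem exists_reduction (a : Fin X.k → ℤ)
    (ha : ∀ r ∈ rels, (r.R.map a).sum ≤ (r.P.map a).sum) (M : Multiset (Fin X.k)) :
    ∃ M' : Multiset (Fin X.k), (∃ t ∈ cones, ∀ ρ ∈ M', ρ ∈ t) ∧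
      (M'.map X.v).sum = (M.map X.v).sum ∧ (M'.map a).sum ≤ (M.map a).sum ∧
      ((∀ r ∈ rels, (r.R.map a).sum < (r.P.map a).sum) → (¬ ∃ t ∈ cones, ∀ ρ ∈ M, ρ ∈ t) →
        (M'.map a).sum < (M.map a).sum) := by
  induction hn : M.card using Nat.strong_induction_on generalizing M with
  | _ n ih =>
    subst hn
    rcases hX.cover M.toFinset with ⟨r, hr, hs⟩ | ⟨t, ht, hs⟩
    -- Replacing `P` by `R` keeps the sum of the rays, does not increase the `a`-sum and lowers the
    -- number of terms, so the process terminates.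
    · have hle : r.P ≤ M := (Multiset.le_iff_subset r.nodup).2 fun ρ hρ => by simpa using hs ρ hρ
      obtain ⟨Q, rfl⟩ := Multiset.le_iff_exists_add.1 hle
      obtain ⟨M', h1, h2, h3, h4⟩ := ih (r.R + Q).card
        (by simpa using r.card_lt) (r.R + Q) rfl
      have e := ha r hr
      simp only [Multiset.map_add, Multiset.sum_add] at h2 h3 ⊢
      refine ⟨M', h1, by rw [h2, r.sum_eq], by linarith, fun h5 _ => ?_⟩
      have := h5 r hr
      linarith
    · refine ⟨M, ⟨t, ht, fun ρ hρ => hs (by simpa using hρ)⟩, rfl, le_rfl, fun _ h => ?_⟩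
      exact (h ⟨t, ht, fun ρ hρ => hs (by simpa using hρ)⟩).elim

/-- A sum of rays of a cone `s` can be written as a sum of rays of a cone in one way only. -/
theorem mem_of_sum_eq {s t : Finset (Fin X.k)} (hs : s ∈ cones) (ht : t ∈ cones)
    {M N : Multiset (Fin X.k)} (hM : ∀ ρ ∈ M, ρ ∈ s) (hN : ∀ ρ ∈ N, ρ ∈ t)
    (h : (M.map X.v).sum = (N.map X.v).sum) : ∀ ρ ∈ N, ρ ∈ s := by
  obtain ⟨m, m1, m2⟩ := hX.spans s hs
  obtain ⟨n, n1, n2⟩ := hX.spans t ht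
  have e1 : ∀ {l : Module.Dual ℤ (Fin 4 → ℤ)} {M : Multiset (Fin X.k)},
      (∀ ρ ∈ M, l (X.v ρ) = -1) → l ((M.map X.v).sum) = -(M.card : ℤ) := by
    intro l M hl
    rw [dual_multiset_sum, Multiset.map_congr rfl hl]
    simp
  have e2 : ∀ {l : Module.Dual ℤ (Fin 4 → ℤ)} (M : Multiset (Fin X.k)),
      (∀ ρ, -1 ≤ l (X.v ρ)) → -(M.card : ℤ) ≤ l ((M.map X.v).sum) := by
    intro l M hl
    rw [dual_multiset_sum]
    have := Multiset.card_nsmul_le_sum (s := M.map fun ρ => l (X.v ρ)) (a := -1)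
      (by simpa using fun ρ _ => hl ρ)
    simpa using this
  have hMm := e1 fun ρ hρ => m2 ρ (hM ρ hρ)
  have hNn := e1 fun ρ hρ => n2 ρ (hN ρ hρ)
  have hMn := e2 M n1
  rw [h, hNn] at hMn
  -- The form `n` gives `|N| ≤ |M|`, and `m` has the value `-|M|` on the common sum while its values
  -- on the terms of `N` are at least -1. So all of these equal -1, and `N` lies on the facet cut
  -- out by `m`. The rays of that facet lie in a cone of four rays that contains `s`, that is, in
  -- `s` itself.
  have hspan : X.SpansCone (Finset.univ.filter fun ρ => m (X.v ρ) = -1) :=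
    ⟨m, m1, fun ρ hρ => (Finset.mem_filter.1 hρ).2⟩
  obtain ⟨s', hs', hsub⟩ := hX.spansCone_iff.1 hspan
  have hss : s ⊆ s' := fun ρ hρ => hsub (by simpa using m2 ρ hρ)
  have heq : s = s' :=
    Finset.eq_of_subset_of_card_le hss (by rw [hX.card_eq s hs, hX.card_eq s' hs'])
  intro ρ hρ
  rw [heq]
  refine hsub (Finset.mem_filter.2 ⟨Finset.mem_univ _, ?_⟩)
  obtain ⟨Q, rfl⟩ := Multiset.exists_cons_of_mem hρ
  have h3 := e2 Q m1
  rw [h, Multiset.map_cons, Multiset.sum_cons, map_add] at hMm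
  rw [Multiset.card_cons] at hMn
  push_cast at hMn
  have h4 := m1 ρ
  omega

/-- Normalize the divisor to a representative `b` that vanishes on `s`; the claim becomes `b τ ≥ 0`
for every ray `τ`. Adding a multiple of the sum of the rays of `s` moves `v_τ` into the cone `s`.
Reducing the corresponding multiset by the relations does not increase its `b`-sum, and by
uniqueness the reduced multiset is supported in `s`, where `b` is zero. If `τ ∉ s` the multiset does
not lie in a cone, so at least one relation is used and strictness follows. -/
theorem exists_support (a : Fin X.k → ℤ) (ha : ∀ r ∈ rels, 0 ≤ r.functional (X.cls a))
    {s : Finset (Fin X.k)} (hs : s ∈ cones) :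
    ∃ m : Module.Dual ℤ (Fin 4 → ℤ), (∀ ρ ∈ s, m (X.v ρ) = -a ρ) ∧ (∀ ρ, -a ρ ≤ m (X.v ρ)) ∧
      ((∀ r ∈ rels, 0 < r.functional (X.cls a)) → ∀ ρ, ρ ∉ s → -a ρ < m (X.v ρ)) := by
  obtain ⟨m, hm⟩ := hX.exists_dual hs (-a)
  obtain ⟨u, hu⟩ := hX.dual s hs
  set b : Fin X.k → ℤ := fun ρ => a ρ + m (X.v ρ) with hb
  have hcls : X.cls b = X.cls a := cls_eq_cls_iff.2 ⟨m, fun _ => rfl⟩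
  have hb0 : ∀ ρ ∈ s, b ρ = 0 := fun ρ hρ => by simp [hb, hm ρ hρ]
  have hv : ∀ τ, X.v τ = ∑ ρ ∈ s, u ρ (X.v τ) • X.v ρ := by
    have hlin : LinearIndependent ℤ (fun ρ : s => X.v ρ) := by
      rw [Fintype.linearIndependent_iff]
      intro g hg ρ
      have := congrArg (u ρ) hg
      rw [map_sum, Finset.sum_eq_single ρ] at this
      · simpa only [map_smul, hu ρ ρ.2 ρ ρ.2, if_true, smul_eq_mul, mul_one, map_zero] using this
      · intro σ _ hne
        rw [map_smul, hu ρ ρ.2 σ σ.2, if_neg fun h => hne (Subtype.ext h.symm), smul_zero]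
      · simp
    intro τ
    -- Five vectors in a lattice of rank four are dependent. The coefficient of `v_τ` is nonzero by
    -- independence of the other four, and it cancels after the dual forms `u ρ` are applied.
    have hdep : ¬ LinearIndependent ℤ (fun o : Option s => o.elim (X.v τ) fun ρ => X.v ρ) := by
      intro h
      have := h.fintype_card_le_finrank
      simp [hX.card_eq s hs] at this
    rw [Fintype.not_linearIndependent_iff] at hdep
    obtain ⟨g, hg, o, ho⟩ := hdep
    rw [Fintype.sum_option] at hg
    simp only [Option.elim] at hg
    have hg0 : g none ≠ 0 := by
      intro h0
      rw [h0, zero_smul, zero_add] at hg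
      rw [Fintype.linearIndependent_iff] at hlin
      have := hlin (fun ρ => g (some ρ)) hg
      rcases o with _ | ρ
      · exact ho h0
      · exact ho (this ρ)
    have hcoef : ∀ ρ : s, g none * u ρ (X.v τ) = -g (some ρ) := by
      intro ρ
      have := congrArg (u ρ) hg
      rw [map_add, map_sum, Finset.sum_eq_single ρ] at this
      · simp only [map_smul, hu ρ ρ.2 ρ ρ.2, if_pos, smul_eq_mul, mul_one, map_zero] at this
        linarith
      · intro σ _ hne
        rw [map_smul, hu ρ ρ.2 σ σ.2, if_neg fun h => hne (Subtype.ext h.symm), smul_zero]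
      · simp
    refine smul_right_injective _ hg0 ?_
    simp only
    rw [eq_neg_of_add_eq_zero_left hg, Finset.smul_sum, ← Finset.sum_coe_sort s, ← Finset.sum_neg_distrib]
    refine Finset.sum_congr rfl fun ρ _ => ?_
    rw [smul_smul, hcoef, neg_smul]
  have key : ∀ τ, 0 ≤ b τ ∧ ((∀ r ∈ rels, 0 < r.functional (X.cls a)) → τ ∉ s → 0 < b τ) := by
    intro τ
    -- This `c` makes all the coefficients `u ρ (v_τ) + c` nonnegative, so that both sides are sums
    -- over multisets.
    set c : ℕ := ∑ ρ ∈ s, (u ρ (X.v τ)).natAbs with hc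
    set M : Multiset (Fin X.k) := τ ::ₘ c • s.val with hM
    set N : Multiset (Fin X.k) := ∑ ρ ∈ s, Multiset.replicate ((u ρ (X.v τ) + c).toNat) ρ with hN
    have hMN : (M.map X.v).sum = (N.map X.v).sum := by
      rw [hM, Multiset.map_cons, Multiset.sum_cons, Multiset.map_nsmul, Multiset.sum_nsmul, hN,
        ← Multiset.coe_mapAddMonoidHom, map_sum, ← Multiset.coe_sumAddMonoidHom, map_sum]
      conv_lhs => rw [hv τ]
      rw [Multiset.coe_sumAddMonoidHom]
      change _ + c • (∑ ρ ∈ s, X.v ρ) = _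
      rw [Finset.smul_sum, ← Finset.sum_add_distrib]
      refine Finset.sum_congr rfl fun ρ hρ => ?_
      have : (u ρ (X.v τ)).natAbs ≤ c :=
        Finset.single_le_sum (f := fun ρ => (u ρ (X.v τ)).natAbs) (fun _ _ => Nat.zero_le _) hρ
      have hnn : 0 ≤ u ρ (X.v τ) + c := by omega
      rw [Multiset.coe_mapAddMonoidHom, Multiset.map_replicate, Multiset.sum_replicate,
        ← natCast_zsmul, ← natCast_zsmul, Int.toNat_of_nonneg hnn, add_smul]
    have hNs : ∀ ρ ∈ N, ρ ∈ s := by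
      intro ρ hρ
      rw [hN, Multiset.mem_sum] at hρ
      obtain ⟨σ, hσ, h⟩ := hρ
      rwa [Multiset.eq_of_mem_replicate h]
    have hfun : ∀ r : X.Relation, r.functional (X.cls a) = (r.P.map b).sum - (r.R.map b).sum := by
      intro r; rw [← hcls]; rfl
    obtain ⟨M', ⟨t, ht, ht'⟩, h2, h3, h4⟩ := hX.exists_reduction b
      (fun r hr => sub_nonneg.1 (hfun r ▸ ha r hr)) M
    have hM's := hX.mem_of_sum_eq hs ht hNs ht' (hMN.symm.trans h2.symm)
    have e1 : (M'.map b).sum = 0 := by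
      rw [Multiset.map_congr rfl fun ρ hρ => hb0 ρ (hM's ρ hρ)]
      simp
    have e2 : (M.map b).sum = b τ := by
      rw [hM, Multiset.map_cons, Multiset.sum_cons, Multiset.map_nsmul, Multiset.sum_nsmul,
        Multiset.map_congr rfl fun ρ hρ => hb0 ρ (by simpa using hρ)]
      simp
    rw [e1, e2] at h3 h4
    refine ⟨h3, fun hpos hτ => h4 (fun r hr => sub_pos.1 (hfun r ▸ hpos r hr)) ?_⟩
    rintro ⟨t', ht1, ht2⟩
    -- For `c = 0` the ray `v_τ` would be zero, which lies on no facet. With `c ≠ 0` the multiset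
    -- contains all of `s` and `τ`, five rays if `τ ∉ s`.
    have hc0 : c ≠ 0 := by
      intro h0
      have hz : X.v τ = 0 := by
        rw [hv τ]
        refine Finset.sum_eq_zero fun ρ hρ => ?_
        have : (u ρ (X.v τ)).natAbs ≤ c :=
          Finset.single_le_sum (f := fun ρ => (u ρ (X.v τ)).natAbs) (fun _ _ => Nat.zero_le _) hρ
        rw [show u ρ (X.v τ) = 0 by omega, zero_smul]
      obtain ⟨n, -, n2⟩ := hX.spans t' ht1
      have := n2 τ (ht2 τ (by simp [hM]))
      simp [hz] at this
    have hsub : insert τ s ⊆ t' := by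
      intro ρ hρ
      refine ht2 ρ ?_
      rcases Finset.mem_insert.1 hρ with rfl | hρ
      · simp [hM]
      · exact Multiset.mem_cons_of_mem (Multiset.mem_nsmul.2 ⟨hc0, hρ⟩)
    have := Finset.card_le_card hsub
    rw [Finset.card_insert_of_notMem hτ, hX.card_eq s hs, hX.card_eq t' ht1] at this
    omega
  refine ⟨m, hm, fun ρ => ?_, fun hpos ρ hρ => ?_⟩
  · have := (key ρ).1
    simp only [hb] at this
    linarith
  · have := (key ρ).2 hpos hρ
    simp only [hb] at this
    linarith

theorem isNef_iff {D : X.Pic} : X.IsNef D ↔ ∀ r ∈ rels, 0 ≤ r.functional D := by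
  refine ⟨fun h r hr => hX.functional_nonneg hr h, fun h => ?_⟩
  obtain ⟨a, rfl⟩ := exists_cls D
  refine ⟨a, rfl, fun σ hσ => ?_⟩
  obtain ⟨m, h1, h2, -⟩ := hX.exists_support a h (hX.isMaximalCone_iff.1 hσ)
  exact ⟨m, h1, h2⟩

theorem isAmple_iff {D : X.Pic} : X.IsAmple D ↔ ∀ r ∈ rels, 0 < r.functional D := by
  refine ⟨fun h r hr => hX.functional_pos hr h, fun h => ?_⟩
  obtain ⟨a, rfl⟩ := exists_cls D
  refine ⟨a, rfl, fun σ hσ => ?_⟩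
  obtain ⟨m, h1, -, h2⟩ := hX.exists_support a (fun r hr => (h r hr).le)
    (hX.isMaximalCone_iff.1 hσ)
  exact ⟨m, h1, h2 h⟩

end IsFan

end ToricSpace


/-! ## Intersection numbers by localization -/

namespace ToricSpace

/-- Fixed point data of a one-parameter group `ξ`: the functions `x s` are the coordinates of `ξ`
with respect to the rays of the maximal cones, and `w s / L` is the inverse of the product of the
nonzero values of `x s`. -/
structure IsLocalization (X : ToricSpace) {ι : Type*} [Fintype ι] (x : ι → Fin X.k → ℤ) (w : ι → ℤ)
    (L : ℕ) (ξ : Fin 4 → ℤ) : Prop where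
  pos : L ≠ 0
  ne : ξ ≠ 0
  sum_eq : ∀ s, ∑ ρ, x s ρ • X.v ρ = ξ
  spans : ∀ s, X.SpansCone (Finset.univ.filter fun ρ => x s ρ ≠ 0)
  prod_eq : ∀ σ, X.IsMaximalCone σ → ∑ s, w s * ∏ ρ ∈ σ, x s ρ = L
  vanish : ∀ ρ σ τ, ∑ s, w s * (x s ρ * x s σ * x s τ) = 0

namespace IsLocalization

variable {X : ToricSpace} {ι : Type*} [Fintype ι] {x : ι → Fin X.k → ℤ} {w : ι → ℤ} {L : ℕ}
  {ξ : Fin 4 → ℤ} (hx : X.IsLocalization x w L ξ)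
include hx

theorem dual_apply (m : Module.Dual ℤ (Fin 4 → ℤ)) (s : ι) :
    ∑ ρ, m (X.v ρ) * x s ρ = m ξ := by
  rw [← hx.sum_eq s, map_sum]
  exact Finset.sum_congr rfl fun ρ _ => by rw [map_smul, smul_eq_mul, mul_comm]

theorem vanish_three (a b c : Fin X.k → ℤ) :
    ∑ s, w s * ((∑ ρ, a ρ * x s ρ) * (∑ ρ, b ρ * x s ρ) * (∑ ρ, c ρ * x s ρ)) = 0 := by
  have h : ∀ s, w s * ((∑ ρ, a ρ * x s ρ) * (∑ ρ, b ρ * x s ρ) * (∑ ρ, c ρ * x s ρ))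
      = ∑ ρ, ∑ σ, ∑ τ, a ρ * b σ * c τ * (w s * (x s ρ * x s σ * x s τ)) := by
    intro s
    rw [Finset.sum_mul_sum, Finset.sum_mul, Finset.mul_sum]
    refine Finset.sum_congr rfl fun ρ _ => ?_
    rw [Finset.sum_mul, Finset.mul_sum]
    refine Finset.sum_congr rfl fun σ _ => ?_
    rw [Finset.mul_sum, Finset.mul_sum]
    exact Finset.sum_congr rfl fun τ _ => by ring
  simp only [h]
  rw [Finset.sum_comm]
  refine Finset.sum_eq_zero fun ρ _ => ?_
  rw [Finset.sum_comm]
  refine Finset.sum_eq_zero fun σ _ => ?_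
  rw [Finset.sum_comm]
  refine Finset.sum_eq_zero fun τ _ => ?_
  rw [← Finset.mul_sum, hx.vanish, mul_zero]

/-- A linear form of the lattice takes the same value at all fixed points. With a coordinate where
`ξ` is nonzero as the third factor, that constant can be cancelled; the lower degrees follow in the
same way. -/
theorem vanish_two (a b : Fin X.k → ℤ) :
    ∑ s, w s * ((∑ ρ, a ρ * x s ρ) * (∑ ρ, b ρ * x s ρ)) = 0 := by
  obtain ⟨j, hj⟩ := Function.ne_iff.1 hx.ne
  have h := hx.vanish_three a b (X.alpha (LinearMap.proj j))
  have h2 : ∀ s, ∑ ρ, X.alpha (LinearMap.proj j) ρ * x s ρ = ξ j :=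
    fun s => hx.dual_apply (LinearMap.proj j) s
  simp only [h2, ← mul_assoc] at h ⊢
  rw [← Finset.sum_mul] at h
  exact (mul_eq_zero.1 h).resolve_right hj

theorem vanish_one (a : Fin X.k → ℤ) : ∑ s, w s * (∑ ρ, a ρ * x s ρ) = 0 := by
  obtain ⟨j, hj⟩ := Function.ne_iff.1 hx.ne
  have h := hx.vanish_two a (X.alpha (LinearMap.proj j))
  have h2 : ∀ s, ∑ ρ, X.alpha (LinearMap.proj j) ρ * x s ρ = ξ j :=
    fun s => hx.dual_apply (LinearMap.proj j) s
  simp only [h2, ← mul_assoc] at h ⊢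
  rw [← Finset.sum_mul] at h
  exact (mul_eq_zero.1 h).resolve_right hj

theorem vanish_zero : ∑ s, w s = 0 := by
  obtain ⟨j, hj⟩ := Function.ne_iff.1 hx.ne
  have h := hx.vanish_one (X.alpha (LinearMap.proj j))
  have h2 : ∀ s, ∑ ρ, X.alpha (LinearMap.proj j) ρ * x s ρ = ξ j :=
    fun s => hx.dual_apply (LinearMap.proj j) s
  simp only [h2] at h
  rw [← Finset.sum_mul] at h
  exact (mul_eq_zero.1 h).resolve_right hj

/-- Expanding the product, every term that contains a constant has degree less than four and
vanishes. So the sum does not depend on the equivariant lifts of the four classes. -/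
theorem sum_mul_prod_sub (a : Fin 4 → Fin X.k → ℤ) (t : Fin 4 → ℤ) :
    ∑ s, w s * ∏ i, ((∑ ρ, a i ρ * x s ρ) - t i) = ∑ s, w s * ∏ i, ∑ ρ, a i ρ * x s ρ := by
  set e : Fin 4 → ι → ℤ := fun i s => ∑ ρ, a i ρ * x s ρ with he
  have h3 : ∀ i j l, ∑ s, w s * (e i s * e j s * e l s) = 0 := fun i j l => hx.vanish_three _ _ _
  have h2 : ∀ i j, ∑ s, w s * (e i s * e j s) = 0 := fun i j => hx.vanish_two _ _
  have h1 : ∀ i, ∑ s, w s * e i s = 0 := fun i => hx.vanish_one _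
  have h0 := hx.vanish_zero
  have key : ∀ s, w s * ∏ i, (e i s - t i) = w s * ∏ i, e i s
      - (t 0 * (w s * (e 1 s * e 2 s * e 3 s)) + t 1 * (w s * (e 0 s * e 2 s * e 3 s))
        + t 2 * (w s * (e 0 s * e 1 s * e 3 s)) + t 3 * (w s * (e 0 s * e 1 s * e 2 s)))
      + (t 0 * t 1 * (w s * (e 2 s * e 3 s)) + t 0 * t 2 * (w s * (e 1 s * e 3 s))
        + t 0 * t 3 * (w s * (e 1 s * e 2 s)) + t 1 * t 2 * (w s * (e 0 s * e 3 s))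
        + t 1 * t 3 * (w s * (e 0 s * e 2 s)) + t 2 * t 3 * (w s * (e 0 s * e 1 s)))
      - (t 0 * t 1 * t 2 * (w s * e 3 s) + t 0 * t 1 * t 3 * (w s * e 2 s)
        + t 0 * t 2 * t 3 * (w s * e 1 s) + t 1 * t 2 * t 3 * (w s * e 0 s))
      + t 0 * t 1 * t 2 * t 3 * w s := by
    intro s
    rw [Fin.prod_univ_four, Fin.prod_univ_four]
    ring
  change ∑ s, w s * ∏ i, (e i s - t i) = ∑ s, w s * ∏ i, e i s
  simp only [key, Finset.sum_add_distrib, Finset.sum_sub_distrib, ← Finset.mul_sum, h0, h1, h2, h3]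
  ring

/-- The fixed point formula for the intersection form. -/
theorem exists_form (hX : X.IsSmoothFan) (s₀ : ι) :
    ∃ d, X.IsIntersectionForm d ∧ ∀ a : Fin 4 → Fin X.k → ℤ,
      L * d (fun i => X.cls (a i)) = ∑ s, w s * ∏ i, ∑ ρ, a i ρ * x s ρ := by
  let e : ι → ((Fin X.k → ℤ) →ₗ[ℤ] ℤ) := fun s =>
    { toFun := fun a => ∑ ρ, a ρ * x s ρ
      map_add' := fun a b => by simp [add_mul, Finset.sum_add_distrib]
      map_smul' := fun c a => by simp [Finset.mul_sum, mul_assoc] }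
  -- Subtracting the value at the base point `s₀` removes the constant that linear equivalence adds,
  -- so the difference is defined on the Picard group.
  let y : ι → (X.Pic →ₗ[ℤ] ℤ) := fun s => Submodule.liftQ _ (e s - e s₀) (by
    rintro _ ⟨m, rfl⟩
    change ∑ ρ, m (X.v ρ) * x s ρ - ∑ ρ, m (X.v ρ) * x s₀ ρ = 0
    rw [hx.dual_apply, hx.dual_apply, sub_self])
  let Q : MultilinearMap ℤ (fun _ : Fin 4 => X.Pic) ℤ :=
    ∑ s, w s • (MultilinearMap.mkPiAlgebra ℤ (Fin 4) ℤ).compLinearMap (fun _ => y s)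
  have hQ : ∀ a : Fin 4 → Fin X.k → ℤ,
      Q (fun i => X.cls (a i)) = ∑ s, w s * ∏ i, ∑ ρ, a i ρ * x s ρ := by
    intro a
    rw [← hx.sum_mul_prod_sub a fun i => ∑ ρ, a i ρ * x s₀ ρ, sum_apply]
    refine Finset.sum_congr rfl fun s _ => ?_
    rw [smul_apply, MultilinearMap.compLinearMap_apply,
      MultilinearMap.mkPiAlgebra_apply]
    rfl
  have hQρ : ∀ ρ : Fin 4 → Fin X.k,
      Q (fun i => X.toricDivisor (ρ i)) = ∑ s, w s * ∏ i, x s (ρ i) := by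
    intro ρ
    have := hQ fun i => Pi.single (ρ i) 1
    simp only [Pi.single_apply, ite_mul, one_mul, zero_mul, Finset.sum_ite_eq', Finset.mem_univ,
      if_true] at this
    exact this
  have h0 : ∀ ρ : Fin 4 → Fin X.k, ¬ X.SpansCone (Finset.univ.image ρ) →
      Q (fun i => X.toricDivisor (ρ i)) = 0 := by
    intro ρ hρ
    rw [hQρ]
    refine Finset.sum_eq_zero fun s _ => mul_eq_zero_of_right _ ?_
    by_contra hne
    refine hρ ((hx.spans s).mono fun σ hσ => ?_)
    obtain ⟨i, -, rfl⟩ := Finset.mem_image.1 hσ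
    exact Finset.mem_filter.2 ⟨Finset.mem_univ _, Finset.prod_ne_zero_iff.1 hne i (Finset.mem_univ _)⟩
  have h1 : ∀ ρ : Fin 4 → Fin X.k, Function.Injective ρ → X.SpansCone (Finset.univ.image ρ) →
      Q (fun i => X.toricDivisor (ρ i)) = L := by
    intro ρ hinj hsp
    rw [hQρ, ← hx.prod_eq _ ⟨hsp, by rw [Finset.card_image_of_injective _ hinj]; simp⟩]
    refine Finset.sum_congr rfl fun s _ => ?_
    rw [Finset.prod_image fun _ _ _ _ h => hinj h]
  -- The form `Q` takes the values 0 and `L` on the products that determine it. Modulo `L` it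
  -- vanishes by the moving argument, so `Q / L` is integral on all classes.
  have hdvd : ∀ D, (L : ℤ) ∣ Q D := by
    have hz : (Int.castAddHom (ZMod L)).toIntLinearMap.compMultilinearMap Q = 0 := by
      refine hX.form_eq_zero fun ρ hρ => ?_
      change ((Q (fun i => X.toricDivisor (ρ i)) : ℤ) : ZMod L) = 0
      by_cases hsp : X.SpansCone (Finset.univ.image ρ)
      · rw [h1 ρ (hρ.resolve_right (not_not.2 hsp)) hsp]
        simp
      · rw [h0 ρ hsp, Int.cast_zero]
    intro D
    rw [← ZMod.intCast_zmod_eq_zero_iff_dvd]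
    exact congrArg (fun f => f D) hz
  choose d hd using hdvd
  have hL : (L : ℤ) ≠ 0 := by exact_mod_cast hx.pos
  refine ⟨{ toFun := d, map_update_add' := fun {inst} D i E F => ?_, map_update_smul' := fun {inst} D i c E => ?_ },
    fun ρ => ⟨fun hinj hsp => ?_, fun hsp => ?_⟩, fun a => ?_⟩
  -- The axioms of a multilinear map quantify over a decidability instance; it is replaced by the
  -- standard one.
  · obtain rfl := Subsingleton.elim inst (instDecidableEqFin 4)
    refine mul_left_cancel₀ hL ?_
    rw [mul_add, ← hd, ← hd, ← hd]
    exact Q.map_update_add D i E F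
  · obtain rfl := Subsingleton.elim inst (instDecidableEqFin 4)
    refine mul_left_cancel₀ hL ?_
    rw [smul_eq_mul, mul_left_comm, ← hd, ← hd]
    exact Q.map_update_smul D i c E
  · refine mul_left_cancel₀ hL ?_
    rw [mul_one]
    exact (hd _).symm.trans (h1 ρ hinj hsp)
  · refine mul_left_cancel₀ hL ?_
    rw [mul_zero]
    exact (hd _).symm.trans (h0 ρ hsp)
  · rw [← hQ]
    exact (hd _).symm

/-- The value of `∑ a_ρ D_ρ` at the fixed points. -/
def val (x : ι → Fin X.k → ℤ) (a : Fin X.k → ℤ) (s : ι) : ℤ := ∑ ρ, a ρ * x s ρ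

/-- The power sums of the weights at the fixed points. -/
def power (x : ι → Fin X.k → ℤ) (n : ℕ) (s : ι) : ℤ := ∑ ρ, x s ρ ^ n

omit hx [Fintype ι] in
theorem val_single (ρ : Fin X.k) (s : ι) : val x (Pi.single ρ 1) s = x s ρ := by
  simp [val, Pi.single_apply]

theorem intersectionForm_cls (hX : X.IsSmoothFan) (s₀ : ι) (a b c e : Fin X.k → ℤ) :
    L * X.intersectionForm ![X.cls a, X.cls b, X.cls c, X.cls e]
      = ∑ s, w s * (val x a s * val x b s * val x c s * val x e s) := by
  obtain ⟨d, hd, h⟩ := hx.exists_form hX s₀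
  have h1 := h ![a, b, c, e]
  have h2 : (fun i => X.cls (![a, b, c, e] i)) = ![X.cls a, X.cls b, X.cls c, X.cls e] := by
    ext i; fin_cases i <;> rfl
  rw [h2] at h1
  rw [hX.intersectionForm_eq hd, h1]
  refine Finset.sum_congr rfl fun s _ => ?_
  rw [Fin.prod_univ_four]
  rfl

omit hx [Fintype ι] in
theorem normalBundle_eq_cls : X.normalBundle = X.cls fun _ => 1 := by
  rw [cls_eq_sum]; simp [normalBundle]

theorem triple_cls (hX : X.IsSmoothFan) (s₀ : ι) (a b c : Fin X.k → ℤ) :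
    L * X.triple (X.cls a) (X.cls b) (X.cls c)
      = ∑ s, w s * (val x a s * val x b s * val x c s * power x 1 s) := by
  rw [triple, normalBundle_eq_cls, hx.intersectionForm_cls hX s₀]
  simp [val, power]

omit hx in
-- Newton's identity for the second elementary symmetric function, by splitting off the first
-- variable.
theorem two_mul_sum_Ioi {n : ℕ} (y : Fin n → ℤ) :
    2 * ∑ i, ∑ j ∈ Finset.Ioi i, y i * y j = (∑ i, y i) ^ 2 - ∑ i, y i ^ 2 := by
  induction n with
  | zero => simp
  | succ n ih =>
    rw [Fin.sum_univ_succ, Fin.sum_univ_succ (f := y), Fin.sum_univ_succ (f := fun i => y i ^ 2)]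
    have h := ih fun i => y i.succ
    simp only [Fin.Ioi_zero_eq_map, Fin.Ioi_succ, Finset.sum_map, Fin.coe_succEmb] at h ⊢
    rw [← Finset.mul_sum]
    linarith

omit hx in
theorem six_mul_sum_Ioi {n : ℕ} (y : Fin n → ℤ) :
    6 * ∑ i, ∑ j ∈ Finset.Ioi i, ∑ l ∈ Finset.Ioi j, y i * y j * y l
      = (∑ i, y i) ^ 3 - 3 * (∑ i, y i) * (∑ i, y i ^ 2) + 2 * ∑ i, y i ^ 3 := by
  induction n with
  | zero => simp
  | succ n ih =>
    rw [Fin.sum_univ_succ, Fin.sum_univ_succ (f := y), Fin.sum_univ_succ (f := fun i => y i ^ 2),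
      Fin.sum_univ_succ (f := fun i => y i ^ 3)]
    have h := ih fun i => y i.succ
    have h2 := two_mul_sum_Ioi fun i => y i.succ
    simp only [Fin.Ioi_zero_eq_map, Fin.Ioi_succ, Finset.sum_map, Fin.coe_succEmb, mul_assoc,
      ← Finset.mul_sum] at h h2 ⊢
    linear_combination h + 3 * y 0 * h2

/-- At a fixed point `c₂(X)` is the second elementary symmetric function of the weights, `(p₁² - p₂)
/ 2` in power sums; the further factor `p₁` is the class of `X`. -/
theorem two_mul_c₂ (hX : X.IsSmoothFan) (s₀ : ι) (a : Fin X.k → ℤ) :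
    2 * (L * X.c₂ (X.cls a))
      = ∑ s, w s * (val x a s * power x 1 s * (power x 1 s ^ 2 - power x 2 s)) := by
  have h : ∀ s, power x 1 s ^ 2 - power x 2 s
      = 2 * ∑ ρ, ∑ σ ∈ Finset.Ioi ρ, x s ρ * x s σ := fun s => by
    rw [two_mul_sum_Ioi]; simp [power]
  simp only [c₂, toricDivisor, Finset.mul_sum, hx.triple_cls hX s₀, h, val_single]
  rw [Finset.sum_comm (s := (Finset.univ : Finset ι))]
  refine Finset.sum_congr rfl fun ρ _ => ?_
  rw [Finset.sum_comm (s := (Finset.univ : Finset ι))]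
  refine Finset.sum_congr rfl fun σ _ => Finset.sum_congr rfl fun s _ => ?_
  ring

/-- With `6 e₃ = p₁³ - 3 p₁ p₂ + 2 p₃` and `2 e₂ = p₁² - p₂`, the expression `e₃ - e₂ p₁` becomes
`(p₃ - p₁³) / 3`: the terms with `p₂` cancel. -/
theorem three_mul_eulerNumber (hX : X.IsSmoothFan) (s₀ : ι) :
    3 * (L * X.eulerNumber) = ∑ s, w s * (power x 1 s * (power x 3 s - power x 1 s ^ 3)) := by
  have h : ∀ s, power x 1 s ^ 3 - 3 * power x 1 s * power x 2 s + 2 * power x 3 s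
      = 6 * ∑ ρ, ∑ σ ∈ Finset.Ioi ρ, ∑ τ ∈ Finset.Ioi σ, x s ρ * x s σ * x s τ := fun s => by
    rw [six_mul_sum_Ioi]; simp [power]
  have h1 : 6 * (L * ∑ ρ, ∑ σ ∈ Finset.Ioi ρ, ∑ τ ∈ Finset.Ioi σ,
      X.triple (X.toricDivisor ρ) (X.toricDivisor σ) (X.toricDivisor τ))
      = ∑ s, w s * (power x 1 s * (power x 1 s ^ 3 - 3 * power x 1 s * power x 2 s
        + 2 * power x 3 s)) := by
    simp only [toricDivisor, Finset.mul_sum, hx.triple_cls hX s₀, h, val_single]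
    rw [Finset.sum_comm (s := (Finset.univ : Finset ι))]
    refine Finset.sum_congr rfl fun ρ _ => ?_
    rw [Finset.sum_comm (s := (Finset.univ : Finset ι))]
    refine Finset.sum_congr rfl fun σ _ => ?_
    rw [Finset.sum_comm (s := (Finset.univ : Finset ι))]
    refine Finset.sum_congr rfl fun τ _ => Finset.sum_congr rfl fun s _ => ?_
    ring
  have h2 := hx.two_mul_c₂ hX s₀ fun _ => 1
  rw [← normalBundle_eq_cls] at h2
  have h3 : ∀ s, val x (fun _ => 1) s = power x 1 s := fun s => by simp [val, power]
  refine mul_left_cancel₀ (two_ne_zero (α := ℤ)) ?_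
  rw [eulerNumber]
  simp only [h3] at h2
  trans 6 * (L * ∑ ρ, ∑ σ ∈ Finset.Ioi ρ, ∑ τ ∈ Finset.Ioi σ,
      X.triple (X.toricDivisor ρ) (X.toricDivisor σ) (X.toricDivisor τ))
      - 3 * (2 * (L * X.c₂ X.normalBundle))
  · ring
  rw [h1, h2, Finset.mul_sum, Finset.mul_sum, ← Finset.sum_sub_distrib]
  exact Finset.sum_congr rfl fun s _ => by ring

end IsLocalization

end ToricSpace


/-! ## A decidable criterion -/

namespace ToricCheck

/-- Lattice vectors. -/
abbrev Vec : Type := ℤ × ℤ × ℤ × ℤ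

namespace Vec

def add (x y : Vec) : Vec := (x.1 + y.1, x.2.1 + y.2.1, x.2.2.1 + y.2.2.1, x.2.2.2 + y.2.2.2)

def smul (c : ℤ) (x : Vec) : Vec := (c * x.1, c * x.2.1, c * x.2.2.1, c * x.2.2.2)

def dot (x y : Vec) : ℤ := x.1 * y.1 + x.2.1 * y.2.1 + x.2.2.1 * y.2.2.1 + x.2.2.2 * y.2.2.2

def beq (x y : Vec) : Bool :=
  decide (x.1 = y.1) && decide (x.2.1 = y.2.1) && decide (x.2.2.1 = y.2.2.1) &&
    decide (x.2.2.2 = y.2.2.2)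

/-- `dot x (cross p q r)` is the determinant of `x, p, q, r`. -/
def cross (p q r : Vec) : Vec :=
  let m12 := q.1 * r.2.1 - q.2.1 * r.1
  let m13 := q.1 * r.2.2.1 - q.2.2.1 * r.1
  let m14 := q.1 * r.2.2.2 - q.2.2.2 * r.1
  let m23 := q.2.1 * r.2.2.1 - q.2.2.1 * r.2.1
  let m24 := q.2.1 * r.2.2.2 - q.2.2.2 * r.2.1
  let m34 := q.2.2.1 * r.2.2.2 - q.2.2.2 * r.2.2.1
  (p.2.1 * m34 - p.2.2.1 * m24 + p.2.2.2 * m23, -(p.1 * m34 - p.2.2.1 * m14 + p.2.2.2 * m13),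
    p.1 * m24 - p.2.1 * m14 + p.2.2.2 * m12, -(p.1 * m23 - p.2.1 * m13 + p.2.2.1 * m12))

end Vec

/-- The rays of `ToricSpace.ofList L`. -/
def rays (L : List Vec) : List Vec :=
  (1, 0, 0, 0) :: (0, 1, 0, 0) :: (0, 0, 1, 0) :: (0, 0, 0, 1) :: L

def ray (V : List Vec) (i : ℕ) : Vec := V.getD i 0

def sumRays (V : List Vec) (l : List ℕ) : Vec := l.foldr (fun i s => (ray V i).add s) 0

def mem (i : ℕ) (l : List ℕ) : Bool := l.any (Nat.beq i)

def subset (l l' : List ℕ) : Bool := l.all fun i => mem i l'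

def distinct : List ℕ → Bool
  | [] => true
  | a :: l => !mem a l && distinct l

/-- `∑_P v_ρ = ∑_R v_ρ` is a relation of positive degree. -/
def relationOK (V : List Vec) (r : List ℕ × List ℕ) : Bool :=
  distinct r.1 && r.1.all (Nat.blt · V.length) && r.2.all (Nat.blt · V.length) &&
    Nat.blt r.2.length r.1.length && (sumRays V r.1).beq (sumRays V r.2)

/-- The set of the elements of a list as a binary number. -/
def mask (l : List ℕ) : ℕ := l.foldr (fun i m => Nat.lor (Nat.pow 2 i) m) 0

def maskLE (m n : ℕ) : Bool := Nat.beq (Nat.land m n) m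

/-- Every set that agrees with `s` on the numbers `≥ n` contains a set in `Ps` or is contained in
a set in `Cs`. -/
def cover (Ps Cs : List ℕ) : ℕ → ℕ → Bool
  | 0, s => Ps.any (maskLE · s) || Cs.any (maskLE s)
  | n + 1, s => Ps.any (maskLE · s) || (cover Ps Cs n s && cover Ps Cs n (Nat.lor (Nat.pow 2 n) s))

/-- All four-element sets of numbers `< k` that do not contain a set in `Ps`. -/
def fourSets (k : ℕ) (Ps : List ℕ) : List (List ℕ) :=
  (List.range k).flatMap fun d => (List.range d).flatMap fun c => (List.range c).flatMap fun b =>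
    (List.range b).flatMap fun a =>
      bif Ps.any (maskLE · (mask [a, b, c, d])) then [] else [[a, b, c, d]]

/-- A maximal cone, with the coordinates of `ξ` with respect to its rays. -/
structure Cone where
  idx : List ℕ
  coord : List ℤ

def Cone.coefAux : List ℕ → List ℤ → ℕ → ℤ
  | a :: l, x :: m, i => bif Nat.beq a i then x else coefAux l m i
  | _, _, _ => 0

/-- The coordinate of `ξ` for the ray `i`. -/
def Cone.coef (c : Cone) (i : ℕ) : ℤ := coefAux c.idx c.coord i

/-- Coordinates of `ξ` by Cramer's rule. For a smooth cone the determinant `e` is `±1`, so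
multiplication by `e` replaces division; nothing is assumed here, since `coneOK` tests the result.
-/
def mkCone (V : List Vec) (ξ : Vec) : List ℕ → Cone
  | [a, b, c, d] =>
    let p := ray V a
    let q := ray V b
    let r := ray V c
    let s := ray V d
    let x := Vec.cross q r s
    let e := Vec.dot p x
    ⟨[a, b, c, d], [e * Vec.dot ξ x, -(e * Vec.dot ξ (Vec.cross p r s)),
      e * Vec.dot ξ (Vec.cross p q s), -(e * Vec.dot ξ (Vec.cross p q r))]⟩
  | _ => ⟨[], []⟩

def allLE (m : Vec) (V : List Vec) : Bool := V.all fun v => decide (-1 ≤ m.dot v)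

/-- The four rays are a basis of the lattice, they lie on a facet, and `coord` has the required
property. -/
def coneOK (V : List Vec) (ξ : Vec) (K : Cone) : Bool :=
  match K.idx with
  | [a, b, c, d] =>
    let p := ray V a
    let q := ray V b
    let r := ray V c
    let s := ray V d
    let x := Vec.cross q r s
    let y := Vec.cross p r s
    let z := Vec.cross p q s
    let t := Vec.cross p q r
    let e := Vec.dot p x
    distinct K.idx && K.idx.all (Nat.blt · V.length) && decide (e * e = 1) &&
      allLE (Vec.smul e ((t.add y).add (Vec.smul (-1) (x.add z)))) V &&
      match K.coord with
      | [k, l, m, n] =>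
        ((Vec.smul k p).add ((Vec.smul l q).add ((Vec.smul m r).add (Vec.smul n s)))).beq ξ
      | _ => false
  | _ => false

/-- No cone in the list contains a later one. -/
def conesDistinct : List Cone → Bool
  | [] => true
  | K :: l => l.all (fun K' => !subset K'.idx K.idx) && conesDistinct l

def prodZ (l : List ℤ) : ℤ := l.foldr (· * ·) 1

def sumZ (l : List ℤ) : ℤ := l.foldr (· + ·) 0

/-- A common multiple of the products of coordinates, so that the quotients in `weight` are exact.
-/
def level (Ks : List Cone) : ℕ := Ks.foldr (fun K m => Nat.lcm (prodZ K.coord).natAbs m) 1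

def weight (lev : ℕ) (K : Cone) : ℤ := (lev : ℤ) / prodZ K.coord

/-- The values of the toric divisors at the fixed points, with a factor. -/
def state (k lev : ℕ) (Ks : List Cone) : List (ℤ × List ℤ) :=
  Ks.map fun K => (weight lev K, (List.range k).map K.coef)

/-- Multiply the weights by the first column, and then also by the other columns. -/
def vanishAux (f : ℕ → List (ℤ × List ℤ) → Bool) : ℕ → List (ℤ × List ℤ) → Bool
  | 0, _ => true
  | n + 1, st =>
    f (n + 1) ((st.filter fun s => !decide (s.2.headD 0 = 0)).map
      fun s => (s.1 * s.2.headD 0, s.2)) &&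
    vanishAux f n (st.map fun s => (s.1, s.2.tail))

/-- All sums of products of `d` of the first `n` columns, with weights, are zero. -/
def vanish : ℕ → ℕ → List (ℤ × List ℤ) → Bool
  | 0 => fun _ st => decide (sumZ (st.map Prod.fst) = 0)
  | d + 1 => vanishAux (vanish d)

/-- The value of a relation on a divisor. -/
def relVal (r : List ℕ × List ℕ) (a : List ℤ) : ℤ :=
  sumZ (r.1.map (a.getD · 0)) - sumZ (r.2.map (a.getD · 0))

/-- Data for a toric space: the primitive relations, a one-parameter group, and nef divisors. In the
simplicial case also the intersection numbers, the second Chern class, a bound for the search, the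
Euler number, the factors of a product of projective spaces, the permutations of its factors, and
the numbers of monads. -/
structure Cert where
  rel : List (List ℕ × List ℕ)
  ξ : Vec
  nef : List (List ℤ)
  D : List (List (List ℕ))
  S : List ℕ
  b : ℕ
  χ : ℤ
  φ : List ℕ
  G : List (List ℕ)
  total : ℕ
  three : ℕ
  strong : ℕ

def Cert.cones (c : Cert) (V : List Vec) : List Cone :=
  (fourSets V.length (c.rel.map fun r => mask r.1)).map (mkCone V c.ξ)

def fanOK (V : List Vec) (c : Cert) (Ks : List Cone) : Bool :=
  c.rel.all (relationOK V) &&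
  cover (c.rel.map fun r => mask r.1) (Ks.map fun K => mask K.idx) V.length 0 &&
  Ks.all (coneOK V c.ξ) &&
  c.rel.all (fun r => Ks.any fun K => subset r.2 K.idx)

/-- Since the level is nonzero, the test of the weights also shows that no coordinate of `ξ` is zero
with respect to any maximal cone. -/
def locOK (V : List Vec) (c : Cert) (Ks : List Cone) (lev : ℕ) : Bool :=
  !c.ξ.beq 0 && conesDistinct Ks && !Nat.beq lev 0 &&
  Ks.all (fun K => decide (weight lev K * prodZ K.coord = lev)) &&
  vanish 3 V.length (state V.length lev Ks)

/-- The first four rays are the standard basis, so every class has a representative without the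
first four divisors; the certificate stores the remaining coefficients. -/
def divisors (c : Cert) : List (List ℤ) := c.nef.map ([0, 0, 0, 0] ++ ·)

/-- The first relations are dual to the divisors in `nef`, and the latter are nef with ample sum. -/
def frameOK (h : ℕ) (c : Cert) : Bool :=
  Nat.beq c.nef.length h &&
  (List.range h).all (fun i => (List.range h).all fun j =>
    decide (relVal (c.rel.getD i ([], [])) ((divisors c).getD j []) = bif Nat.beq i j then 1 else 0)) &&
  c.rel.all (fun r => (divisors c).all (fun a => decide (0 ≤ relVal r a)) &&
    decide (0 < sumZ ((divisors c).map (relVal r))))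

/-- There are more than `h` facets. -/
def notSimpleOK (h : ℕ) (c : Cert) : Bool :=
  Nat.blt h c.nef.length &&
  (List.range c.nef.length).all (fun i => decide (relVal (c.rel.getD i ([], [])) ((divisors c).getD i []) = 0)
    && Nat.blt i c.rel.length) &&
  c.rel.all fun r => (List.range c.nef.length).all fun i =>
    decide (0 ≤ relVal r ((divisors c).getD i [])) && (List.range i).all fun j =>
      decide (0 < relVal r ((divisors c).getD i []) + relVal r ((divisors c).getD j []))

def dotZ (x y : List ℤ) : ℤ := sumZ (List.zipWith (· * ·) x y)

def powerL (n : ℕ) (K : Cone) : ℤ := sumZ (K.coord.map (· ^ n))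

/-- The values of the nef divisors at a fixed point. -/
def nefVals (c : Cert) (k : ℕ) (K : Cone) : List ℤ :=
  (divisors c).map fun a => dotZ a ((List.range k).map K.coef)

/-- The intersection number `∫ J_a J_b J_r`. -/
def entry (D : List (List (List ℕ))) (a b r : ℕ) : ℕ := ((D.getD r []).getD b []).getD a 0

def symmOK (h : ℕ) (D : List (List (List ℕ))) : Bool :=
  (List.range h).all fun r => (List.range h).all fun b => (List.range h).all fun a =>
    Nat.beq (entry D a b r) (entry D b a r) && Nat.beq (entry D a b r) (entry D a r b)

/-- The intersection numbers and the second Chern class. -/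
def numbersOK (k h : ℕ) (c : Cert) (Ks : List Cone) (lev : ℕ) : Bool :=
  let st := Ks.map fun K => (weight lev K * powerL 1 K, powerL 1 K ^ 2 - powerL 2 K, nefVals c k K)
  Nat.beq c.D.length h && Nat.beq c.S.length h && symmOK h c.D &&
  (List.range h).all fun r =>
    let st1 := st.map fun s => (s.1 * s.2.2.getD r 0, s.2)
    decide (sumZ (st1.map fun s => s.1 * s.2.1) = lev * (c.S.getD r 0 : ℕ)) &&
    (List.range (r + 1)).all fun b =>
      let st2 := st1.map fun s => (s.1 * s.2.2.getD b 0, s.2.2)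
      (List.range (b + 1)).all fun a =>
        decide (sumZ (st2.map fun s => s.1 * s.2.getD a 0) = lev * (entry c.D a b r : ℕ))

end ToricCheck


/-! ## Soundness of the criterion: fans -/

namespace ToricCheck

open ToricSpace

namespace Vec

/-- A lattice vector as a function. -/
def toFun (v : Vec) : Fin 4 → ℤ := ![v.1, v.2.1, v.2.2.1, v.2.2.2]

/-- A lattice vector as a linear form. -/
def toDual (m : Vec) : Module.Dual ℤ (Fin 4 → ℤ) where
  toFun x := m.1 * x 0 + m.2.1 * x 1 + m.2.2.1 * x 2 + m.2.2.2 * x 3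
  map_add' x y := by simp only [Pi.add_apply]; ring
  map_smul' c x := by simp only [Pi.smul_apply, smul_eq_mul, RingHom.id_apply]; ring

theorem toDual_toFun (m v : Vec) : m.toDual v.toFun = m.dot v := rfl

theorem toFun_add (x y : Vec) : (x.add y).toFun = x.toFun + y.toFun := by
  ext i; fin_cases i <;> rfl

theorem toFun_smul (c : ℤ) (x : Vec) : (x.smul c).toFun = c • x.toFun := by
  ext i; fin_cases i <;> rfl

theorem toFun_zero : (0 : Vec).toFun = 0 := by
  ext i; fin_cases i <;> rfl

theorem eq_of_beq {x y : Vec} (h : x.beq y = true) : x = y := by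
  simp only [beq, Bool.and_eq_true, decide_eq_true_eq] at h
  obtain ⟨⟨⟨h1, h2⟩, h3⟩, h4⟩ := h
  ext1
  · exact h1
  ext1
  · exact h2
  ext1
  · exact h3
  · exact h4

theorem toFun_ne_zero {x : Vec} (h : (!x.beq 0) = true) : x.toFun ≠ 0 := by
  intro h0
  have e0 : x.1 = 0 := congrFun h0 0
  have e1 : x.2.1 = 0 := congrFun h0 1
  have e2 : x.2.2.1 = 0 := congrFun h0 2
  have e3 : x.2.2.2 = 0 := congrFun h0 3
  simp [beq, e0, e1, e2, e3] at h

end Vec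

section Lists

theorem mem_iff {i : ℕ} {l : List ℕ} : mem i l = true ↔ i ∈ l := by
  simp only [mem, List.any_eq_true, Nat.beq_eq]
  exact ⟨fun ⟨x, hx, h⟩ => h ▸ hx, fun h => ⟨i, h, rfl⟩⟩

theorem subset_iff {l l' : List ℕ} : subset l l' = true ↔ ∀ i ∈ l, i ∈ l' := by
  simp [subset, List.all_eq_true, mem_iff]

theorem distinct_iff {l : List ℕ} : distinct l = true ↔ l.Nodup := by
  induction l with
  | nil => simp [distinct]
  | cons a l ih =>
    rw [distinct, Bool.and_eq_true, ih, List.nodup_cons, Bool.not_eq_true', ← Bool.not_eq_true,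
      mem_iff]

theorem testBit_mask {l : List ℕ} {i : ℕ} : (mask l).testBit i = true ↔ i ∈ l := by
  induction l with
  | nil => simp [mask]
  | cons a l ih =>
    change (2 ^ a ||| mask l).testBit i = true ↔ _
    rw [Nat.testBit_or, Bool.or_eq_true, ih, Nat.testBit_two_pow, decide_eq_true_eq,
      List.mem_cons, eq_comm]

theorem maskLE_testBit {m n : ℕ} (h : maskLE m n = true) {i : ℕ} (hi : m.testBit i = true) :
    n.testBit i = true := by
  have h1 : m &&& n = m := Nat.eq_of_beq_eq_true h
  rw [← h1, Nat.testBit_and, Bool.and_eq_true] at hi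
  exact hi.2

/-- A binary decision tree over the rays: the bits from `n` on are decided and agree with `t`. A
branch closes early when the part already chosen contains a forbidden set. -/
theorem cover_sound {Ps Cs : List ℕ} {n s : ℕ} (h : cover Ps Cs n s = true) (t : Set ℕ)
    (h1 : ∀ i, s.testBit i = true → i ∈ t) (h2 : ∀ i ∈ t, n ≤ i → s.testBit i = true) :
    (∃ P ∈ Ps, ∀ i, P.testBit i = true → i ∈ t) ∨
      ∃ C ∈ Cs, ∀ i ∈ t, C.testBit i = true := by
  have key : ∀ s, Ps.any (maskLE · s) = true → (∀ i, s.testBit i = true → i ∈ t) →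
      ∃ P ∈ Ps, ∀ i, P.testBit i = true → i ∈ t := by
    intro s hs h1
    obtain ⟨P, hP, hle⟩ := List.any_eq_true.1 hs
    exact ⟨P, hP, fun i hi => h1 i (maskLE_testBit hle hi)⟩
  induction n generalizing s with
  | zero =>
    rw [cover, Bool.or_eq_true] at h
    refine h.imp (fun h => key s h h1) fun h => ?_
    obtain ⟨C, hC, hle⟩ := List.any_eq_true.1 h
    exact ⟨C, hC, fun i hi => maskLE_testBit hle (h2 i hi (Nat.zero_le _))⟩
  | succ n ih =>
    rw [cover, Bool.or_eq_true, Bool.and_eq_true] at h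
    rcases h with h | ⟨h3, h4⟩
    · exact Or.inl (key s h h1)
    by_cases hn : n ∈ t
    · have hbit : ∀ i, (Nat.lor (Nat.pow 2 n) s).testBit i = true ↔ n = i ∨ s.testBit i = true := by
        intro i
        change (2 ^ n ||| s).testBit i = true ↔ _
        rw [Nat.testBit_or, Bool.or_eq_true, Nat.testBit_two_pow, decide_eq_true_eq]
      refine ih h4 (fun i hi => ?_) fun i hi hle => ?_
      · rcases (hbit i).1 hi with rfl | hi
        · exact hn
        · exact h1 i hi
      · rw [hbit]
        rcases hle.eq_or_lt with h | h
        · exact Or.inl h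
        · exact Or.inr (h2 i hi h)
    · refine ih h3 h1 fun i hi hle => h2 i hi ?_
      rcases hle.eq_or_lt with h | h
      · exact (hn (h ▸ hi)).elim
      · exact h

theorem sumZ_eq (l : List ℤ) : sumZ l = l.sum := by
  induction l with
  | nil => rfl
  | cons a l ih => rw [List.sum_cons, ← ih]; rfl

theorem prodZ_eq (l : List ℤ) : prodZ l = l.prod := by
  induction l with
  | nil => rfl
  | cons a l ih => rw [List.prod_cons, ← ih]; rfl

theorem sumRays_eq (V : List Vec) (l : List ℕ) :
    (sumRays V l).toFun = (l.map fun i => (ray V i).toFun).sum := by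
  induction l with
  | nil => exact Vec.toFun_zero
  | cons a l ih => rw [List.map_cons, List.sum_cons, ← ih, ← Vec.toFun_add]; rfl

end Lists

variable {L : List Vec}

theorem length_rays : (rays L).length = (ofList L).k :=
  Nat.add_comm L.length 4

theorem v_ofList (ρ : Fin (ofList L).k) : (ofList L).v ρ = (ray (rays L) ρ).toFun := by
  have hv : (ofList L).v = (Fin.append (fun i => Pi.single i 1)
    (fun j => (L.get j).toFun) : Fin (4 + L.length) → Fin 4 → ℤ) := rfl
  rw [hv]
  change Fin (4 + L.length) at ρ
  refine Fin.addCases (fun i => ?_) (fun j => ?_) ρ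
  · rw [Fin.append_left]
    fin_cases i <;> (ext j; fin_cases j <;> rfl)
  · rw [Fin.append_right]
    have : ray (rays L) (Fin.natAdd 4 j) = L.get j := by
      rw [ray, Fin.val_natAdd, Nat.add_comm]
      simp [rays]
    rw [this]

/-- The set of rays with indices in a list. -/
def raySet (L : List Vec) (l : List ℕ) : Finset (Fin (ofList L).k) :=
  Finset.univ.filter fun ρ => ρ.val ∈ l

theorem mem_raySet {l : List ℕ} {ρ : Fin (ofList L).k} : ρ ∈ raySet L l ↔ ρ.val ∈ l := by
  simp [raySet]

theorem map_val_raySet {l : List ℕ} (hl : l.Nodup) (hk : ∀ i ∈ l, i < (ofList L).k) :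
    (raySet L l).val.map Fin.val = (l : Multiset ℕ) := by
  refine Multiset.Nodup.ext ?_ ?_ |>.2 fun i => ?_
  · exact (raySet L l).nodup.map Fin.val_injective
  · simpa using hl
  · rw [Multiset.mem_map, Multiset.mem_coe]
    constructor
    · rintro ⟨ρ, hρ, rfl⟩
      exact mem_raySet.1 hρ
    · exact fun hi => ⟨⟨i, hk i hi⟩, mem_raySet.2 hi, rfl⟩

theorem exists_relation {r : List ℕ × List ℕ} (h : relationOK (rays L) r = true) :
    ∃ R : (ofList L).Relation, R.P.map Fin.val = (r.1 : Multiset ℕ) ∧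
      R.R.map Fin.val = (r.2 : Multiset ℕ) := by
  simp only [relationOK, Bool.and_eq_true, List.all_eq_true, Nat.blt_eq, length_rays,
    distinct_iff] at h
  obtain ⟨⟨⟨⟨h1, h2⟩, h3⟩, h4⟩, h5⟩ := h
  have hlist : ∀ l : List ℕ, (∀ i ∈ l, i < (ofList L).k) →
      ∃ m : Multiset (Fin (ofList L).k), m.map Fin.val = (l : Multiset ℕ) := by
    intro l hl
    refine ⟨((l.attach.map fun i => (⟨i.1, hl i.1 i.2⟩ : Fin (ofList L).k)) : List _), ?_⟩
    simp [Multiset.map_coe, List.map_map, Function.comp_def]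
  obtain ⟨P, hP⟩ := hlist r.1 h2
  obtain ⟨R, hR⟩ := hlist r.2 h3
  have hsum : ∀ {l : List ℕ} {m : Multiset (Fin (ofList L).k)},
      m.map Fin.val = (l : Multiset ℕ) → (m.map (ofList L).v).sum = (sumRays (rays L) l).toFun := by
    intro l m hm
    rw [sumRays_eq, ← Multiset.sum_coe, ← Multiset.map_coe, ← hm, Multiset.map_map]
    exact congrArg _ (Multiset.map_congr rfl fun ρ _ => v_ofList ρ)
  refine ⟨⟨P, R, ?_, ?_, ?_⟩, hP, hR⟩
  · refine Multiset.Nodup.of_map Fin.val ?_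
    rw [hP]
    simpa using h1
  · have e1 := congrArg Multiset.card hP
    have e2 := congrArg Multiset.card hR
    simp only [Multiset.card_map, Multiset.coe_card] at e1 e2
    omega
  · rw [hsum hP, hsum hR, Vec.eq_of_beq h5]

/-- The relations in a list. -/
def relSet (L : List Vec) (l : List (List ℕ × List ℕ)) : Set (ofList L).Relation :=
  {R | ∃ r ∈ l, R.P.map Fin.val = (r.1 : Multiset ℕ) ∧ R.R.map Fin.val = (r.2 : Multiset ℕ)}

theorem dot_cross (p q r : Vec) : Vec.dot p (Vec.cross p q r) = 0 ∧
    Vec.dot q (Vec.cross p q r) = 0 ∧ Vec.dot r (Vec.cross p q r) = 0 := by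
  simp only [Vec.dot, Vec.cross]
  refine ⟨?_, ?_, ?_⟩ <;> ring

/-- Up to sign all four cofactors give the same determinant; together with `dot_cross` they form the
dual basis when it is `±1`. -/
theorem dot_cross_eq (p q r s : Vec) :
    Vec.dot q (Vec.cross p r s) = -Vec.dot p (Vec.cross q r s) ∧
    Vec.dot r (Vec.cross p q s) = Vec.dot p (Vec.cross q r s) ∧
    Vec.dot s (Vec.cross p q r) = -Vec.dot p (Vec.cross q r s) := by
  simp only [Vec.dot, Vec.cross]
  refine ⟨?_, ?_, ?_⟩ <;> ring

theorem dot_comm (x y : Vec) : x.dot y = y.dot x := by simp only [Vec.dot]; ring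

theorem dot_add (x y z : Vec) : (x.add y).dot z = x.dot z + y.dot z := by
  simp only [Vec.dot, Vec.add]; ring

theorem dot_smul (c : ℤ) (x z : Vec) : (x.smul c).dot z = c * x.dot z := by
  simp only [Vec.dot, Vec.smul]; ring

/-- What `coneOK` says. -/
structure Cone.Good (L : List Vec) (ξ : Vec) (K : Cone) : Prop where
  nodup : K.idx.Nodup
  lt : ∀ i ∈ K.idx, i < (ofList L).k
  length_idx : K.idx.length = 4
  length_coord : K.coord.length = 4
  dual : ∃ u : ℕ → Vec, ∀ i ∈ K.idx, ∀ j ∈ K.idx,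
    (u i).dot (ray (rays L) j) = if i = j then 1 else 0
  spans : ∃ m : Vec, (∀ ρ : Fin (ofList L).k, -1 ≤ m.dot (ray (rays L) ρ)) ∧
    ∀ i ∈ K.idx, m.dot (ray (rays L) i) = -1
  sum_eq : ((K.idx.zip K.coord).map fun p => p.2 • (ray (rays L) p.1).toFun).sum = ξ.toFun

theorem coneOK_sound {ξ : Vec} {K : Cone} (h : coneOK (rays L) ξ K = true) : K.Good L ξ := by
  obtain ⟨idx, coord⟩ := K
  rw [coneOK] at h
  match idx, coord with
  | [a, b, c, d], [k, l, m, n] =>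
    simp only [Bool.and_eq_true, decide_eq_true_eq, distinct_iff] at h
    obtain ⟨⟨⟨⟨h1, h2⟩, h3⟩, h4⟩, h5⟩ := h
    set p := ray (rays L) a with hp
    set q := ray (rays L) b with hq
    set r := ray (rays L) c with hr
    set s := ray (rays L) d with hs
    set e := Vec.dot p (Vec.cross q r s) with he
    have hd := h1
    simp only [List.nodup_cons, List.mem_cons, List.not_mem_nil, or_false, not_or, not_false_eq_true,
      List.nodup_nil, and_true] at hd
    obtain ⟨⟨ab, ac, ad⟩, ⟨bc, bd⟩, cd⟩ := hd
    obtain ⟨x1, x2, x3⟩ := dot_cross q r s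
    obtain ⟨y1, y2, y3⟩ := dot_cross p r s
    obtain ⟨z1, z2, z3⟩ := dot_cross p q s
    obtain ⟨t1, t2, t3⟩ := dot_cross p q r
    obtain ⟨y4, z4, t4⟩ := dot_cross_eq p q r s
    rw [← he] at y4 z4 t4
    rw [dot_comm] at x1 x2 x3 y1 y2 y3 z1 z2 z3 t1 t2 t3 y4 z4 t4 he
    refine ⟨h1, ?_, rfl, rfl, ?_, ?_, ?_⟩
    · simpa only [List.all_eq_true, Nat.blt_eq, length_rays] using h2
    -- The dual basis consists of the cofactor vectors with alternating signs, multiplied by `e`,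
    -- which is its own inverse.
    · refine ⟨fun i => if i = a then (Vec.cross q r s).smul e else if i = b then
        (Vec.cross p r s).smul (-e) else if i = c then (Vec.cross p q s).smul e else
        (Vec.cross p q r).smul (-e), ?_⟩
      have e2 : -e * -e = 1 := by rw [neg_mul_neg, h3]
      simp only [List.mem_cons, List.not_mem_nil, or_false]
      rintro i (rfl | rfl | rfl | rfl) j (rfl | rfl | rfl | rfl) <;>
      simp only [← hp, ← hq, ← hr, ← hs, dot_smul, if_true, if_false, ab, ac, ad, bc, bd, cd,
        Ne.symm ab, Ne.symm ac, Ne.symm ad, Ne.symm bc, Ne.symm bd, Ne.symm cd,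
        x1, x2, x3, y1, y2, y3, z1, z2, z3, t1, t2, t3, y4, z4, t4, ← he, mul_zero, h3, e2]
    -- Minus the sum of the dual basis is the linear form with value -1 on the four rays.
    · refine ⟨Vec.smul e (((Vec.cross p q r).add (Vec.cross p r s)).add
        (Vec.smul (-1) ((Vec.cross q r s).add (Vec.cross p q s)))), fun ρ => ?_, ?_⟩
      · have h6 := List.all_eq_true.1 h4 (ray (rays L) ρ) (by
          rw [ray, List.getD_eq_getElem _ _ (ρ.2.trans_eq length_rays.symm)]
          exact List.getElem_mem _)
        exact of_decide_eq_true h6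
      · simp only [List.mem_cons, List.not_mem_nil, or_false]
        rintro i (rfl | rfl | rfl | rfl) <;>
        simp only [← hp, ← hq, ← hr, ← hs, dot_smul, dot_add, x1, x2, x3, y1, y2, y3, z1, z2, z3,
          t1, t2, t3, y4, z4, t4, ← he] <;> linarith
    · rw [← Vec.eq_of_beq h5]
      simp only [Vec.toFun_add, Vec.toFun_smul]
      simp [← hp, ← hq, ← hr, ← hs]
  | [a, b, c, d], [] => simp at h
  | [a, b, c, d], [_] => simp at h
  | [a, b, c, d], [_, _] => simp at h
  | [a, b, c, d], [_, _, _] => simp at h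
  | [a, b, c, d], _ :: _ :: _ :: _ :: _ :: _ => simp at h
  | [], _ => simp at h
  | [_], _ => simp at h
  | [_, _], _ => simp at h
  | [_, _, _], _ => simp at h
  | _ :: _ :: _ :: _ :: _ :: _, _ => simp at h

/-- The cones in a list. -/
def coneSet (L : List Vec) (Ks : List Cone) : Set (Finset (Fin (ofList L).k)) :=
  {t | ∃ K ∈ Ks, t = raySet L K.idx}

theorem Cone.Good.spansCone {ξ : Vec} {K : Cone} (h : K.Good L ξ) :
    (ofList L).SpansCone (raySet L K.idx) := by
  obtain ⟨m, h1, h2⟩ := h.spans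
  refine ⟨m.toDual, fun ρ => ?_, fun ρ hρ => ?_⟩
  · rw [v_ofList, Vec.toDual_toFun]; exact h1 ρ
  · rw [v_ofList, Vec.toDual_toFun]; exact h2 ρ (mem_raySet.1 hρ)

theorem Cone.Good.card {ξ : Vec} {K : Cone} (h : K.Good L ξ) : (raySet L K.idx).card = 4 := by
  have := congrArg Multiset.card (map_val_raySet (L := L) h.nodup h.lt)
  rw [Multiset.card_map, Multiset.coe_card, h.length_idx] at this
  exact this

theorem fanOK_sound {c : Cert} {Ks : List Cone} (h : fanOK (rays L) c Ks = true) :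
    (ofList L).IsFan (coneSet L Ks) (relSet L c.rel) ∧
      (∀ r ∈ c.rel, relationOK (rays L) r = true) ∧ ∀ K ∈ Ks, K.Good L c.ξ := by
  simp only [fanOK, Bool.and_eq_true, List.all_eq_true] at h
  obtain ⟨⟨⟨h1, h2⟩, h3⟩, h4⟩ := h
  have hgood := fun K hK => coneOK_sound (h3 K hK)
  refine ⟨⟨fun s => ?_, ?_, ?_, ?_, ?_⟩, h1, hgood⟩
  · rcases cover_sound h2 (Fin.val '' (s : Set (Fin (ofList L).k))) (by simp) (by
      rintro _ ⟨ρ, _, rfl⟩ hle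
      rw [length_rays] at hle
      exact absurd ρ.2 (not_lt.2 hle)) with ⟨P, hP, h5⟩ | ⟨C, hC, h5⟩
    · obtain ⟨r, hr, rfl⟩ := List.mem_map.1 hP
      obtain ⟨R, e1, e2⟩ := exists_relation (h1 r hr)
      refine Or.inl ⟨R, ⟨r, hr, e1, e2⟩, fun ρ hρ => ?_⟩
      have hm : ρ.val ∈ r.1 := by
        rw [← Multiset.mem_coe, ← e1]; exact Multiset.mem_map_of_mem _ hρ
      obtain ⟨σ, hσ, h6⟩ := h5 ρ (testBit_mask.2 hm)
      rwa [← Fin.ext h6]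
    · obtain ⟨K, hK, rfl⟩ := List.mem_map.1 hC
      refine Or.inr ⟨_, ⟨K, hK, rfl⟩, fun ρ hρ => mem_raySet.2 (testBit_mask.1 (h5 ρ ⟨ρ, hρ, rfl⟩))⟩
  · rintro _ ⟨K, hK, rfl⟩
    exact (hgood K hK).card
  · rintro _ ⟨K, hK, rfl⟩
    exact (hgood K hK).spansCone
  · rintro _ ⟨K, hK, rfl⟩
    obtain ⟨u, hu⟩ := (hgood K hK).dual
    refine ⟨fun ρ => (u ρ).toDual, fun ρ hρ σ hσ => ?_⟩
    rw [v_ofList, Vec.toDual_toFun, hu ρ (mem_raySet.1 hρ) σ (mem_raySet.1 hσ)]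
    simp [Fin.ext_iff]
  · rintro R ⟨r, hr, e1, e2⟩
    obtain ⟨K, hK, h5⟩ := List.any_eq_true.1 (h4 r hr)
    refine ⟨_, ⟨K, hK, rfl⟩, fun ρ hρ => mem_raySet.2 (subset_iff.1 h5 _ ?_)⟩
    rw [← Multiset.mem_coe, ← e2]
    exact Multiset.mem_map_of_mem _ hρ

end ToricCheck


/-! ## Soundness of the criterion: localization -/

namespace ToricCheck

open ToricSpace

theorem beq_eq_false {a i : ℕ} (h : a ≠ i) : Nat.beq a i = false := by
  rw [← Bool.not_eq_true, Nat.beq_eq]; exact h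

theorem map_coefAux {M : Type*} (g : ℕ → ℤ → M) {l : List ℕ} {m : List ℤ} (hl : l.Nodup)
    (hm : l.length = m.length) :
    l.map (fun i => g i (Cone.coefAux l m i)) = (l.zip m).map fun p => g p.1 p.2 := by
  induction l generalizing m with
  | nil => rfl
  | cons a l ih =>
    cases m with
    | nil => simp at hm
    | cons x m =>
      rw [List.nodup_cons] at hl
      rw [List.map_cons, List.zip_cons_cons, List.map_cons, ← ih hl.2 (by simpa using hm)]
      congr 1
      · simp [Cone.coefAux]
      · refine List.map_congr_left fun i hi => ?_
        have : a ≠ i := fun h => hl.1 (h ▸ hi)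
        simp only [Cone.coefAux, beq_eq_false this, cond_false]

theorem coefAux_of_notMem {l : List ℕ} {m : List ℤ} {i : ℕ} (h : i ∉ l) :
    Cone.coefAux l m i = 0 := by
  induction l generalizing m with
  | nil => rfl
  | cons a l ih =>
    cases m with
    | nil => rfl
    | cons x m =>
      rw [List.mem_cons, not_or] at h
      rw [Cone.coefAux, beq_eq_false (Ne.symm h.1), cond_false, ih h.2]

variable {L : List Vec}

/-- The coordinates of the one-parameter group at the fixed points. -/
def coords (L : List Vec) (Ks : List Cone) (s : Fin Ks.length) (ρ : Fin (ofList L).k) : ℤ :=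
  Ks[s].coef ρ

/-- The weights of the fixed points. -/
def weights (lev : ℕ) (Ks : List Cone) (s : Fin Ks.length) : ℤ := weight lev Ks[s]

theorem sum_map_fin {M : Type*} [AddCommMonoid M] {α : Type*} (l : List α) (f : α → M) :
    (l.map f).sum = ∑ s : Fin l.length, f l[s] := (Fin.sum_univ_fun_getElem l f).symm

theorem Cone.Good.sum_coef {ξ : Vec} {K : Cone} (h : K.Good L ξ) {M : Type*} [AddCommMonoid M]
    (g : ℕ → ℤ → M) (hg : ∀ i, g i 0 = 0) :
    ∑ ρ : Fin (ofList L).k, g ρ (K.coef ρ) = ((K.idx.zip K.coord).map fun p => g p.1 p.2).sum := by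
  rw [← map_coefAux g h.nodup (h.length_idx.trans h.length_coord.symm), ← Multiset.sum_coe,
    ← Multiset.map_coe, ← map_val_raySet (L := L) h.nodup h.lt, Multiset.map_map]
  refine (Finset.sum_subset (Finset.subset_univ (raySet L K.idx)) fun ρ _ hρ => ?_).symm
  rw [Cone.coef, coefAux_of_notMem fun h => hρ (mem_raySet.2 h), hg]

theorem Cone.Good.prod_coef {ξ : Vec} {K : Cone} (h : K.Good L ξ) :
    ∏ ρ ∈ raySet L K.idx, K.coef ρ = prodZ K.coord := by
  have h1 := map_coefAux (fun _ x => x) h.nodup (h.length_idx.trans h.length_coord.symm)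
  have h2 : (K.idx.zip K.coord).map (fun p => p.2) = K.coord :=
    List.map_snd_zip (by rw [h.length_idx, h.length_coord])
  rw [h2] at h1
  rw [prodZ_eq]
  conv_rhs => rw [← h1]
  rw [← Multiset.prod_coe, ← Multiset.map_coe, ← map_val_raySet (L := L) h.nodup h.lt,
    Multiset.map_map]
  rfl

/-- Rays outside the cone have coordinate 0; with exponent 0 they would contribute 1 each. -/
theorem Cone.Good.power_eq {ξ : Vec} {K : Cone} (h : K.Good L ξ) {n : ℕ} (hn : n ≠ 0) :
    ∑ ρ : Fin (ofList L).k, K.coef ρ ^ n = powerL n K := by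
  rw [h.sum_coef (fun _ x => x ^ n) (by simp [hn]), powerL, sumZ_eq]
  have h2 : (K.idx.zip K.coord).map (fun p => p.2) = K.coord :=
    List.map_snd_zip (by rw [h.length_idx, h.length_coord])
  conv_rhs => rw [← h2, List.map_map]
  rfl

theorem headD_eq_getD (l : List ℤ) : l.headD 0 = l.getD 0 0 := by cases l <;> rfl

theorem getD_tail (l : List ℤ) (i : ℕ) : l.tail.getD i 0 = l.getD (i + 1) 0 := by
  cases l <;> simp

/-- A monomial either contains the first column, which is then multiplied into the weights, or it is
a monomial in the other columns, with indices shifted by one. Fixed points where the first column is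
zero are dropped, as they contribute nothing. -/
theorem vanish_sound {d n : ℕ} {st : List (ℤ × List ℤ)} (h : vanish d n st = true)
    {idx : Multiset ℕ} (hd : idx.card = d) (hn : ∀ i ∈ idx, i < n) :
    (st.map fun s => s.1 * (idx.map (s.2.getD · 0)).prod).sum = 0 := by
  induction d generalizing n st idx with
  | zero =>
    obtain rfl := Multiset.card_eq_zero.1 hd
    have := of_decide_eq_true h
    rw [sumZ_eq] at this
    simpa using this
  | succ d ih =>
    change vanishAux (vanish d) n st = true at h
    induction n generalizing st idx with
    | zero =>
      obtain ⟨i, hi⟩ := Multiset.card_pos_iff_exists_mem.1 (by omega : 0 < idx.card)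
      exact absurd (hn i hi) (Nat.not_lt_zero i)
    | succ n ihn =>
      rw [vanishAux, Bool.and_eq_true] at h
      by_cases h0 : 0 ∈ idx
      · obtain ⟨idx', rfl⟩ := Multiset.exists_cons_of_mem h0
        have := ih h.1 (idx := idx') (by simpa using hd)
          fun i hi => hn i (Multiset.mem_cons_of_mem hi)
        rw [List.map_map] at this
        refine Eq.trans ?_ this
        clear this h ihn
        induction st with
        | nil => rfl
        | cons s st ihs =>
          rw [List.map_cons, List.sum_cons, ihs, List.filter_cons, headD_eq_getD]
          by_cases hs : s.2.getD 0 0 = 0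
          · simp only [Multiset.map_cons, Multiset.prod_cons, hs, zero_mul, mul_zero, zero_add,
              decide_true, Bool.not_true, Bool.false_eq_true, if_false]
          · simp only [Multiset.map_cons, Multiset.prod_cons, hs, decide_false, Bool.not_false,
              if_true, List.map_cons, List.sum_cons, Function.comp_apply, headD_eq_getD, mul_assoc]
      · have h1 : idx = (idx.map Nat.pred).map Nat.succ := by
          rw [Multiset.map_map]
          conv_lhs => rw [← Multiset.map_id idx]
          refine Multiset.map_congr rfl fun i hi => ?_
          have : i ≠ 0 := fun h => h0 (h ▸ hi)
          simp only [id, Function.comp_apply]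
          exact (Nat.succ_pred this).symm
        have := ihn (idx := idx.map Nat.pred) (by simpa using hd) (by
          intro i hi
          obtain ⟨j, hj, rfl⟩ := Multiset.mem_map.1 hi
          have := hn j hj
          have : j ≠ 0 := fun h => h0 (h ▸ hj)
          exact (Nat.pred_lt_pred this (hn j hj))) h.2
        rw [h1]
        simpa only [List.map_map, Function.comp_def, getD_tail, Multiset.map_map,
          Nat.succ_eq_add_one] using this

theorem conesDistinct_sound {Ks : List Cone} (h : conesDistinct Ks = true) :
    Ks.Pairwise fun K K' => ¬ ∀ i ∈ K'.idx, i ∈ K.idx := by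
  induction Ks with
  | nil => exact List.Pairwise.nil
  | cons K l ih =>
    rw [conesDistinct, Bool.and_eq_true, List.all_eq_true] at h
    refine List.Pairwise.cons (fun K' hK' hsub => ?_) (ih h.2)
    have := h.1 K' hK'
    rw [Bool.not_eq_true', ← Bool.not_eq_true, subset_iff] at this
    exact this hsub

/-- Since the coordinates at a fixed point vanish off its cone, a product over a maximal cone is
nonzero at the fixed point of that cone only. Its weight is by construction the level divided by
this product. -/
theorem locOK_sound {c : Cert} {Ks : List Cone} {lev : ℕ} (hgood : ∀ K ∈ Ks, K.Good L c.ξ)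
    (hfan : (ofList L).IsFan (coneSet L Ks) (relSet L c.rel))
    (h : locOK (rays L) c Ks lev = true) :
    (ofList L).IsLocalization (coords L Ks) (weights lev Ks) lev c.ξ.toFun := by
  simp only [locOK, Bool.and_eq_true, List.all_eq_true, decide_eq_true_eq] at h
  obtain ⟨⟨⟨⟨h1, h2⟩, h3⟩, h4⟩, h5⟩ := h
  have hlev : lev ≠ 0 := by
    rintro rfl
    simp at h3
  have hmem : ∀ s : Fin Ks.length, Ks[s] ∈ Ks := fun s => List.getElem_mem _
  refine ⟨hlev, Vec.toFun_ne_zero h1, fun s => ?_, fun s => ?_, ?_, fun ρ σ τ => ?_⟩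
  · have hK := hgood _ (hmem s)
    rw [← hK.sum_eq, ← hK.sum_coef (fun i x => x • (ray (rays L) i).toFun) (by simp)]
    exact Finset.sum_congr rfl fun ρ _ => by rw [v_ofList]; rfl
  · refine (hgood _ (hmem s)).spansCone.mono fun ρ hρ => mem_raySet.2 ?_
    by_contra hcon
    exact (Finset.mem_filter.1 hρ).2 (coefAux_of_notMem hcon)
  · intro σ hσ
    obtain ⟨K, hK, rfl⟩ := hfan.isMaximalCone_iff.1 hσ
    obtain ⟨t, ht, rfl⟩ := List.getElem_of_mem hK
    rw [Finset.sum_eq_single ⟨t, ht⟩]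
    · change weight lev Ks[t] * ∏ ρ ∈ raySet L Ks[t].idx, Ks[t].coef ρ = lev
      rw [(hgood _ hK).prod_coef, h4 _ hK]
    · intro s _ hne
      refine mul_eq_zero_of_right _ ?_
      by_contra hprod
      -- A nonzero product puts one four-element cone inside another, so they have the same rays,
      -- against the distinctness of the listed cones.
      have hsub : raySet L Ks[t].idx ⊆ raySet L Ks[s].idx := by
        intro ρ hρ
        refine mem_raySet.2 ?_
        by_contra hcon
        exact Finset.prod_ne_zero_iff.1 hprod ρ hρ (coefAux_of_notMem hcon)
      have heq : raySet L Ks[t].idx = raySet L Ks[s].idx :=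
        Finset.eq_of_subset_of_card_le hsub
          (by rw [(hgood _ hK).card, (hgood _ (hmem s)).card])
      have hpair := List.pairwise_iff_getElem.1 (conesDistinct_sound h2)
      have hidx : ∀ i, i ∈ Ks[t].idx ↔ i ∈ Ks[s].idx := by
        intro i
        constructor
        · intro hi
          have h6 : (⟨i, (hgood _ hK).lt i hi⟩ : Fin (ofList L).k) ∈ raySet L Ks[t].idx :=
            mem_raySet.2 hi
          rw [heq] at h6
          exact mem_raySet.1 h6
        · intro hi
          have h6 : (⟨i, (hgood _ (hmem s)).lt i hi⟩ : Fin (ofList L).k) ∈ raySet L Ks[s].idx :=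
            mem_raySet.2 hi
          rw [← heq] at h6
          exact mem_raySet.1 h6
      rcases lt_trichotomy s.val t with hlt | heq' | hlt
      · exact hpair s t s.2 ht hlt fun i hi => (hidx i).1 hi
      · exact hne (Fin.ext heq')
      · exact hpair t s ht s.2 hlt fun i hi => (hidx i).2 hi
    · simp
  · have := vanish_sound h5 (idx := {ρ.val, σ.val, τ.val}) rfl (by
      simp only [Multiset.insert_eq_cons, Multiset.mem_cons, Multiset.mem_singleton, length_rays]
      rintro i (rfl | rfl | rfl)
      exacts [ρ.2, σ.2, τ.2])
    rw [state, List.map_map, sum_map_fin] at this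
    refine Eq.trans (Finset.sum_congr rfl fun s _ => ?_) this
    have hget : ∀ (K : Cone) (i : Fin (ofList L).k),
        ((List.range (rays L).length).map K.coef).getD i 0 = K.coef i := by
      intro K i
      have : i.val < (rays L).length := i.2.trans_eq length_rays.symm
      rw [List.getD_eq_getElem _ _ (by simpa using this)]
      simp
    simp only [Function.comp_apply, Multiset.insert_eq_cons, Multiset.map_cons,
      Multiset.prod_cons, Multiset.map_singleton, Multiset.prod_singleton, hget]
    rw [mul_assoc (coords L Ks s ρ)]
    rfl

end ToricCheck


/-! ## Coordinates on the Picard group -/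

namespace ToricSpace

/-- Coordinates on the Picard group of a space with a simplicial nef cone, in which the nef classes
are those with nonnegative coordinates. The triple intersection numbers and the values of the second
Chern class are given by `d` and `S`. -/
structure NefFrame (X : ToricSpace) {h : ℕ} (d : Fin h → Fin h → Fin h → ℕ) (S : Fin h → ℕ)
    (n : Fin h → ℤ) where
  coord : X.Pic ≃ₗ[ℤ] (Fin h → ℤ)
  isNef_iff : ∀ D, X.IsNef D ↔ ∀ r, 0 ≤ coord D r
  isAmple_iff : ∀ D, X.IsAmple D ↔ ∀ r, 1 ≤ coord D r
  triple_eq : ∀ D E F, X.triple D E F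
    = ∑ r, ∑ b, ∑ a, (d a b r : ℤ) * (coord E a * coord F b * coord D r)
  c₂_eq : ∀ D, 2 * X.c₂ D = ∑ r, (S r : ℤ) * coord D r
  normal : coord X.normalBundle = n

end ToricSpace

namespace ToricCheck

open ToricSpace

variable {L : List Vec}

/-- The conditions that are needed for all spaces. -/
structure Checked (L : List Vec) (c : Cert) (Ks : List Cone) (lev : ℕ) : Prop where
  fan : (ofList L).IsFan (coneSet L Ks) (relSet L c.rel)
  rel : ∀ r ∈ c.rel, relationOK (rays L) r = true
  good : ∀ K ∈ Ks, K.Good L c.ξ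
  loc : (ofList L).IsLocalization (coords L Ks) (weights lev Ks) lev c.ξ.toFun

theorem checked_of {c : Cert} {Ks : List Cone} {lev : ℕ} (h1 : fanOK (rays L) c Ks = true)
    (h2 : locOK (rays L) c Ks lev = true) : Checked L c Ks lev := by
  obtain ⟨hfan, hrel, hgood⟩ := fanOK_sound h1
  exact ⟨hfan, hrel, hgood, locOK_sound hgood hfan h2⟩

/-- A list as a divisor. -/
def divisor (L : List Vec) (a : List ℤ) (ρ : Fin (ofList L).k) : ℤ := a.getD ρ 0

theorem functional_divisor {r : List ℕ × List ℕ} {R : (ofList L).Relation}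
    (h1 : R.P.map Fin.val = (r.1 : Multiset ℕ)) (h2 : R.R.map Fin.val = (r.2 : Multiset ℕ))
    (a : List ℤ) : R.functional ((ofList L).cls (divisor L a)) = relVal r a := by
  have : ∀ {m : Multiset (Fin (ofList L).k)} {l : List ℕ}, m.map Fin.val = (l : Multiset ℕ) →
      (m.map (divisor L a)).sum = sumZ (l.map (a.getD · 0)) := by
    intro m l h
    rw [sumZ_eq, ← Multiset.sum_coe, ← Multiset.map_coe, ← h, Multiset.map_map]
    rfl
  rw [R.functional_cls, this h1, this h2, relVal]

theorem functional_normalBundle {r : List ℕ × List ℕ} {R : (ofList L).Relation}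
    (h1 : R.P.map Fin.val = (r.1 : Multiset ℕ)) (h2 : R.R.map Fin.val = (r.2 : Multiset ℕ)) :
    R.functional (ofList L).normalBundle = (r.1.length : ℤ) - r.2.length := by
  have : ∀ {m : Multiset (Fin (ofList L).k)} {l : List ℕ}, m.map Fin.val = (l : Multiset ℕ) →
      (m.map (fun _ => (1 : ℤ))).sum = l.length := by
    intro m l h
    have := congrArg Multiset.card h
    simp only [Multiset.card_map, Multiset.coe_card] at this
    simp [this]
  rw [IsLocalization.normalBundle_eq_cls, R.functional_cls, this h1, this h2]

/-- The first four rays are a basis of the lattice, so the coefficients of their divisors can be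
removed by linear equivalence. -/
theorem exists_eq_sum_toricDivisor (D : (ofList L).Pic) : ∃ z : Fin L.length → ℤ,
    D = ∑ j, z j • (ofList L).toricDivisor (Fin.natAdd 4 j) := by
  obtain ⟨a, rfl⟩ := exists_cls D
  let m : Module.Dual ℤ (Fin 4 → ℤ) := ∑ i : Fin 4, a (Fin.castAdd L.length i) • LinearMap.proj i
  have hm : ∀ i : Fin 4, m ((ofList L).v (Fin.castAdd L.length i)) = a (Fin.castAdd L.length i) := by
    intro i
    have hv : (ofList L).v (Fin.castAdd L.length i) = Pi.single i 1 :=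
      Fin.append_left (m := 4) (fun i => Pi.single i 1) (fun j : Fin L.length => (L.get j).toFun) i
    rw [hv]
    simp [m, LinearMap.sum_apply, Pi.single_apply]
  have hcls : (ofList L).cls a = (ofList L).cls fun ρ => a ρ + (-m) ((ofList L).v ρ) :=
    cls_eq_cls_iff.2 ⟨m, fun ρ => by simp⟩
  refine ⟨fun j => a (Fin.natAdd 4 j) + (-m) ((ofList L).v (Fin.natAdd 4 j)), ?_⟩
  rw [hcls, cls_eq_sum]
  refine (Fin.sum_univ_add (a := 4) (b := L.length) _).trans ?_
  rw [Finset.sum_eq_zero, zero_add]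
  intro i _
  rw [LinearMap.neg_apply, hm, add_neg_cancel, zero_smul]

namespace Checked

variable {c : Cert} {Ks : List Cone} {lev : ℕ} (hc : Checked L c Ks lev)
include hc

theorem nonempty : Nonempty (Fin Ks.length) := by
  rcases hc.fan.cover ∅ with ⟨R, _, hR⟩ | ⟨t, ⟨K, hK, _⟩, _⟩
  · have h := R.card_lt
    obtain ⟨ρ, hρ⟩ := Multiset.card_pos_iff_exists_mem.1 (by omega : 0 < R.P.card)
    exact absurd (hR ρ hρ) (by simp)
  · exact ⟨⟨0, List.length_pos_of_mem hK⟩⟩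

theorem existsUnique_form : ∃! d, (ofList L).IsIntersectionForm d := by
  obtain ⟨s₀⟩ := hc.nonempty
  obtain ⟨d, hd, -⟩ := hc.loc.exists_form hc.fan.isSmoothFan s₀
  exact ⟨d, hd, fun d' hd' => hc.fan.isSmoothFan.form_unique hd' hd⟩

theorem exists_rel {r : List ℕ × List ℕ} (hr : r ∈ c.rel) :
    ∃ R ∈ relSet L c.rel, R.P.map Fin.val = (r.1 : Multiset ℕ) ∧
      R.R.map Fin.val = (r.2 : Multiset ℕ) := by
  obtain ⟨R, h1, h2⟩ := exists_relation (hc.rel r hr)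
  exact ⟨R, ⟨r, hr, h1, h2⟩, h1, h2⟩

theorem power_eq {n : ℕ} (hn : n ≠ 0) (s : Fin Ks.length) :
    IsLocalization.power (coords L Ks) n s = powerL n Ks[s] :=
  (hc.good _ (List.getElem_mem _)).power_eq hn

/-- The Euler number as a sum over the fixed points. -/
theorem three_mul_eulerNumber : 3 * (lev * (ofList L).eulerNumber)
    = sumZ (Ks.map fun K => weight lev K * (powerL 1 K * (powerL 3 K - powerL 1 K ^ 3))) := by
  obtain ⟨s₀⟩ := hc.nonempty
  rw [hc.loc.three_mul_eulerNumber hc.fan.isSmoothFan s₀, sumZ_eq, sum_map_fin]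
  refine Finset.sum_congr rfl fun s _ => ?_
  rw [hc.power_eq one_ne_zero, hc.power_eq three_ne_zero]
  rfl

end Checked

theorem dotZ_eq (a x : List ℤ) :
    dotZ a x = ∑ i ∈ Finset.range x.length, a.getD i 0 * x.getD i 0 := by
  rw [dotZ, sumZ_eq]
  induction x generalizing a with
  | nil => cases a <;> rfl
  | cons x l ih =>
    cases a with
    | nil => simp
    | cons b a =>
      rw [List.zipWith_cons_cons, List.sum_cons, ih, List.length_cons, Finset.sum_range_succ']
      simp [add_comm]

theorem val_divisor {Ks : List Cone} (a : List ℤ) (s : Fin Ks.length) :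
    IsLocalization.val (coords L Ks) (divisor L a) s
      = dotZ a ((List.range (rays L).length).map Ks[s].coef) := by
  rw [dotZ_eq, List.length_map, List.length_range, length_rays, IsLocalization.val,
    Finset.sum_range]
  refine Finset.sum_congr rfl fun ρ _ => ?_
  rw [List.getD_eq_getElem ((List.range (ofList L).k).map Ks[s].coef) 0 (by simp : ρ.val < _)]
  simp [divisor, coords]

/-- The two transpositions generate the symmetric group on three letters, so symmetric functions are
compared on sorted indices only. -/
theorem eq_of_sorted {M : Type*} {f g : ℕ → ℕ → ℕ → M} {h : ℕ}
    (f1 : ∀ a b r, f a b r = f b a r) (f2 : ∀ a b r, f a b r = f a r b)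
    (g1 : ∀ a < h, ∀ b < h, ∀ r < h, g a b r = g b a r)
    (g2 : ∀ a < h, ∀ b < h, ∀ r < h, g a b r = g a r b)
    (hfg : ∀ r < h, ∀ b ≤ r, ∀ a ≤ b, f a b r = g a b r) {a b r : ℕ} (ha : a < h) (hb : b < h)
    (hr : r < h) : f a b r = g a b r := by
  rcases le_total a b with h1 | h1 <;> rcases le_total b r with h2 | h2 <;>
    rcases le_total a r with h3 | h3
  · exact hfg r hr b h2 a h1
  · exact hfg r hr b h2 a h1
  · rw [f2, g2 a ha b hb r hr]; exact hfg b hb r h2 a h3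
  · rw [f2, f1, g2 a ha b hb r hr, g1 a ha r hr b hb]; exact hfg b hb a h1 r h3
  · rw [f1, g1 a ha b hb r hr]; exact hfg r hr a h3 b h1
  · rw [f1, f2, g1 a ha b hb r hr, g2 b hb a ha r hr]; exact hfg a ha r h3 b h2
  · rw [f1, f2, f1, g1 a ha b hb r hr, g2 b hb a ha r hr, g1 b hb r hr a ha]
    exact hfg a ha b h1 r h2
  · rw [f1, f2, f1, g1 a ha b hb r hr, g2 b hb a ha r hr, g1 b hb r hr a ha]
    exact hfg a ha b h1 r h2

theorem numbersOK_sound {c : Cert} {Ks : List Cone} {h k lev : ℕ}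
    (hn : numbersOK k h c Ks lev = true) : c.D.length = h ∧ c.S.length = h ∧
    (∀ r < h, (Ks.map fun K => weight lev K * ((nefVals c k K).getD r 0 *
      (powerL 1 K * (powerL 1 K ^ 2 - powerL 2 K)))).sum = lev * (c.S.getD r 0 : ℤ)) ∧
    ∀ a < h, ∀ b < h, ∀ r < h, (Ks.map fun K => weight lev K * powerL 1 K *
      ((nefVals c k K).getD a 0 * (nefVals c k K).getD b 0 * (nefVals c k K).getD r 0)).sum
        = lev * (entry c.D a b r : ℤ) := by
  simp only [numbersOK, symmOK, Bool.and_eq_true, List.all_eq_true, List.mem_range, Nat.beq_eq,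
    decide_eq_true_eq, List.map_map, sumZ_eq] at hn
  obtain ⟨⟨⟨h1, h2⟩, h3⟩, h4⟩ := hn
  refine ⟨h1, h2, fun r hr => ?_, fun a ha b hb r hr => ?_⟩
  · rw [← (h4 r hr).1]
    refine congrArg _ (List.map_congr_left fun K _ => ?_)
    simp only [Function.comp_apply]
    ring
  · refine eq_of_sorted (f := fun a b r => (Ks.map fun K => weight lev K * powerL 1 K *
      ((nefVals c k K).getD a 0 * (nefVals c k K).getD b 0 * (nefVals c k K).getD r 0)).sum)
      (g := fun a b r => lev * (entry c.D a b r : ℤ)) (fun a b r => ?_) (fun a b r => ?_)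
      (fun a ha b hb r hr => ?_) (fun a ha b hb r hr => ?_) (fun r hr b hb a hab => ?_) ha hb hr
    · refine congrArg _ (List.map_congr_left fun K _ => ?_)
      ring
    · refine congrArg _ (List.map_congr_left fun K _ => ?_)
      ring
    · rw [(h3 r hr b hb a ha).1]
    · rw [(h3 r hr b hb a ha).2]
    · rw [← (h4 r hr).2 b (by omega) a (by omega)]
      refine congrArg _ (List.map_congr_left fun K _ => ?_)
      simp only [Function.comp_apply]
      ring

/-- The coordinates of the normal bundle. -/
def normalL (c : Cert) (r : ℕ) : ℤ :=
  ((c.rel.getD r ([], [])).1.length : ℤ) - (c.rel.getD r ([], [])).2.length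

theorem cls_sum_smul {X : ToricSpace} {h : ℕ} (y : Fin h → ℤ) (a : Fin h → Fin X.k → ℤ) :
    X.cls (∑ r, y r • a r) = ∑ r, y r • X.cls (a r) := by
  change Submodule.mkQ (LinearMap.range X.alpha) _ = _
  rw [map_sum]
  exact Finset.sum_congr rfl fun r _ => map_smul _ _ _

theorem val_sum_smul {k : ℕ} {ι : Type*} {h : ℕ} (x : ι → Fin k → ℤ) (y : Fin h → ℤ)
    (a : Fin h → Fin k → ℤ) (s : ι) :
    ∑ ρ, (∑ r, y r • a r) ρ * x s ρ = ∑ r, y r * ∑ ρ, a r ρ * x s ρ := by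
  simp only [Finset.sum_apply, Finset.sum_mul, Finset.mul_sum, Pi.smul_apply, smul_eq_mul]
  rw [Finset.sum_comm]
  exact Finset.sum_congr rfl fun r _ => Finset.sum_congr rfl fun ρ _ => mul_assoc _ _ _

/-- The functionals of the first `h` relations and the divisors of the certificate are dual to each
other, so they give coordinates. Each relation is nonnegative on the divisors and positive on their
sum. Hence nonnegative coordinates suffice for nefness, and coordinates at least 1 for ampleness.
The numbers `d` and `S` are the localization sums at the basis, extended by linearity. -/
theorem Checked.exists_frame {c : Cert} {Ks : List Cone} {lev : ℕ} (hc : Checked L c Ks lev)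
    (hf : frameOK L.length c = true)
    (hn : numbersOK (rays L).length L.length c Ks lev = true) :
    (ofList L).IsSimple ∧ ∃ F : (ofList L).NefFrame (MonadSearch.form L.length c.D)
      (MonadSearch.vec L.length c.S) (fun r => normalL c r), ∀ j : Fin L.length,
        F.coord ((ofList L).cls (divisor L ((divisors c).getD j []))) = Pi.single j 1 := by
  simp only [frameOK, Bool.and_eq_true, List.all_eq_true, List.mem_range, decide_eq_true_eq,
    Nat.beq_eq] at hf
  obtain ⟨⟨hlen, hdual⟩, hnef⟩ := hf
  set X := ofList L with hX
  set h := L.length with hh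
  have hdlen : (divisors c).length = h := by simp [divisors, hlen]
  have hmem : ∀ j < h, (divisors c).getD j [] ∈ divisors c := by
    intro j hj
    rw [List.getD_eq_getElem _ _ (by omega)]
    exact List.getElem_mem _
  have hrel : ∀ i : Fin h, c.rel.getD i ([], []) ∈ c.rel := by
    intro i
    by_cases hi : i.val < c.rel.length
    · rw [List.getD_eq_getElem _ _ hi]
      exact List.getElem_mem _
    -- An index out of range would give the empty relation, whose value 0 contradicts the diagonal
    -- entry 1.
    · have h1 := hdual i i.2 i i.2
      rw [List.getD_eq_default _ _ (by omega)] at h1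
      simp [relVal, sumZ] at h1
  choose K hK K1 K2 using fun i : Fin h => hc.exists_rel (hrel i)
  set row : Fin h → Fin X.k → ℤ := fun j => divisor L ((divisors c).getD j []) with hrow
  set J : Fin h → X.Pic := fun j => X.cls (row j) with hJ
  have hKJ : ∀ i j, (K i).functional (J j) = if i = j then 1 else 0 := by
    intro i j
    rw [hJ]
    simp only [hrow]
    rw [functional_divisor (K1 i) (K2 i), hdual i i.2 j j.2]
    by_cases hij : i = j
    · simp [hij]
    · rw [if_neg hij, beq_eq_false fun h => hij (Fin.ext h), cond_false]
  set κ : X.Pic →ₗ[ℤ] (Fin h → ℤ) := LinearMap.pi fun i => (K i).functional with hκ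
  set φ : (Fin h → ℤ) →ₗ[ℤ] X.Pic := Fintype.linearCombination ℤ J with hφ
  have hφa : ∀ y, φ y = ∑ r, y r • J r := fun y => Fintype.linearCombination_apply _ _ _
  have hκφ : ∀ y, κ (φ y) = y := by
    intro y
    ext i
    rw [hφa, map_sum, Finset.sum_apply, Finset.sum_eq_single i]
    · rw [map_smul, Pi.smul_apply, hκ, LinearMap.pi_apply, hKJ, if_pos rfl, smul_eq_mul, mul_one]
    · intro j _ hji
      rw [map_smul, Pi.smul_apply, hκ, LinearMap.pi_apply, hKJ, if_neg (Ne.symm hji), smul_zero]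
    · simp
  have hκs : Function.Surjective κ := fun y => ⟨φ y, hκφ y⟩
  -- The Picard group is a quotient of `ℤ^h`. The composite with `κ` is a surjective endomorphism of
  -- a finitely generated module, hence injective, and so is `κ`.
  have hκi : Function.Injective κ := by
    set π : (Fin h → ℤ) →ₗ[ℤ] X.Pic :=
      Fintype.linearCombination ℤ fun j => X.toricDivisor (Fin.natAdd 4 j) with hπ
    have hπs : Function.Surjective π := by
      intro D
      obtain ⟨z, hz⟩ := exists_eq_sum_toricDivisor D
      exact ⟨z, by rw [hz, hπ, Fintype.linearCombination_apply]⟩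
    have hinj : Function.Injective (κ ∘ₗ π) :=
      OrzechProperty.injective_of_surjective_endomorphism _ (hκs.comp hπs)
    intro D E hDE
    obtain ⟨y, rfl⟩ := hπs D
    obtain ⟨z, rfl⟩ := hπs E
    rw [hinj hDE]
  have hφκ : ∀ D, D = φ (κ D) := fun D => hκi (hκφ (κ D)).symm
  have hval : ∀ D, ∀ R : X.Relation, R.functional D = ∑ r, κ D r * R.functional (J r) := by
    intro D R
    conv_lhs => rw [hφκ D, hφa, map_sum]
    exact Finset.sum_congr rfl fun r _ => by rw [map_smul, smul_eq_mul]
  have hRJ : ∀ R ∈ relSet L c.rel, (∀ j, 0 ≤ R.functional (J j)) ∧ 0 < ∑ j, R.functional (J j) := by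
    rintro R ⟨r, hr, h1, h2⟩
    obtain ⟨n1, n2⟩ := hnef r hr
    have h3 : ∀ j, R.functional (J j) = relVal r ((divisors c).getD j []) := fun j =>
      functional_divisor h1 h2 _
    refine ⟨fun j => by rw [h3]; exact n1 _ (hmem j j.2), ?_⟩
    simp only [h3]
    rw [sumZ_eq, sum_map_fin] at n2
    refine n2.trans_eq ?_
    refine Fintype.sum_equiv (finCongr hdlen) _ _ fun j => ?_
    rw [List.getD_eq_getElem _ _ (by simp)]
    simp
  have hNef : ∀ D, X.IsNef D ↔ ∀ r, 0 ≤ κ D r := by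
    intro D
    rw [hc.fan.isNef_iff]
    refine ⟨fun h1 i => h1 _ (hK i), fun h1 R hR => ?_⟩
    rw [hval]
    exact Finset.sum_nonneg fun r _ => mul_nonneg (h1 r) ((hRJ R hR).1 r)
  have hAmple : ∀ D, X.IsAmple D ↔ ∀ r, 1 ≤ κ D r := by
    intro D
    rw [hc.fan.isAmple_iff]
    refine ⟨fun h1 i => h1 _ (hK i), fun h1 R hR => ?_⟩
    rw [hval]
    refine (hRJ R hR).2.trans_le (Finset.sum_le_sum fun r _ => ?_)
    exact le_mul_of_one_le_left ((hRJ R hR).1 r) (h1 r)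
  obtain ⟨s₀⟩ := hc.nonempty
  have hlev : (lev : ℤ) ≠ 0 := by exact_mod_cast hc.loc.pos
  obtain ⟨-, -, hS, hD⟩ := numbersOK_sound hn
  set v : Fin h → Fin Ks.length → ℤ := fun r s => (nefVals c (rays L).length Ks[s]).getD r 0 with hv
  have hrowval : ∀ r s, IsLocalization.val (coords L Ks) (row r) s = v r s := by
    intro r s
    rw [hrow, val_divisor, hv]
    simp only [nefVals]
    rw [List.getD_eq_getElem _ _ (by rw [hdlen]; exact r.2), List.getD_eq_getElem _ _
      (by rw [List.length_map, hdlen]; exact r.2), List.getElem_map]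
  have hlift : ∀ D, ∃ a, X.cls a = D ∧
      ∀ s, IsLocalization.val (coords L Ks) a s = ∑ r, κ D r * v r s := by
    intro D
    refine ⟨∑ r, κ D r • row r, ?_, fun s => ?_⟩
    · conv_rhs => rw [hφκ D, hφa]
      exact cls_sum_smul _ _
    · rw [IsLocalization.val, val_sum_smul]
      exact Finset.sum_congr rfl fun r _ => by rw [← hrowval]; rfl
  refine ⟨?_, ⟨LinearEquiv.ofBijective κ ⟨hκi, hκs⟩, hNef, hAmple, ?_, ?_, ?_⟩, fun j => ?_⟩
  · have hk : X.k - 4 = h := Nat.add_sub_cancel_left 4 L.length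
    refine ⟨fun r => (K (Fin.cast hk r)).functional, fun D => (hNef D).trans ?_⟩
    exact ⟨fun h1 r => h1 _, fun h1 r => h1 (Fin.cast hk.symm r)⟩
  · intro D E F
    obtain ⟨a, ha, ha'⟩ := hlift D
    obtain ⟨b, hb, hb'⟩ := hlift E
    obtain ⟨e, he, he'⟩ := hlift F
    refine mul_left_cancel₀ hlev ?_
    rw [← ha, ← hb, ← he, hc.loc.triple_cls hc.fan.isSmoothFan s₀, ha, hb, he]
    simp only [ha', hb', he', hc.power_eq one_ne_zero]
    change _ = (lev : ℤ) * ∑ r, ∑ b, ∑ a, _ * (κ E a * κ F b * κ D r)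
    have h1 : ∀ s, weights lev Ks s * ((∑ r, κ D r * v r s) * (∑ r, κ E r * v r s)
        * (∑ r, κ F r * v r s) * powerL 1 Ks[s]) = ∑ r, ∑ b, ∑ a,
          (κ E a * κ F b * κ D r) * (weight lev Ks[s] * powerL 1 Ks[s] * (v a s * v b s * v r s)) := by
      intro s
      have h2 : ∀ x y z w p : ℤ, w * (x * y * z * p) = x * (z * (y * (w * p))) := by
        intros; ring
      rw [h2, Finset.sum_mul]
      refine Finset.sum_congr rfl fun r _ => ?_
      rw [Finset.sum_mul, Finset.mul_sum]
      refine Finset.sum_congr rfl fun b _ => ?_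
      rw [Finset.sum_mul, Finset.mul_sum, Finset.mul_sum]
      refine Finset.sum_congr rfl fun a _ => ?_
      rw [weights]
      ring
    simp only [h1]
    simp only [Finset.mul_sum]
    rw [Finset.sum_comm]
    refine Finset.sum_congr rfl fun r _ => ?_
    rw [Finset.sum_comm]
    refine Finset.sum_congr rfl fun b _ => ?_
    rw [Finset.sum_comm]
    refine Finset.sum_congr rfl fun a _ => ?_
    rw [← Finset.mul_sum]
    have h2 := hD a a.2 b b.2 r r.2
    rw [sum_map_fin] at h2
    have h3 : (MonadSearch.form h c.D a b r : ℤ) = entry c.D a b r := rfl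
    rw [h3, ← mul_assoc, ← h2, mul_comm]
  · intro D
    obtain ⟨a, ha, ha'⟩ := hlift D
    refine mul_left_cancel₀ hlev ?_
    rw [← ha, mul_left_comm, hc.loc.two_mul_c₂ hc.fan.isSmoothFan s₀, ha]
    simp only [ha', hc.power_eq one_ne_zero, hc.power_eq two_ne_zero]
    change _ = (lev : ℤ) * ∑ r, _ * κ D r
    rw [Finset.mul_sum]
    have h1 : ∀ s, weights lev Ks s * ((∑ r, κ D r * v r s) * powerL 1 Ks[s]
        * (powerL 1 Ks[s] ^ 2 - powerL 2 Ks[s])) = ∑ r, κ D r * (weight lev Ks[s] *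
          (v r s * (powerL 1 Ks[s] * (powerL 1 Ks[s] ^ 2 - powerL 2 Ks[s])))) := by
      intro s
      rw [Finset.sum_mul, Finset.sum_mul, Finset.mul_sum]
      refine Finset.sum_congr rfl fun r _ => ?_
      rw [weights]
      ring
    simp only [h1]
    rw [Finset.sum_comm]
    refine Finset.sum_congr rfl fun r _ => ?_
    rw [← Finset.mul_sum]
    have h2 := hS r r.2
    rw [sum_map_fin] at h2
    have h3 : (MonadSearch.vec h c.S r : ℤ) = c.S.getD r 0 := rfl
    rw [h3, ← mul_assoc, ← h2, mul_comm]
  · ext r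
    exact functional_normalBundle (K1 r) (K2 r)
  · ext i
    refine (hKJ i j).trans ?_
    rw [Pi.single_apply]

/-- The `i`-th divisor of the certificate lies on the hyperplane of the `i`-th relation, and the sum
of any two divisors is positive on every relation. So the divisors lie on distinct facets, and there
are too many of them. -/
theorem Checked.not_isSimple {c : Cert} {Ks : List Cone} {lev : ℕ} (hc : Checked L c Ks lev)
    (h : notSimpleOK L.length c = true) : ¬ (ofList L).IsSimple := by
  simp only [notSimpleOK, Bool.and_eq_true, List.all_eq_true, List.mem_range, decide_eq_true_eq,
    Nat.blt_eq] at h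
  obtain ⟨⟨h1, h2⟩, h3⟩ := h
  have hrel : ∀ i : Fin c.nef.length, c.rel.getD i ([], []) ∈ c.rel := by
    intro i
    rw [List.getD_eq_getElem _ _ (h2 i i.2).2]
    exact List.getElem_mem _
  choose K hK K1 K2 using fun i : Fin c.nef.length => hc.exists_rel (hrel i)
  set J : Fin c.nef.length → (ofList L).Pic :=
    fun j => (ofList L).cls (divisor L ((divisors c).getD j [])) with hJ
  have hsym : ∀ f g, f ≠ g → ∀ R ∈ relSet L c.rel, 0 < R.functional (J f) + R.functional (J g) := by
    rintro f g hfg R ⟨r, hr, e1, e2⟩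
    simp only [hJ, functional_divisor e1 e2]
    rcases lt_or_gt_of_ne hfg with hlt | hlt
    · rw [add_comm]
      exact (h3 r hr g g.2).2 f hlt
    · exact (h3 r hr f f.2).2 g hlt
  have hzero : ∀ f, (K f).functional (J f) = 0 := fun f => by
    simp only [hJ, functional_divisor (K1 f) (K2 f)]
    exact (h2 f f.2).1
  refine hc.fan.isSmoothFan.not_isSimple (n := c.nef.length) ?_ J (fun f => (K f).functional) ?_ ?_
    hzero ?_ ?_
  · exact (Nat.add_sub_cancel_left 4 L.length).trans_lt h1
  · intro f
    rw [hc.fan.isNef_iff]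
    rintro R ⟨r, hr, e1, e2⟩
    simp only [hJ, functional_divisor e1 e2]
    exact (h3 r hr f f.2).1
  · exact fun f D hD => hc.fan.functional_nonneg (hK f) hD
  · intro f
    have hpos : 0 < (K f).P.card := (Nat.zero_le _).trans_lt (K f).card_lt
    -- The normal bundle is a witness: its value is `|P| - |R|`, which is positive.
    obtain ⟨a, ha⟩ : ∃ a, 0 < (K f).functional ((ofList L).cls a) :=
      ⟨fun _ => 1, by
        have := (K f).card_lt
        rw [(K f).functional_cls]
        simpa using this⟩
    exact ⟨_, ha⟩
  · intro f g hfg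
    rw [hc.fan.isAmple_iff]
    intro R hR
    rw [map_add]
    exact hsym f g hfg R hR

end ToricCheck


/-! ## Positive monads in coordinates -/

namespace ToricSpace.NefFrame

open LatticeMonad MonadSearch

variable {X : ToricSpace} {h : ℕ} {d : Fin h → Fin h → Fin h → ℕ} {S : Fin h → ℕ} {n : Fin h → ℤ}
  (F : X.NefFrame d S n)

/-- The nef class with given coordinates. -/
noncomputable def nefClass : (Fin h → ℕ) →+ X.Pic where
  toFun y := F.coord.symm fun r => (y r : ℤ)
  map_zero' := by rw [← map_zero F.coord.symm]; rfl
  map_add' y z := by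
    rw [← map_add]; congr 1

theorem coord_nefClass (y : Fin h → ℕ) (r : Fin h) : F.coord (F.nefClass y) r = y r := by
  change F.coord (F.coord.symm _) r = _
  rw [LinearEquiv.apply_symm_apply]

theorem nefClass_injective : Function.Injective F.nefClass := by
  intro y z hyz
  ext r
  have := congrFun (congrArg F.coord hyz) r
  rw [coord_nefClass, coord_nefClass] at this
  exact_mod_cast this

theorem exists_nefClass {D : X.Pic} (hD : ∀ r, 0 ≤ F.coord D r) : ∃ y, F.nefClass y = D := by
  refine ⟨fun r => (F.coord D r).toNat, F.coord.injective ?_⟩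
  ext r
  rw [coord_nefClass, Int.toNat_of_nonneg (hD r)]

theorem isAmple_nefClass {y : Fin h → ℕ} : X.IsAmple (F.nefClass y) ↔ 1 ≤ y := by
  rw [F.isAmple_iff]
  simp only [coord_nefClass]
  exact ⟨fun h r => by exact_mod_cast h r, fun h r => by exact_mod_cast h r⟩

theorem isNef_sub {y z : Fin h → ℕ} : X.IsNef (F.nefClass z - F.nefClass y) ↔ y ≤ z := by
  rw [F.isNef_iff]
  simp only [map_sub, Pi.sub_apply, coord_nefClass, sub_nonneg]
  exact ⟨fun h r => by exact_mod_cast h r, fun h r => by exact_mod_cast h r⟩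

theorem triple_nefClass (D : X.Pic) (y : Fin h → ℕ) :
    X.triple D (F.nefClass y) (F.nefClass y) = ∑ r, F.coord D r * (quad d r y y : ℕ) := by
  rw [F.triple_eq]
  refine Finset.sum_congr rfl fun r _ => ?_
  rw [quad, Finset.sum_comm]
  push_cast
  rw [Finset.mul_sum]
  refine Finset.sum_congr rfl fun a _ => ?_
  rw [Finset.mul_sum]
  refine Finset.sum_congr rfl fun b _ => ?_
  rw [coord_nefClass, coord_nefClass]
  ring

theorem triple_self (y : Fin h → ℕ) :
    X.triple (F.nefClass y) (F.nefClass y) (F.nefClass y) = cube d y := by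
  rw [triple_nefClass, cube]
  push_cast
  exact Finset.sum_congr rfl fun r _ => by rw [coord_nefClass]

/-- The monad with given coordinates. -/
noncomputable def monad (B C : Multiset (Fin h → ℕ)) : X.MonadData :=
  ⟨B.map F.nefClass, C.map F.nefClass⟩

theorem monad_injective {B C B' C' : Multiset (Fin h → ℕ)} (e : F.monad B C = F.monad B' C') :
    B = B' ∧ C = C' := by
  have h1 := congrArg MonadData.B e
  have h2 := congrArg MonadData.C e
  exact ⟨Multiset.map_injective F.nefClass_injective h1,
    Multiset.map_injective F.nefClass_injective h2⟩

theorem sum_triple (D : X.Pic) (B : Multiset (Fin h → ℕ)) :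
    ((B.map F.nefClass).map fun b => X.triple D b b).sum
      = ∑ r, F.coord D r * ((B.map fun b => quad d r b b).sum : ℕ) := by
  induction B using Multiset.induction_on with
  | empty => simp
  | cons b B ih =>
    simp only [Multiset.map_cons, Multiset.sum_cons, ih, triple_nefClass]
    rw [← Finset.sum_add_distrib]
    refine Finset.sum_congr rfl fun r _ => ?_
    push_cast
    ring

theorem sum_cube (B : Multiset (Fin h → ℕ)) :
    ((B.map F.nefClass).map fun b => X.triple b b b).sum = ((B.map (cube d)).sum : ℕ) := by
  induction B using Multiset.induction_on with
  | empty => simp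
  | cons b B ih =>
    simp only [Multiset.map_cons, Multiset.sum_cons, ih, triple_self]
    push_cast
    ring

/-- All conditions become componentwise. The five-brane class has to be tested on the generators of
the nef orthant only, and doubling it removes the denominator of `c₂(V)`. -/
theorem isPositiveMonad_iff {B C : Multiset (Fin h → ℕ)} :
    (F.monad B C).IsPositiveMonad ↔ IsMonad d S B C := by
  have heff : (∀ J, X.IsNef J → 0 ≤ X.c₂ J - (F.monad B C).c₂ J) ↔
      ∀ r, (C.map fun c => quad d r c c).sum ≤ (B.map fun b => quad d r b b).sum + S r := by
    have h1 : ∀ J, 0 ≤ X.c₂ J - (F.monad B C).c₂ J ↔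
        0 ≤ ∑ r, F.coord J r * (((B.map fun b => quad d r b b).sum + S r : ℕ)
          - ((C.map fun c => quad d r c c).sum : ℕ) : ℤ) := by
      intro J
      have h2 : ∑ r, F.coord J r * (((B.map fun b => quad d r b b).sum + S r : ℕ)
          - ((C.map fun c => quad d r c c).sum : ℕ) : ℤ) = 2 * X.c₂ J
          - ((((F.monad B C).C.map fun c => X.triple J c c).sum
            - ((F.monad B C).B.map fun b => X.triple J b b).sum)) := by
        rw [F.c₂_eq]
        simp only [monad]
        rw [sum_triple, sum_triple, ← Finset.sum_sub_distrib, ← Finset.sum_sub_distrib]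
        refine Finset.sum_congr rfl fun r _ => ?_
        push_cast
        ring
      rw [h2, MonadData.c₂, ← Int.cast_nonneg_iff (R := ℚ), ← mul_nonneg_iff_of_pos_left (c := 2) two_pos]
      push_cast
      ring_nf
    simp only [h1]
    constructor
    -- The class of the `r`-th unit vector isolates the `r`-th component.
    · intro h2 r
      have hJ : ∀ r', F.coord (F.nefClass (unit r)) r' = if r' = r then 1 else 0 := fun r' => by
        rw [coord_nefClass]
        change ((Pi.single r 1 : Fin h → ℕ) r' : ℤ) = _
        rw [Pi.single_apply]
        split_ifs <;> rfl
      have h3 := h2 (F.nefClass (unit r)) ((F.isNef_iff _).2 fun r' => by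
        rw [coord_nefClass]; exact Int.natCast_nonneg _)
      simp only [hJ, ite_mul, one_mul, zero_mul, Finset.sum_ite_eq', Finset.mem_univ,
        if_true] at h3
      omega
    · intro h2 J hJ
      refine Finset.sum_nonneg fun r _ => mul_nonneg ((F.isNef_iff J).1 hJ r) ?_
      have := h2 r
      omega
  constructor
  · intro hV
    obtain ⟨N, hN, hcard⟩ := hV.rank
    refine ⟨⟨N, hN, by simpa [monad] using hcard⟩, ?_, ?_, ?_, ?_, ?_, heff.1 hV.effective⟩
    · refine F.nefClass_injective ?_
      rw [map_multiset_sum, map_multiset_sum]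
      exact hV.c₁_eq_zero
    · exact fun b hb => F.isAmple_nefClass.1 (hV.ample_B _ (Multiset.mem_map_of_mem _ hb))
    · exact fun c hc => F.isAmple_nefClass.1 (hV.ample_C _ (Multiset.mem_map_of_mem _ hc))
    · exact fun b hb c hc => F.isNef_sub.1
        (hV.nef_sub _ (Multiset.mem_map_of_mem _ hb) _ (Multiset.mem_map_of_mem _ hc))
    · exact fun b hb c hc e =>
        hV.ne _ (Multiset.mem_map_of_mem _ hb) _ (Multiset.mem_map_of_mem _ hc) (congrArg _ e)
  · intro hm
    obtain ⟨N, hN, hcard⟩ := hm.rank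
    refine ⟨⟨N, hN, by simpa [monad] using hcard⟩, ?_, ?_, ?_, ?_, ?_, heff.2 hm.cost⟩
    · have := congrArg F.nefClass hm.sum_eq
      rwa [map_multiset_sum, map_multiset_sum] at this
    · intro b hb
      obtain ⟨y, hy, rfl⟩ := Multiset.mem_map.1 hb
      exact F.isAmple_nefClass.2 (hm.one_le_B y hy)
    · intro b hb
      obtain ⟨y, hy, rfl⟩ := Multiset.mem_map.1 hb
      exact F.isAmple_nefClass.2 (hm.one_le_C y hy)
    · intro b hb c hc
      obtain ⟨y, hy, rfl⟩ := Multiset.mem_map.1 hb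
      obtain ⟨z, hz, rfl⟩ := Multiset.mem_map.1 hc
      exact F.isNef_sub.2 (hm.le y hy z hz)
    · intro b hb c hc
      obtain ⟨y, hy, rfl⟩ := Multiset.mem_map.1 hb
      obtain ⟨z, hz, rfl⟩ := Multiset.mem_map.1 hc
      exact fun e => hm.ne y hy z hz (F.nefClass_injective e)

theorem exists_monad {V : X.MonadData} (hV : V.IsPositiveMonad) : ∃ B C, F.monad B C = V := by
  have key : ∀ M : Multiset X.Pic, (∀ D ∈ M, X.IsAmple D) → ∃ B : Multiset (Fin h → ℕ), B.map F.nefClass = M := by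
    intro M
    induction M using Multiset.induction_on with
    | empty => exact fun _ => ⟨0, rfl⟩
    | cons D M ih =>
      intro hM
      obtain ⟨B, hB⟩ := ih fun E hE => hM E (Multiset.mem_cons_of_mem hE)
      have h1 := (F.isAmple_iff D).1 (hM D (Multiset.mem_cons_self D M))
      obtain ⟨y, hy⟩ := F.exists_nefClass fun r => zero_le_one.trans (h1 r)
      exact ⟨y ::ₘ B, by rw [Multiset.map_cons, hy, hB]⟩
  obtain ⟨B, hB⟩ := key V.B hV.ample_B
  obtain ⟨C, hC⟩ := key V.C hV.ample_C
  exact ⟨B, C, MonadData.ext hB hC⟩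

/-- The monad with a given code. -/
noncomputable def ofCode (c : Code h) : X.MonadData := F.monad c.B c.C

theorem isPositiveMonad_ofCode {c : Code h} (hc : c.IsValid d S) :
    (F.ofCode c).IsPositiveMonad := F.isPositiveMonad_iff.2 hc.isMonad

theorem exists_code {V : X.MonadData} (hV : V.IsPositiveMonad) :
    ∃ c : Code h, c.IsValid d S ∧ F.ofCode c = V := by
  obtain ⟨B, C, rfl⟩ := F.exists_monad hV
  obtain ⟨h1, h2, h3⟩ := (F.isPositiveMonad_iff.1 hV).encode_spec
  exact ⟨encode B C, h1, by rw [ofCode, h2, h3]⟩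

theorem ofCode_injective {c c' : Code h} (hc : c.IsValid d S) (hc' : c'.IsValid d S)
    (e : F.ofCode c = F.ofCode c') : c = c' := by
  obtain ⟨h1, h2⟩ := F.monad_injective e
  rw [← hc.encode_eq, ← hc'.encode_eq, h1, h2]

theorem six_mul_ind (B C : Multiset (Fin h → ℕ)) : 6 * (F.monad B C).ind
    = (((B.map (cube d)).sum : ℕ) : ℚ) - ((C.map (cube d)).sum : ℕ) := by
  simp only [MonadData.ind, MonadData.c₃, monad, sum_cube]
  generalize (B.map (cube d)).sum = x
  generalize (C.map (cube d)).sum = y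
  push_cast
  ring

end ToricSpace.NefFrame


/-! ## Three-family monads in coordinates -/

namespace ToricSpace

variable {X : ToricSpace}

/-- The integer `t` is six times the index, so `ind(V) = 3k` means `t = 18 k`, and `k` is recovered
by division. -/
theorem MonadData.isThreeFamily_iff {V : X.MonadData} {t : ℤ} (ht : 6 * V.ind = t) :
    V.IsThreeFamily ↔ t ≠ 0 ∧ t % 18 = 0 ∧ X.eulerNumber % (t / 18) = 0 := by
  have key : ∀ k : ℤ, V.ind = 3 * k ↔ t = 18 * k := by
    intro k
    rw [← Int.cast_inj (α := ℚ), ← ht]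
    push_cast
    constructor <;> intro h <;> linarith
  constructor
  · rintro ⟨k, hk, h1, h2⟩
    rw [key] at h1
    subst h1
    rw [Int.mul_ediv_cancel_left _ (by norm_num)]
    exact ⟨by omega, Int.mul_emod_right _ _, Int.emod_eq_zero_of_dvd h2⟩
  · rintro ⟨h0, h1, h2⟩
    have h3 : t = 18 * (t / 18) := by omega
    exact ⟨t / 18, by omega, (key _).2 h3, Int.dvd_of_emod_eq_zero h2⟩

/-- The divisibility conditions for the group orders, in terms of the Euler number `E`, the number
`M = ∫ c₁(𝒩)³` and `c = 2 ∫ c₂(X) c₁(𝒩)`. -/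
def orderOK (E M c n : ℤ) : Bool :=
  decide (E % (2 * n) = 0) && decide ((4 * M + c) % (24 * n) = 0) &&
    decide ((32 * M + 2 * c) % (24 * n) = 0) && decide ((108 * M + 3 * c) % (24 * n) = 0) &&
    decide ((4 * M + 4 * E - 6 * c) % n = 0)

theorem exists_eq_mul_iff {q : ℚ} {a b n : ℤ} (hb : b ≠ 0) (hq : b * q = a) :
    (∃ z : ℤ, q = n * z) ↔ a % (b * n) = 0 := by
  rw [← Int.dvd_iff_emod_eq_zero]
  refine exists_congr fun z => ?_
  rw [← Int.cast_inj (α := ℚ), ← hq]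
  push_cast
  rw [mul_assoc]
  exact ⟨fun h => by rw [h], fun h => mul_left_cancel₀ (by exact_mod_cast hb) h⟩

/-- Factors 2 and 24 clear the denominators of the Euler characteristics; the signature of `𝒩 ⊗ TX`
is already integral in these terms. -/
theorem mem_groupOrders_iff {M c : ℤ} (hM : X.normalCubed = M) (hc : 2 * X.c₂ X.normalBundle = c)
    {n : ℕ} : n ∈ X.groupOrders ↔ 1 < n ∧ orderOK X.eulerNumber M c n = true := by
  subst hM hc
  simp only [groupOrders, Set.mem_ofPred_eq, List.forall_mem_cons, List.not_mem_nil,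
    IsEmpty.forall_iff, implies_true, and_true, orderOK, Bool.and_eq_true, decide_eq_true_eq,
    and_assoc]
  have e1 := exists_eq_mul_iff (q := X.twistedEuler 0 1) (a := X.eulerNumber) (b := 2) (n := n)
    (by norm_num) (by rw [twistedEuler]; push_cast; ring)
  have e2 := exists_eq_mul_iff (q := X.twistedEuler 1 0) (n := n) (b := 24)
    (a := 4 * X.normalCubed + 2 * X.c₂ X.normalBundle)
    (by norm_num) (by rw [twistedEuler]; push_cast; ring)
  have e3 := exists_eq_mul_iff (q := X.twistedEuler 2 0) (n := n) (b := 24)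
    (a := 32 * X.normalCubed + 2 * (2 * X.c₂ X.normalBundle))
    (by norm_num) (by rw [twistedEuler]; push_cast; ring)
  have e4 := exists_eq_mul_iff (q := X.twistedEuler 3 0) (n := n) (b := 24)
    (a := 108 * X.normalCubed + 3 * (2 * X.c₂ X.normalBundle))
    (by norm_num) (by rw [twistedEuler]; push_cast; ring)
  have e5 := exists_eq_mul_iff (q := X.twistedSignature 1 1) (n := n) (b := 1)
    (a := 4 * X.normalCubed + 4 * X.eulerNumber - 6 * (2 * X.c₂ X.normalBundle))
    (by norm_num) (by rw [twistedSignature]; push_cast; ring)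
  rw [one_mul] at e5
  push_cast at e1 e2 e3 e4 e5
  rw [e1, e2, e3, e4, e5]

theorem MonadData.isStrongThreeFamily_iff {V : X.MonadData} {t M c : ℤ} (ht : 6 * V.ind = t)
    (hM : X.normalCubed = M) (hc : 2 * X.c₂ X.normalBundle = c) :
    V.IsStrongThreeFamily ↔ (t ≠ 0 ∧ t % 18 = 0 ∧ X.eulerNumber % (t / 18) = 0) ∧
      1 < (t / 18).natAbs ∧ orderOK X.eulerNumber M c (t / 18).natAbs = true := by
  rw [← mem_groupOrders_iff hM hc, ← isThreeFamily_iff ht]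
  have key : ∀ k : ℤ, V.ind = 3 * k → t / 18 = k := by
    intro k hk
    have : t = 18 * k := by
      rw [← Int.cast_inj (α := ℚ), ← ht, hk]
      push_cast
      ring
    omega
  constructor
  · rintro ⟨k, hk, h1, h2, h3⟩
    rw [key k h1]
    exact ⟨⟨k, hk, h1, h2⟩, h3⟩
  · rintro ⟨⟨k, hk, h1, h2⟩, h3⟩
    rw [key k h1] at h3
    exact ⟨k, hk, h1, h2, h3⟩

end ToricSpace

namespace MonadSearch

/-- The condition for three-family monads, where `χ` is the Euler number. -/
def Entry.three (χ : ℤ) (e : Entry) : Bool :=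
  let t : ℤ := (e.x : ℤ) - e.y
  !decide (t = 0) && decide (t % 18 = 0) && decide (χ % (t / 18) = 0)

/-- The condition for the group order. -/
def Entry.strong (χ M c : ℤ) (e : Entry) : Bool :=
  let t : ℤ := (e.x : ℤ) - e.y
  e.three χ && Nat.blt 1 (t / 18).natAbs && ToricSpace.orderOK χ M c (t / 18).natAbs

end MonadSearch


/-! ## Symmetries of the fan in coordinates -/

namespace ToricSpace

variable {X : ToricSpace}

theorem symmetryOnPic_cls (π : X.fanSymmetries) (a : Fin X.k → ℤ) :
    X.symmetryOnPic π (X.cls a) = X.cls (a ∘ (π : Equiv.Perm (Fin X.k)).symm) := rfl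

theorem symmetryOnPic_toricDivisor (π : X.fanSymmetries) (ρ : Fin X.k) :
    X.symmetryOnPic π (X.toricDivisor ρ) = X.toricDivisor ((π : Equiv.Perm (Fin X.k)) ρ) := by
  rw [toricDivisor, symmetryOnPic_cls, toricDivisor]
  congr 1
  ext σ
  simp only [Function.comp_apply, Pi.single_apply, Equiv.symm_apply_eq]

theorem symmetryOnPic_normalBundle (π : X.fanSymmetries) :
    X.symmetryOnPic π X.normalBundle = X.normalBundle := by
  rw [normalBundle, map_sum]
  simp only [symmetryOnPic_toricDivisor]
  exact Equiv.sum_comp (π : Equiv.Perm (Fin X.k)) X.toricDivisor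

theorem isMaximalCone_map {π : Equiv.Perm (Fin X.k)} (hπ : π ∈ X.fanSymmetries)
    {σ : Finset (Fin X.k)} (hσ : X.IsMaximalCone σ) : X.IsMaximalCone (σ.map π.toEmbedding) := by
  obtain ⟨g, hg⟩ := hπ
  obtain ⟨⟨m, h1, h2⟩, h3⟩ := hσ
  have key : ∀ ρ, m (g.symm (X.v ρ)) = m (X.v (π.symm ρ)) := by
    intro ρ
    congr 1
    rw [LinearEquiv.symm_apply_eq, hg, Equiv.apply_symm_apply]
  refine ⟨⟨m ∘ₗ (g.symm : (Fin 4 → ℤ) →ₗ[ℤ] (Fin 4 → ℤ)), fun ρ => ?_, fun ρ hρ => ?_⟩, ?_⟩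
  · exact (h1 _).trans_eq (key ρ).symm
  · obtain ⟨ρ', hρ', rfl⟩ := Finset.mem_map.1 hρ
    refine (key _).trans (h2 _ ?_)
    simpa using hρ'
  · rw [Finset.card_map, h3]

theorem IsNef.symmetryOnPic {D : X.Pic} (hD : X.IsNef D) (π : X.fanSymmetries) :
    X.IsNef (X.symmetryOnPic π D) := by
  obtain ⟨a, rfl, ha⟩ := hD
  refine ⟨_, (symmetryOnPic_cls π a).symm, fun σ hσ => ?_⟩
  obtain ⟨m, h1, h2⟩ := ha _ (isMaximalCone_map (inv_mem π.2) hσ)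
  obtain ⟨π, g, hg⟩ := π
  have key : ∀ ρ, m (g.symm (X.v ρ)) = m (X.v (π.symm ρ)) := by
    intro ρ
    congr 1
    rw [LinearEquiv.symm_apply_eq, hg, Equiv.apply_symm_apply]
  refine ⟨m ∘ₗ (g.symm : (Fin 4 → ℤ) →ₗ[ℤ] (Fin 4 → ℤ)), fun ρ hρ => ?_, fun ρ => ?_⟩
  · refine (key ρ).trans (h1 _ ?_)
    exact Finset.mem_map.2 ⟨ρ, hρ, rfl⟩
  · exact (h2 _).trans_eq (key ρ).symm

/-- A nonnegative integral matrix with a nonnegative inverse is a permutation matrix. -/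
theorem exists_perm_of_nonneg {h : ℕ} (T : (Fin h → ℤ) ≃ₗ[ℤ] (Fin h → ℤ))
    (h1 : ∀ x, 0 ≤ x → 0 ≤ T x) (h2 : ∀ x, 0 ≤ x → 0 ≤ T.symm x) :
    ∃ g : Equiv.Perm (Fin h), ∀ x, T x = x ∘ g := by
  classical
  have hpos : ∀ x : Fin h → ℤ, 0 ≤ x → x ≠ 0 → 1 ≤ ∑ i, x i := by
    intro x hx hx0
    obtain ⟨i, hi⟩ := Function.ne_iff.1 hx0
    exact (Int.one_le_abs hi).trans_eq (abs_of_nonneg (hx i)) |>.trans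
      (Finset.single_le_sum (fun j _ => hx j) (Finset.mem_univ i))
  have hs : ∀ j, (0 : Fin h → ℤ) ≤ Pi.single j 1 := fun j => Pi.single_nonneg.2 zero_le_one
  have hne : ∀ j, (Pi.single j 1 : Fin h → ℤ) ≠ 0 := fun j => by simp
  have hunit : ∀ i, ∃ j, T (Pi.single i 1) = Pi.single j 1 := by
    intro i
    set t := T (Pi.single i 1) with ht
    have ht0 : 0 ≤ t := h1 _ (hs i)
    have htn : t ≠ 0 := by
      rw [ht, Ne, LinearEquiv.map_eq_zero_iff]
      exact hne i
    have e1 : ∑ j, t j * ∑ a, T.symm (Pi.single j 1) a = 1 := by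
      have e2 : T.symm t = ∑ j, t j • T.symm (Pi.single j 1) := by
        conv_lhs => rw [pi_eq_sum_univ' t, map_sum]
        exact Finset.sum_congr rfl fun j _ => by rw [map_smul]
      have e3 : ∑ a, T.symm t a = 1 := by
        rw [ht, LinearEquiv.symm_apply_apply]
        simp
      refine Eq.trans ?_ e3
      rw [e2]
      simp only [Finset.sum_apply, Pi.smul_apply, smul_eq_mul, Finset.mul_sum]
      rw [Finset.sum_comm]
    have e2 : ∑ j, t j ≤ 1 := by
      rw [← e1]
      refine Finset.sum_le_sum fun j _ => le_mul_of_one_le_right (ht0 j) ?_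
      refine hpos _ (h2 _ (hs j)) ?_
      rw [Ne, LinearEquiv.map_eq_zero_iff]
      exact hne j
    obtain ⟨j, hj⟩ := Function.ne_iff.1 htn
    have hj1 : 1 ≤ t j := (Int.one_le_abs hj).trans_eq (abs_of_nonneg (ht0 j))
    refine ⟨j, ?_⟩
    have e3 := Finset.add_sum_erase Finset.univ t (Finset.mem_univ j)
    have e4 : ∀ a ∈ Finset.univ.erase j, 0 ≤ t a := fun a _ => ht0 a
    have e5 : ∑ a ∈ Finset.univ.erase j, t a = 0 :=
      le_antisymm (by linarith) (Finset.sum_nonneg e4)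
    rw [Finset.sum_eq_zero_iff_of_nonneg e4] at e5
    ext a
    rcases eq_or_ne a j with rfl | ha
    · rw [Pi.single_eq_same]
      exact le_antisymm ((Finset.single_le_sum (fun j _ => ht0 j) (Finset.mem_univ a)).trans e2) hj1
    · rw [Pi.single_eq_of_ne ha, e5 a (Finset.mem_erase.2 ⟨ha, Finset.mem_univ a⟩)]
  choose g hg using hunit
  have hginj : Function.Injective g := by
    intro i j hij
    have e : T (Pi.single i 1) = T (Pi.single j 1) := by rw [hg, hg, hij]
    by_contra hne'
    have := congrFun (T.injective e) i
    simp [Pi.single_eq_of_ne hne'] at this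
  set γ : Equiv.Perm (Fin h) := Equiv.ofBijective g (Finite.injective_iff_bijective.1 hginj)
  refine ⟨γ.symm, fun x => ?_⟩
  ext a
  conv_lhs => rw [pi_eq_sum_univ' x, map_sum]
  simp only [map_smul, hg, Finset.sum_apply, Pi.smul_apply, smul_eq_mul, Function.comp_apply]
  rw [Finset.sum_eq_single (γ.symm a)]
  · have : g (γ.symm a) = a := γ.apply_symm_apply a
    rw [this, Pi.single_eq_same, mul_one]
  · intro b _ hb
    rw [Pi.single_eq_of_ne, mul_zero]
    rintro rfl
    exact hb (γ.symm_apply_apply b).symm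
  · simp

namespace NefFrame

open LatticeMonad

variable {h : ℕ} {d : Fin h → Fin h → Fin h → ℕ} {S : Fin h → ℕ} {n : Fin h → ℤ}
  (F : X.NefFrame d S n)

/-- A symmetry and its inverse preserve the nef cone, which is the orthant, so in coordinates they
are permutations. The normal bundle is the sum of all toric divisors and therefore invariant. -/
theorem exists_perm (π : X.fanSymmetries) : ∃ g : Equiv.Perm (Fin h), n ∘ g = n ∧
    ∀ D, F.coord (X.symmetryOnPic π D) = F.coord D ∘ g := by
  have hinv : ∀ (π : X.fanSymmetries) D,
      X.symmetryOnPic π⁻¹ (X.symmetryOnPic π D) = D := fun π D => by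
    rw [← symmetryOnPic_mul, inv_mul_cancel, symmetryOnPic_one]
  have hinv' : ∀ (π : X.fanSymmetries) D,
      X.symmetryOnPic π (X.symmetryOnPic π⁻¹ D) = D := fun π D => by
    rw [← symmetryOnPic_mul, mul_inv_cancel, symmetryOnPic_one]
  set e : X.Pic ≃ₗ[ℤ] X.Pic := LinearEquiv.ofLinearMap (X.symmetryOnPic π) (X.symmetryOnPic π⁻¹)
    (LinearMap.ext (hinv' π)) (LinearMap.ext (hinv π)) with he
  have hnn : ∀ (π : X.fanSymmetries) (x : Fin h → ℤ), 0 ≤ x →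
      0 ≤ F.coord (X.symmetryOnPic π (F.coord.symm x)) := by
    intro π x hx
    refine (F.isNef_iff _).1 (IsNef.symmetryOnPic ((F.isNef_iff _).2 fun r => ?_) π)
    rw [LinearEquiv.apply_symm_apply]
    exact hx r
  obtain ⟨g, hg⟩ := exists_perm_of_nonneg ((F.coord.symm.trans e).trans F.coord) (hnn π) (hnn π⁻¹)
  have key : ∀ D, F.coord (X.symmetryOnPic π D) = F.coord D ∘ g := by
    intro D
    rw [← hg]
    change _ = F.coord (X.symmetryOnPic π (F.coord.symm (F.coord D)))
    rw [LinearEquiv.symm_apply_apply]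
  refine ⟨g, ?_, key⟩
  rw [← F.normal, ← key, symmetryOnPic_normalBundle]

theorem symmetryOnPic_nefClass {π : X.fanSymmetries} {g : Equiv.Perm (Fin h)}
    (hg : ∀ D, F.coord (X.symmetryOnPic π D) = F.coord D ∘ g) (y : Fin h → ℕ) :
    X.symmetryOnPic π (F.nefClass y) = F.nefClass (y ∘ g) := by
  refine F.coord.injective ?_
  ext r
  rw [hg, Function.comp_apply, coord_nefClass, coord_nefClass, Function.comp_apply]

theorem map_monad {π : X.fanSymmetries} {g : Equiv.Perm (Fin h)}
    (hg : ∀ D, F.coord (X.symmetryOnPic π D) = F.coord D ∘ g) (B C : Multiset (Fin h → ℕ)) :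
    (F.monad B C).map π = F.monad (B.map (· ∘ g)) (C.map (· ∘ g)) := by
  ext1 <;> simp only [MonadData.map, monad, Multiset.map_map] <;>
    exact Multiset.map_congr rfl fun y _ => F.symmetryOnPic_nefClass hg y

end NefFrame

end ToricSpace


/-! ## Products of projective spaces -/

namespace ToricSpace

theorem sum_smul_projectiveRay {n : ℕ} (c : Fin (n + 1) → ℤ) (a : Fin n) :
    (∑ j, c j • projectiveRay n j) a = c a.castSucc - c (Fin.last n) := by
  rw [Fin.sum_univ_castSucc]
  simp only [projectiveRay, Fin.lastCases_castSucc, Fin.lastCases_last, Pi.add_apply,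
    Finset.sum_apply, Pi.smul_apply, Pi.single_apply, smul_eq_mul, mul_ite, mul_one, mul_zero,
    Finset.sum_ite_eq, Finset.mem_univ, if_true]
  ring

/-- The level sets of a linear relation between the rays are relations. -/
theorem IsProductOfProjectiveSpaces.sum_filter_eq_zero {X : ToricSpace}
    (hX : X.IsProductOfProjectiveSpaces) {c : Fin X.k → ℤ} (hc : ∑ ρ, c ρ • X.v ρ = 0) (t : ℤ) :
    ∑ ρ with c ρ = t, X.v ρ = 0 := by
  obtain ⟨s, n, e, g, -, hg⟩ := hX
  have key : ∀ f : Fin X.k → ℤ, ∀ i, g (∑ ρ, f ρ • X.v ρ) i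
      = ∑ j, f (e.symm ⟨i, j⟩) • projectiveRay (n i) j := by
    intro f i
    rw [map_sum, Finset.sum_apply, ← e.symm.sum_comp, Fintype.sum_sigma, Finset.sum_eq_single i]
    · refine Finset.sum_congr rfl fun j _ => ?_
      rw [map_smul, hg, Equiv.apply_symm_apply, Pi.smul_apply, Pi.single_eq_same]
    · intro i' _ hi'
      refine Finset.sum_eq_zero fun j _ => ?_
      rw [map_smul, hg, Equiv.apply_symm_apply, Pi.smul_apply, Pi.single_eq_of_ne hi'.symm,
        smul_zero]
    · simp
  -- The rays of `ℙⁿ` satisfy one relation up to multiples, with equal coefficients. So the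
  -- coefficients of any relation are constant on each factor, and the level sets are unions of
  -- factors.
  have hconst : ∀ i j, c (e.symm ⟨i, j⟩) = c (e.symm ⟨i, Fin.last _⟩) := by
    intro i j
    induction j using Fin.lastCases with
    | last => rfl
    | cast a =>
      have := congrFun (key c i) a
      rw [hc, map_zero, sum_smul_projectiveRay] at this
      exact (sub_eq_zero.1 this.symm)
  rw [← g.map_eq_zero_iff]
  have h1 : ∑ ρ with c ρ = t, X.v ρ = ∑ ρ, (if c ρ = t then (1 : ℤ) else 0) • X.v ρ := by
    rw [Finset.sum_filter]
    exact Finset.sum_congr rfl fun ρ _ => by split_ifs <;> simp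
  rw [h1]
  ext i a
  rw [key, sum_smul_projectiveRay, hconst i a.castSucc, sub_self]
  rfl

/-- Moved to one side, the relation has the coefficient -1 at `σ` only. On a product this level set
would be a relation by itself, forcing `v_σ = 0`. -/
theorem Relation.not_isProduct {X : ToricSpace} (r : X.Relation) {σ : Fin X.k} (hR : r.R = {σ})
    (hP : σ ∉ r.P) (hσ : X.v σ ≠ 0) : ¬ X.IsProductOfProjectiveSpaces := by
  intro hX
  have hsum : ∀ M : Multiset (Fin X.k), ∑ ρ, (M.count ρ : ℤ) • X.v ρ = (M.map X.v).sum := by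
    intro M
    rw [Finset.sum_multiset_map_count]
    refine (Finset.sum_subset (Finset.subset_univ _) fun ρ _ hρ => ?_).symm.trans
      (Finset.sum_congr rfl fun ρ _ => natCast_zsmul _ _)
    rw [Multiset.count_eq_zero_of_notMem (by simpa using hρ)]
    simp
  have h1 : ∑ ρ, ((r.P.count ρ : ℤ) - r.R.count ρ) • X.v ρ = 0 := by
    simp only [sub_smul, Finset.sum_sub_distrib, hsum, r.sum_eq, sub_self]
  have h2 := hX.sum_filter_eq_zero h1 (-1)
  have h3 : (Finset.univ.filter fun ρ => (r.P.count ρ : ℤ) - r.R.count ρ = -1) = {σ} := by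
    ext ρ
    simp only [Finset.mem_filter, Finset.mem_univ, true_and, Finset.mem_singleton, hR,
      Multiset.count_singleton]
    constructor
    · intro h
      by_contra hne
      simp only [if_neg hne] at h
      omega
    · rintro rfl
      simp [Multiset.count_eq_zero_of_notMem hP]
  rw [h3, Finset.sum_singleton] at h2
  exact hσ h2

section Product

variable {L : List (ℤ × ℤ × ℤ × ℤ)} {φ : Fin 4 → Fin L.length}

theorem v_castAdd (a : Fin 4) : (ofList L).v (Fin.castAdd L.length a) = Pi.single a 1 :=
  Fin.append_left (m := 4) (fun i => Pi.single i 1)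
    (fun j : Fin L.length => ![(L.get j).1, (L.get j).2.1, (L.get j).2.2.1, (L.get j).2.2.2]) a

/-- The map `φ` assigns basis vectors to factors, and the ray with index `4 + i` is minus the sum of
the basis vectors of the factor `i`. Splitting the coordinates along the fibres of `φ` gives the
isomorphism. -/
theorem isProduct_of_factors
    (hv : ∀ i a, (ofList L).v (Fin.natAdd 4 i) a = if φ a = i then -1 else 0)
    (hs : Function.Surjective φ) : (ofList L).IsProductOfProjectiveSpaces := by
  set n : Fin L.length → ℕ := fun i => Fintype.card {a // φ a = i} with hn
  set α : ∀ i, Fin (n i) ≃ {a // φ a = i} := fun i => (Fintype.equivFin _).symm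
  -- The factor of a basis vector equals `i` only propositionally; the heterogeneous equality
  -- transports along this.
  have hα : ∀ {i} {β : Fin L.length → Type} (y : ∀ i, Fin (n i) → β i) (s : {a // φ a = i}),
      HEq (y (φ s) ((α (φ s)).symm ⟨s, rfl⟩)) (y i ((α i).symm s)) := by
    rintro i β y ⟨a, rfl⟩
    rfl
  set g : (Fin 4 → ℤ) ≃ₗ[ℤ] ((i : Fin L.length) → Fin (n i) → ℤ) :=
    { toFun := fun x i j => x (α i j)
      map_add' := fun _ _ => rfl
      map_smul' := fun _ _ => rfl
      invFun := fun y a => y (φ a) ((α (φ a)).symm ⟨a, rfl⟩)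
      left_inv := fun x => by simp
      right_inv := fun y => by
        ext i j
        have := eq_of_heq (hα y (α i j))
        rw [Equiv.symm_apply_apply] at this
        exact this }
  set f : Fin (4 + L.length) → Σ i, Fin (n i + 1) :=
    Fin.addCases (fun a => ⟨φ a, ((α (φ a)).symm ⟨a, rfl⟩).castSucc⟩) (fun i => ⟨i, Fin.last _⟩)
  have hf1 : ∀ a, f (Fin.castAdd _ a) = ⟨φ a, ((α (φ a)).symm ⟨a, rfl⟩).castSucc⟩ :=
    fun a => Fin.addCases_left a
  have hf2 : ∀ i, f (Fin.natAdd _ i) = ⟨i, Fin.last _⟩ := fun i => Fin.addCases_right i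
  have hfs : Function.Surjective f := by
    rintro ⟨i, j⟩
    induction j using Fin.lastCases with
    | last => exact ⟨Fin.natAdd 4 i, hf2 i⟩
    | cast j =>
      obtain ⟨⟨a, rfl⟩, rfl⟩ := (α i).symm.surjective j
      exact ⟨Fin.castAdd _ a, by rw [hf1]⟩
  have hcard : Fintype.card (Fin (4 + L.length)) = Fintype.card (Σ i, Fin (n i + 1)) := by
    have : ∑ i, n i = 4 := by
      rw [hn, ← Fintype.card_sigma, Fintype.card_congr (Equiv.sigmaFiberEquiv φ), Fintype.card_fin]
    simp only [Fintype.card_sigma, Fintype.card_fin, Finset.sum_add_distrib, this]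
    simp
  refine ⟨L.length, n, Equiv.ofBijective f ((Fintype.bijective_iff_surjective_and_card f).2
    ⟨hfs, hcard⟩), g, fun i => ?_, ?_⟩
  · obtain ⟨a, ha⟩ := hs i
    exact Fintype.card_pos_iff.2 ⟨⟨a, ha⟩⟩
  · intro ρ
    change g _ = Pi.single (f ρ).1 (projectiveRay _ (f ρ).2)
    ext i j
    change (ofList L).v ρ (α i j) = _
    induction ρ using Fin.addCases with
    | left a =>
      rw [hf1]
      simp only [projectiveRay, Fin.lastCases_castSucc]
      rw [v_castAdd]
      by_cases hi : i = φ a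
      · subst hi
        rw [Pi.single_eq_same, Pi.single_apply, Pi.single_apply]
        refine if_congr ?_ rfl rfl
        rw [Equiv.eq_symm_apply, Subtype.ext_iff]
      · rw [Pi.single_eq_of_ne hi, Pi.single_eq_of_ne, Pi.zero_apply]
        rintro h
        exact hi ((α i j).2.symm.trans (congrArg φ h))
    | right i' =>
      rw [hf2]
      simp only [projectiveRay, Fin.lastCases_last]
      rw [hv, (α i j).2]
      by_cases hi : i = i'
      · subst hi
        rw [if_pos rfl, Pi.single_eq_same]
      · rw [if_neg hi, Pi.single_eq_of_ne hi, Pi.zero_apply]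

/-- Factors of equal dimension have fibres of equal size. Bijections between these fibres give a
permutation of the basis vectors that carries each remaining ray to the one of the target factor. -/
theorem exists_symmetry
    (hv : ∀ i a, (ofList L).v (Fin.natAdd 4 i) a = if φ a = i then -1 else 0)
    (g : Equiv.Perm (Fin L.length))
    (hg : ∀ i, Fintype.card {a // φ a = i} = Fintype.card {a // φ a = g i}) :
    ∃ π : (ofList L).fanSymmetries, ∀ i,
      (π : Equiv.Perm (Fin (ofList L).k)) (Fin.natAdd 4 i) = Fin.natAdd 4 (g i) := by
  set E : ∀ i, {a // φ a = i} ≃ {a // φ a = g i} := fun i => Fintype.equivOfCardEq (hg i)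
  set τ : Equiv.Perm (Fin 4) := (Equiv.sigmaFiberEquiv φ).symm.trans
    ((Equiv.sigmaCongr g E).trans (Equiv.sigmaFiberEquiv φ))
  have hτ : ∀ a, φ (τ a) = g (φ a) := fun a => (E (φ a) ⟨a, rfl⟩).2
  set π : Equiv.Perm (Fin (4 + L.length)) :=
    finSumFinEquiv.symm.trans ((Equiv.sumCongr τ g).trans finSumFinEquiv)
  have h1 : ∀ a, π (Fin.castAdd _ a) = Fin.castAdd _ (τ a) := fun a => by simp [π]
  have h2 : ∀ i, π (Fin.natAdd _ i) = Fin.natAdd _ (g i) := fun a => by simp [π]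
  refine ⟨⟨π, LinearEquiv.funCongrLeft ℤ ℤ τ.symm, fun ρ => ?_⟩, h2⟩
  ext a
  change (ofList L).v ρ (τ.symm a) = (ofList L).v (π ρ) a
  induction ρ using Fin.addCases with
  | left b =>
    rw [h1, v_castAdd, v_castAdd, Pi.single_apply, Pi.single_apply]
    exact if_congr (Equiv.symm_apply_eq _) rfl rfl
  | right i =>
    rw [h2, hv, hv]
    refine if_congr ?_ rfl rfl
    conv_rhs => rw [← τ.apply_symm_apply a, hτ]
    exact g.injective.eq_iff.symm

theorem NefFrame.exists_symmetry {d : Fin L.length → Fin L.length → Fin L.length → ℕ}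
    {S : Fin L.length → ℕ} {n : Fin L.length → ℤ} (F : (ofList L).NefFrame d S n)
    (hv : ∀ i a, (ofList L).v (Fin.natAdd 4 i) a = if φ a = i then -1 else 0)
    (hn : ∀ i, n i = Fintype.card {a // φ a = i} + 1)
    (hF : ∀ i, F.coord ((ofList L).toricDivisor (Fin.natAdd 4 i)) = Pi.single i 1)
    {g : Equiv.Perm (Fin L.length)} (hg : n ∘ g = n) :
    ∃ π : (ofList L).fanSymmetries, ∀ D,
      F.coord ((ofList L).symmetryOnPic π D) = F.coord D ∘ g := by
  have hg' : ∀ i, Fintype.card {a // φ a = i} = Fintype.card {a // φ a = g.symm i} := by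
    intro i
    have h1 := congrFun hg (g.symm i)
    rw [Function.comp_apply, Equiv.apply_symm_apply, hn, hn] at h1
    omega
  obtain ⟨π, hπ⟩ := ToricSpace.exists_symmetry hv g.symm hg'
  obtain ⟨g', -, hg''⟩ := F.exists_perm π
  -- The symmetry moves the divisor of the factor `i` to that of `g⁻¹ i`, and precomposition with
  -- `g` moves the coordinate vector in the same way.
  have : g' = g := by
    ext1 j
    obtain ⟨i, rfl⟩ := g.symm.surjective j
    have h1 := hg'' ((ofList L).toricDivisor (Fin.natAdd 4 i))
    have h0 : (ofList L).symmetryOnPic π ((ofList L).toricDivisor (Fin.natAdd 4 i))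
        = (ofList L).toricDivisor (Fin.natAdd 4 (g.symm i)) :=
      (symmetryOnPic_toricDivisor π _).trans (congrArg _ (hπ i))
    rw [h0, hF, hF] at h1
    have h2 := congrFun h1 (g.symm i)
    rw [Pi.single_eq_same, Function.comp_apply, Pi.single_apply] at h2
    rw [Equiv.apply_symm_apply]
    by_contra h3
    rw [if_neg h3] at h2
    exact one_ne_zero h2
  exact ⟨π, this ▸ hg''⟩

end Product

end ToricSpace


/-! ## Permutations of coordinates -/

namespace LatticeMonad

variable {h : ℕ} {d : Fin h → Fin h → Fin h → ℕ} {S : Fin h → ℕ} (g : Equiv.Perm (Fin h))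

/-- The intersection numbers and the second Chern class are invariant under a permutation. -/
structure IsInvariant (d : Fin h → Fin h → Fin h → ℕ) (S : Fin h → ℕ) (g : Equiv.Perm (Fin h)) :
    Prop where
  d_eq : ∀ a b r, d (g a) (g b) (g r) = d a b r
  S_eq : ∀ r, S (g r) = S r

theorem size_comp (x : Fin h → ℕ) : size (x ∘ g) = size x := Equiv.sum_comp g x

theorem sum_map_comp (M : Multiset (Fin h → ℕ)) : (M.map (· ∘ g)).sum = M.sum ∘ g := by
  induction M using Multiset.induction_on with
  | empty => simp
  | cons x M ih => rw [Multiset.map_cons, Multiset.sum_cons, ih, Multiset.sum_cons]; rfl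

theorem unit_comp (a : Fin h) : unit (g a) ∘ g = unit a := by
  ext i
  simp [Pi.single_apply]

theorem units_comp (n : Fin h → ℕ) : units (n ∘ g) = (units n).map (· ∘ g) := by
  symm
  convert eq_units (M := (units n).map (· ∘ g)) ?_ using 1
  · rw [sum_map_comp, sum_units]
  · intro x hx
    obtain ⟨y, hy, rfl⟩ := Multiset.mem_map.1 hx
    rw [size_comp, size_of_mem_units hy]

variable {g}

theorem IsInvariant.quad_comp (hg : IsInvariant d S g) (r : Fin h) (x y : Fin h → ℕ) :
    quad d r (x ∘ g) (y ∘ g) = quad d (g r) x y := by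
  simp only [quad, Function.comp_apply]
  rw [← Equiv.sum_comp g fun a => ∑ b, d a b (g r) * x a * y b]
  refine Finset.sum_congr rfl fun a _ => ?_
  rw [← Equiv.sum_comp g fun b => d (g a) b (g r) * x (g a) * y b]
  exact Finset.sum_congr rfl fun b _ => by rw [hg.d_eq]

theorem IsInvariant.cube_comp (hg : IsInvariant d S g) (x : Fin h → ℕ) :
    MonadSearch.cube d (x ∘ g) = MonadSearch.cube d x := by
  simp only [MonadSearch.cube, hg.quad_comp, Function.comp_apply]
  exact Equiv.sum_comp g fun r => x r * quad d r x x

namespace Code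

/-- The action of permutations of the coordinates on codes. -/
def perm (g : Equiv.Perm (Fin h)) (c : Code h) : Code h where
  N := c.N
  m := c.m ∘ g
  β := c.β.map (· ∘ g)
  γ := c.γ.map (· ∘ g)

theorem perm_one (c : Code h) : c.perm 1 = c := by
  cases c
  simp [perm]

theorem perm_perm (g g' : Equiv.Perm (Fin h)) (c : Code h) :
    (c.perm g).perm g' = c.perm (g * g') := by
  simp [perm, Multiset.map_map, Function.comp_def]

variable (g) (c : Code h)

theorem mult_perm : (c.perm g).mult = c.mult ∘ g := by
  simp only [mult, perm, sum_map_comp]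
  rfl

theorem p_perm : (c.perm g).p = c.p := by
  rw [p, mult_perm, size_comp, p]
  simp [perm]

theorem B_perm : (c.perm g).B = c.B.map (· ∘ g) := by
  rw [B, p_perm, B]
  simp only [perm, Multiset.map_add, Multiset.map_map, Multiset.map_replicate, Multiset.card_map]
  rfl

theorem C_perm : (c.perm g).C = c.C.map (· ∘ g) := by
  rw [C, p_perm, mult_perm, units_comp, C]
  simp only [perm, Multiset.map_add, Multiset.map_map, Multiset.map_replicate, Multiset.card_map]
  rfl

variable {g c}

theorem cost_perm (hg : IsInvariant d S g) (r : Fin h) :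
    (c.perm g).cost d r = c.cost d (g r) := by
  have h1 : ∀ x y, quad d r (x ∘ g) (y ∘ g) = quad d (g r) x y := hg.quad_comp r
  rw [cost, mult_perm, cost]
  simp only [perm, Multiset.map_map]
  congr 1
  · congr 1
    · exact congrArg _ (Multiset.map_congr rfl fun b _ => h1 (c.m - b) b)
    · exact congrArg _ (Multiset.map_congr rfl fun b _ => h1 (c.m + b) b)
  · rw [← Equiv.sum_comp g fun a => c.mult a * quad d (g r) (c.m + unit a) (unit a)]
    refine Finset.sum_congr rfl fun a _ => ?_
    have h2 : (c.m + unit (g a)) ∘ g = c.m ∘ g + unit a := by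
      rw [← unit_comp g a]
      rfl
    rw [← h1, h2, unit_comp]
    rfl

theorem IsValid.perm (hc : c.IsValid d S) (hg : IsInvariant d S g) : (c.perm g).IsValid d S where
  N_mem := hc.N_mem
  one_le := fun i => hc.one_le (g i)
  β_ne := by
    intro b hb hb0
    obtain ⟨b, hb', rfl⟩ := Multiset.mem_map.1 hb
    refine hc.β_ne b hb' (funext fun i => ?_)
    have := congrFun hb0 (g.symm i)
    simpa using this
  β_le := by
    intro b hb i
    obtain ⟨b, hb', rfl⟩ := Multiset.mem_map.1 hb
    exact hc.β_le b hb' (g i)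
  γ_size := by
    intro b hb
    obtain ⟨b, hb', rfl⟩ := Multiset.mem_map.1 hb
    rw [size_comp]
    exact hc.γ_size b hb'
  sum_le := by
    intro i
    have := hc.sum_le (g i)
    simp only [Code.perm, sum_map_comp]
    exact this
  cost_le := by
    intro r
    rw [cost_perm hg, ← hg.S_eq]
    exact hc.cost_le _
  join := by
    intro h1 a
    rw [p_perm] at h1
    obtain ⟨b, hb, hb0⟩ := hc.join (by simpa [Code.perm] using h1) (g a)
    exact ⟨b ∘ g, Multiset.mem_map_of_mem _ hb, hb0⟩

end Code

end LatticeMonad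

/-! ### Classes of monads as orbits of codes -/

namespace ToricSpace.NefFrame

open LatticeMonad

variable {X : ToricSpace} {h : ℕ} {d : Fin h → Fin h → Fin h → ℕ} {S : Fin h → ℕ} {n : Fin h → ℤ}
  (F : X.NefFrame d S n)

theorem ind_perm (c : Code h) {g : Equiv.Perm (Fin h)} (hg : IsInvariant d S g) :
    (F.ofCode (c.perm g)).ind = (F.ofCode c).ind := by
  have h1 : ∀ M : Multiset (Fin h → ℕ), (M.map (· ∘ g)).map (MonadSearch.cube d)
      = M.map (MonadSearch.cube d) := by
    intro M
    rw [Multiset.map_map]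
    exact Multiset.map_congr rfl fun x _ => hg.cube_comp x
  have h2 := F.six_mul_ind c.B c.C
  have h3 := F.six_mul_ind (c.perm g).B (c.perm g).C
  rw [Code.B_perm, Code.C_perm, h1, h1, ← h2] at h3
  rw [ofCode, Code.B_perm, Code.C_perm]
  exact mul_left_cancel₀ (by norm_num) h3

/-- Equivalence of monads is given by a group of permutations of the coordinates. -/
structure IsSymmetry (Γ : Subgroup (Equiv.Perm (Fin h))) : Prop where
  inv : ∀ g ∈ Γ, IsInvariant d S g
  rel_iff : ∀ c c' : Code h, c.IsValid d S → c'.IsValid d S →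
    (X.monadSetoid.r (F.ofCode c) (F.ofCode c') ↔ ∃ g ∈ Γ, c' = c.perm g)

/-- The permutations that fix the coordinates of the normal bundle. -/
def stabilizer (n : Fin h → ℤ) : Subgroup (Equiv.Perm (Fin h)) where
  carrier := {g | n ∘ g = n}
  one_mem' := rfl
  mul_mem' := by
    intro a b (ha : n ∘ a = n) (hb : n ∘ b = n)
    change (n ∘ a) ∘ b = n
    rw [ha, hb]
  inv_mem' := by
    intro a (ha : n ∘ a = n)
    change n ∘ a.symm = n
    conv_lhs => rw [← ha]
    ext i
    simp

theorem ofCode_map {π : X.fanSymmetries} {g : Equiv.Perm (Fin h)}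
    (hg : ∀ D, F.coord (X.symmetryOnPic π D) = F.coord D ∘ g) (c : Code h) :
    (F.ofCode c).map π = F.ofCode (c.perm g) := by
  rw [ofCode, F.map_monad hg, ofCode, Code.B_perm, Code.C_perm]

/-- Nothing is identified if the space is not a product, or if only the identity fixes the
coordinates of the normal bundle. If there is no valid code, the claim is empty, so the alternative
is required only when one exists. -/
theorem isSymmetry_bot (H : (∃ c : Code h, c.IsValid d S) →
    ¬ X.IsProductOfProjectiveSpaces ∨ Function.Injective n) : F.IsSymmetry ⊥ where
  inv := by
    rintro g hg
    rw [Subgroup.mem_bot.1 hg]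
    exact ⟨fun _ _ _ => rfl, fun _ => rfl⟩
  rel_iff := by
    intro c c' hc hc'
    simp only [Subgroup.mem_bot, exists_eq_left, Code.perm_one]
    constructor
    · rintro (h1 | ⟨h1, π, h2⟩)
      · exact (F.ofCode_injective hc hc' h1).symm
      · rcases H ⟨c, hc⟩ with h3 | h3
        · exact absurd h1 h3
        · obtain ⟨g, hg, hg'⟩ := F.exists_perm π
          have : g = 1 := Equiv.ext fun i => h3 (congrFun hg i)
          subst this
          rw [F.ofCode_map hg', Code.perm_one] at h2
          exact (F.ofCode_injective hc hc' h2).symm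
    · rintro rfl
      exact Or.inl rfl

theorem isSymmetry_stabilizer (hX : X.IsProductOfProjectiveSpaces)
    (hinv : ∀ g ∈ stabilizer n, IsInvariant d S g)
    (hex : ∀ g ∈ stabilizer n, ∃ π : X.fanSymmetries, ∀ D,
      F.coord (X.symmetryOnPic π D) = F.coord D ∘ g) : F.IsSymmetry (stabilizer n) where
  inv := hinv
  rel_iff := by
    intro c c' hc hc'
    constructor
    · rintro (h1 | ⟨h1, π, h2⟩)
      · exact ⟨1, one_mem _, by rw [Code.perm_one, F.ofCode_injective hc hc' h1]⟩
      · obtain ⟨g, hg, hg'⟩ := F.exists_perm π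
        rw [F.ofCode_map hg'] at h2
        exact ⟨g, hg, (F.ofCode_injective (hc.perm (hinv g hg)) hc' h2).symm⟩
    · rintro ⟨g, hg, rfl⟩
      obtain ⟨π, hπ⟩ := hex g hg
      exact Or.inr ⟨hX, π, F.ofCode_map hπ c⟩

variable {F} {Γ : Subgroup (Equiv.Perm (Fin h))}

/-- Classes of monads are counted by the codes at which a function is minimal on an orbit. -/
theorem IsSymmetry.ncard_eq (hΓ : F.IsSymmetry Γ) (key : Code h → ℕ) {reps l : List (Code h)}
    (hreps : ∀ c, c ∈ reps ↔ c.IsValid d S ∧ ∀ g ∈ Γ, key c ≤ key (c.perm g))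
    (hfix : ∀ c ∈ reps, ∀ g ∈ Γ, key (c.perm g) = key c → c.perm g = c)
    {P : X.MonadData → Prop} (hP : ∀ V V' : X.MonadData, V.ind = V'.ind → (P V ↔ P V'))
    (hl : l.Nodup) (hmem : ∀ c, c ∈ l ↔ c ∈ reps ∧ P (F.ofCode c)) :
    {q : Quotient X.monadSetoid | ∃ V, Quotient.mk _ V = q ∧ V.IsPositiveMonad ∧ P V}.Finite ∧
    {q : Quotient X.monadSetoid | ∃ V, Quotient.mk _ V = q ∧ V.IsPositiveMonad ∧ P V}.ncard
      = l.length := by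
  classical
  have himage : {q : Quotient X.monadSetoid | ∃ V, Quotient.mk _ V = q ∧ V.IsPositiveMonad ∧ P V}
      = (fun c => Quotient.mk X.monadSetoid (F.ofCode c)) '' (l.toFinset : Set (Code h)) := by
    ext q
    constructor
    · rintro ⟨V, rfl, hV, hPV⟩
      obtain ⟨c, hc, rfl⟩ := F.exists_code hV
      -- The group is finite, so every orbit contains a code with minimal key, which represents the
      -- class.
      obtain ⟨⟨g, hg⟩, hmin⟩ := Finite.exists_min fun g : Γ => key (c.perm g)
      have hv := hc.perm (hΓ.inv g hg)
      refine ⟨c.perm g, ?_, Quotient.sound ?_⟩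
      · rw [Finset.mem_coe, List.mem_toFinset, hmem, hreps]
        refine ⟨⟨hv, fun g' hg' => ?_⟩, (hP _ _ (F.ind_perm c (hΓ.inv g hg))).2 hPV⟩
        rw [Code.perm_perm]
        exact hmin ⟨g * g', mul_mem hg hg'⟩
      · exact X.monadSetoid.symm' ((hΓ.rel_iff _ _ hc hv).2 ⟨g, hg, rfl⟩)
    · rintro ⟨c, hc, rfl⟩
      rw [Finset.mem_coe, List.mem_toFinset, hmem, hreps] at hc
      exact ⟨_, rfl, F.isPositiveMonad_ofCode hc.1.1, hc.2⟩
  have hinj : Set.InjOn (fun c => Quotient.mk X.monadSetoid (F.ofCode c))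
      (l.toFinset : Set (Code h)) := by
    intro c hc c' hc' e
    rw [Finset.mem_coe, List.mem_toFinset, hmem] at hc hc'
    have h1 := (hreps c).1 hc.1
    have h2 := (hreps c').1 hc'.1
    obtain ⟨g, hg, rfl⟩ := (hΓ.rel_iff _ _ h1.1 h2.1).1 (Quotient.exact e)
    -- Two minimal codes in one orbit have the same key, and `hfix` excludes ties between different
    -- codes.
    refine (hfix c hc.1 g hg (le_antisymm ?_ (h1.2 g hg))).symm
    have := h2.2 g⁻¹ (inv_mem hg)
    rwa [Code.perm_perm, mul_inv_cancel, Code.perm_one] at this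
  rw [himage]
  refine ⟨l.toFinset.finite_toSet.image _, ?_⟩
  rw [hinj.ncard_image, Set.ncard_coe_finset, List.toFinset_card_of_nodup hl]

end ToricSpace.NefFrame


/-! ## Counting orbits of monads -/

namespace MonadSearch

open LatticeMonad

/-- A permutation of coordinates applied to a vector. -/
def permL (l v : List ℕ) : List ℕ := l.map fun i => v.getD i 0

/-- The first entries of a vector as digits. -/
def digitsL : ℕ → List ℕ → ℕ
  | n + 1, a :: v => Nat.add a (Nat.mul 7 (digitsL n v))
  | _, _ => 0

/-- A function on vectors that is injective on small vectors and not linear. -/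
def hashL (h : ℕ) (v : List ℕ) : ℕ := Nat.pow (digitsL h v) 3

/-- The digits of a permuted vector. -/
def permDigitsL : List ℕ → List ℕ → ℕ
  | i :: l, a :: v => Nat.add (Nat.mul (Nat.pow 7 i) a) (permDigitsL l v)
  | _, _ => 0

def permHashL (l v : List ℕ) : ℕ := Nat.pow (permDigitsL l v) 3

/-- A function that distinguishes codes. -/
def Entry.key (h : ℕ) (e : Entry) : ℕ :=
  Nat.add (Nat.add (hashL h e.m) (sumL (e.β.map (hashL h))))
    (Nat.mul 3 (sumL (e.γ.map (hashL h))))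

/-- The key of an entry after an inverse permutation. -/
def Entry.permKey (l : List ℕ) (e : Entry) : ℕ :=
  Nat.add (Nat.add (permHashL l e.m) (sumL (e.β.map (permHashL l))))
    (Nat.mul 3 (sumL (e.γ.map (permHashL l))))

/-- A permutation of the coordinates of an entry. -/
def Entry.perm (l : List ℕ) (e : Entry) : Entry :=
  ⟨e.N, permL l e.m, e.β.map (permL l), e.γ.map (permL l), e.x, e.y⟩

def Entry.sameCode (e e' : Entry) : Bool :=
  e.m == e'.m && e.β.isPerm e'.β && e.γ.isPerm e'.γ

/-- The key is minimal in the orbit. -/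
def Entry.isRep (h : ℕ) (G : List (List ℕ)) (e : Entry) : Bool :=
  G.all fun l => Nat.ble (e.key h) (e.permKey l)

/-- The key is strictly less than the other keys in the orbit. -/
def Entry.keyOK (h : ℕ) (G : List (List ℕ)) (e : Entry) : Bool :=
  G.all fun l => Nat.blt (e.key h) (e.permKey l) || (e.perm l).sameCode e

/-- Decrease a number by one if a condition holds. -/
def pop (b : Bool) (n : ℕ) (f : ℕ → Bool) : Bool :=
  bif b then (match n with | 0 => false | k + 1 => f k) else f n

/-- The numbers of elements with the property `rep`, with also the property `p`, and with also the
property `q` are `a`, `b` and `c`, and the elements with the property `rep` have the property `ok`. -/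
def tally {α : Type*} (rep ok p q : α → Bool) : List α → ℕ → ℕ → ℕ → Bool
  | [], a, b, c => Nat.beq a 0 && Nat.beq b 0 && Nat.beq c 0
  | e :: l, a, b, c => bif rep e then ok e && pop true a fun a => pop (p e) b fun b =>
      pop (q e) c fun c => tally rep ok p q l a b c
    else tally rep ok p q l a b c

theorem pop_eq_true {b : Bool} {n : ℕ} {f : ℕ → Bool} (H : pop b n f = true) :
    ∃ k, n = k + b.toNat ∧ f k = true := by
  cases b with
  | false => exact ⟨n, rfl, H⟩
  | true =>
    cases n with
    | zero => exact absurd H (by simp [pop])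
    | succ k => exact ⟨k, rfl, H⟩

theorem tally_sound {α : Type*} {rep ok p q : α → Bool} {l : List α} {a b c : ℕ}
    (H : tally rep ok p q l a b c = true) : (∀ e ∈ l, rep e = true → ok e = true) ∧
      (l.filter rep).length = a ∧ (l.filter fun e => rep e && p e).length = b ∧
      (l.filter fun e => rep e && q e).length = c := by
  induction l generalizing a b c with
  | nil =>
    simp only [tally, Bool.and_eq_true, Nat.beq_eq] at H
    simp [H.1.1, H.1.2, H.2]
  | cons e l ih =>
    rw [tally] at H
    cases he : rep e with
    | false =>
      rw [he, cond_false] at H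
      obtain ⟨h1, h2, h3, h4⟩ := ih H
      refine ⟨?_, ?_, ?_, ?_⟩
      · intro e' he' hr
        rcases List.mem_cons.1 he' with rfl | he'
        · rw [he] at hr
          exact absurd hr (by simp)
        · exact h1 e' he' hr
      · rwa [List.filter_cons_of_neg (by simp [he])]
      · rwa [List.filter_cons_of_neg (by simp [he])]
      · rwa [List.filter_cons_of_neg (by simp [he])]
    | true =>
      rw [he, cond_true, Bool.and_eq_true] at H
      obtain ⟨hok, H1⟩ := H
      obtain ⟨a, rfl, H2⟩ := pop_eq_true H1
      obtain ⟨b, rfl, H3⟩ := pop_eq_true H2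
      obtain ⟨c, rfl, H4⟩ := pop_eq_true H3
      obtain ⟨h1, h2, h3, h4⟩ := ih H4
      refine ⟨?_, ?_, ?_, ?_⟩
      · intro e' he' hr
        rcases List.mem_cons.1 he' with rfl | he'
        · exact hok
        · exact h1 e' he' hr
      · simp [he, h2]
      · cases hp : p e <;> simp [he, hp, h3]
      · cases hp : q e <;> simp [he, hp, h4]

/-- The list of the values of a permutation. -/
structure Represents {h : ℕ} (l : List ℕ) (g : Equiv.Perm (Fin h)) : Prop where
  length_eq : l.length = h
  getD_eq : ∀ i : Fin h, l.getD i 0 = g i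

variable {h : ℕ}

theorem vec_permL {l : List ℕ} {g : Equiv.Perm (Fin h)} (hl : Represents l g) (v : List ℕ) :
    vec h (permL l v) = vec h v ∘ g := by
  ext i
  rw [vec, permL, Function.comp_apply, vec, ← hl.getD_eq, List.getD_eq_getElem _ _
    (by rw [List.length_map, hl.length_eq]; exact i.2), List.getElem_map,
    List.getD_eq_getElem l _ (by rw [hl.length_eq]; exact i.2)]

theorem toCode_perm {l : List ℕ} {g : Equiv.Perm (Fin h)} (hl : Represents l g) (e : Entry) :
    (e.perm l).toCode h = (e.toCode h).perm g := by
  simp [Entry.toCode, Entry.perm, Code.perm, vec_permL hl, List.map_map, Function.comp_def]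

/-- The key of a code. -/
def key (c : Code h) : ℕ :=
  let hash : (Fin h → ℕ) → ℕ := fun x => (∑ i : Fin h, 7 ^ (i : ℕ) * x i) ^ 3
  hash c.m + (c.β.map hash).sum + 3 * (c.γ.map hash).sum

theorem digitsL_eq (h : ℕ) (v : List ℕ) : digitsL h v = ∑ i : Fin h, 7 ^ (i : ℕ) * vec h v i := by
  induction h generalizing v with
  | zero => simp [digitsL]
  | succ n ih =>
    cases v with
    | nil => simp [digitsL, vec]
    | cons a v =>
      rw [digitsL, ih, Fin.sum_univ_succ]
      simp only [vec, Nat.add_eq, Nat.mul_eq, Finset.mul_sum, Fin.val_zero, pow_zero, one_mul,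
        List.getD_cons_zero, Fin.val_succ, List.getD_cons_succ, pow_succ']
      exact congrArg _ (Finset.sum_congr rfl fun i _ => (mul_assoc _ _ _).symm)

theorem key_toCode (e : Entry) : key (e.toCode h) = e.key h := by
  have h1 : ∀ v, (∑ i : Fin h, 7 ^ (i : ℕ) * vec h v i) ^ 3 = hashL h v := by
    intro v
    exact congrArg (· ^ 3) (digitsL_eq h v).symm
  simp only [key, Entry.toCode, Multiset.map_coe, Multiset.sum_coe, List.map_map, Entry.key,
    sumL_map, h1, Function.comp_def, Nat.add_eq, Nat.mul_eq]

theorem permDigitsL_eq {l : List ℕ} {g : Equiv.Perm (Fin h)} (hl : Represents l g) (v : List ℕ) :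
    permDigitsL l v = ∑ i : Fin h, 7 ^ (i : ℕ) * (vec h v ∘ g.symm) i := by
  have key : ∀ (l v : List ℕ) {n : ℕ}, l.length = n →
      permDigitsL l v = ∑ i : Fin n, 7 ^ l.getD i 0 * v.getD i 0 := by
    intro l
    induction l with
    | nil =>
      rintro v n rfl
      simp [permDigitsL]
    | cons a l ih =>
      rintro v n rfl
      rw [List.length_cons, Fin.sum_univ_succ]
      cases v with
      | nil => simp [permDigitsL]
      | cons b v =>
        rw [permDigitsL, ih v rfl]
        rfl
  rw [key l v hl.length_eq, ← Equiv.sum_comp g fun i => 7 ^ (i : ℕ) * (vec h v ∘ g.symm) i]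
  refine Finset.sum_congr rfl fun i _ => ?_
  rw [hl.getD_eq, Function.comp_apply, Equiv.symm_apply_apply]
  rfl

/-- The digit at position `i` is placed directly at position `g i`, so the permuted vector need not
be formed. This yields the action of `g⁻¹`, which is harmless because the whole group is tested. -/
theorem key_perm_inv {l : List ℕ} {g : Equiv.Perm (Fin h)} (hl : Represents l g) (e : Entry) :
    key ((e.toCode h).perm g⁻¹) = e.permKey l := by
  have h1 : ∀ v, (∑ i : Fin h, 7 ^ (i : ℕ) * vec h v ((g⁻¹ : Equiv.Perm (Fin h)) i)) ^ 3
      = permHashL l v := fun v => congrArg (· ^ 3) (permDigitsL_eq hl v).symm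
  simp only [key, Code.perm, Entry.toCode, Multiset.map_coe, Multiset.sum_coe, List.map_map,
    Entry.permKey, sumL_map, Function.comp_def, h1, Nat.add_eq, Nat.mul_eq]

theorem toCode_eq_of_sameCode {e e' : Entry} (hN : e.N = e'.N) (H : e.sameCode e' = true) :
    e.toCode h = e'.toCode h := by
  simp only [Entry.sameCode, Bool.and_eq_true, beq_iff_eq, List.isPerm_iff] at H
  obtain ⟨⟨h1, h2⟩, h3⟩ := H
  simp only [Entry.toCode, hN, h1, Code.mk.injEq, true_and, Multiset.coe_eq_coe]
  exact ⟨h2.map _, h3.map _⟩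

end MonadSearch

/-! ### Classes of monads counted in the list of entries -/

namespace ToricSpace.NefFrame

open LatticeMonad MonadSearch

variable {X : ToricSpace} {h b : ℕ} {D : List (List (List ℕ))} {S : List ℕ} {n : Fin h → ℤ}
  {F : X.NefFrame (form h D) (vec h S) n}

/-- The representatives are the entries with minimal key. Injectivity of the key on all codes is not
needed: `hkey` checks on each representative that a permutation either raises the key or fixes the
code. -/
theorem IsSymmetry.ncard_eq_length {Γ : Subgroup (Equiv.Perm (Fin h))} (hΓ : F.IsSymmetry Γ)
    (hD : D.length = h) (hS : S.length = h) (hb : boundOK h D S b = true) {G : List (List ℕ)}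
    (hG1 : ∀ g ∈ Γ, g = 1 ∨ ∃ l ∈ G, Represents l g)
    (hG2 : ∀ l ∈ G, ∃ g ∈ Γ, Represents l g)
    (hkey : ∀ e ∈ entries h D S b, e.isRep h G = true → e.keyOK h G = true)
    {P : X.MonadData → Prop} (hP : ∀ V V' : X.MonadData, V.ind = V'.ind → (P V ↔ P V'))
    {p : Entry → Bool} (hp : ∀ e ∈ entries h D S b, p e = true ↔ P (F.ofCode (e.toCode h))) :
    {q : Quotient X.monadSetoid | ∃ V, Quotient.mk _ V = q ∧ V.IsPositiveMonad ∧ P V}.Finite ∧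
    {q : Quotient X.monadSetoid | ∃ V, Quotient.mk _ V = q ∧ V.IsPositiveMonad ∧ P V}.ncard
      = ((entries h D S b).filter fun e => e.isRep h G && p e).length := by
  have hrep : ∀ e : Entry, e.isRep h G = true ↔
      ∀ g ∈ Γ, key (e.toCode h) ≤ key ((e.toCode h).perm g) := by
    intro e
    simp only [Entry.isRep, List.all_eq_true, Nat.ble_eq]
    constructor
    · intro H g hg
      rcases hG1 g⁻¹ (inv_mem hg) with hg1 | ⟨l, hl, hlg⟩
      · rw [inv_eq_one.1 hg1, Code.perm_one]
      · rw [← inv_inv g, key_perm_inv hlg, key_toCode]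
        exact H l hl
    · intro H l hl
      obtain ⟨g, hg, hlg⟩ := hG2 l hl
      rw [← key_toCode, ← key_perm_inv hlg]
      exact H g⁻¹ (inv_mem hg)
  rw [← List.length_map (f := Entry.toCode h)]
  refine hΓ.ncard_eq key (reps := ((entries h D S b).filter (Entry.isRep h G)).map (Entry.toCode h))
    ?_ ?_ hP ?_ ?_
  · intro c
    simp only [List.mem_map, List.mem_filter]
    constructor
    · rintro ⟨e, ⟨he, he'⟩, rfl⟩
      exact ⟨(entries_sound hD hS he).1, (hrep e).1 he'⟩
    · rintro ⟨hc, hmin⟩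
      obtain ⟨e, he, rfl⟩ := entries_complete hD hS hb hc
      exact ⟨e, ⟨he, (hrep e).2 hmin⟩, rfl⟩
  · intro c hc g hg heq
    obtain ⟨e, he, rfl⟩ := List.mem_map.1 hc
    rw [List.mem_filter] at he
    rcases hG1 g⁻¹ (inv_mem hg) with hg1 | ⟨l, hl, hlg⟩
    · rw [inv_eq_one.1 hg1, Code.perm_one]
    · have h1 := List.all_eq_true.1 (hkey e he.1 he.2) l hl
      rw [← inv_inv g, key_perm_inv hlg, key_toCode] at heq
      rw [Bool.or_eq_true, Nat.blt_eq] at h1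
      rcases h1 with h1 | h1
      · omega
      -- The test shows that the permutation in the list fixes the code; then its inverse does so as
      -- well.
      · have h2 := toCode_eq_of_sameCode (h := h) (e := e.perm l) (e' := e) rfl h1
        rw [toCode_perm hlg] at h2
        conv_lhs => rw [← h2]
        rw [Code.perm_perm, inv_mul_cancel, Code.perm_one]
  · exact (entries_nodup hD b).sublist (List.filter_sublist.map _)
  · intro c
    simp only [List.mem_map, List.mem_filter, Bool.and_eq_true]
    constructor
    · rintro ⟨e, ⟨he, he1, he2⟩, rfl⟩
      exact ⟨⟨e, ⟨he, he1⟩, rfl⟩, (hp e he).1 he2⟩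
    · rintro ⟨⟨e, ⟨he, he1⟩, rfl⟩, hc⟩
      exact ⟨e, ⟨he, he1, (hp e he).2 hc⟩, rfl⟩

theorem six_mul_ind_ofCode {e : Entry} (he : e.Correct h D) :
    6 * (F.ofCode (e.toCode h)).ind = ((e.x - e.y : ℤ) : ℚ) := by
  rw [ofCode, six_mul_ind, ← he.1, ← he.2]
  push_cast
  rfl

theorem three_iff {e : Entry} (he : e.Correct h D) :
    e.three X.eulerNumber = true ↔ (F.ofCode (e.toCode h)).IsThreeFamily := by
  rw [MonadData.isThreeFamily_iff (six_mul_ind_ofCode he)]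
  simp [Entry.three, and_assoc]

theorem strong_iff {e : Entry} (he : e.Correct h D) {M c : ℤ} (hM : X.normalCubed = M)
    (hc : 2 * X.c₂ X.normalBundle = c) :
    e.strong X.eulerNumber M c = true ↔ (F.ofCode (e.toCode h)).IsStrongThreeFamily := by
  rw [MonadData.isStrongThreeFamily_iff (six_mul_ind_ofCode he) hM hc]
  simp [Entry.strong, Entry.three, and_assoc]

theorem isThreeFamily_congr {V V' : X.MonadData} (e : V.ind = V'.ind) :
    V.IsThreeFamily ↔ V'.IsThreeFamily := by
  rw [MonadData.IsThreeFamily, MonadData.IsThreeFamily, e]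

theorem isStrongThreeFamily_congr {V V' : X.MonadData} (e : V.ind = V'.ind) :
    V.IsStrongThreeFamily ↔ V'.IsStrongThreeFamily := by
  rw [MonadData.IsStrongThreeFamily, MonadData.IsStrongThreeFamily, e]

end ToricSpace.NefFrame


/-! ## Certificates for all numbers of monads -/

namespace ToricCheck

open MonadSearch

/-- The number `c.χ` is the Euler number. -/
def eulerOK (c : Cert) (Ks : List Cone) (lev : ℕ) : Bool :=
  decide (3 * (lev * c.χ)
    = sumZ (Ks.map fun K => weight lev K * (powerL 1 K * (powerL 3 K - powerL 1 K ^ 3))))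

/-- The number `∫ c₁(𝒩)³`. -/
def cubeN (h : ℕ) (c : Cert) : ℤ :=
  sumZ ((List.range h).map fun r => sumZ ((List.range h).map fun b => sumZ ((List.range h).map
    fun a => (entry c.D a b r : ℤ) * (normalL c a * normalL c b * normalL c r))))

/-- The number `2 ∫ c₂(X) c₁(𝒩)`. -/
def chernN (h : ℕ) (c : Cert) : ℤ :=
  sumZ ((List.range h).map fun r => (c.S.getD r 0 : ℤ) * normalL c r)

/-- The permutation preserves the normal bundle. -/
def fixesN (h : ℕ) (c : Cert) (l : List ℕ) : Bool :=
  (List.range h).all fun i => decide (normalL c (l.getD i 0) = normalL c i)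

/-- The ambient space is a product of projective spaces. -/
def productOK (L : List Vec) (c : Cert) : Bool :=
  let f : ℕ → ℕ → ℤ := fun i a => bif Nat.beq (c.φ.getD a 0) i then -1 else 0
  Nat.beq c.φ.length 4 && c.φ.all (Nat.blt · L.length) &&
  (List.range L.length).all fun i => mem i c.φ &&
    (ray (rays L) (4 + i)).beq (f i 0, f i 1, f i 2, f i 3) &&
    decide (normalL c i = 1 - (f i 0 + f i 1 + f i 2 + f i 3)) &&
    (List.range (4 + L.length)).all fun ρ =>
      decide (((divisors c).getD i []).getD ρ 0 = bif Nat.beq ρ (4 + i) then 1 else 0)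

/-- The permutations in `c.G` are all nontrivial permutations that preserve the normal bundle. -/
def groupOK (h : ℕ) (c : Cert) : Bool :=
  ((box (List.replicate h (h - 1))).all fun l =>
    !(distinct l && fixesN h c l) || (l == List.range h || c.G.elem l)) &&
  c.G.all fun l => Nat.beq l.length h && l.all (Nat.blt · h) && distinct l && fixesN h c l &&
    (List.range h).all fun r => Nat.beq (c.S.getD (l.getD r 0) 0) (c.S.getD r 0) &&
      (List.range h).all fun b => (List.range h).all fun a =>
        Nat.beq (entry c.D (l.getD a 0) (l.getD b 0) (l.getD r 0)) (entry c.D a b r)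

/-- The symmetries of the fan do not identify monads. -/
def rigidOK (L : List Vec) (c : Cert) : Bool :=
  c.G.isEmpty && Nat.beq c.strong 0 && (Nat.beq c.total 0 ||
    ((List.range L.length).all (fun i => (List.range i).all fun j =>
      !decide (normalL c j = normalL c i)) ||
    c.rel.any fun r => Nat.beq r.2.length 1 && r.2.all fun s =>
      !mem s r.1 && !(ray (rays L) s).beq 0))

/-- The numbers of monads. -/
def monadsOK (h : ℕ) (c : Cert) : Bool :=
  boundOK h c.D c.S c.b &&
  tally (Entry.isRep h c.G) (Entry.keyOK h c.G) (Entry.three c.χ)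
    (Entry.strong c.χ (cubeN h c) (chernN h c)) (entries h c.D c.S c.b) c.total c.three c.strong

/-- An empty tensor `D` marks a space to be shown non-simple. For simple spaces an empty `φ` means
that no product structure is used and that the fan must not identify any monads. -/
def check (L : List Vec) (c : Cert) : Bool :=
  let V := rays L
  let Ks := c.cones V
  let lev := level Ks
  fanOK V c Ks && locOK V c Ks lev &&
  bif c.D.isEmpty then
    notSimpleOK L.length c && Nat.beq c.total 0 && Nat.beq c.three 0 && Nat.beq c.strong 0
  else
    frameOK L.length c && numbersOK V.length L.length c Ks lev && eulerOK c Ks lev &&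
    (bif c.φ.isEmpty then rigidOK L c else productOK L c && groupOK L.length c) &&
    monadsOK L.length c

end ToricCheck

/-! ### Soundness of the complete check -/

namespace ToricSpace

open ToricCheck MonadSearch LatticeMonad

/-- The classes of positive monads with a property. -/
def monadClasses (X : ToricSpace) (P : X.MonadData → Prop) : Set (Quotient X.monadSetoid) :=
  {q | ∃ V, Quotient.mk _ V = q ∧ V.IsPositiveMonad ∧ P V}

/-- The facts about a space that enter the count of monads. -/
structure HasSummary (X : ToricSpace) (simple : Prop) (a b c : ℕ) : Prop where
  form : ∃! d, X.IsIntersectionForm d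
  isSimple_iff : X.IsSimple ↔ simple
  eq_zero : ¬ X.IsSimple → a = 0 ∧ b = 0 ∧ c = 0
  finite : X.IsSimple → (X.monadClasses fun _ => True).Finite
  total : X.IsSimple → (X.monadClasses fun _ => True).ncard = a
  three : X.IsSimple → (X.monadClasses MonadData.IsThreeFamily).ncard = b
  strong : X.IsSimple → (X.monadClasses MonadData.IsStrongThreeFamily).ncard = c
  product : c ≠ 0 → X.IsProductOfProjectiveSpaces

variable {L : List Vec} {c : Cert}

theorem exists_represents {h : ℕ} {l : List ℕ} (h1 : l.length = h) (h2 : ∀ i ∈ l, i < h)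
    (h3 : l.Nodup) : ∃ g : Equiv.Perm (Fin h), Represents l g := by
  have hmem : ∀ i : Fin h, l.getD i 0 ∈ l := fun i => by
    rw [List.getD_eq_getElem _ _ (by rw [h1]; exact i.2)]
    exact List.getElem_mem _
  set f : Fin h → Fin h := fun i => ⟨l.getD i 0, h2 _ (hmem i)⟩ with hf
  have hinj : Function.Injective f := by
    intro i j e
    have e1 : l.getD i 0 = l.getD j 0 := congrArg Fin.val e
    rw [List.getD_eq_getElem _ _ (by rw [h1]; exact i.2),
      List.getD_eq_getElem _ _ (by rw [h1]; exact j.2)] at e1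
    exact Fin.ext ((List.Nodup.getElem_inj_iff h3).1 e1)
  exact ⟨Equiv.ofBijective f (Finite.injective_iff_bijective.1 hinj), h1, fun i => rfl⟩

theorem represents_ofFn {h : ℕ} (g : Equiv.Perm (Fin h)) :
    Represents (List.ofFn fun i => (g i : ℕ)) g :=
  ⟨by simp, fun i => by rw [List.getD_eq_getElem _ _ (by simp)]; simp⟩

theorem comp_eq_of_fixesN {h : ℕ} {l : List ℕ} {g : Equiv.Perm (Fin h)} (hl : Represents l g) :
    fixesN h c l = true ↔ (fun r : Fin h => normalL c r) ∘ g = fun r : Fin h => normalL c r := by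
  simp only [fixesN, List.all_eq_true, List.mem_range, decide_eq_true_eq, funext_iff,
    Function.comp_apply, ← hl.getD_eq]
  exact ⟨fun H i => H i i.2, fun H i hi => H ⟨i, hi⟩⟩

/-- The list of values of any permutation lies in the box of all lists with entries below `h`, so
the stabilizer of the normal bundle is searched exhaustively. -/
theorem groupOK_sound {h : ℕ} (H : groupOK h c = true) :
    (∀ g ∈ NefFrame.stabilizer (fun r : Fin h => normalL c r), g = 1 ∨ ∃ l ∈ c.G, Represents l g) ∧
    (∀ l ∈ c.G, ∃ g ∈ NefFrame.stabilizer (fun r : Fin h => normalL c r), Represents l g) ∧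
    ∀ g ∈ NefFrame.stabilizer (fun r : Fin h => normalL c r),
      IsInvariant (form h c.D) (vec h c.S) g := by
  simp only [groupOK, Bool.and_eq_true, List.all_eq_true, Bool.or_eq_true, beq_iff_eq,
    List.elem_eq_mem, decide_eq_true_eq, Nat.blt_eq, Nat.beq_eq, List.mem_range,
    distinct_iff] at H
  obtain ⟨H1, H2⟩ := H
  have key : ∀ g ∈ NefFrame.stabilizer (fun r : Fin h => normalL c r),
      g = 1 ∨ ∃ l ∈ c.G, Represents l g := by
    intro g hg
    have hl := represents_ofFn g
    set l := List.ofFn fun i => (g i : ℕ) with hldef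
    have hbox : l ∈ box (List.replicate h (h - 1)) := by
      rw [mem_box]
      refine ⟨by simp [hl.length_eq], fun i => ?_⟩
      by_cases hi : i < h
      · rw [hl.getD_eq ⟨i, hi⟩, List.getD_eq_getElem _ _ (by simpa using hi)]
        simp only [List.getElem_replicate]
        omega
      · rw [List.getD_eq_default _ _ (by rw [hl.length_eq]; omega)]
        exact Nat.zero_le _
    have hnd : l.Nodup := List.nodup_ofFn.2 fun i j e => g.injective (Fin.ext e)
    rcases H1 l hbox with h1 | h1 | h1
    · have h2 : (distinct l && fixesN h c l) = true := by
        rw [Bool.and_eq_true, distinct_iff]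
        exact ⟨hnd, (comp_eq_of_fixesN hl).2 hg⟩
      rw [h2] at h1
      exact absurd h1 (by decide)
    · left
      ext i
      rw [← hl.getD_eq, h1, List.getD_eq_getElem _ _ (by simp)]
      simp
    · exact Or.inr ⟨l, h1, hl⟩
  refine ⟨key, fun l hl => ?_, fun g hg => ?_⟩
  · obtain ⟨⟨⟨⟨h1, h2⟩, h3⟩, h4⟩, -⟩ := H2 l hl
    obtain ⟨g, hg⟩ := exists_represents h1 h2 h3
    exact ⟨g, (comp_eq_of_fixesN hg).1 h4, hg⟩
  · rcases key g hg with rfl | ⟨l, hl, hlg⟩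
    · exact ⟨fun _ _ _ => rfl, fun _ => rfl⟩
    · obtain ⟨-, h5⟩ := H2 l hl
      refine ⟨fun a b r => ?_, fun r => ?_⟩
      · have := (h5 r r.2).2 b b.2 a a.2
        rwa [hlg.getD_eq, hlg.getD_eq, hlg.getD_eq] at this
      · have := (h5 r r.2).1
        rwa [hlg.getD_eq] at this

theorem productOK_sound (H : productOK L c = true) : ∃ φ : Fin 4 → Fin L.length,
    (∀ i a, (ofList L).v (Fin.natAdd 4 i) a = if φ a = i then -1 else 0) ∧
    Function.Surjective φ ∧
    (∀ i : Fin L.length, normalL c i = Fintype.card {a // φ a = i} + 1) ∧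
    ∀ i : Fin L.length, (ofList L).cls (divisor L ((divisors c).getD i []))
      = (ofList L).toricDivisor (Fin.natAdd 4 i) := by
  simp only [productOK, Bool.and_eq_true, List.all_eq_true, Nat.blt_eq, Nat.beq_eq, List.mem_range,
    decide_eq_true_eq, mem_iff] at H
  obtain ⟨⟨H1, H2⟩, H3⟩ := H
  have hmem : ∀ a : Fin 4, c.φ.getD a 0 ∈ c.φ := fun a => by
    rw [List.getD_eq_getElem _ _ (by rw [H1]; exact a.2)]
    exact List.getElem_mem _
  have hf : ∀ (a : Fin 4) (i : Fin L.length),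
      (bif Nat.beq (c.φ.getD a 0) i then (-1 : ℤ) else 0)
        = if (⟨c.φ.getD a 0, H2 _ (hmem a)⟩ : Fin L.length) = i then -1 else 0 := by
    intro a i
    by_cases e : c.φ.getD a 0 = i
    · rw [if_pos (Fin.ext e), e, Nat.beq_refl, cond_true]
    · rw [if_neg fun e' => e (congrArg Fin.val e'), beq_eq_false e, cond_false]
  refine ⟨fun a => ⟨c.φ.getD a 0, H2 _ (hmem a)⟩, fun i a => ?_, fun i => ?_, fun i => ?_,
    fun i => ?_⟩
  · have hvi : (ofList L).v (Fin.natAdd 4 i) = (ray (rays L) (4 + i)).toFun := v_ofList _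
    rw [hvi, Vec.eq_of_beq (H3 i i.2).1.1.2, ← hf]
    fin_cases a <;> rfl
  · obtain ⟨a, ha, e⟩ := List.mem_iff_getElem.1 (H3 i i.2).1.1.1
    exact ⟨⟨a, by omega⟩, Fin.ext ((List.getD_eq_getElem _ _ ha).trans e)⟩
  · rw [(H3 i i.2).1.2, Fintype.card_subtype, Finset.card_filter]
    push_cast
    have h1 : ∀ a : Fin 4, (if (⟨c.φ.getD a 0, H2 _ (hmem a)⟩ : Fin L.length) = i then (1 : ℤ) else 0)
        = -(bif Nat.beq (c.φ.getD a 0) i then (-1 : ℤ) else 0) := by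
      intro a
      rw [hf]
      split_ifs <;> rfl
    have h2 : ∀ x y z w : ℤ, 1 - (x + y + z + w) = -x + -y + -z + -w + 1 := by
      intros
      ring
    rw [Finset.sum_congr rfl fun a _ => h1 a, Fin.sum_univ_four]
    exact h2 _ _ _ _
  · change _ = (ofList L).cls (Pi.single _ 1)
    congr 1
    ext ρ
    rw [divisor, (H3 i i.2).2 ρ ρ.2]
    by_cases e : ρ = Fin.natAdd 4 i
    · rw [e]
      refine Eq.trans ?_ (Pi.single_eq_same (M := fun _ => ℤ) _ _).symm
      rw [Fin.val_natAdd, Nat.beq_refl, cond_true]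
    · refine Eq.trans ?_ (Pi.single_eq_of_ne (M := fun _ => ℤ) e _).symm
      have e' : (ρ : ℕ) ≠ 4 + i := fun e' => e (Fin.ext e')
      rw [beq_eq_false e', cond_false]

/-- Two criteria: the normal bundle has pairwise distinct coordinates, or a relation with a single
ray on the right, not occurring on the left, shows that the space is not a product. -/
theorem rigidOK_sound {Ks : List Cone} {lev : ℕ} (hc : Checked L c Ks lev)
    (H : rigidOK L c = true) : c.G = [] ∧ c.strong = 0 ∧ (c.total ≠ 0 →
      ¬ (ofList L).IsProductOfProjectiveSpaces ∨
        Function.Injective fun r : Fin L.length => normalL c r) := by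
  simp only [rigidOK, Bool.and_eq_true, Bool.or_eq_true, List.all_eq_true, List.any_eq_true,
    List.isEmpty_iff, Nat.beq_eq, List.mem_range, Bool.not_eq_true', decide_eq_false_iff_not] at H
  obtain ⟨⟨h1, h2⟩, h3⟩ := H
  refine ⟨h1, h2, fun h0 => ?_⟩
  rcases h3 with h3 | h3 | ⟨r, hr, h4, h5⟩
  · exact absurd h3 h0
  · right
    intro i j e
    rcases lt_trichotomy i j with hij | hij | hij
    · exact absurd e (h3 j j.2 i hij)
    · exact hij
    · exact absurd e.symm (h3 i i.2 j hij)
  · left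
    obtain ⟨s, hs⟩ := List.length_eq_one_iff.1 h4
    obtain ⟨h6, h7⟩ := h5 s (by simp [hs])
    obtain ⟨R, -, hP, hR⟩ := hc.exists_rel hr
    rw [hs, Multiset.coe_singleton, Multiset.map_eq_singleton] at hR
    obtain ⟨σ, hσ, rfl⟩ := hR
    refine R.not_isProduct hσ (fun hmem => ?_) ?_
    · have := Multiset.mem_map_of_mem Fin.val hmem
      rw [hP, Multiset.mem_coe, ← mem_iff, h6] at this
      exact absurd this (by decide)
    · rw [v_ofList]
      exact Vec.toFun_ne_zero (by rw [h7]; rfl)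

theorem eulerNumber_eq {Ks : List Cone} {lev : ℕ} (hc : Checked L c Ks lev)
    (H : eulerOK c Ks lev = true) : (ofList L).eulerNumber = c.χ := by
  have h1 := hc.three_mul_eulerNumber
  rw [eulerOK, decide_eq_true_eq] at H
  have hlev : (lev : ℤ) ≠ 0 := by exact_mod_cast hc.loc.pos
  rw [← H] at h1
  exact mul_left_cancel₀ hlev (mul_left_cancel₀ three_ne_zero h1)

theorem normalCubed_eq {S : Fin L.length → ℕ}
    (F : (ofList L).NefFrame (form L.length c.D) S fun r => normalL c r) :
    (ofList L).normalCubed = cubeN L.length c := by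
  have hsum : ∀ f : ℕ → ℤ, sumZ ((List.range L.length).map f) = ∑ r : Fin L.length, f r :=
    fun f => by rw [sumZ_eq, ← Finset.sum_range]; rfl
  simp only [normalCubed, F.triple_eq, F.normal, cubeN, hsum]
  rfl

theorem two_mul_c₂_normalBundle {d : Fin L.length → Fin L.length → Fin L.length → ℕ}
    (F : (ofList L).NefFrame d (vec L.length c.S) fun r => normalL c r) :
    2 * (ofList L).c₂ (ofList L).normalBundle = chernN L.length c := by
  have hsum : ∀ f : ℕ → ℤ, sumZ ((List.range L.length).map f) = ∑ r : Fin L.length, f r :=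
    fun f => by rw [sumZ_eq, ← Finset.sum_range]; rfl
  simp only [F.c₂_eq, F.normal, chernN, hsum]
  rfl

/-- The frame turns monads into codes, the list of entries contains each code once, and the tally
counts the representatives. Three choices of the property give the three numbers. -/
theorem check_sound (H : check L c = true) :
    (ofList L).HasSummary (c.D.isEmpty = false) c.total c.three c.strong := by
  rw [check] at H
  set Ks := c.cones (rays L)
  set lev := level Ks
  simp only [Bool.and_eq_true] at H
  obtain ⟨⟨h1, h2⟩, h3⟩ := H
  have hc := checked_of h1 h2
  have hform := hc.existsUnique_form
  cases hD : c.D.isEmpty with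
  | true =>
    simp only [hD, cond_true, Bool.and_eq_true, Nat.beq_eq] at h3
    obtain ⟨⟨⟨h3, h4⟩, h5⟩, h6⟩ := h3
    have hns := hc.not_isSimple h3
    exact ⟨hform, by simp [hns], fun _ => ⟨h4, h5, h6⟩, fun h => absurd h hns,
      fun h => absurd h hns, fun h => absurd h hns, fun h => absurd h hns, fun h => absurd h6 h⟩
  | false =>
    simp only [hD, cond_false, Bool.and_eq_true] at h3
    obtain ⟨⟨⟨⟨hf, hn⟩, hχ⟩, hmode⟩, hm⟩ := h3
    obtain ⟨hs, F, hF⟩ := hc.exists_frame hf hn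
    obtain ⟨hDl, hSl, -, -⟩ := numbersOK_sound hn
    rw [monadsOK, Bool.and_eq_true] at hm
    obtain ⟨hb, ht⟩ := hm
    obtain ⟨hkey, t1, t2, t3⟩ := tally_sound ht
    have hsym : (c.strong ≠ 0 → (ofList L).IsProductOfProjectiveSpaces) ∧
        ∃ Γ, F.IsSymmetry Γ ∧ (∀ g ∈ Γ, g = 1 ∨ ∃ l ∈ c.G, Represents l g) ∧
          ∀ l ∈ c.G, ∃ g ∈ Γ, Represents l g := by
      cases hφ : c.φ.isEmpty with
      | true =>
        rw [hφ, cond_true] at hmode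
        obtain ⟨hG, h0, hr⟩ := rigidOK_sound hc hmode
        -- With an empty list of permutations every entry is a representative, so a valid code makes
        -- the total nonzero and the rigidity criterion applies.
        refine ⟨fun h => absurd h0 h, ⊥, F.isSymmetry_bot fun ⟨x, hx⟩ => hr ?_,
          fun g hg => Or.inl (Subgroup.mem_bot.1 hg), by simp [hG]⟩
        obtain ⟨e, he, -⟩ := entries_complete hDl hSl hb hx
        rw [← t1]
        refine (List.length_pos_of_mem (List.mem_filter.2 ⟨he, ?_⟩)).ne'
        simp [Entry.isRep, hG]
      | false =>
        rw [hφ, cond_false, Bool.and_eq_true] at hmode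
        obtain ⟨φ, hv, hφs, hn', htd⟩ := productOK_sound hmode.1
        obtain ⟨hG1, hG2, hinv⟩ := groupOK_sound hmode.2
        have hprod := isProduct_of_factors hv hφs
        refine ⟨fun _ => hprod, _, F.isSymmetry_stabilizer hprod hinv fun g hg => ?_, hG1, hG2⟩
        exact F.exists_symmetry hv hn' (fun i => by rw [← htd, hF]) hg
    obtain ⟨hprod, Γ, hΓ, hG1, hG2⟩ := hsym
    have hχ' := eulerNumber_eq hc hχ
    have hM := normalCubed_eq F
    have hC := two_mul_c₂_normalBundle F
    have r1 := hΓ.ncard_eq_length hDl hSl hb hG1 hG2 hkey (P := fun _ => True)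
      (p := fun _ => true) (fun _ _ _ => Iff.rfl) (fun _ _ => by simp)
    have r2 := hΓ.ncard_eq_length hDl hSl hb hG1 hG2 hkey (P := MonadData.IsThreeFamily)
      (p := Entry.three c.χ) (fun _ _ e => NefFrame.isThreeFamily_congr e) fun e he => by
        rw [← hχ']
        exact NefFrame.three_iff (entries_sound hDl hSl he).2
    have r3 := hΓ.ncard_eq_length hDl hSl hb hG1 hG2 hkey (P := MonadData.IsStrongThreeFamily)
      (p := Entry.strong c.χ (cubeN L.length c) (chernN L.length c))
      (fun _ _ e => NefFrame.isStrongThreeFamily_congr e) fun e he => by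
        rw [← hχ']
        exact NefFrame.strong_iff (entries_sound hDl hSl he).2 hM hC
    rw [t2] at r2
    rw [t3] at r3
    simp only [Bool.and_true] at r1
    rw [t1] at r1
    exact ⟨hform, by simp [hs], fun h => absurd hs h, fun _ => r1.1, fun _ => r1.2, fun _ => r2.2,
      fun _ => r3.2, hprod⟩

end ToricSpace


/-! ## The certificates -/

namespace ToricCheck

/-- Corresponding spaces and certificates. -/
def checkAll : List (List Vec) → List Cert → Bool
  | [], [] => true
  | L :: Ls, c :: cs => check L c && checkAll Ls cs
  | _, _ => false

theorem forall₂_of_checkAll {Ls : List (List Vec)} {cs : List Cert} (H : checkAll Ls cs = true) :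
    List.Forall₂ (fun L c => check L c = true) Ls cs := by
  induction Ls generalizing cs with
  | nil =>
    cases cs with
    | nil => exact .nil
    | cons c cs => exact absurd H (by simp [checkAll])
  | cons L Ls ih =>
    cases cs with
    | nil => exact absurd H (by simp [checkAll])
    | cons c cs =>
      rw [checkAll, Bool.and_eq_true] at H
      exact .cons H.1 (ih H.2)

set_option maxRecDepth 1000000

/-- The first, second and seventh entries belong to `ℙ⁴`, `ℙ¹ × ℙ³` and `ℙ² × ℙ²`; they have a
nonempty `φ`. -/
def certs1to10 : List Cert := [
  ⟨[([0,1,2,3,4],[])], (-2,-1,1,2), [[1]], [[[5]]], [100], 6, -200, [0,0,0,0], [], 43, 9, 5⟩,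
  ⟨[([0,4],[]),([1,2,3,5],[])], (-1,-2,-1,1), [[1,0],[0,1]], [[[0,0],[0,4]],[[0,4],[4,2]]], [48,
    88], 5, -168, [0,1,1,1], [], 975, 57, 0⟩,
  ⟨[([1,2,3,5],[0]),([0,4],[])], (-2,-2,-1,1), [[0,1],[1,0]], [[[2,5],[5,5]],[[5,5],[5,5]]], [88,
    100], 2, -176, [], [], 4, 1, 0⟩,
  ⟨[([2,3,5],[0]),([0,1,4],[])], (-2,-1,-2,-1), [[0,1],[1,0]], [[[0,3],[3,5]],[[3,5],[5,5]]], [72,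
    100], 2, -168, [], [], 9, 1, 0⟩,
  ⟨[([2,3,5],[0,1]),([0,1,4],[])], (-2,-1,-2,-1), [[0,1],[1,0]], [[[0,3],[3,7]],[[3,7],[7,11]]],
    [72,124], 2, -168, [], [], 0, 0, 0⟩,
  ⟨[([3,5],[0]),([0,1,2,4],[])], (-2,-1,1,-1), [[0,1],[1,0]], [[[0,0],[0,4]],[[0,4],[4,5]]], [48,
    100], 6, -168, [], [], 207, 33, 0⟩,
  ⟨[([1,2,4],[]),([0,3,5],[])], (-1,-1,1,1), [[1,0],[0,1]], [[[0,3],[3,3]],[[3,3],[3,0]]], [72,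
    72], 3, -162, [1,0,0,1], [[1,0]], 75, 12, 1⟩,
  ⟨[([1,2,3,5],[0,0]),([0,4],[])], (-1,-1,1,2), [[0,1],[1,0]], [[[2,6],[6,12]],[[6,12],[12,24]]],
    [88,168], 1, -200, [], [], 0, 0, 0⟩,
  ⟨[([2,3,5],[0,0]),([0,1,4],[])], (-1,-2,-1,1), [[0,1],[1,0]], [[[0,3],[3,7]],[[3,7],[7,14]]],
    [72,136], 2, -186, [], [], 0, 0, 0⟩,
  ⟨[([1,2,3,5],[0,0,0]),([0,4],[])], (-2,-1,1,2), [[0,1],[1,0]], [[[2,7],[7,21]],[[7,21],[21,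
    63]]], [88,252], 0, -240, [], [], 0, 0, 0⟩]

/-- The kernel evaluates the whole check, including the knapsack searches; nothing in the
certificates is trusted. -/
theorem checkAll_certs1to10 : checkAll spaces1to10 certs1to10 = true := by
  decide +kernel

def certs11to20 : List Cert := [
  ⟨[([1,5],[4]),([2,3,6],[0]),([0,4],[])], (-2,-1,-2,-1), [[0,1,0],[0,0,1],[1,1,0]], [[[0,0,0],[0,
    2,4],[0,4,4]],[[0,2,4],[2,0,3],[4,3,5]],[[0,4,4],[4,3,5],[4,5,5]]], [48,72,100], 0, -136, [],
    [], 0, 0, 0⟩,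
  ⟨[([3,6],[1]),([1,2,5],[]),([0,4],[])], (-1,-1,1,-1), [[0,0,1],[0,1,0],[1,0,0]], [[[0,0,0],[0,2,
    3],[0,3,0]],[[0,2,3],[2,2,4],[3,4,0]],[[0,3,0],[3,4,0],[0,0,0]]], [48,88,48], 2, -144, [], [],
    74, 12, 0⟩,
  ⟨[([0,1,2],[3,6]),([3,5,6],[0]),([3,4,6],[1,2]),([0,4],[]),([1,2,5],[])], (-2,1,2,1), [[1,1,-1],
    [0,1,0],[1,0,0]], [[[11,11,7],[11,9,7],[7,7,3]],[[11,9,7],[9,4,7],[7,7,3]],[[7,7,3],[7,7,3],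
    [3,3,0]]], [124,104,72], 0, -144, [], [], 0, 0, 0⟩,
  ⟨[([0,1],[6]),([2,3,5,6],[0]),([4,6],[1]),([0,4],[]),([1,2,3,5],[])], (-2,1,-1,2), [[1,1,-1],[0,
    1,0],[1,0,0]], [[[5,5,4],[5,5,4],[4,4,0]],[[5,5,4],[5,2,4],[4,4,0]],[[4,4,0],[4,4,0],[0,0,
    0]]], [100,88,48], 0, -144, [], [], 0, 0, 0⟩,
  ⟨[([0,1],[6]),([2,3,5,6],[0,0]),([4,6],[1]),([0,4],[]),([1,2,3,5],[0])], (-2,-1,-2,1), [[1,1,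
    -1],[0,1,0],[1,0,0]], [[[24,12,20],[12,6,10],[20,10,10]],[[12,6,10],[6,2,5],[10,5,5]],[[20,10,
    10],[10,5,5],[10,5,5]]], [168,88,100], 0, -160, [], [], 0, 0, 0⟩,
  ⟨[([3,6],[1]),([1,2,5],[0]),([0,4],[])], (-2,-2,1,1), [[0,0,1],[0,1,0],[1,0,0]], [[[0,0,0],[0,2,
    4],[0,4,4]],[[0,2,4],[2,2,5],[4,5,5]],[[0,4,4],[4,5,5],[4,5,5]]], [48,88,100], 0, -152, [],
    [], 0, 0, 0⟩,
  ⟨[([1,3,6],[]),([2,5],[0]),([0,4],[])], (-1,-1,-1,1), [[0,0,1],[0,1,0],[1,0,0]], [[[0,2,3],[2,0,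
    3],[3,3,3]],[[2,0,3],[0,0,0],[3,0,0]],[[3,3,3],[3,0,0],[3,0,0]]], [72,48,72], 2, -144, [], [],
    34, 8, 0⟩,
  ⟨[([0,1,2],[3,6]),([3,5,6],[0,0]),([3,4,6],[1,2]),([0,4],[]),([1,2,5],[0])], (-1,-2,2,-1), [[1,
    1,-1],[0,1,0],[1,0,0]], [[[46,23,36],[23,11,18],[36,18,26]],[[23,11,18],[11,4,9],[18,9,13]],
    [[36,18,26],[18,9,13],[26,13,17]]], [200,104,148], 0, -168, [], [], 0, 0, 0⟩,
  ⟨[([2,3,6],[1,4]),([1,5],[0]),([0,4],[])], (-2,-2,-1,1), [[0,0,1],[0,1,0],[1,0,1]], [[[0,2,3],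
    [2,2,6],[3,6,7]],[[2,2,6],[2,2,6],[6,6,10]],[[3,6,7],[6,6,10],[7,10,11]]], [72,88,124], 0,
    -144, [], [], 0, 0, 0⟩,
  ⟨[([2,3,6],[1]),([1,5],[0]),([0,4],[])], (-2,-1,-1,2), [[0,0,1],[0,1,0],[1,0,0]], [[[0,2,3],[2,
    2,5],[3,5,5]],[[2,2,5],[2,2,5],[5,5,5]],[[3,5,5],[5,5,5],[5,5,5]]], [72,88,100], 0, -156, [],
    [], 0, 0, 0⟩]

theorem checkAll_certs11to20 : checkAll spaces11to20 certs11to20 = true := by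
  decide +kernel

/-- The sixth entry is `ℙ¹ × ℙ¹ × ℙ²`, where only the exchange of the two lines acts. -/
def certs21to30 : List Cert := [
  ⟨[([2,3,6],[0]),([1,5],[0]),([0,4],[])], (-2,-1,-1,1), [[0,0,1],[0,1,0],[1,0,0]], [[[0,2,3],[2,
    0,4],[3,4,7]],[[2,0,4],[0,0,0],[4,0,4]],[[3,4,7],[4,0,4],[7,4,11]]], [72,48,124], 0, -160, [],
    [], 0, 0, 0⟩,
  ⟨[([3,6],[0]),([2,5],[1]),([0,1,4],[])], (-1,1,1,-1), [[0,0,1],[0,1,0],[1,0,0]], [[[0,0,0],[0,0,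
    3],[0,3,4]],[[0,0,3],[0,0,0],[3,0,4]],[[0,3,4],[3,0,4],[4,4,5]]], [48,48,100], 1, -138, [],
    [], 9, 9, 0⟩,
  ⟨[([1,6],[2]),([2,3,5],[0,1]),([0,2,4],[6]),([0,1,4],[]),([3,5,6],[0])], (-2,2,-1,1), [[1,0,1],
    [0,1,0],[1,0,0]], [[[11,7,11],[7,3,7],[11,7,9]],[[7,3,7],[3,0,3],[7,3,5]],[[11,7,9],[7,3,5],
    [9,5,5]]], [124,72,100], 0, -140, [], [], 0, 0, 0⟩,
  ⟨[([3,6],[2]),([2,5],[0]),([0,1,4],[])], (-1,1,-1,-1), [[0,0,1],[0,1,0],[1,0,0]], [[[0,0,0],[0,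
    0,3],[0,3,4]],[[0,0,3],[0,0,3],[3,3,5]],[[0,3,4],[3,3,5],[4,5,5]]], [48,72,100], 1, -150, [],
    [], 0, 0, 0⟩,
  ⟨[([3,6],[0]),([2,5],[0]),([0,1,4],[])], (-1,1,-1,-1), [[0,0,1],[0,1,0],[1,0,0]], [[[0,0,0],[0,
    0,3],[0,3,4]],[[0,0,3],[0,0,0],[3,0,4]],[[0,3,4],[3,0,4],[4,4,8]]], [48,48,112], 2, -156, [],
    [], 0, 0, 0⟩,
  ⟨[([1,4],[]),([0,5],[]),([2,3,6],[])], (-1,-1,-1,1), [[1,0,0],[0,1,0],[0,0,1]], [[[0,0,0],[0,0,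
    3],[0,3,2]],[[0,0,3],[0,0,0],[3,0,2]],[[0,3,2],[3,0,2],[2,2,0]]], [48,48,72], 3, -144, [1,0,2,
    2], [[1,0,2]], 439, 108, 0⟩,
  ⟨[([2,3,6],[0]),([0,5],[]),([1,4],[])], (-2,-1,-1,1), [[0,0,1],[0,1,0],[1,0,0]], [[[0,2,2],[2,2,
    4],[2,4,0]],[[2,2,4],[2,2,4],[4,4,0]],[[2,4,0],[4,4,0],[0,0,0]]], [72,88,48], 1, -148, [], [],
    0, 0, 0⟩,
  ⟨[([2,3,6],[0,1]),([0,5],[]),([1,4],[])], (-2,2,-1,1), [[0,0,1],[0,1,0],[1,0,0]], [[[0,2,2],[2,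
    2,5],[2,5,2]],[[2,2,5],[2,2,5],[5,5,5]],[[2,5,2],[5,5,5],[2,5,2]]], [72,88,88], 0, -152, [],
    [], 0, 0, 0⟩,
  ⟨[([0,1],[6]),([3,5,6],[1]),([2,4,6],[0]),([0,3,5],[]),([1,2,4],[])], (-1,1,-1,1), [[1,1,-1],[0,
    1,0],[1,0,0]], [[[5,5,5],[5,3,5],[5,5,3]],[[5,3,5],[3,0,3],[5,3,3]],[[5,5,3],[5,3,3],[3,3,
    0]]], [100,72,72], 0, -136, [], [], 0, 0, 0⟩,
  ⟨[([0,1,2],[6]),([3,5,6],[1,2]),([4,6],[0]),([0,3,5],[]),([1,2,4],[])], (-2,-1,1,1), [[1,1,-1],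
    [0,1,0],[1,0,0]], [[[11,7,9],[7,3,6],[9,6,3]],[[7,3,6],[3,0,3],[6,3,3]],[[9,6,3],[6,3,3],[3,3,
    0]]], [124,72,72], 0, -138, [], [], 0, 0, 0⟩]

theorem checkAll_certs21to30 : checkAll spaces21to30 certs21to30 = true := by
  decide +kernel

/-- The last entry is `(ℙ¹)⁴`; its 23 permutations are the nontrivial elements of the symmetric
group on the factors. -/
def certs31to40 : List Cert := [
  ⟨[([1,5],[4]),([2,3,6],[0,0]),([0,4],[])], (-1,-2,-1,1), [[0,1,0],[0,0,1],[1,1,0]], [[[0,0,0],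
    [0,2,5],[0,5,10]],[[0,2,5],[2,0,3],[5,3,7]],[[0,5,10],[5,3,7],[10,7,14]]], [48,72,136], 0,
    -136, [], [], 0, 0, 0⟩,
  ⟨[([0,1],[6]),([2,3,5,6],[0,0,0]),([4,6],[1]),([0,4],[]),([1,2,3,5],[0,0])], (-1,-2,-1,1), [[1,
    1,-1],[0,1,0],[1,0,0]], [[[63,21,54],[21,7,18],[54,18,36]],[[21,7,18],[7,2,6],[18,6,12]],[[54,
    18,36],[18,6,12],[36,12,24]]], [252,88,168], 0, -192, [], [], 0, 0, 0⟩,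
  ⟨[([3,6],[1]),([1,2,5],[0,0]),([0,4],[])], (-1,1,-1,1), [[0,0,1],[0,1,0],[1,0,0]], [[[0,0,0],[0,
    2,5],[0,5,10]],[[0,2,5],[2,2,6],[5,6,12]],[[0,5,10],[5,6,12],[10,12,24]]], [48,88,168], 0,
    -176, [], [], 0, 0, 0⟩,
  ⟨[([2,3,6],[1,1]),([1,5],[0]),([0,4],[])], (-2,-1,1,2), [[0,0,1],[0,1,0],[1,0,0]], [[[0,2,3],[2,
    4,7],[3,7,7]],[[2,4,7],[4,8,14],[7,14,14]],[[3,7,7],[7,14,14],[7,14,14]]], [72,136,136], 0,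
    -180, [], [], 0, 0, 0⟩,
  ⟨[([2,3,6],[0,5]),([1,5],[0]),([0,4],[])], (-2,1,-1,2), [[0,0,1],[0,1,1],[1,0,0]], [[[0,2,3],[2,
    2,6],[3,6,9]],[[2,2,6],[2,2,6],[6,6,12]],[[3,6,9],[6,6,12],[9,12,21]]], [72,88,156], 0, -176,
    [], [], 0, 0, 0⟩,
  ⟨[([2,3,6],[0,0]),([1,5],[0]),([0,4],[])], (-1,-2,1,2), [[0,0,1],[0,1,0],[1,0,0]], [[[0,2,3],[2,
    0,5],[3,5,11]],[[2,0,5],[0,0,0],[5,0,10]],[[3,5,11],[5,0,10],[11,10,32]]], [72,48,184], 0,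
    -184, [], [], 0, 0, 0⟩,
  ⟨[([2,3,6],[0,0]),([0,5],[6]),([1,4,6],[5]),([0,1,4],[]),([2,3,5],[0])], (-2,-1,-2,-1), [[0,1,
    1],[1,1,0],[1,0,0]], [[[0,3,3],[3,7,7],[3,7,5]],[[3,7,7],[7,14,14],[7,14,10]],[[3,7,5],[7,14,
    10],[5,10,5]]], [72,136,100], 0, -146, [], [], 0, 0, 0⟩,
  ⟨[([2,3,6],[0,0]),([0,5],[]),([1,4],[])], (-1,-1,-1,1), [[0,0,1],[0,1,0],[1,0,0]], [[[0,2,2],[2,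
    4,5],[2,5,0]],[[2,4,5],[4,8,10],[5,10,0]],[[2,5,0],[5,10,0],[0,0,0]]], [72,136,48], 0, -160,
    [], [], 0, 0, 0⟩,
  ⟨[([0,1],[6]),([2,3],[7]),([5,6,7],[1,2]),([4,6,7],[0,3]),([0,3,5],[]),([0,5,7],[2]),([1,2,4],
    []),([1,4,7],[3]),([2,4,6],[0]),([3,5,6],[1])], (-1,1,-1,1), [[1,1,-1,0],[1,1,0,-1],[0,1,0,0],
    [1,0,0,0]], [[[5,9,5,5],[9,9,7,7],[5,7,3,5],[5,7,5,3]],[[9,9,7,7],[9,5,5,5],[7,5,3,5],[7,5,5,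
    3]],[[5,7,3,5],[7,5,3,5],[3,3,0,3],[5,5,3,3]],[[5,7,5,3],[7,5,5,3],[5,5,3,3],[3,3,3,0]]],
    [100,100,72,72], 0, -112, [], [], 0, 0, 0⟩,
  ⟨[([3,4],[]),([2,5],[]),([1,6],[]),([0,7],[])], (-1,-1,-1,-1), [[1,0,0,0],[0,1,0,0],[0,0,1,0],
    [0,0,0,1]], [[[0,0,0,0],[0,0,2,2],[0,2,0,2],[0,2,2,0]],[[0,0,2,2],[0,0,0,0],[2,0,0,2],[2,0,2,
    0]],[[0,2,0,2],[2,0,0,2],[0,0,0,0],[2,2,0,0]],[[0,2,2,0],[2,0,2,0],[2,2,0,0],[0,0,0,0]]], [48,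
    48,48,48], 2, -128, [3,2,1,0], [[0,1,3,2],[0,2,1,3],[0,2,3,1],[0,3,1,2],[0,3,2,1],[1,0,2,3],
    [1,0,3,2],[1,2,0,3],[1,2,3,0],[1,3,0,2],[1,3,2,0],[2,0,1,3],[2,0,3,1],[2,1,0,3],[2,1,3,0],[2,
    3,0,1],[2,3,1,0],[3,0,1,2],[3,0,2,1],[3,1,0,2],[3,1,2,0],[3,2,0,1],[3,2,1,0]], 321, 15, 15⟩]

theorem checkAll_certs31to40 : checkAll spaces31to40 certs31to40 = true := by
  decide +kernel

/-- The fourth and the ninth entry are not simple: with `h = 4` they list five nef divisors on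
distinct facets, and the intersection numbers are omitted. -/
def certs41to50 : List Cert := [
  ⟨[([1,5],[4]),([0,2],[7]),([3,6,7],[0]),([4,7],[2]),([0,4],[]),([2,3,6],[])], (-1,1,1,-1), [[0,
    1,0,0],[1,1,1,-1],[0,0,1,0],[1,1,0,0]], [[[0,0,0,0],[0,4,4,3],[0,4,2,3],[0,3,3,0]],[[0,4,4,3],
    [4,5,5,5],[4,5,3,5],[3,5,5,3]],[[0,4,2,3],[4,5,3,5],[2,3,0,3],[3,5,3,3]],[[0,3,3,0],[3,5,5,3],
    [3,5,3,3],[0,3,3,0]]], [48,100,72,72], 0, -118, [], [], 0, 0, 0⟩,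
  ⟨[([1,5],[4]),([0,2],[7]),([3,6,7],[0,0]),([4,7],[2]),([0,4],[]),([2,3,6],[0])], (-2,1,-1,-2),
    [[0,1,0,0],[1,1,1,-1],[0,0,1,0],[1,1,0,0]], [[[0,0,0,0],[0,10,5,8],[0,5,2,4],[0,8,4,4]],[[0,
    10,5,8],[10,14,7,14],[5,7,3,7],[8,14,7,10]],[[0,5,2,4],[5,7,3,7],[2,3,0,3],[4,7,3,5]],[[0,8,4,
    4],[8,14,7,10],[4,7,3,5],[4,10,5,5]]], [48,136,72,100], 0, -114, [], [], 0, 0, 0⟩,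
  ⟨[([1,5],[4]),([3,7],[2]),([2,6],[0]),([0,4],[])], (-1,1,-1,-1), [[0,1,0,0],[0,0,0,1],[0,0,1,0],
    [1,1,0,0]], [[[0,0,0,0],[0,0,2,3],[0,2,2,4],[0,3,4,4]],[[0,0,2,3],[0,0,0,0],[2,0,0,3],[3,0,3,
    4]],[[0,2,2,4],[2,0,0,3],[2,0,0,3],[4,3,3,5]],[[0,3,4,4],[3,0,3,4],[4,3,3,5],[4,4,5,5]]], [48,
    48,72,100], 0, -120, [], [], 0, 0, 0⟩,
  ⟨[([3,5,7],[4]),([0,3,7],[2,6]),([1,2,6],[0]),([0,5],[1]),([1,4],[5]),([2,4,6],[3,7]),([0,4],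
    []),([1,3,7],[]),([2,5,6],[])], (-2,-2,1,-1), [[3,1,1,2],[2,1,2,2],[3,2,0,2],[2,0,2,3],[2,2,1,
    2]], [], [], 0, 0, [], [], 0, 0, 0⟩,
  ⟨[([2,5],[4]),([1,7],[0]),([3,6],[0]),([0,4],[])], (-1,-1,1,-1), [[0,1,0,0],[0,0,0,1],[0,0,1,0],
    [1,1,0,0]], [[[0,0,0,0],[0,0,2,3],[0,2,0,3],[0,3,3,6]],[[0,0,2,3],[0,0,0,0],[2,0,0,3],[3,0,3,
    4]],[[0,2,0,3],[2,0,0,3],[0,0,0,0],[3,3,0,4]],[[0,3,3,6],[3,0,3,4],[3,3,0,4],[6,4,4,8]]], [48,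
    48,48,112], 0, -120, [], [], 0, 0, 0⟩,
  ⟨[([0,1],[6]),([3,7],[1]),([2,5,6],[0]),([4,6],[1]),([0,4],[]),([1,2,5],[])], (-1,1,-1,1), [[1,
    1,-1,0],[0,0,0,1],[0,1,0,0],[1,0,0,0]], [[[8,4,8,4],[4,0,4,3],[8,4,6,4],[4,3,4,0]],[[4,0,4,3],
    [0,0,0,0],[4,0,2,3],[3,0,3,0]],[[8,4,6,4],[4,0,2,3],[6,2,2,4],[4,3,4,0]],[[4,3,4,0],[3,0,3,0],
    [4,3,4,0],[0,0,0,0]]], [112,48,88,48], 0, -128, [], [], 0, 0, 0⟩,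
  ⟨[([0,1,2],[6,7]),([3,6],[0]),([5,7],[3]),([4,6,7],[1,2]),([0,4],[]),([1,2,3],[7]),([1,2,5],
    [])], (-1,-2,-1,2), [[1,1,0,-1],[0,1,1,-1],[0,1,0,0],[1,0,0,0]], [[[11,11,9,7],[11,9,8,7],[9,
    8,3,6],[7,7,6,3]],[[11,9,8,7],[9,4,4,7],[8,4,2,6],[7,7,6,3]],[[9,8,3,6],[8,4,2,6],[3,2,0,3],
    [6,6,3,3]],[[7,7,6,3],[7,7,6,3],[6,6,3,3],[3,3,3,0]]], [124,104,72,72], 0, -124, [], [], 0, 0,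
    0⟩,
  ⟨[([0,1],[6]),([3,7],[2]),([2,5,6],[0]),([4,6],[1]),([0,4],[]),([1,2,5],[])], (-1,1,-1,-1), [[1,
    1,-1,0],[0,0,0,1],[0,1,0,0],[1,0,0,0]], [[[5,4,5,4],[4,0,4,3],[5,4,5,4],[4,3,4,0]],[[4,0,4,3],
    [0,0,0,0],[4,0,2,3],[3,0,3,0]],[[5,4,5,4],[4,0,2,3],[5,2,2,4],[4,3,4,0]],[[4,3,4,0],[3,0,3,0],
    [4,3,4,0],[0,0,0,0]]], [100,48,88,48], 0, -122, [], [], 0, 0, 0⟩,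
  ⟨[([0,1],[6]),([3,6,7],[0,0]),([0,2,5],[3,7]),([3,4,7],[2,5]),([4,6],[1]),([0,4],[]),([1,2,5],
    []),([1,3,7],[0]),([2,5,6],[0])], (-2,-1,2,1), [[2,2,0,1],[2,2,-1,1],[2,2,-1,2],[2,4,-1,2],[2,
    4,-2,3]], [], [], 0, 0, [], [], 0, 0, 0⟩,
  ⟨[([0,1],[6]),([3,7],[6]),([2,5,6],[0]),([4,6],[1]),([0,4],[]),([1,2,5],[])], (-2,-1,2,-1), [[1,
    1,-1,-1],[0,0,0,1],[0,1,0,0],[1,0,0,0]], [[[5,4,5,5],[4,0,4,3],[5,4,5,5],[5,3,5,3]],[[4,0,4,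
    3],[0,0,0,0],[4,0,2,3],[3,0,3,0]],[[5,4,5,5],[4,0,2,3],[5,2,2,5],[5,3,5,3]],[[5,3,5,3],[3,0,3,
    0],[5,3,5,3],[3,0,3,0]]], [100,48,88,72], 0, -134, [], [], 0, 0, 0⟩]

theorem checkAll_certs41to50 : checkAll spaces41to50 certs41to50 = true := by
  decide +kernel

def certs51to60 : List Cert := [
  ⟨[([0,1],[6]),([3,7],[1]),([2,5,6],[0,0]),([4,6],[1]),([0,4],[]),([1,2,5],[0])], (-2,-1,1,-2),
    [[1,1,-1,0],[0,0,0,1],[0,1,0,0],[1,0,0,0]], [[[30,10,15,20],[10,0,5,8],[15,5,7,10],[20,8,10,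
    10]],[[10,0,5,8],[0,0,0,0],[5,0,2,4],[8,0,4,4]],[[15,5,7,10],[5,0,2,4],[7,2,2,5],[10,4,5,5]],
    [[20,8,10,10],[8,0,4,4],[10,4,5,5],[10,4,5,5]]], [168,48,88,100], 0, -138, [], [], 0, 0, 0⟩,
  ⟨[([2,7],[0]),([3,6],[0]),([1,5],[0]),([0,4],[])], (-1,-1,-1,-1), [[0,0,0,1],[0,0,1,0],[0,1,0,
    0],[1,0,0,0]], [[[0,0,0,0],[0,0,2,3],[0,2,0,3],[0,3,3,6]],[[0,0,2,3],[0,0,0,0],[2,0,0,3],[3,0,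
    3,6]],[[0,2,0,3],[2,0,0,3],[0,0,0,0],[3,3,0,6]],[[0,3,3,6],[3,0,3,6],[3,3,0,6],[6,6,6,18]]],
    [48,48,48,144], 0, -152, [], [], 0, 0, 0⟩,
  ⟨[([0,3,7],[1,2]),([2,6],[0]),([1,5],[0]),([1,2,4],[3,7]),([0,4],[]),([3,5,7],[2]),([3,6,7],
    [1])], (-2,-2,1,1), [[1,0,0,1],[0,0,1,0],[0,1,0,0],[1,0,0,0]], [[[22,11,11,16],[11,3,7,8],[11,
    7,3,8],[16,8,8,10]],[[11,3,7,8],[3,0,2,3],[7,2,2,5],[8,3,5,5]],[[11,7,3,8],[7,2,2,5],[3,2,0,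
    3],[8,5,3,5]],[[16,8,8,10],[8,3,5,5],[8,5,3,5],[10,5,5,5]]], [152,72,72,100], 0, -136, [], [],
    0, 0, 0⟩,
  ⟨[([0,1],[6]),([3,7],[2]),([2,5,6],[0,0]),([4,6],[1]),([0,4],[]),([1,2,5],[0])], (-2,-1,1,2),
    [[1,1,-1,0],[0,0,0,1],[0,1,0,0],[1,0,0,0]], [[[24,10,12,20],[10,0,5,8],[12,5,6,10],[20,8,10,
    10]],[[10,0,5,8],[0,0,0,0],[5,0,2,4],[8,0,4,4]],[[12,5,6,10],[5,0,2,4],[6,2,2,5],[10,4,5,5]],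
    [[20,8,10,10],[8,0,4,4],[10,4,5,5],[10,4,5,5]]], [168,48,88,100], 0, -138, [], [], 0, 0, 0⟩,
  ⟨[([0,1],[6]),([3,7],[6]),([2,5,6],[0,0]),([4,6],[1]),([0,4],[]),([1,2,5],[0])], (-2,-1,1,-1),
    [[1,1,-1,-1],[0,0,0,1],[0,1,0,0],[1,0,0,0]], [[[24,10,12,24],[10,0,5,8],[12,5,6,12],[24,8,12,
    20]],[[10,0,5,8],[0,0,0,0],[5,0,2,4],[8,0,4,4]],[[12,5,6,12],[5,0,2,4],[6,2,2,6],[12,4,6,10]],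
    [[24,8,12,20],[8,0,4,4],[12,4,6,10],[20,4,10,14]]], [168,48,88,136], 0, -156, [], [], 0, 0, 0⟩,
  ⟨[([2,3,6],[1,4]),([0,2],[7]),([1,5],[0]),([4,7],[2]),([0,4],[]),([3,6,7],[1])], (-2,-2,-1,1),
    [[0,0,1,0],[1,0,1,-1],[0,1,0,0],[1,0,1,0]], [[[0,3,2,3],[3,5,5,7],[2,5,2,6],[3,7,6,7]],[[3,5,
    5,7],[5,5,5,9],[5,5,5,9],[7,9,9,11]],[[2,5,2,6],[5,5,5,9],[2,5,2,6],[6,9,6,10]],[[3,7,6,7],[7,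
    9,9,11],[6,9,6,10],[7,11,10,11]]], [72,100,88,124], 0, -128, [], [], 0, 0, 0⟩,
  ⟨[([3,7],[2]),([2,6],[1]),([1,5],[0]),([0,4],[])], (-1,-1,-1,-1), [[0,0,0,1],[0,0,1,0],[0,1,0,
    0],[1,0,0,0]], [[[0,0,0,0],[0,0,2,3],[0,2,2,4],[0,3,4,4]],[[0,0,2,3],[0,0,2,3],[2,2,2,5],[3,3,
    5,5]],[[0,2,2,4],[2,2,2,5],[2,2,2,5],[4,5,5,5]],[[0,3,4,4],[3,3,5,5],[4,5,5,5],[4,5,5,5]]],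
    [48,72,88,100], 0, -140, [], [], 0, 0, 0⟩,
  ⟨[([3,7],[1]),([2,6],[1]),([1,5],[0]),([0,4],[])], (-1,-1,-1,-1), [[0,0,0,1],[0,0,1,0],[0,1,0,
    0],[1,0,0,0]], [[[0,0,0,0],[0,0,2,3],[0,2,2,4],[0,3,4,4]],[[0,0,2,3],[0,0,0,0],[2,0,2,4],[3,0,
    4,4]],[[0,2,2,4],[2,0,2,4],[2,2,4,8],[4,4,8,8]],[[0,3,4,4],[3,0,4,4],[4,4,8,8],[4,4,8,8]]],
    [48,48,104,112], 0, -148, [], [], 0, 0, 0⟩,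
  ⟨[([0,2],[7]),([3,6,7],[0]),([1,5],[0]),([4,7],[2]),([0,4],[]),([2,3,6],[])], (-1,-1,1,-1), [[1,
    0,1,-1],[0,0,1,0],[0,1,0,0],[1,0,0,0]], [[[11,7,4,9],[7,3,4,6],[4,4,0,3],[9,6,3,3]],[[7,3,4,
    6],[3,0,2,3],[4,2,0,3],[6,3,3,3]],[[4,4,0,3],[4,2,0,3],[0,0,0,0],[3,3,0,0]],[[9,6,3,3],[6,3,3,
    3],[3,3,0,0],[3,3,0,0]]], [124,72,48,72], 0, -130, [], [], 0, 0, 0⟩,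
  ⟨[([0,2],[7]),([3,6,7],[0,1]),([1,5],[0]),([4,7],[2]),([0,4],[]),([2,3,6],[1])], (-2,-1,-1,2),
    [[1,0,1,-1],[0,0,1,0],[0,1,0,0],[1,0,0,0]], [[[21,9,12,18],[9,3,6,8],[12,6,6,10],[18,8,10,
    10]],[[9,3,6,8],[3,0,2,3],[6,2,2,5],[8,3,5,5]],[[12,6,6,10],[6,2,2,5],[6,2,2,5],[10,5,5,5]],
    [[18,8,10,10],[8,3,5,5],[10,5,5,5],[10,5,5,5]]], [156,72,88,100], 0, -144, [], [], 0, 0, 0⟩]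

theorem checkAll_certs51to60 : checkAll spaces51to60 certs51to60 = true := by
  decide +kernel

def certs61to70 : List Cert := [
  ⟨[([2,6],[5]),([3,7],[1]),([1,5],[0]),([0,4],[])], (-2,-2,1,1), [[0,0,1,0],[0,0,0,1],[0,1,1,0],
    [1,0,0,0]], [[[0,0,0,0],[0,0,2,3],[0,2,2,4],[0,3,4,4]],[[0,0,2,3],[0,0,0,0],[2,0,2,4],[3,0,4,
    4]],[[0,2,2,4],[2,0,2,4],[2,2,2,5],[4,4,5,5]],[[0,3,4,4],[3,0,4,4],[4,4,5,5],[4,4,5,5]]], [48,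
    48,88,100], 0, -128, [], [], 0, 0, 0⟩,
  ⟨[([0,2],[7]),([3,6,7],[0,0]),([1,5],[0]),([4,7],[2]),([0,4],[]),([2,3,6],[0])], (-2,-2,-1,1),
    [[1,0,1,-1],[0,0,1,0],[0,1,0,0],[1,0,0,0]], [[[32,11,10,28],[11,3,5,10],[10,5,0,8],[28,10,8,
    18]],[[11,3,5,10],[3,0,2,3],[5,2,0,4],[10,3,4,7]],[[10,5,0,8],[5,2,0,4],[0,0,0,0],[8,4,0,4]],
    [[28,10,8,18],[10,3,4,7],[8,4,0,4],[18,7,4,11]]], [184,72,48,124], 0, -150, [], [], 0, 0, 0⟩,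
  ⟨[([3,7],[2]),([2,6],[0]),([1,5],[0]),([0,4],[])], (-1,-1,-1,-1), [[0,0,0,1],[0,0,1,0],[0,1,0,
    0],[1,0,0,0]], [[[0,0,0,0],[0,0,2,3],[0,2,0,3],[0,3,3,6]],[[0,0,2,3],[0,0,2,3],[2,2,0,4],[3,3,
    4,7]],[[0,2,0,3],[2,2,0,4],[0,0,0,0],[3,4,0,4]],[[0,3,3,6],[3,3,4,7],[3,4,0,4],[6,7,4,11]]],
    [48,72,48,124], 0, -144, [], [], 0, 0, 0⟩,
  ⟨[([0,6],[4]),([1,6],[5]),([2,3,7],[0,1]),([4,5],[6]),([0,5],[]),([1,4],[])], (-2,-1,-2,-1),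
    [[0,1,1,0],[1,0,1,0],[0,0,0,1],[1,1,1,0]], [[[2,5,2,6],[5,5,5,9],[2,5,2,6],[6,9,6,10]],[[5,5,
    5,9],[5,2,2,6],[5,2,2,6],[9,6,6,10]],[[2,5,2,6],[5,2,2,6],[2,2,0,3],[6,6,3,7]],[[6,9,6,10],[9,
    6,6,10],[6,6,3,7],[10,10,7,11]]], [88,88,72,124], 0, -120, [], [], 0, 0, 0⟩,
  ⟨[([2,3,7],[0]),([0,6],[1]),([1,5],[6]),([4,6],[5]),([0,5],[]),([1,4],[])], (-2,-1,-1,1), [[0,0,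
    0,1],[0,1,1,0],[1,1,0,0],[1,0,0,0]], [[[0,2,3,2],[2,2,5,4],[3,5,5,4],[2,4,4,0]],[[2,2,5,4],[2,
    2,5,4],[5,5,5,4],[4,4,4,0]],[[3,5,5,4],[5,5,5,4],[5,5,5,4],[4,4,4,0]],[[2,4,4,0],[4,4,4,0],[4,
    4,4,0],[0,0,0,0]]], [72,88,100,48], 0, -124, [], [], 0, 0, 0⟩,
  ⟨[([2,3,7],[0,1]),([0,6],[1]),([1,5],[6]),([4,6],[5]),([0,5],[]),([1,4],[])], (-1,-1,-1,2), [[0,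
    0,0,1],[0,1,1,0],[1,1,0,0],[1,0,0,0]], [[[0,2,3,2],[2,2,6,5],[3,6,9,7],[2,5,7,2]],[[2,2,6,5],
    [2,2,6,5],[6,6,12,10],[5,5,10,5]],[[3,6,9,7],[6,6,12,10],[9,12,21,17],[7,10,17,7]],[[2,5,7,2],
    [5,5,10,5],[7,10,17,7],[2,5,7,2]]], [72,88,156,88], 0, -136, [], [], 0, 0, 0⟩,
  ⟨[([2,6],[5]),([3,7],[0]),([0,5],[]),([1,4],[])], (-1,-1,1,-1), [[0,0,1,0],[0,0,0,1],[0,1,1,0],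
    [1,0,0,0]], [[[0,0,0,0],[0,0,2,2],[0,2,2,3],[0,2,3,0]],[[0,0,2,2],[0,0,0,0],[2,0,2,3],[2,0,3,
    0]],[[0,2,2,3],[2,0,2,3],[2,2,2,4],[3,3,4,0]],[[0,2,3,0],[2,0,3,0],[3,3,4,0],[0,0,0,0]]], [48,
    48,88,48], 0, -120, [], [], 0, 0, 0⟩,
  ⟨[([0,2],[7]),([3,6,7],[0]),([5,7],[2]),([1,4],[]),([0,5],[]),([2,3,6],[])], (-1,-1,1,-1), [[0,
    1,1,-1],[0,0,1,0],[0,1,0,0],[1,0,0,0]], [[[2,2,2,4],[2,2,2,4],[2,2,0,3],[4,4,3,0]],[[2,2,2,4],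
    [2,0,2,2],[2,2,0,3],[4,2,3,0]],[[2,2,0,3],[2,2,0,3],[0,0,0,0],[3,3,0,0]],[[4,4,3,0],[4,2,3,0],
    [3,3,0,0],[0,0,0,0]]], [88,72,48,48], 0, -124, [], [], 0, 0, 0⟩,
  ⟨[([2,7],[0]),([3,6],[1]),([0,5],[]),([1,4],[])], (-1,-1,-1,-1), [[0,0,0,1],[0,0,1,0],[0,1,0,0],
    [1,0,0,0]], [[[0,0,0,0],[0,0,2,2],[0,2,0,3],[0,2,3,2]],[[0,0,2,2],[0,0,0,0],[2,0,2,3],[2,0,3,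
    0]],[[0,2,0,3],[2,0,2,3],[0,2,0,3],[3,3,3,3]],[[0,2,3,2],[2,0,3,0],[3,3,3,3],[2,0,3,0]]], [48,
    48,72,72], 0, -128, [], [], 0, 0, 0⟩,
  ⟨[([3,5,7],[4,6]),([1,3,7],[0,6]),([2,6],[1]),([0,4,6],[3,7]),([0,5],[]),([1,4],[]),([2,3,7],
    [0])], (-2,-1,-1,1), [[0,1,0,0],[1,0,0,1],[0,0,1,1],[1,1,0,0]], [[[0,3,2,3],[3,7,6,7],[2,6,2,
    6],[3,7,6,7]],[[3,7,6,7],[7,4,4,9],[6,4,2,8],[7,9,8,11]],[[2,6,2,6],[6,4,2,8],[2,2,0,4],[6,8,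
    4,10]],[[3,7,6,7],[7,9,8,11],[6,8,4,10],[7,11,10,11]]], [72,104,72,124], 0, -124, [], [], 0,
    0, 0⟩]

theorem checkAll_certs61to70 : checkAll spaces61to70 certs61to70 = true := by
  decide +kernel

def certs71to80 : List Cert := [
  ⟨[([1,2],[7]),([3,6,7],[0,1]),([0,5],[]),([4,7],[2]),([1,4],[]),([2,3,6],[0])], (-2,1,-1,1),
    [[1,0,1,-1],[0,0,1,0],[0,1,0,0],[1,0,0,0]], [[[2,2,5,2],[2,2,5,2],[5,5,5,4],[2,2,4,0]],[[2,2,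
    5,2],[2,0,2,2],[5,2,2,4],[2,2,4,0]],[[5,5,5,4],[5,2,2,4],[5,2,2,4],[4,4,4,0]],[[2,2,4,0],[2,2,
    4,0],[4,4,4,0],[0,0,0,0]]], [88,72,88,48], 0, -128, [], [], 0, 0, 0⟩,
  ⟨[([0,2],[7]),([3,6,7],[0,0]),([5,7],[2]),([1,4],[]),([0,5],[]),([2,3,6],[0])], (-2,-1,-1,1),
    [[0,1,1,-1],[0,0,1,0],[0,1,0,0],[1,0,0,0]], [[[8,4,8,10],[4,2,4,5],[8,4,4,8],[10,5,8,0]],[[4,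
    2,4,5],[2,0,2,2],[4,2,2,4],[5,2,4,0]],[[8,4,4,8],[4,2,2,4],[4,2,2,4],[8,4,4,0]],[[10,5,8,0],
    [5,2,4,0],[8,4,4,0],[0,0,0,0]]], [136,72,88,48], 0, -132, [], [], 0, 0, 0⟩,
  ⟨[([2,7],[0]),([3,6],[0]),([0,5],[]),([1,4],[])], (-1,-1,-1,-1), [[0,0,0,1],[0,0,1,0],[0,1,0,0],
    [1,0,0,0]], [[[0,0,0,0],[0,0,2,2],[0,2,2,3],[0,2,3,0]],[[0,0,2,2],[0,0,0,0],[2,0,2,3],[2,0,3,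
    0]],[[0,2,2,3],[2,0,2,3],[2,2,4,6],[3,3,6,0]],[[0,2,3,0],[2,0,3,0],[3,3,6,0],[0,0,0,0]]], [48,
    48,104,48], 0, -136, [], [], 0, 0, 0⟩,
  ⟨[([3,7],[2]),([2,6],[0]),([0,5],[]),([1,4],[])], (-1,-1,-1,-1), [[0,0,0,1],[0,0,1,0],[0,1,0,0],
    [1,0,0,0]], [[[0,0,0,0],[0,0,2,2],[0,2,2,3],[0,2,3,0]],[[0,0,2,2],[0,0,2,2],[2,2,2,4],[2,2,4,
    0]],[[0,2,2,3],[2,2,2,4],[2,2,2,4],[3,4,4,0]],[[0,2,3,0],[2,2,4,0],[3,4,4,0],[0,0,0,0]]], [48,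
    72,88,48], 0, -132, [], [], 0, 0, 0⟩,
  ⟨[([0,1],[6]),([2,3,7],[]),([5,6],[1]),([4,6],[0]),([0,5],[]),([1,4],[])], (-1,1,-1,1), [[1,1,
    -1,0],[0,0,0,1],[0,1,0,0],[1,0,0,0]], [[[0,3,0,0],[3,3,3,3],[0,3,0,0],[0,3,0,0]],[[3,3,3,3],
    [3,0,2,2],[3,2,0,3],[3,2,3,0]],[[0,3,0,0],[3,2,0,3],[0,0,0,0],[0,3,0,0]],[[0,3,0,0],[3,2,3,0],
    [0,3,0,0],[0,0,0,0]]], [72,72,48,48], 0, -126, [], [], 0, 0, 0⟩,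
  ⟨[([0,1],[6]),([2,3,7],[0]),([5,6],[1]),([4,6],[0]),([0,5],[]),([1,4],[])], (-2,-1,-2,-1), [[1,
    1,-1,0],[0,0,0,1],[0,1,0,0],[1,0,0,0]], [[[11,7,10,4],[7,3,6,4],[10,6,6,4],[4,4,4,0]],[[7,3,6,
    4],[3,0,2,2],[6,2,2,4],[4,2,4,0]],[[10,6,6,4],[6,2,2,4],[6,2,2,4],[4,4,4,0]],[[4,4,4,0],[4,2,
    4,0],[4,4,4,0],[0,0,0,0]]], [124,72,88,48], 0, -136, [], [], 0, 0, 0⟩,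
  ⟨[([0,1],[6]),([2,3,7],[6]),([5,6],[1]),([4,6],[0]),([0,5],[]),([1,4],[])], (-2,-1,-2,-1), [[1,
    1,-1,-1],[0,0,0,1],[0,1,0,0],[1,0,0,0]], [[[5,5,5,5],[5,3,5,5],[5,5,5,5],[5,5,5,5]],[[5,3,5,
    5],[3,0,2,2],[5,2,2,5],[5,2,5,2]],[[5,5,5,5],[5,2,2,5],[5,2,2,5],[5,5,5,5]],[[5,5,5,5],[5,2,5,
    2],[5,5,5,5],[5,2,5,2]]], [100,72,88,88], 0, -144, [], [], 0, 0, 0⟩,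
  ⟨[([3,7],[0]),([0,6],[]),([1,5],[]),([2,4],[])], (-1,-1,-1,-1), [[0,0,0,1],[0,0,1,0],[0,1,0,0],
    [1,0,0,0]], [[[0,0,0,0],[0,0,2,2],[0,2,0,2],[0,2,2,0]],[[0,0,2,2],[0,0,2,2],[2,2,0,3],[2,2,3,
    0]],[[0,2,0,2],[2,2,0,3],[0,0,0,0],[2,3,0,0]],[[0,2,2,0],[2,2,3,0],[2,3,0,0],[0,0,0,0]]], [48,
    72,48,48], 1, -128, [], [], 0, 0, 0⟩,
  ⟨[([0,1,2],[3,7]),([3,6,7],[1,2]),([3,5,7],[0,2]),([3,4,7],[0,1]),([0,6],[]),([1,5],[]),([2,4],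
    [])], (-2,-1,1,-2), [[1,1,1,-1],[0,0,1,0],[0,1,0,0],[1,0,0,0]], [[[31,14,14,14],[14,4,7,7],
    [14,7,4,7],[14,7,7,4]],[[14,4,7,7],[4,0,2,2],[7,2,2,5],[7,2,5,2]],[[14,7,4,7],[7,2,2,5],[4,2,
    0,2],[7,5,2,2]],[[14,7,7,4],[7,2,5,2],[7,5,2,2],[4,2,2,0]]], [164,72,72,72], 0, -128, [], [],
    0, 0, 0⟩,
  ⟨[([0,5,7],[1,4]),([0,1,3],[6,7]),([2,7],[3]),([3,5,6],[1,2]),([4,6],[0]),([0,1,2],[6]),([0,3,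
    5],[]),([1,2,4],[]),([1,3,4],[7]),([5,6,7],[1])], (-1,1,2,1), [[4,3,-2,1],[2,2,-1,1],[2,3,-1,
    0],[4,3,-3,2],[2,3,-2,1]], [], [], 0, 0, [], [], 0, 0, 0⟩]

theorem checkAll_certs71to80 : checkAll spaces71to80 certs71to80 = true := by
  decide +kernel

def certs81to90 : List Cert := [
  ⟨[([2,7],[6]),([0,1],[7]),([3,5,6],[1,2]),([4,6],[0]),([0,3,5],[]),([1,2,4],[]),([3,5,7],[1])],
    (-2,2,1,-1), [[1,1,-1,0],[1,1,-1,-1],[0,1,0,0],[1,0,0,0]], [[[11,11,7,9],[11,9,7,8],[7,7,3,6],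
    [9,8,6,3]],[[11,9,7,8],[9,5,5,5],[7,5,3,5],[8,5,5,3]],[[7,7,3,6],[7,5,3,5],[3,3,0,3],[6,5,3,
    3]],[[9,8,6,3],[8,5,5,3],[6,5,3,3],[3,3,3,0]]], [124,100,72,72], 0, -122, [], [], 0, 0, 0⟩,
  ⟨[([2,3,7],[0,0]),([0,6],[1]),([1,5],[6]),([4,6],[5]),([0,5],[]),([1,4],[])], (-1,-2,1,2), [[0,
    0,0,1],[0,1,1,0],[1,1,0,0],[1,0,0,0]], [[[0,2,3,2],[2,4,7,5],[3,7,7,5],[2,5,5,0]],[[2,4,7,5],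
    [4,8,14,10],[7,14,14,10],[5,10,10,0]],[[3,7,7,5],[7,14,14,10],[7,14,14,10],[5,10,10,0]],[[2,5,
    5,0],[5,10,10,0],[5,10,10,0],[0,0,0,0]]], [72,136,136,48], 0, -130, [], [], 0, 0, 0⟩,
  ⟨[([0,1],[6]),([2,3,7],[0,0]),([5,6],[1]),([4,6],[0]),([0,5],[]),([1,4],[])], (-1,-2,-1,1), [[1,
    1,-1,0],[0,0,0,1],[0,1,0,0],[1,0,0,0]], [[[32,11,28,10],[11,3,9,5],[28,9,18,10],[10,5,10,0]],
    [[11,3,9,5],[3,0,2,2],[9,2,4,5],[5,2,5,0]],[[28,9,18,10],[9,2,4,5],[18,4,8,10],[10,5,10,0]],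
    [[10,5,10,0],[5,2,5,0],[10,5,10,0],[0,0,0,0]]], [184,72,136,48], 0, -154, [], [], 0, 0, 0⟩,
  ⟨[([0,1],[6]),([2,3,7],[0,6]),([5,6],[1]),([4,6],[0]),([0,5],[]),([1,4],[])], (-2,-1,-1,2), [[1,
    1,-1,-1],[0,0,0,1],[0,1,0,0],[1,0,0,0]], [[[21,9,20,12],[9,3,8,6],[20,8,16,12],[12,6,12,6]],
    [[9,3,8,6],[3,0,2,2],[8,2,4,6],[6,2,6,2]],[[20,8,16,12],[8,2,4,6],[16,4,8,12],[12,6,12,6]],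
    [[12,6,12,6],[6,2,6,2],[12,6,12,6],[6,2,6,2]]], [156,72,136,88], 0, -160, [], [], 0, 0, 0⟩,
  ⟨[([2,3,7],[6,6]),([0,1],[6]),([5,6],[1]),([4,6],[0]),([0,5],[]),([1,4],[])], (-1,1,-1,1), [[0,
    0,0,1],[1,1,-1,-2],[0,1,0,0],[1,0,0,0]], [[[0,3,2,2],[3,7,7,7],[2,7,4,7],[2,7,7,4]],[[3,7,7,
    7],[7,14,14,14],[7,14,14,14],[7,14,14,14]],[[2,7,4,7],[7,14,14,14],[4,14,8,14],[7,14,14,14]],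
    [[2,7,7,4],[7,14,14,14],[7,14,14,14],[4,14,14,8]]], [72,136,136,136], 0, -174, [], [], 0, 0,
    0⟩,
  ⟨[([0,1],[8]),([7,8],[1]),([6,8],[0]),([2,5],[]),([3,4],[]),([0,7],[]),([1,6],[])], (-1,1,-1,
    -1), [[0,0,1,1,-1],[0,0,0,1,0],[0,0,1,0,0],[0,1,0,0,0],[1,0,0,0,0]], [[[0,0,0,2,2],[0,0,0,2,
    2],[0,0,0,2,2],[2,2,2,0,3],[2,2,2,3,0]],[[0,0,0,2,2],[0,0,0,0,0],[0,0,0,2,2],[2,0,2,0,2],[2,0,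
    2,2,0]],[[0,0,0,2,2],[0,0,0,2,2],[0,0,0,0,0],[2,2,0,0,2],[2,2,0,2,0]],[[2,2,2,0,3],[2,0,2,0,
    2],[2,2,0,0,2],[0,0,0,0,0],[3,2,2,0,0]],[[2,2,2,3,0],[2,0,2,2,0],[2,2,0,2,0],[3,2,2,0,0],[0,0,
    0,0,0]]], [72,48,48,48,48], 0, -112, [], [], 0, 0, 0⟩,
  ⟨[([0,1,2],[4,8]),([0,1,3],[5,8]),([0,2,3],[6,8]),([1,2,3],[7,8]),([6,7,8],[2,3]),([5,7,8],[1,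
    3]),([5,6,8],[0,3]),([4,7,8],[1,2]),([4,6,8],[0,2]),([4,5,8],[0,1]),([0,7],[]),([1,6],[]),([2,
    5],[]),([3,4],[])], (-2,-1,1,2), [[3,2,2,2,-3],[2,3,2,2,-3],[2,2,3,2,-3],[2,2,2,3,-3],[3,3,2,
    2,-4],[3,2,3,2,-4]], [], [], 0, 0, [], [], 0, 0, 0⟩,
  ⟨[([3,5,8],[2,4]),([1,3,8],[0,2]),([2,7],[1]),([0,6],[1]),([1,5],[6]),([4,6],[5]),([0,2,4],[3,
    8]),([0,5],[]),([1,4],[]),([3,6,8],[2]),([3,7,8],[0])], (-2,-2,1,1), [[3,2,1,1,1],[2,3,2,1,0],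
    [2,2,1,0,1],[3,2,0,1,2],[2,2,2,1,1],[2,3,1,1,1]], [], [], 0, 0, [], [], 0, 0, 0⟩,
  ⟨[([2,8],[0]),([3,7],[0]),([0,6],[1]),([1,5],[6]),([4,6],[5]),([0,5],[]),([1,4],[])], (-1,-1,-1,
    -1), [[0,0,0,0,1],[0,0,0,1,0],[0,1,1,0,0],[1,1,0,0,0],[1,0,0,0,0]], [[[0,0,0,0,0],[0,0,2,3,2],
    [0,2,2,4,3],[0,3,4,4,3],[0,2,3,3,0]],[[0,0,2,3,2],[0,0,0,0,0],[2,0,2,4,3],[3,0,4,4,3],[2,0,3,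
    3,0]],[[0,2,2,4,3],[2,0,2,4,3],[2,2,4,8,6],[4,4,8,8,6],[3,3,6,6,0]],[[0,3,4,4,3],[3,0,4,4,3],
    [4,4,8,8,6],[4,4,8,8,6],[3,3,6,6,0]],[[0,2,3,3,0],[2,0,3,3,0],[3,3,6,6,0],[3,3,6,6,0],[0,0,0,
    0,0]]], [48,48,104,112,48], 0, -112, [], [], 0, 0, 0⟩,
  ⟨[([3,8],[2]),([2,7],[0]),([0,6],[1]),([1,5],[6]),([4,6],[5]),([0,5],[]),([1,4],[])], (-1,-1,-1,
    -1), [[0,0,0,0,1],[0,0,0,1,0],[0,1,1,0,0],[1,1,0,0,0],[1,0,0,0,0]], [[[0,0,0,0,0],[0,0,2,3,2],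
    [0,2,2,4,3],[0,3,4,4,3],[0,2,3,3,0]],[[0,0,2,3,2],[0,0,2,3,2],[2,2,2,5,4],[3,3,5,5,4],[2,2,4,
    4,0]],[[0,2,2,4,3],[2,2,2,5,4],[2,2,2,5,4],[4,5,5,5,4],[3,4,4,4,0]],[[0,3,4,4,3],[3,3,5,5,4],
    [4,5,5,5,4],[4,5,5,5,4],[3,4,4,4,0]],[[0,2,3,3,0],[2,2,4,4,0],[3,4,4,4,0],[3,4,4,4,0],[0,0,0,
    0,0]]], [48,72,88,100,48], 0, -110, [], [], 0, 0, 0⟩]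

theorem checkAll_certs81to90 : checkAll spaces81to90 certs81to90 = true := by
  decide +kernel

def certs91to100 : List Cert := [
  ⟨[([3,8],[4]),([2,6],[5]),([0,1],[7]),([5,7],[1]),([4,7],[0]),([0,5],[]),([1,4],[])], (-1,1,1,
    -1), [[0,0,0,0,1],[0,0,1,0,0],[1,1,1,-1,1],[0,1,1,0,0],[1,0,0,0,1]], [[[0,0,0,0,0],[0,0,3,2,
    2],[0,3,4,4,3],[0,2,4,2,3],[0,2,3,3,0]],[[0,0,3,2,2],[0,0,0,0,0],[3,0,4,3,4],[2,0,3,0,3],[2,0,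
    4,3,2]],[[0,3,4,4,3],[3,0,4,3,4],[4,4,5,5,5],[4,3,5,3,5],[3,4,5,5,3]],[[0,2,4,2,3],[2,0,3,0,
    3],[4,3,5,3,5],[2,0,3,0,3],[3,3,5,3,3]],[[0,2,3,3,0],[2,0,4,3,2],[3,4,5,5,3],[3,3,5,3,3],[0,2,
    3,3,0]]], [48,48,100,72,72], 0, -102, [], [], 0, 0, 0⟩,
  ⟨[([2,6],[5]),([0,1],[7]),([3,8],[0]),([5,7],[1]),([4,7],[0]),([0,5],[]),([1,4],[])], (-1,1,1,
    -1), [[0,0,1,0,0],[1,1,1,-1,0],[0,0,0,0,1],[0,1,1,0,0],[1,0,0,0,0]], [[[0,0,0,0,0],[0,6,3,5,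
    3],[0,3,0,2,2],[0,5,2,2,3],[0,3,2,3,0]],[[0,6,3,5,3],[6,8,4,8,4],[3,4,0,4,3],[5,8,4,6,4],[3,4,
    3,4,0]],[[0,3,0,2,2],[3,4,0,4,3],[0,0,0,0,0],[2,4,0,2,3],[2,3,0,3,0]],[[0,5,2,2,3],[5,8,4,6,
    4],[2,4,0,2,3],[2,6,2,2,4],[3,4,3,4,0]],[[0,3,2,3,0],[3,4,3,4,0],[2,3,0,3,0],[3,4,3,4,0],[0,0,
    0,0,0]]], [48,112,48,88,48], 0, -104, [], [], 0, 0, 0⟩,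
  ⟨[([0,3],[7]),([1,2],[8]),([6,7,8],[0,1]),([5,7],[3]),([4,8],[2]),([0,5],[]),([1,4],[]),([2,3,
    6],[]),([2,6,7],[0]),([3,6,8],[1])], (-1,1,-1,1), [[0,1,1,-1,0],[1,0,1,0,-1],[0,0,1,0,0],[0,1,
    0,0,0],[1,0,0,0,0]], [[[2,5,2,2,4],[5,5,5,4,4],[2,5,2,2,4],[2,4,2,0,3],[4,4,4,3,0]],[[5,5,5,4,
    4],[5,2,2,4,2],[5,2,2,4,2],[4,4,4,0,3],[4,2,2,3,0]],[[2,5,2,2,4],[5,2,2,4,2],[2,2,0,2,2],[2,4,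
    2,0,3],[4,2,2,3,0]],[[2,4,2,0,3],[4,4,4,0,3],[2,4,2,0,3],[0,0,0,0,0],[3,3,3,0,0]],[[4,4,4,3,
    0],[4,2,2,3,0],[4,2,2,3,0],[3,3,3,0,0],[0,0,0,0,0]]], [88,88,72,48,48], 0, -106, [], [], 0, 0,
    0⟩,
  ⟨[([2,6],[4]),([0,1],[7]),([3,8],[0]),([5,7],[1]),([4,7],[0]),([0,5],[]),([1,4],[])], (-1,1,-1,
    -1), [[0,0,1,0,0],[1,1,1,-1,0],[0,0,0,0,1],[0,1,0,0,0],[1,0,1,0,0]], [[[0,0,0,0,0],[0,6,3,5,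
    3],[0,3,0,2,2],[0,5,2,2,3],[0,3,2,3,0]],[[0,6,3,5,3],[6,11,4,9,7],[3,4,0,3,4],[5,9,3,3,6],[3,
    7,4,6,3]],[[0,3,0,2,2],[3,4,0,3,4],[0,0,0,0,0],[2,3,0,0,3],[2,4,0,3,2]],[[0,5,2,2,3],[5,9,3,3,
    6],[2,3,0,0,3],[2,3,0,0,3],[3,6,3,3,3]],[[0,3,2,3,0],[3,7,4,6,3],[2,4,0,3,2],[3,6,3,3,3],[0,3,
    2,3,0]]], [48,124,48,72,72], 0, -114, [], [], 0, 0, 0⟩,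
  ⟨[([2,6],[4]),([0,1],[7]),([3,8],[7]),([5,7],[1]),([4,7],[0]),([0,5],[]),([1,4],[])], (-2,-1,2,
    -1), [[0,0,1,0,0],[1,1,1,-1,-1],[0,0,0,0,1],[0,1,0,0,0],[1,0,1,0,0]], [[[0,0,0,0,0],[0,4,3,4,
    4],[0,3,0,2,2],[0,4,2,2,4],[0,4,2,4,2]],[[0,4,3,4,4],[4,5,4,5,5],[3,4,0,3,4],[4,5,3,3,5],[4,5,
    4,5,5]],[[0,3,0,2,2],[3,4,0,3,4],[0,0,0,0,0],[2,3,0,0,3],[2,4,0,3,2]],[[0,4,2,2,4],[4,5,3,3,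
    5],[2,3,0,0,3],[2,3,0,0,3],[4,5,3,3,5]],[[0,4,2,4,2],[4,5,4,5,5],[2,4,0,3,2],[4,5,3,3,5],[2,5,
    2,5,2]]], [48,100,48,72,88], 0, -110, [], [], 0, 0, 0⟩,
  ⟨[([0,1],[6]),([3,8],[2]),([2,7],[0]),([5,6],[1]),([4,6],[0]),([0,5],[]),([1,4],[])], (-1,1,-1,
    -1), [[1,1,-1,0,0],[0,0,0,0,1],[0,0,0,1,0],[0,1,0,0,0],[1,0,0,0,0]], [[[11,6,7,10,4],[6,0,3,5,
    3],[7,3,3,6,4],[10,5,6,6,4],[4,3,4,4,0]],[[6,0,3,5,3],[0,0,0,0,0],[3,0,0,2,2],[5,0,2,2,3],[3,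
    0,2,3,0]],[[7,3,3,6,4],[3,0,0,2,2],[3,0,0,2,2],[6,2,2,2,4],[4,2,2,4,0]],[[10,5,6,6,4],[5,0,2,
    2,3],[6,2,2,2,4],[6,2,2,2,4],[4,3,4,4,0]],[[4,3,4,4,0],[3,0,2,3,0],[4,2,2,4,0],[4,3,4,4,0],[0,
    0,0,0,0]]], [124,48,72,88,48], 0, -122, [], [], 0, 0, 0⟩,
  ⟨[([0,1],[6]),([3,8],[0]),([2,7],[0]),([5,6],[1]),([4,6],[0]),([0,5],[]),([1,4],[])], (-1,1,-1,
    -1), [[1,1,-1,0,0],[0,0,0,0,1],[0,0,0,1,0],[0,1,0,0,0],[1,0,0,0,0]], [[[18,6,6,16,6],[6,0,3,5,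
    3],[6,3,0,5,3],[16,5,5,10,6],[6,3,3,6,0]],[[6,0,3,5,3],[0,0,0,0,0],[3,0,0,2,2],[5,0,2,2,3],[3,
    0,2,3,0]],[[6,3,0,5,3],[3,0,0,2,2],[0,0,0,0,0],[5,2,0,2,3],[3,2,0,3,0]],[[16,5,5,10,6],[5,0,2,
    2,3],[5,2,0,2,3],[10,2,2,4,6],[6,3,3,6,0]],[[6,3,3,6,0],[3,0,2,3,0],[3,2,0,3,0],[6,3,3,6,0],
    [0,0,0,0,0]]], [144,48,48,104,48], 0, -128, [], [], 0, 0, 0⟩,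
  ⟨[([0,2,3],[4,8]),([1,2,3],[5,8]),([0,1],[6]),([7,8],[6]),([5,6],[1]),([4,6],[0]),([4,5,8],[2,
    3]),([0,5],[]),([1,4],[]),([2,3,6],[8]),([2,3,7],[])], (-2,-1,1,2), [[3,2,-1,3,-3],[2,3,-1,3,
    -3],[2,2,0,4,-3],[2,2,-1,2,-3],[3,2,-2,3,-4],[2,3,-2,3,-4]], [], [], 0, 0, [], [], 0, 0, 0⟩,
  ⟨[([0,1],[6]),([3,8],[0]),([2,7],[1]),([5,6],[1]),([4,6],[0]),([0,5],[]),([1,4],[])], (-1,1,1,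
    -1), [[1,1,-1,0,0],[0,0,0,0,1],[0,0,0,1,0],[0,1,0,0,0],[1,0,0,0,0]], [[[15,6,6,9,9],[6,0,3,3,
    5],[6,3,0,5,3],[9,3,5,3,6],[9,5,3,6,3]],[[6,0,3,3,5],[0,0,0,0,0],[3,0,0,2,2],[3,0,2,0,3],[5,0,
    2,3,2]],[[6,3,0,5,3],[3,0,0,2,2],[0,0,0,0,0],[5,2,0,2,3],[3,2,0,3,0]],[[9,3,5,3,6],[3,0,2,0,
    3],[5,2,0,2,3],[3,0,2,0,3],[6,3,3,3,3]],[[9,5,3,6,3],[5,0,2,3,2],[3,2,0,3,0],[6,3,3,3,3],[3,2,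
    0,3,0]]], [132,48,48,72,72], 0, -118, [], [], 0, 0, 0⟩,
  ⟨[([0,1],[6]),([2,7],[6]),([3,8],[2]),([5,6],[1]),([4,6],[0]),([0,5],[]),([1,4],[])], (-2,-1,-2,
    1), [[1,1,-1,-1,0],[0,0,0,1,0],[0,0,0,0,1],[0,1,0,0,0],[1,0,0,0,0]], [[[5,5,4,5,5],[5,3,3,5,
    5],[4,3,0,4,4],[5,5,4,5,5],[5,5,4,5,5]],[[5,3,3,5,5],[3,0,0,2,2],[3,0,0,2,2],[5,2,2,2,5],[5,2,
    2,5,2]],[[4,3,0,4,4],[3,0,0,2,2],[0,0,0,0,0],[4,2,0,2,4],[4,2,0,4,2]],[[5,5,4,5,5],[5,2,2,2,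
    5],[4,2,0,2,4],[5,2,2,2,5],[5,5,4,5,5]],[[5,5,4,5,5],[5,2,2,5,2],[4,2,0,4,2],[5,5,4,5,5],[5,2,
    2,5,2]]], [100,72,48,88,88], 0, -130, [], [], 0, 0, 0⟩]

theorem checkAll_certs91to100 : checkAll spaces91to100 certs91to100 = true := by
  decide +kernel

def certs101to110 : List Cert := [
  ⟨[([0,1],[6]),([3,8],[6]),([2,7],[0]),([5,6],[1]),([4,6],[0]),([0,5],[]),([1,4],[])], (-2,-1,-1,
    -1), [[1,1,-1,0,-1],[0,0,0,0,1],[0,0,0,1,0],[0,1,0,0,0],[1,0,0,0,0]], [[[11,6,4,11,7],[6,0,3,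
    5,3],[4,3,0,4,4],[11,5,4,9,7],[7,3,4,7,3]],[[6,0,3,5,3],[0,0,0,0,0],[3,0,0,2,2],[5,0,2,2,3],
    [3,0,2,3,0]],[[4,3,0,4,4],[3,0,0,2,2],[0,0,0,0,0],[4,2,0,2,4],[4,2,0,4,2]],[[11,5,4,9,7],[5,0,
    2,2,3],[4,2,0,2,4],[9,2,2,4,7],[7,3,4,7,3]],[[7,3,4,7,3],[3,0,2,3,0],[4,2,0,4,2],[7,3,4,7,3],
    [3,0,2,3,0]]], [124,48,48,104,72], 0, -130, [], [], 0, 0, 0⟩,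
  ⟨[([0,1],[6]),([3,8],[6]),([2,7],[6]),([5,6],[1]),([4,6],[0]),([0,5],[]),([1,4],[])], (-2,-1,-1,
    -1), [[1,1,-1,-1,-1],[0,0,0,0,1],[0,0,0,1,0],[0,1,0,0,0],[1,0,0,0,0]], [[[8,4,4,8,8],[4,0,3,4,
    4],[4,3,0,4,4],[8,4,4,8,8],[8,4,4,8,8]],[[4,0,3,4,4],[0,0,0,0,0],[3,0,0,2,2],[4,0,2,2,4],[4,0,
    2,4,2]],[[4,3,0,4,4],[3,0,0,2,2],[0,0,0,0,0],[4,2,0,2,4],[4,2,0,4,2]],[[8,4,4,8,8],[4,0,2,2,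
    4],[4,2,0,2,4],[8,2,2,4,8],[8,4,4,8,8]],[[8,4,4,8,8],[4,0,2,4,2],[4,2,0,4,2],[8,4,4,8,8],[8,2,
    2,8,4]]], [112,48,48,104,104], 0, -140, [], [], 0, 0, 0⟩,
  ⟨[([1,7],[4]),([2,7],[5]),([0,1,2],[3,8]),([3,6,8],[1,2]),([3,5,8],[0,2]),([3,4,8],[0,1]),([4,
    5],[7]),([0,6],[]),([1,5],[]),([2,4],[]),([3,7,8],[0])], (-2,1,2,1), [[3,2,2,3,-1],[2,3,2,3,
    -1],[2,2,1,3,0],[2,2,1,3,-1],[3,2,3,4,-2],[2,3,3,4,-2]], [], [], 0, 0, [], [], 0, 0, 0⟩,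
  ⟨[([1,2],[7]),([3,8],[0]),([0,6],[]),([5,7],[2]),([4,7],[1]),([1,5],[]),([2,4],[])], (-1,-1,1,
    -1), [[1,1,0,-1,0],[0,0,0,0,1],[0,0,1,0,0],[0,1,0,0,0],[1,0,0,0,0]], [[[0,2,3,0,0],[2,0,3,2,
    2],[3,3,3,3,3],[0,2,3,0,0],[0,2,3,0,0]],[[2,0,3,2,2],[0,0,0,0,0],[3,0,0,2,2],[2,0,2,0,2],[2,0,
    2,2,0]],[[3,3,3,3,3],[3,0,0,2,2],[3,0,0,2,2],[3,2,2,0,3],[3,2,2,3,0]],[[0,2,3,0,0],[2,0,2,0,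
    2],[3,2,2,0,3],[0,0,0,0,0],[0,2,3,0,0]],[[0,2,3,0,0],[2,0,2,2,0],[3,2,2,3,0],[0,2,3,0,0],[0,0,
    0,0,0]]], [72,48,72,48,48], 0, -112, [], [], 0, 0, 0⟩,
  ⟨[([0,1],[7]),([3,8],[0]),([6,7],[1]),([5,7],[0]),([2,4],[]),([0,6],[]),([1,5],[])], (-1,1,-1,
    -1), [[0,1,1,-1,0],[0,0,0,0,1],[0,0,1,0,0],[0,1,0,0,0],[1,0,0,0,0]], [[[4,2,4,2,6],[2,0,2,2,
    3],[4,2,2,2,5],[2,2,2,0,3],[6,3,5,3,0]],[[2,0,2,2,3],[0,0,0,0,0],[2,0,0,2,2],[2,0,2,0,2],[3,0,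
    2,2,0]],[[4,2,2,2,5],[2,0,0,2,2],[2,0,0,2,2],[2,2,2,0,3],[5,2,2,3,0]],[[2,2,2,0,3],[2,0,2,0,
    2],[2,2,2,0,3],[0,0,0,0,0],[3,2,3,0,0]],[[6,3,5,3,0],[3,0,2,2,0],[5,2,2,3,0],[3,2,3,0,0],[0,0,
    0,0,0]]], [104,48,72,48,48], 0, -116, [], [], 0, 0, 0⟩,
  ⟨[([3,8],[5]),([0,1],[7]),([6,7],[1]),([5,7],[0]),([2,4],[]),([0,6],[]),([1,5],[])], (-1,1,-1,
    -1), [[0,0,0,0,1],[0,1,1,-1,1],[0,0,1,0,0],[0,1,0,0,1],[1,0,0,0,0]], [[[0,0,0,0,0],[0,2,2,2,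
    3],[0,2,0,2,2],[0,2,2,0,2],[0,3,2,2,0]],[[0,2,2,2,3],[2,2,2,2,4],[2,2,0,2,3],[2,2,2,2,4],[3,4,
    3,4,0]],[[0,2,0,2,2],[2,2,0,2,3],[0,0,0,0,0],[2,2,0,2,3],[2,3,0,3,0]],[[0,2,2,0,2],[2,2,2,2,
    4],[2,2,0,2,3],[0,2,2,0,2],[2,4,3,2,0]],[[0,3,2,2,0],[3,4,3,4,0],[2,3,0,3,0],[2,4,3,2,0],[0,0,
    0,0,0]]], [48,88,48,72,48], 0, -108, [], [], 0, 0, 0⟩,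
  ⟨[([0,1],[7]),([3,8],[7]),([6,7],[1]),([5,7],[0]),([2,4],[]),([0,6],[]),([1,5],[])], (-2,-1,-1,
    -1), [[0,1,1,-1,-1],[0,0,0,0,1],[0,0,1,0,0],[0,1,0,0,0],[1,0,0,0,0]], [[[2,2,2,2,4],[2,0,2,2,
    3],[2,2,2,2,4],[2,2,2,2,4],[4,3,4,4,0]],[[2,0,2,2,3],[0,0,0,0,0],[2,0,0,2,2],[2,0,2,0,2],[3,0,
    2,2,0]],[[2,2,2,2,4],[2,0,0,2,2],[2,0,0,2,2],[2,2,2,2,4],[4,2,2,4,0]],[[2,2,2,2,4],[2,0,2,0,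
    2],[2,2,2,2,4],[2,0,2,0,2],[4,2,4,2,0]],[[4,3,4,4,0],[3,0,2,2,0],[4,2,2,4,0],[4,2,4,2,0],[0,0,
    0,0,0]]], [88,48,72,72,48], 0, -120, [], [], 0, 0, 0⟩,
  ⟨[([0,6],[4]),([1,7],[5]),([2,3,8],[]),([0,5],[1]),([5,6],[7]),([4,7],[6]),([1,4],[0]),([0,7],
    []),([1,6],[]),([4,5],[])], (-1,-1,-1,1), [[2,1,2,2,1],[1,2,2,2,1],[1,1,2,2,0],[2,0,3,2,1],[1,
    1,2,3,1],[1,1,3,2,1]], [], [], 0, 0, [], [], 0, 0, 0⟩,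
  ⟨[([0,6],[4]),([1,7],[5]),([2,3,8],[0]),([0,5],[1]),([5,6],[7]),([4,7],[6]),([1,4],[0]),([0,7],
    []),([1,6],[]),([4,5],[])], (-2,-1,-1,1), [[2,1,2,2,1],[1,2,2,2,1],[1,1,2,2,0],[2,0,3,2,1],[1,
    1,2,3,1],[1,1,3,2,1]], [], [], 0, 0, [], [], 0, 0, 0⟩,
  ⟨[([0,6],[4]),([1,7],[5]),([2,3,8],[0,1]),([0,5],[1]),([5,6],[7]),([4,7],[6]),([1,4],[0]),([0,
    7],[]),([1,6],[]),([4,5],[])], (-1,-1,-1,2), [[2,1,2,2,1],[1,2,2,2,1],[1,1,2,2,0],[2,0,3,2,1],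
    [1,1,2,3,1],[1,1,3,2,1]], [], [], 0, 0, [], [], 0, 0, 0⟩]

theorem checkAll_certs101to110 : checkAll spaces101to110 certs101to110 = true := by
  decide +kernel

def certs111to120 : List Cert := [
  ⟨[([0,6,8],[4,5]),([0,3,7],[2,4]),([1,7,8],[2,5]),([0,2,8],[1,3]),([2,6],[7]),([0,5,7],[1,6]),
    ([3,5],[8]),([4,7,8],[3,6]),([1,4],[0]),([0,2,5],[1]),([0,3,6],[4]),([0,7,8],[]),([1,3,6],[]),
    ([1,3,7],[2]),([1,6,8],[5]),([2,4,5],[]),([2,4,8],[3]),([4,5,7],[6])], (-2,-2,1,1), [[2,3,4,3,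
    1],[2,3,4,2,2],[1,4,4,2,2],[2,2,5,4,0],[1,2,3,3,1],[2,2,5,3,1]], [], [], 0, 0, [], [], 0, 0,
    0⟩,
  ⟨[([0,6],[4]),([1,7],[5]),([2,3,8],[0,0]),([0,5],[1]),([5,6],[7]),([4,7],[6]),([1,4],[0]),([0,
    7],[]),([1,6],[]),([4,5],[])], (-1,-2,1,2), [[2,1,2,2,1],[1,2,2,2,1],[1,1,2,2,0],[2,0,3,2,1],
    [1,1,2,3,1],[1,1,3,2,1]], [], [], 0, 0, [], [], 0, 0, 0⟩,
  ⟨[([0,1],[8]),([2,3],[9]),([7,8],[1]),([6,8],[0]),([5,9],[3]),([4,9],[2]),([0,7],[]),([1,6],[]),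
    ([2,5],[]),([3,4],[])], (-1,1,-1,1), [[0,0,1,1,-1,0],[1,1,0,0,0,-1],[0,0,0,1,0,0],[0,0,1,0,0,
    0],[0,1,0,0,0,0],[1,0,0,0,0,0]], [[[0,3,0,0,2,2],[3,3,3,3,3,3],[0,3,0,0,2,2],[0,3,0,0,2,2],[2,
    3,2,2,0,3],[2,3,2,2,3,0]],[[3,3,3,3,3,3],[3,0,2,2,0,0],[3,2,0,3,2,2],[3,2,3,0,2,2],[3,0,2,2,0,
    0],[3,0,2,2,0,0]],[[0,3,0,0,2,2],[3,2,0,3,2,2],[0,0,0,0,0,0],[0,3,0,0,2,2],[2,2,0,2,0,2],[2,2,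
    0,2,2,0]],[[0,3,0,0,2,2],[3,2,3,0,2,2],[0,3,0,0,2,2],[0,0,0,0,0,0],[2,2,2,0,0,2],[2,2,2,0,2,
    0]],[[2,3,2,2,0,3],[3,0,2,2,0,0],[2,2,0,2,0,2],[2,2,2,0,0,2],[0,0,0,0,0,0],[3,0,2,2,0,0]],[[2,
    3,2,2,3,0],[3,0,2,2,0,0],[2,2,0,2,2,0],[2,2,2,0,2,0],[3,0,2,2,0,0],[0,0,0,0,0,0]]], [72,72,48,
    48,48,48], 0, -98, [], [], 0, 0, 0⟩,
  ⟨[([2,6],[4]),([3,7],[5]),([0,9],[]),([1,8],[]),([2,5],[3]),([5,6],[7]),([4,7],[6]),([3,4],[2]),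
    ([2,7],[]),([3,6],[]),([4,5],[])], (-1,-1,-1,-1), [[2,1,2,2,1,1],[1,2,2,2,1,1],[1,1,2,2,1,0],
    [1,1,2,2,0,1],[2,0,3,2,1,1],[1,1,2,3,1,1],[1,1,3,2,1,1]], [], [], 0, 0, [], [], 0, 0, 0⟩,
  ⟨[([0,1,7],[3,4]),([0,1,6],[2,4]),([0,6,7],[4,8]),([1,6,7],[4,9]),([2,8,9],[5,6]),([3,8,9],[5,
    7]),([2,3,9],[1,5]),([2,3,8],[0,5]),([0,1,5],[2,3]),([0,5,7],[3,8]),([1,5,7],[3,9]),([0,5,6],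
    [2,8]),([1,5,6],[2,9]),([5,6,7],[8,9]),([4,8,9],[6,7]),([2,4,9],[1,6]),([2,4,8],[0,6]),([3,4,
    9],[1,7]),([3,4,8],[0,7]),([2,3,4],[0,1]),([0,9],[]),([1,8],[]),([2,7],[]),([3,6],[]),([4,5],
    [])], (-2,-1,-2,-1), [[3,1,4,3,3,3],[3,1,3,4,3,3],[2,2,3,3,4,3],[2,2,3,3,3,4],[2,2,4,3,3,3],
    [2,2,3,4,3,3],[1,3,3,3,4,3]], [], [], 0, 0, [], [], 0, 0, 0⟩,
  ⟨[([1,6],[4]),([2,7],[5]),([3,9],[0]),([0,8],[]),([1,5],[2]),([5,6],[7]),([4,7],[6]),([2,4],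
    [1]),([1,7],[]),([2,6],[]),([4,5],[])], (-1,-1,-1,-1), [[2,1,2,2,1,1],[1,2,2,2,1,1],[1,1,2,2,
    1,0],[1,1,2,2,0,1],[2,0,3,2,1,1],[1,1,2,3,1,1],[1,1,3,2,1,1]], [], [], 0, 0, [], [], 0, 0, 0⟩,
  ⟨[([0,6],[4]),([2,8],[5]),([3,9],[0]),([1,7],[]),([0,5],[2]),([5,6],[8]),([4,8],[6]),([2,4],
    [0]),([0,8],[]),([2,6],[]),([4,5],[])], (-1,-1,-1,-1), [[2,1,2,1,2,1],[1,2,2,1,2,1],[1,1,2,1,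
    2,0],[1,1,2,0,2,1],[2,0,3,1,2,1],[1,1,2,1,3,1],[1,1,3,1,2,1]], [], [], 0, 0, [], [], 0, 0, 0⟩,
  ⟨[([0,6],[4]),([1,7],[5]),([2,8],[7]),([3,9],[0]),([0,5],[1]),([5,6],[7]),([4,7],[6]),([1,4],
    [0]),([0,7],[]),([1,6],[]),([4,5],[])], (-1,-1,1,-1), [[2,1,2,2,3,1],[1,2,2,2,3,1],[1,1,2,2,2,
    1],[1,1,2,2,3,0],[2,0,3,2,3,1],[1,1,2,3,4,1],[1,1,3,2,3,1]], [], [], 0, 0, [], [], 0, 0, 0⟩,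
  ⟨[([0,6],[4]),([2,8],[5]),([1,7],[5]),([3,9],[0]),([0,5],[1]),([5,6],[7]),([4,7],[6]),([1,4],
    [0]),([0,7],[]),([1,6],[]),([4,5],[])], (-2,-2,1,1), [[2,1,2,2,2,1],[1,1,2,2,1,1],[1,2,2,2,3,
    1],[1,1,2,2,2,0],[2,0,3,2,1,1],[1,1,2,3,2,1],[1,1,3,2,2,1]], [], [], 0, 0, [], [], 0, 0, 0⟩,
  ⟨[([0,6],[4]),([1,7],[5]),([2,9],[0]),([3,8],[1]),([0,5],[1]),([5,6],[7]),([4,7],[6]),([1,4],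
    [0]),([0,7],[]),([1,6],[]),([4,5],[])], (-1,-1,-1,-1), [[2,1,2,2,1,1],[1,2,2,2,1,1],[1,1,2,2,
    1,0],[1,1,2,2,0,1],[2,0,3,2,1,1],[1,1,2,3,1,1],[1,1,3,2,1,1]], [], [], 0, 0, [], [], 0, 0, 0⟩]

theorem checkAll_certs111to120 : checkAll spaces111to120 certs111to120 = true := by
  decide +kernel

def certs121to124 : List Cert := [
  ⟨[([0,6],[4]),([1,7],[5]),([2,9],[0]),([3,8],[0]),([0,5],[1]),([5,6],[7]),([4,7],[6]),([1,4],
    [0]),([0,7],[]),([1,6],[]),([4,5],[])], (-1,-1,-1,-1), [[2,1,2,2,1,1],[1,2,2,2,1,1],[1,1,2,2,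
    1,0],[1,1,2,2,0,1],[2,0,3,2,1,1],[1,1,2,3,1,1],[1,1,3,2,1,1]], [], [], 0, 0, [], [], 0, 0, 0⟩,
  ⟨[([0,6],[4]),([1,7],[5]),([3,9],[2]),([2,8],[0]),([0,5],[1]),([5,6],[7]),([4,7],[6]),([1,4],
    [0]),([0,7],[]),([1,6],[]),([4,5],[])], (-1,-1,-1,-1), [[2,1,2,2,1,1],[1,2,2,2,1,1],[1,1,2,2,
    1,0],[1,1,2,2,0,1],[2,0,3,2,1,1],[1,1,2,3,1,1],[1,1,3,2,1,1]], [], [], 0, 0, [], [], 0, 0, 0⟩,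
  ⟨[([2,6],[4]),([3,7],[5]),([0,1],[10]),([9,10],[1]),([8,10],[0]),([2,5],[3]),([5,6],[7]),([4,7],
    [6]),([3,4],[2]),([0,9],[]),([1,8],[]),([2,7],[]),([3,6],[]),([4,5],[])], (-1,1,-1,-1), [[2,1,
    2,2,2,2,-1],[1,2,2,2,2,2,-1],[1,1,2,2,1,1,0],[1,1,2,2,2,1,-1],[1,1,2,2,1,2,-1],[2,0,3,2,2,2,
    -1],[1,1,2,3,2,2,-1],[1,1,3,2,2,2,-1]], [], [], 0, 0, [], [], 0, 0, 0⟩,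
  ⟨[([0,8],[4]),([1,9],[5]),([2,10],[6]),([3,11],[7]),([0,7],[3]),([7,8],[11]),([1,6],[2]),([6,9],
    [10]),([5,10],[9]),([2,5],[1]),([4,11],[8]),([3,4],[0]),([0,11],[]),([1,10],[]),([2,9],[]),
    ([3,8],[]),([4,7],[]),([5,6],[])], (-1,-1,-1,-1), [[2,1,1,1,2,2,2,2],[1,2,1,1,2,2,2,2],[1,1,2,
    1,2,2,2,2],[1,1,1,2,2,2,2,2],[2,1,1,0,3,2,2,2],[1,1,1,1,2,2,2,3],[1,2,0,1,2,3,2,2],[1,1,1,1,2,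
    2,3,2],[1,1,1,1,2,3,2,2]], [], [], 0, 0, [], [], 0, 0, 0⟩]

theorem checkAll_certs121to124 : checkAll spaces121to124 certs121to124 = true := by
  decide +kernel

/-- The certificates for all spaces in the database. -/
def certs : List Cert :=
  certs1to10 ++ certs11to20 ++ certs21to30 ++ certs31to40 ++
    certs41to50 ++ certs51to60 ++ certs61to70 ++ certs71to80 ++
    certs81to90 ++ certs91to100 ++ certs101to110 ++ certs111to120 ++
    certs121to124

theorem forall₂_certs : List.Forall₂ (fun L c => check L c = true) database certs := by
  refine List.rel_append (List.rel_append (List.rel_append (List.rel_append (List.rel_append (List.rel_append (List.rel_append (List.rel_append (List.rel_append (List.rel_append (List.rel_append (List.rel_append (forall₂_of_checkAll checkAll_certs1to10)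
    (forall₂_of_checkAll checkAll_certs11to20))
    (forall₂_of_checkAll checkAll_certs21to30))
    (forall₂_of_checkAll checkAll_certs31to40))
    (forall₂_of_checkAll checkAll_certs41to50))
    (forall₂_of_checkAll checkAll_certs51to60))
    (forall₂_of_checkAll checkAll_certs61to70))
    (forall₂_of_checkAll checkAll_certs71to80))
    (forall₂_of_checkAll checkAll_certs81to90))
    (forall₂_of_checkAll checkAll_certs91to100))
    (forall₂_of_checkAll checkAll_certs101to110))
    (forall₂_of_checkAll checkAll_certs111to120))
    (forall₂_of_checkAll checkAll_certs121to124)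

end ToricCheck


/-! ## The count over all spaces -/

open ToricCheck ToricSpace

theorem Set.ncard_sigma_eq_sum {ι : Type*} [Fintype ι] {α : ι → Type*} {s : Set (Σ i, α i)}
    (hs : ∀ i, {a : α i | (⟨i, a⟩ : Σ i, α i) ∈ s}.Finite) :
    s.ncard = ∑ i, {a : α i | (⟨i, a⟩ : Σ i, α i) ∈ s}.ncard := by
  have : ∀ i, Finite {a : α i | (⟨i, a⟩ : Σ i, α i) ∈ s} := hs
  have e : s ≃ Σ i, {a : α i | (⟨i, a⟩ : Σ i, α i) ∈ s} :=
    { toFun := fun x => ⟨x.1.1, x.1.2, x.2⟩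
      invFun := fun x => ⟨⟨x.1, x.2.1⟩, x.2.2⟩
      left_inv := fun _ => rfl
      right_inv := fun _ => rfl }
  rw [← Nat.card_coe_set_eq, Nat.card_congr e, Nat.card_sigma]
  rfl

namespace ToricCheck

theorem length_eq : database.length = certs.length := forall₂_certs.length_eq

/-- The certificate for a space. -/
def cert (i : Fin database.length) : Cert := certs.get (Fin.cast length_eq i)

theorem hasSummary (i : Fin database.length) : (space i).HasSummary
    ((cert i).D.isEmpty = false) (cert i).total (cert i).three (cert i).strong :=
  check_sound (forall₂_certs.get i.2 (Fin.cast length_eq i).2)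

theorem sum_cert (f : Cert → ℕ) : ∑ i, f (cert i) = (certs.map f).sum := by
  rw [← Fin.sum_univ_fun_getElem certs f]
  exact Fintype.sum_equiv (finCongr length_eq) _ _ fun _ => rfl

theorem ncard_cert (p : Cert → Bool) : {i | p (cert i) = true}.ncard = certs.countP p := by
  classical
  have h1 : ∑ i, (p (cert i)).toNat = certs.countP p := by
    rw [sum_cert fun c => (p c).toNat]
    induction certs with
    | nil => rfl
    | cons c l ih =>
      rw [List.map_cons, List.sum_cons, ih, List.countP_cons, add_comm]
      cases p c <;> rfl
  rw [← h1, Set.ncard_eq_toFinset_card', Finset.card_eq_sum_ones, Set.toFinset_ofPred,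
    Finset.sum_filter]
  exact Finset.sum_congr rfl fun i _ => by cases p (cert i) <;> rfl

/-- The number of monads is the sum of the numbers for the simple spaces. -/
theorem numberOfMonads_eq {Q : (i : Fin database.length) → (space i).MonadData → Prop}
    {f : Cert → ℕ} (h1 : ∀ i, (space i).IsSimple → ((space i).monadClasses (Q i)).ncard = f (cert i))
    (h2 : ∀ i, ¬ (space i).IsSimple → f (cert i) = 0) :
    numberOfMonads (fun i V => V.IsPositiveMonad ∧ Q i V) = (certs.map f).sum := by
  have key : ∀ i, {q : Quotient (space i).monadSetoid |
      (⟨i, q⟩ : Σ i, Quotient (space i).monadSetoid) ∈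
        {x : Σ i, Quotient (space i).monadSetoid | (space x.1).IsSimple ∧
          ∃ V, Quotient.mk _ V = x.2 ∧ V.IsPositiveMonad ∧ Q x.1 V}}
        = {q | (space i).IsSimple ∧ q ∈ (space i).monadClasses (Q i)} := fun i => rfl
  rw [numberOfMonads, Set.ncard_sigma_eq_sum]
  · rw [← sum_cert]
    refine Finset.sum_congr rfl fun i _ => ?_
    rw [key]
    by_cases hi : (space i).IsSimple
    · rw [← h1 i hi]
      simp only [hi, true_and]
      rfl
    · rw [h2 i hi]
      simp only [hi, false_and]
      exact Set.ncard_empty _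
  · intro i
    rw [key]
    by_cases hi : (space i).IsSimple
    · refine ((hasSummary i).finite hi).subset ?_
      rintro q ⟨-, V, hV, hV', -⟩
      exact ⟨V, hV, hV', trivial⟩
    · simp only [hi, false_and]
      exact Set.finite_empty

/-- A nonzero cardinality of classes means existence because the set of classes is finite, being
part of the finite set of all positive monads. -/
theorem strong_ne_zero_iff {i : Fin database.length} : (cert i).strong ≠ 0 ↔ (space i).IsSimple ∧
    ∃ V : (space i).MonadData, V.IsPositiveMonad ∧ V.IsStrongThreeFamily := by
  have hi := hasSummary i
  have hfin : (space i).IsSimple →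
      ((space i).monadClasses MonadData.IsStrongThreeFamily).Finite := fun h =>
    (hi.finite h).subset fun q ⟨V, hV, hV', _⟩ => ⟨V, hV, hV', trivial⟩
  constructor
  · intro h0
    have hs : (space i).IsSimple := by
      by_contra hs
      exact h0 (hi.eq_zero hs).2.2
    rw [← hi.strong hs, ← Nat.pos_iff_ne_zero, Set.ncard_pos (hfin hs)] at h0
    obtain ⟨q, V, -, hV⟩ := h0
    exact ⟨hs, V, hV⟩
  · rintro ⟨hs, V, hV⟩
    rw [← hi.strong hs, ← Nat.pos_iff_ne_zero, Set.ncard_pos (hfin hs)]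
    exact ⟨_, V, rfl, hV⟩

end ToricCheck

theorem mainTheorem3 :
    database.length = 124 ∧
    (∀ i, ∃! d, (space i).IsIntersectionForm d) ∧
    Set.ncard {i | (space i).IsSimple} = 101 ∧
    numberOfMonads (fun _ V => V.IsPositiveMonad) = 2190 ∧
    numberOfMonads (fun _ V => V.IsPositiveMonad ∧ V.IsThreeFamily) = 265 ∧
    numberOfMonads (fun _ V => V.IsPositiveMonad ∧ V.IsStrongThreeFamily) = 21 ∧
    (∀ i, (space i).IsSimple →
      ∀ V : (space i).MonadData, V.IsPositiveMonad → V.IsStrongThreeFamily →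
        (space i).IsProductOfProjectiveSpaces) ∧
    Set.ncard {i | (space i).IsSimple ∧
      ∃ V : (space i).MonadData, V.IsPositiveMonad ∧ V.IsStrongThreeFamily} = 3 := by
  refine ⟨by decide +kernel, fun i => (hasSummary i).form, ?_, ?_, ?_, ?_, ?_, ?_⟩
  · have h : {i | (space i).IsSimple} = {i | (!(cert i).D.isEmpty) = true} := by
      ext i
      rw [Set.mem_ofPred_eq, Set.mem_ofPred_eq, (hasSummary i).isSimple_iff, Bool.not_eq_true']
    rw [h, ncard_cert fun c => !c.D.isEmpty]
    decide +kernel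
  -- The trivial second condition brings the total into the common form of the three counts.
  · have h : numberOfMonads (fun _ V => V.IsPositiveMonad)
        = numberOfMonads (fun _ V => V.IsPositiveMonad ∧ True) := by
      simp only [and_true]
    rw [h, numberOfMonads_eq (f := Cert.total) (fun i hi => (hasSummary i).total hi)
      fun i hi => ((hasSummary i).eq_zero hi).1]
    decide +kernel
  · rw [numberOfMonads_eq (f := Cert.three) (fun i hi => (hasSummary i).three hi)
      fun i hi => ((hasSummary i).eq_zero hi).2.1]
    decide +kernel
  · rw [numberOfMonads_eq (f := Cert.strong) (fun i hi => (hasSummary i).strong hi)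
      fun i hi => ((hasSummary i).eq_zero hi).2.2]
    decide +kernel
  · exact fun i hi V hV hV' => (hasSummary i).product (strong_ne_zero_iff.2 ⟨hi, V, hV, hV'⟩)
  · have h : {i | (space i).IsSimple ∧
        ∃ V : (space i).MonadData, V.IsPositiveMonad ∧ V.IsStrongThreeFamily}
        = {i | (!Nat.beq (cert i).strong 0) = true} := by
      ext i
      rw [Set.mem_ofPred_eq, Set.mem_ofPred_eq, ← strong_ne_zero_iff, Bool.not_eq_true',
        ← Bool.not_eq_true, Nat.beq_eq]
    rw [h, ncard_cert fun c => !Nat.beq c.strong 0]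
    decide +kernel
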